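/- **Setting.** Functions $h(x,p)$ live on $\mathbb R^3_x\times\mathbb R^3_p$; $\partial_{x^i}h$ and $\partial_{p^i}h$ are the derivatives in the first and in the second argument, $I,J\in\mathbb N^3$ are multi-indices, repeated indices are summed, and $L^2_xL^2_p=L^2(\mathbb R^6)$. For a potential $\phi(t,x)$ put $\mathbb X_\phi=\partial_t+p^i\partial_{x^i}+\partial_{x^i}\phi(t,x)\,\partial_{p^i}$. The Vlasov–Poisson system is $\mathbb X_\phi f=0$, $\Delta\phi=\varrho$, $\varrho=\int f\,dp$. Let $f_\infty\colon\mathbb R^3\times\mathbb R^3\to[0,\infty)$ be smooth with $\operatorname{supp} f_\infty\subset\{|x|+|p|\le B\}$. Put $\varrho_\infty(p)=\int f_\infty(y,p)\,dy$ and let $\phi_\infty=-\frac1{4\pi}\int\frac{\varrho_\infty(y)}{|y-\cdot|}\,dy$ be the solution of $\Delta\phi_\infty=\varrho_\infty$ that tends to $0$ at infinity. For an increasing sequence of integers $\mathfrak n(n)>n$ put $$\mathcal F_\infty^n=\sum_{|I|+|J|\le n}\Big(\|\partial_x^I\partial_p^Jf_\infty\|_{L^2_xL^2_p}+\|\partial_x^I\partial_p^Jf_\infty\|_{L^2_xL^2_p}^{\mathfrak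 n(n)}\Big).$$ For $t>0$ let $L_k=t\partial_{x^k}+\partial_{p^k}+\frac{\log t}{t}\,\partial_k\partial_i\phi_\infty(p)\,\partial_{p^i}$, $L^I=L_1^{I_1}L_2^{I_2}L_3^{I_3}$, and similarly $(t^{-1}\partial_p)^J$, $(t\partial_x)^I$. **Coefficients.** Functions $f_{k,l}\colon\mathbb R^3\times\mathbb R^3\to\mathbb R$ and $\varrho_{k,l},\phi_{k,l}\colon\mathbb R^3\to\mathbb R$, $0\le l\le k$, are defined explicitly from $f_\infty$ by recursion on $k$. In all sums below $0\le l_i\le k_i$. Start with $f_{0,0}=f_\infty$, $\varrho_{0,0}=\varrho_\infty$, $\phi_{0,0}=\phi_\infty$. Write $$\Psi_{k,l}(y,p)=\sum_{\substack{k_1+k_2=k\\ l_1+l_2=l}}\binom{k_2}{l_2}\frac{(-1)^{l_2}}{k_2!}\big(\otimes_{k_2-l_2}\,y\ \otimes_{l_2}\nabla\phi_\infty(p)\big)\cdot\nabla^{k_2+1}\phi_{k_1,l_1}(p)\in\mathbb R^3 .$$ For $k\ge1$ and $l=k,k-1,\dots,0$ (with $f_{k,k+1}:=0$, and with the second sum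 absent when $l=0$) $$\begin{aligned}f_{k,l}={}&\tfrac{l+1}{k}f_{k,l+1}-\tfrac1k\sum_{\substack{k_1+k_2=k\\ l_1+l_2=l\\ k_1<k}}\partial_{x^i}f_{k_1,l_1}\Psi^i_{k_2,l_2}+\tfrac1k\sum_{\substack{k_1+k_2=k-1\\ l_1+l_2=l-1}}\partial_{x^i}f_{k_1,l_1}\Psi^j_{k_2,l_2}\,\partial_i\partial_j\phi_\infty\\&+\tfrac1k\sum_{\substack{k_1+k_2=k-1\\ l_1+l_2=l}}\partial_{p^i}f_{k_1,l_1}\Psi^i_{k_2,l_2}.\end{aligned}$$ Let $\mathcal P_{k,l}(w)$ be the integral over $y\in\mathbb R^3$ of the right-hand side at $(y,w)$, where all the terms containing some $\phi_{k,l'}$, $0\le l'\le k$, are left out (in $f_{k,l+1}$ too). For smooth $h$ put $$D_{k,l}[h](w,y)=\binom kl\frac{(-1)^{k-l}}{k!}\sum_{i_1,\dots,i_k=1}^3\partial_{w^{i_1}}\cdots\partial_{w^{i_k}}\Big(\prod_{a=1}^{l}\partial_{i_a}\phi_\infty(w)\prod_{a=l+1}^{k}y^{i_a}\;h(y,w)\Big),$$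 which is the coefficient of $(\log t)^l/t^k$ in the expansion of $t^3\,h(y,p)\,\big|\det\tfrac{\partial p}{\partial y}\big|$ as $t\to\infty$, where $p=p(t,tw,y)$ is determined by $y=tw-tp+\log t\,\nabla\phi_\infty(p)$. For $k\ge 1$ $$\varrho_{k,l}(w)=\mathcal P_{k,l}(w)+\sum_{\substack{k_1+k_2=k\\ l_1+l_2=l\\ k_1<k}}\int_{\mathbb R^3}D_{k_2,l_2}[f_{k_1,l_1}](w,y)\,dy,\qquad \phi_{k,l}(w)=-\frac1{4\pi}\int_{\mathbb R^3}\frac{\varrho_{k,l}(y)}{|y-w|}\,dy .$$ Thus $\varrho_{k,l}$, then $\phi_{k,l}$, then $f_{k,l}$ are given in terms of the functions with smaller $k$. For $K\ge0$ put $$f_{[K]}(t,x,p)=\sum_{k=0}^K\sum_{l=0}^k\frac{(\log t)^l}{t^k}f_{k,l}\big(x-tp+\log t\,\nabla\phi_\infty(p),p\big),$$ $$\varrho_{[K]}(t,x)=\frac1{t^3}\sum_{k=0}^K\sum_{l=0}^k\frac{(\log t)^l}{t^k}\varrho_{k,l}\Big(\frac xt\Big),\qquad \phi_{[K]}(t,x)=\frac1t\sum_{k=0}^K\sum_{l=0}^k\frac{(\log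 t)^l}{t^k}\phi_{k,l}\Big(\frac xt\Big).$$ **Theorem.** Let $N\ge6$ and $B>0$. There are constants $C_K$ ($K\ge 0$) and an increasing sequence $\mathfrak n(n)>n$, depending only on $N$ and $B$, such that the following holds for every smooth $f_\infty\ge0$ with $\operatorname{supp} f_\infty\subset\{|x|+|p|\le B\}$. The functions $f_{k,l},\varrho_{k,l},\phi_{k,l}$ are smooth, with $f_{0,0}=f_\infty$, $\varrho_{0,0}=\varrho_\infty$, $\phi_{0,0}=\phi_\infty$, and $\Delta\phi_{k,l}=\varrho_{k,l}$, $\phi_{k,l}(w)\to0$ as $|w|\to\infty$. Moreover: 1. There is $T_0>0$ such that for all $K\ge0$ and $t\ge T_0$ $$\sum_{|I|+|J|\le N}\big\|L^I(t^{-1}\partial_p)^J\big(\mathbb X_{\phi_{[K]}}f_{[K]}\big)(t,\cdot,\cdot)\big\|_{L^2_xL^2_p}\le C_K(\mathcal F_\infty^{N+2K+3})^2\frac{(\log t)^{1+K}}{t^{2+K}},$$ $$\sum_{|I|\le N}\Big\|(t\partial_x)^I\Big(\int_{\mathbb R^3}f_{[K]}(t,\cdot,p)\,dp-\varrho_{[K]}(t,\cdot)\Big)\Big\|_{L^2_x}\le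 C_K\mathcal F_\infty^{N+2K+3}\frac{(\log t)^{K+1}}{t^{\frac52+K}},$$ $$\sum_{|I|+|J|\le N}\big\|L^I(t^{-1}\partial_p)^Jf_{[K]}(t,\cdot,\cdot)\big\|_{L^2_xL^2_p}\le\mathcal F_\infty^N+\frac{C_K\mathcal F_\infty^{N+K}\log t}{t},$$ $$\sum_{|I|+|J|\le N}\big\|L^I(t^{-1}\partial_p)^J(f_{[K]}-f_{[0]})(t,\cdot,\cdot)\big\|_{L^2_xL^2_p}\le\frac{C_K\mathcal F_\infty^{N+K}\log t}{t}.$$ 2. For all $0\le l\le k$: $\operatorname{supp} f_{k,l}\subset\{|x|\le B,\ |p|\le B\}$ and $\operatorname{supp}\varrho_{k,l}\subset\{|x|\le B\}$. 3. For all $k\ge1$ and $0\le l\le k$: $$\sum_{|I|+|J|\le N}\|\partial_x^I\partial_p^Jf_{k,l}\|_{L^2_xL^2_p}\le C_k(\mathcal F_\infty^{N+k})^2,\qquad \sum_{|I|\le N}\Big(\|\partial^I\varrho_{k,l}\|_{L^2}+\sum_{i=1}^3\|\partial^I\partial_i\phi_{k,l}\|_{L^2}\Big)\le C_k\mathcal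 F_\infty^{N+k}.$$ -/

import Mathlib

open MeasureTheory Filter Topology
open scoped ContDiff ENNReal

noncomputable section

namespace VlasovPoisson

/-- The space `ℝ³` with its Euclidean norm. A point of phase space is a pair `(x, p) : R3 × R3`. -/
abbrev R3 := EuclideanSpace ℝ (Fin 3)

/-- The `i`-th standard basis vector. -/
def basisVec (i : Fin 3) : R3 := EuclideanSpace.single i 1

/-! ### Differential operators -/

/-- The partial derivative `∂_i u` of a function on `ℝ³`. -/
def pd (i : Fin 3) (u : R3 → ℝ) : R3 → ℝ := fun w => fderiv ℝ u w (basisVec i)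

/-- The partial derivative in the `i`-th component of the first argument. -/
def dx (i : Fin 3) (h : R3 × R3 → ℝ) : R3 × R3 → ℝ := fun z => fderiv ℝ h z (basisVec i, 0)

/-- The partial derivative in the `i`-th component of the second argument. -/
def dp (i : Fin 3) (h : R3 × R3 → ℝ) : R3 × R3 → ℝ := fun z => fderiv ℝ h z (0, basisVec i)

/-- `D^I = (D 0)^{I 0} (D 1)^{I 1} (D 2)^{I 2}` for a family `D` of three operators on functions
and a multi-index `I`. -/
def multi {α : Type} (D : Fin 3 → (α → ℝ) → (α → ℝ)) (I : Fin 3 → ℕ) (u : α → ℝ) : α → ℝ :=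
  (D 0)^[I 0] ((D 1)^[I 1] ((D 2)^[I 2] u))

/-- The weighted derivative `t ∂_{x^i}` on functions on `ℝ³`. -/
def tdx (t : ℝ) (i : Fin 3) (u : R3 → ℝ) : R3 → ℝ := fun x => t * pd i u x

/-- The weighted derivative `t⁻¹ ∂_{p^i}` on functions on phase space. -/
def tinvdp (t : ℝ) (i : Fin 3) (h : R3 × R3 → ℝ) : R3 × R3 → ℝ := fun z => t⁻¹ * dp i h z

/-- The vector field
`L_k = t ∂_{x^k} + ∂_{p^k} + (log t / t) ∑_i ∂_k ∂_i φ_∞(p) ∂_{p^i}`, at time `t`. -/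
def vecL (phiInf : R3 → ℝ) (t : ℝ) (k : Fin 3) (h : R3 × R3 → ℝ) : R3 × R3 → ℝ := fun z =>
  t * dx k h z + dp k h z
    + Real.log t / t * ∑ i : Fin 3, pd k (pd i phiInf) z.2 * dp i h z

/-- The Vlasov operator `X_φ f = ∂_t f + p^i ∂_{x^i} f + ∂_{x^i} φ(t, x) ∂_{p^i} f`. -/
def vlasov (φ : ℝ → R3 → ℝ) (f : ℝ → R3 × R3 → ℝ) (t : ℝ) : R3 × R3 → ℝ := fun z =>
  deriv (fun s => f s z) t + ∑ i : Fin 3, z.2 i * dx i (f t) z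
    + ∑ i : Fin 3, pd i (φ t) z.1 * dp i (f t) z

/-- The multi-indices `I` with `|I| ≤ n`. -/
def multiIndices (n : ℕ) : Finset (Fin 3 → ℕ) :=
  (Finset.Iic (fun _ => n)).filter fun I => ∑ i, I i ≤ n

/-- The pairs `(I, J)` of multi-indices with `|I| + |J| ≤ n`. -/
def multiIndexPairs (n : ℕ) : Finset ((Fin 3 → ℕ) × (Fin 3 → ℕ)) :=
  (Finset.Iic (fun _ => n) ×ˢ Finset.Iic (fun _ => n)).filter
    fun IJ => ∑ i, IJ.1 i + ∑ i, IJ.2 i ≤ n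

/-- The `L²` norm, with values in `[0, ∞]`, with respect to Lebesgue measure. -/
def normL2 {α : Type} [MeasureSpace α] (u : α → ℝ) : ℝ≥0∞ := eLpNorm u 2 volume

/-- The quantity
`F_∞^n = ∑_{|I|+|J| ≤ n} (‖∂_x^I ∂_p^J f_∞‖ + ‖∂_x^I ∂_p^J f_∞‖ ^ 𝔫(n))`, with `L²` norms. -/
def calF (𝔫 : ℕ → ℕ) (n : ℕ) (fInf : R3 × R3 → ℝ) : ℝ≥0∞ :=
  ∑ IJ ∈ multiIndexPairs n,
    (normL2 (multi dx IJ.1 (multi dp IJ.2 fInf)) + normL2 (multi dx IJ.1 (multi dp IJ.2 fInf)) ^ 𝔫 n)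

/-! ### The asymptotic density and potential -/

/-- The Newtonian potential `w ↦ - (1 / 4π) ∫ ρ(y) / |y - w| dy`, which solves `Δ φ = ρ`. -/
def newton (ρ : R3 → ℝ) : R3 → ℝ := fun w => -(1 / (4 * Real.pi)) * ∫ y : R3, ρ y / ‖y - w‖

/-- `ϱ_∞(p) = ∫ f_∞(y, p) dy`. -/
def rhoInf (fInf : R3 × R3 → ℝ) : R3 → ℝ := fun p => ∫ y : R3, fInf (y, p)

/-- `φ_∞`, the decaying solution of `Δ φ_∞ = ϱ_∞`. -/
def phiInf (fInf : R3 × R3 → ℝ) : R3 → ℝ := newton (rhoInf fInf)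

/-! ### The coefficients

In this section `Φ` stands for `φ_∞`, and `f`, `φ` for (tables of) coefficients `f_{k,l}`,
`φ_{k,l}`, indexed by `k` and `l ≤ k`. -/

/-- All `((k₁, k₂), (l₁, l₂))` with `k₁ + k₂ = k`, `l₁ + l₂ = l`, `l₁ ≤ k₁` and `l₂ ≤ k₂`. -/
def splits (k l : ℕ) : Finset ((ℕ × ℕ) × (ℕ × ℕ)) :=
  (Finset.HasAntidiagonal.antidiagonal k ×ˢ Finset.HasAntidiagonal.antidiagonal l).filter
    fun q => q.2.1 ≤ q.1.1 ∧ q.2.2 ≤ q.1.2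

/-- The `i`-th component of
`Ψ_{k,l}(y, p) = ∑ C(k₂, l₂) (-1)^{l₂} / k₂! (⊗_{k₂-l₂} y ⊗_{l₂} ∇φ_∞(p)) · ∇^{k₂+1} φ_{k₁,l₁}(p)`,
the sum being over `splits k l`. These are the coefficients of `(log t)^l / t^{k+2}` in the
expansion of `∇φ_{[K]}(t, x)` in terms of `y = x - t p + log t ∇φ_∞(p)` and `p`. -/
def Psi (Φ : R3 → ℝ) (φ : ℕ → ℕ → R3 → ℝ) (k l : ℕ) (i : Fin 3) (y p : R3) : ℝ :=
  ∑ q ∈ splits k l,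
    (q.1.2.choose q.2.2 : ℝ) * (-1) ^ q.2.2 / (q.1.2.factorial : ℝ)
      * iteratedFDeriv ℝ q.1.2 (pd i (φ q.1.1 q.2.1)) p
          (fun j => if (j : ℕ) < q.2.2 then gradient Φ p else y)

/-- The part of the formula for `f_{k,l}` (`k ≥ 1`) that does not involve `f_{k,l+1}`:
`- (1/k) ∑_{k₁+k₂=k, l₁+l₂=l, k₁<k} ∂_{x^i} f_{k₁,l₁} Ψ^i_{k₂,l₂}`
`+ (1/k) ∑_{k₁+k₂=k-1, l₁+l₂=l-1} ∂_{x^i} f_{k₁,l₁} Ψ^j_{k₂,l₂} ∂_i ∂_j φ_∞` (present if `l ≥ 1`)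
`+ (1/k) ∑_{k₁+k₂=k-1, l₁+l₂=l} ∂_{p^i} f_{k₁,l₁} Ψ^i_{k₂,l₂}`. -/
def source (Φ : R3 → ℝ) (f : ℕ → ℕ → R3 × R3 → ℝ) (φ : ℕ → ℕ → R3 → ℝ) (k l : ℕ) :
    R3 × R3 → ℝ := fun z =>
  -(1 / (k : ℝ)) * (∑ q ∈ (splits k l).filter (fun q => q.1.1 < k), ∑ i : Fin 3,
      dx i (f q.1.1 q.2.1) z * Psi Φ φ q.1.2 q.2.2 i z.1 z.2)
  + (if 1 ≤ l then
      (1 / (k : ℝ)) * ∑ q ∈ splits (k - 1) (l - 1), ∑ i : Fin 3, ∑ j : Fin 3,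
        dx i (f q.1.1 q.2.1) z * Psi Φ φ q.1.2 q.2.2 j z.1 z.2 * pd i (pd j Φ) z.2
    else 0)
  + (1 / (k : ℝ)) * (∑ q ∈ splits (k - 1) l, ∑ i : Fin 3,
      dp i (f q.1.1 q.2.1) z * Psi Φ φ q.1.2 q.2.2 i z.1 z.2)

/-- The functions `f_{k,k}, f_{k,k-1}, …, f_{k,0}` in this order (`fDown j` is `f_{k,k-j}`), given by
`f_{k,k} = source_{k,k}` and `f_{k,l} = ((l+1)/k) f_{k,l+1} + source_{k,l}`. Only the rows of `f`
below `k` and the rows of `φ` up to `k` enter. -/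
def fDown (Φ : R3 → ℝ) (f : ℕ → ℕ → R3 × R3 → ℝ) (φ : ℕ → ℕ → R3 → ℝ) (k : ℕ) :
    ℕ → R3 × R3 → ℝ
  | 0 => source Φ f φ k k
  | j + 1 => fun z =>
      ((k - j : ℕ) : ℝ) / (k : ℝ) * fDown Φ f φ k j z + source Φ f φ k (k - (j + 1)) z

/-- The coefficient of `(log t)^l / t^k`, as a function of `w = x / t` and `y`, in the expansion of
`t³ h(y, p(t,x,y)) |det ∂p/∂y (t,x,y)|`, where `p(t,x,y)` is the inverse of
`p ↦ y = x - t p + log t ∇φ_∞(p)`, i.e. the solution of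
`p = w - y / t + (log t / t) ∇φ_∞(p)`. Explicitly it is
`C(k,l) (-1)^{k-l} / k! ∑_{i_1,…,i_k} ∂_{w^{i_1}} ⋯ ∂_{w^{i_k}}
  (∂_{i_1}φ_∞(w) ⋯ ∂_{i_l}φ_∞(w) y^{i_{l+1}} ⋯ y^{i_k} h(y, w))`. -/
def densityCoeff (Φ : R3 → ℝ) (h : R3 × R3 → ℝ) (k l : ℕ) (w y : R3) : ℝ :=
  (k.choose l : ℝ) * (-1) ^ (k - l) / (k.factorial : ℝ) *
    ∑ i : Fin k → Fin 3,
      iteratedFDeriv ℝ k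
        (fun v => (∏ j : Fin k, if (j : ℕ) < l then pd (i j) Φ v else y (i j)) * h (y, v))
        w (fun j => basisVec (i j))

/-- `P_{k,l}(w) = ∫ f_{k,l}(y, w) dy`, computed from the rows of `f` and `φ` below `k` only:
the contributions of `φ_{k,l'}`, `l' ≤ k`, to this integral vanish, and they are left out here. -/
def calP (Φ : R3 → ℝ) (f : ℕ → ℕ → R3 × R3 → ℝ) (φ : ℕ → ℕ → R3 → ℝ) (k l : ℕ) : R3 → ℝ :=
  fun w => ∫ y : R3, fDown Φ f (Function.update φ k (fun _ _ => 0)) k (k - l) (y, w)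

/-- The function `ϱ_{k,l}`, `k ≥ 1`, in terms of the rows of `f` and `φ` below `k`. -/
def rhoNext (Φ : R3 → ℝ) (f : ℕ → ℕ → R3 × R3 → ℝ) (φ : ℕ → ℕ → R3 → ℝ) (k l : ℕ) : R3 → ℝ :=
  fun w => calP Φ f φ k l w
    + ∑ q ∈ (splits k l).filter (fun q => q.1.1 < k),
        ∫ y : R3, densityCoeff Φ (f q.1.1 q.2.1) q.1.2 q.2.2 w y

/-- A table of coefficients `f_{k,l}`, `ϱ_{k,l}`, `φ_{k,l}`. Only the entries with `l ≤ k` are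
meaningful. -/
structure Table where
  /-- the functions `f_{k,l}` -/
  f : ℕ → ℕ → R3 × R3 → ℝ
  /-- the functions `ϱ_{k,l}` -/
  rho : ℕ → ℕ → R3 → ℝ
  /-- the functions `φ_{k,l}` -/
  phi : ℕ → ℕ → R3 → ℝ

/-- The table with its rows `0, …, K` filled in. The new row `K + 1` is obtained from the earlier
ones: first `ϱ_{K+1,l}`, then `φ_{K+1,l}` by solving the Poisson equation, then `f_{K+1,l}`. -/
def table (fInf : R3 × R3 → ℝ) : ℕ → Table
  | 0 =>
    { f := Function.update (fun _ _ _ => 0) 0 (fun _ => fInf)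
      rho := Function.update (fun _ _ _ => 0) 0 (fun _ => rhoInf fInf)
      phi := Function.update (fun _ _ _ => 0) 0 (fun _ => phiInf fInf) }
  | K + 1 =>
    let T := table fInf K
    let rhoRow : ℕ → R3 → ℝ := fun l => rhoNext (phiInf fInf) T.f T.phi (K + 1) l
    let phi' := Function.update T.phi (K + 1) (fun l => newton (rhoRow l))
    { f := Function.update T.f (K + 1)
        (fun l => fDown (phiInf fInf) T.f phi' (K + 1) (K + 1 - l))
      rho := Function.update T.rho (K + 1) rhoRow
      phi := phi' }

/-- The coefficient `f_{k,l}`. -/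
def fCoeff (fInf : R3 × R3 → ℝ) (k l : ℕ) : R3 × R3 → ℝ := (table fInf k).f k l

/-- The coefficient `ϱ_{k,l}`. -/
def rhoCoeff (fInf : R3 × R3 → ℝ) (k l : ℕ) : R3 → ℝ := (table fInf k).rho k l

/-- The coefficient `φ_{k,l}`. -/
def phiCoeff (fInf : R3 × R3 → ℝ) (k l : ℕ) : R3 → ℝ := (table fInf k).phi k l

/-! ### The polyhomogeneous ansatz -/

/-- `f_{[K]}(t,x,p) = ∑_{k ≤ K} ∑_{l ≤ k} (log t)^l / t^k f_{k,l}(x - t p + log t ∇φ_∞(p), p)`. -/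
def fApprox (fInf : R3 × R3 → ℝ) (K : ℕ) (t : ℝ) : R3 × R3 → ℝ := fun z =>
  ∑ k ∈ Finset.range (K + 1), ∑ l ∈ Finset.range (k + 1),
    Real.log t ^ l / t ^ k *
      fCoeff fInf k l (z.1 - t • z.2 + Real.log t • gradient (phiInf fInf) z.2, z.2)

/-- `ϱ_{[K]}(t,x) = t⁻³ ∑_{k ≤ K} ∑_{l ≤ k} (log t)^l / t^k ϱ_{k,l}(x / t)`. -/
def rhoApprox (fInf : R3 × R3 → ℝ) (K : ℕ) (t : ℝ) : R3 → ℝ := fun x =>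
  1 / t ^ 3 * ∑ k ∈ Finset.range (K + 1), ∑ l ∈ Finset.range (k + 1),
    Real.log t ^ l / t ^ k * rhoCoeff fInf k l (t⁻¹ • x)

/-- `φ_{[K]}(t,x) = t⁻¹ ∑_{k ≤ K} ∑_{l ≤ k} (log t)^l / t^k φ_{k,l}(x / t)`. -/
def phiApprox (fInf : R3 × R3 → ℝ) (K : ℕ) (t : ℝ) : R3 → ℝ := fun x =>
  1 / t * ∑ k ∈ Finset.range (K + 1), ∑ l ∈ Finset.range (k + 1),
    Real.log t ^ l / t ^ k * phiCoeff fInf k l (t⁻¹ • x)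

end VlasovPoisson

end

open VlasovPoisson

/-!
The proof takes place in the coordinates `(y, p)` with `y = x - t p + log t ∇φ_∞(p)`, see `shear`. For
fixed `p` this is a translation, so `L²` norms do not change, and the vector fields `L_k` and
`t⁻¹ ∂_{p^k}` become `∂_{p^k}` and `-∂_{y^k}` up to an error whose size `δ` tends to zero as `t → ∞`
(`isPert_shearedL`, `isPert_shearedP`). At late times the weighted norms in the theorem are therefore
bounded by the ordinary Sobolev norms of functions of `(y, p)` (`weightedNorm_polyBound`).

*The Vlasov equation.* Since `x / t = p + (y - log t ∇φ_∞(p)) / t`, Taylor's theorem at `p` expands the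
field `∂_i φ_{[K]}` in powers of `log t` and `1 / t`, with the coefficients `Ψ_{k,l}`
(`field_expansion`). The recursion for `f_{k,l}` says that all orders up to `K` of
`X_{φ_{[K]}} f_{[K]}` cancel (`residual_identity`, `vlasov_eq_residual`). The rest consists of the tails
of products of two expansions and of Taylor remainders, which have the size `(log t)^{K+1} / t^{K+2}`
(`CFam.taylorRem`, `residual_hFam`).

*The density.* The substitution `y = t (w - p)` turns `t³ ∫ f(t, t w, p) dp` into an integral over `y` of
a function of `(y, w - y / t)`. Its Taylor expansion in `1 / t` has a remainder that is bounded in `L²`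
by integration along the segment, without loss of derivatives through an embedding
(`normL2_radialRem_le`). A translation in `y` identifies the coefficients with the integrals of
`D_{k,l}[f]` (`marg_radial_iterate`, `integral_transport`). The sum of all terms of the same order is
`ϱ_{k,l}`, because the potentials `φ_{k,l'}` that are left out in `𝒫_{k,l}` multiply exact derivatives in
`y`, and drop out of the integral of `f_{k,l}` (`marg_fCoeff`, `density_expansion`). The remainders carry
many logarithms, which stem from `log t ∇φ_∞(p)` in the definition of `y`. They are absorbed by expanding to
one order more than the theorem requires (`densityRem_polyBound`).

*The coefficients.* The bounds are proved along the recursion (`coeff_bounds`). The gradient of a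
Newtonian potential is estimated for sources supported in a fixed ball, in `L²` by splitting the kernel,
and in `L^∞` by Hölder's inequality and the Sobolev inequality (`exists_normL2_pd_newton_le`,
`exists_enorm_pd_newton_le`). To avoid a loss of derivatives, `∇φ_{k,l}` is measured in the norm `aNorm`,
with the top derivatives in `L²` and the others also in `L^∞`. A function that depends on `p` only
and is bounded in this norm acts by multiplication on the Sobolev spaces of phase space
(`exists_hNorm_mul_snd_le`).

*The constants.* All estimates are first proved with a right-hand side that is a polynomial in a Sobolev
norm of `f_∞`, with a lower bound for its order of vanishing (`PolyBound`). Such a polynomial is bounded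
by a power of `F_∞^n`, if `𝔫 n` exceeds its degree (`exists_hNorm_mul_pow_le`); this determines the
sequence `𝔫`. The time `T₀` depends on `f_∞`: it is so large that `δ ≤ 1`, and that the
difference of the weighted norm of `f_{[0]}` and the Sobolev norm of `f_∞` is at most the nonlinear
part of `F_∞^N` (`exists_time`).
-/

open scoped NNReal

noncomputable section

namespace VlasovPoisson

/-! ### Directional derivatives of smooth functions -/

section Directional
variable {V : Type*} [NormedAddCommGroup V] [NormedSpace ℝ V]

/-- The derivative of `g` in the direction `e`. The operators `pd i`, `dx i` and `dp i` are the
cases in which `e` is a basis vector. -/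
def dd (e : V) (g : V → ℝ) : V → ℝ := fun z => fderiv ℝ g z e

lemma pd_eq_dd (i : Fin 3) : pd i = dd (basisVec i) := rfl
lemma dx_eq_dd (i : Fin 3) : dx i = dd ((basisVec i, 0) : R3 × R3) := rfl
lemma dp_eq_dd (i : Fin 3) : dp i = dd ((0, basisVec i) : R3 × R3) := rfl

lemma diff_of_smooth {g : V → ℝ} (hg : ContDiff ℝ ∞ g) : Differentiable ℝ g :=
  hg.differentiable (by simp)

lemma dd_smooth {g : V → ℝ} (hg : ContDiff ℝ ∞ g) (e : V) : ContDiff ℝ ∞ (dd e g) :=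
  (hg.fderiv_right (m := ∞) (by simp)).clm_apply contDiff_const

lemma pd_smooth {g : R3 → ℝ} (hg : ContDiff ℝ ∞ g) (i : Fin 3) : ContDiff ℝ ∞ (pd i g) :=
  dd_smooth hg _

lemma dx_smooth {g : R3 × R3 → ℝ} (hg : ContDiff ℝ ∞ g) (i : Fin 3) : ContDiff ℝ ∞ (dx i g) :=
  dd_smooth hg _

lemma dp_smooth {g : R3 × R3 → ℝ} (hg : ContDiff ℝ ∞ g) (i : Fin 3) : ContDiff ℝ ∞ (dp i g) :=
  dd_smooth hg _

lemma dd_add {f g : V → ℝ} (hf : ContDiff ℝ ∞ f) (hg : ContDiff ℝ ∞ g) (e : V) :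
    dd e (fun z => f z + g z) = fun z => dd e f z + dd e g z := by
  funext z
  simp [dd, fderiv_fun_add (diff_of_smooth hf z) (diff_of_smooth hg z)]

lemma dd_sub {f g : V → ℝ} (hf : ContDiff ℝ ∞ f) (hg : ContDiff ℝ ∞ g) (e : V) :
    dd e (fun z => f z - g z) = fun z => dd e f z - dd e g z := by
  funext z
  simp [dd, fderiv_fun_sub (diff_of_smooth hf z) (diff_of_smooth hg z)]

lemma dd_mul {f g : V → ℝ} (hf : ContDiff ℝ ∞ f) (hg : ContDiff ℝ ∞ g) (e : V) :
    dd e (fun z => f z * g z) = fun z => dd e f z * g z + f z * dd e g z := by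
  funext z
  simp [dd, fderiv_fun_mul (diff_of_smooth hf z) (diff_of_smooth hg z)]
  ring

lemma dd_const_mul {f : V → ℝ} (hf : ContDiff ℝ ∞ f) (c : ℝ) (e : V) :
    dd e (fun z => c * f z) = fun z => c * dd e f z := by
  funext z
  simp [dd, fderiv_const_mul (diff_of_smooth hf z)]

lemma dd_const (c : ℝ) (e : V) : dd e (fun _ : V => c) = fun _ => 0 := by
  funext z; simp [dd]

lemma dd_sum {κ : Type*} (s : Finset κ) {f : κ → V → ℝ} (hf : ∀ a ∈ s, ContDiff ℝ ∞ (f a))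
    (e : V) : dd e (fun z => ∑ a ∈ s, f a z) = fun z => ∑ a ∈ s, dd e (f a) z := by
  funext z
  simp only [dd]
  rw [fderiv_fun_sum fun a ha => diff_of_smooth (hf a ha) z]
  simp

lemma dd_comm {f : V → ℝ} (hf : ContDiff ℝ ∞ f) (e e' : V) :
    dd e (dd e' f) = dd e' (dd e f) := by
  have key : ∀ (a b : V) (z : V), dd a (dd b f) z = fderiv ℝ (fderiv ℝ f) z a b := by
    intro a b z
    have h : DifferentiableAt ℝ (fderiv ℝ f) z :=
      (hf.fderiv_right (m := ∞) (by simp)).differentiable (by simp) z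
    have h2 := fderiv_clm_apply h (differentiableAt_const b)
    change fderiv ℝ (fun y => (fderiv ℝ f y) b) z a = _
    rw [h2]
    simp
  funext z
  rw [key, key]
  refine (hf.contDiffAt.isSymmSndFDerivAt ?_).eq e e'
  simp only [minSmoothness_of_isRCLikeNormedField]
  exact WithTop.coe_le_coe.2 (le_top : (2 : ℕ∞) ≤ ⊤)

lemma dd_compactSupport {f : V → ℝ} (hf : HasCompactSupport f) (e : V) :
    HasCompactSupport (dd e f) := hf.fderiv_apply ℝ e

end Directional

/-! ### The Newtonian potential -/

lemma inner_basisVec (w : R3) (i : Fin 3) : inner ℝ w (basisVec i) = w i := by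
  simp [basisVec, EuclideanSpace.inner_single_right]

lemma integrableOn_ball_norm_rpow {r : ℝ} (hr : r < 3) (R : ℝ) :
    IntegrableOn (fun t : R3 => ‖t‖ ^ (-r)) (Metric.ball 0 R) := by
  have := integrableOn_fun_norm_addHaar (E := R3) volume (f := fun s : ℝ => s ^ (-r)) (r := R)
  rw [this]
  have h2 : IntegrableOn (fun s : ℝ => s ^ (2 - r)) (Set.Ioo 0 R) := by
    rcases le_or_gt R 0 with h | h
    · simp [Set.Ioo_eq_empty_of_le h]
    · rw [intervalIntegral.integrableOn_Ioo_rpow_iff h]; linarith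
  refine h2.congr_fun ?_ measurableSet_Ioo
  intro s hs
  have : (s ^ (2 - r) : ℝ) = s ^ (2 : ℝ) * s ^ (-r) := by
    rw [← Real.rpow_add hs.1]; ring_nf
  simp only [finrank_euclideanSpace, Fintype.card_fin, smul_eq_mul, this]
  norm_num

lemma locallyIntegrable_norm_rpow {r : ℝ} (hr : r < 3) :
    LocallyIntegrable (fun t : R3 => ‖t‖ ^ (-r)) := by
  intro x
  refine ⟨Metric.ball 0 (‖x‖ + 1), Metric.isOpen_ball.mem_nhds (by simp), ?_⟩
  exact integrableOn_ball_norm_rpow hr _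

lemma locallyIntegrable_norm_inv : LocallyIntegrable (fun t : R3 => ‖t‖⁻¹) := by
  have := locallyIntegrable_norm_rpow (r := 1) (by norm_num)
  simpa [Real.rpow_neg_one] using this

lemma integrable_mul_norm_inv {g : R3 → ℝ} (hg : Continuous g) (hc : HasCompactSupport g) :
    Integrable (fun t : R3 => g t * ‖t‖⁻¹) :=
  locallyIntegrable_norm_inv.integrable_smul_left_of_hasCompactSupport hg hc

lemma newton_eq_translate (ρ : R3 → ℝ) (w : R3) :
    newton ρ w = -(1 / (4 * Real.pi)) * ∫ t : R3, ρ (t + w) * ‖t‖⁻¹ := by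
  unfold newton
  rw [← integral_add_right_eq_self _ w]
  simp [div_eq_mul_inv]

lemma newton_eq_convolution (ρ : R3 → ℝ) :
    newton ρ = fun w => -(1 / (4 * Real.pi)) *
      (MeasureTheory.convolution (fun t : R3 => ‖t‖⁻¹) ρ (ContinuousLinearMap.mul ℝ ℝ) volume) w := by
  funext w
  rw [newton_eq_translate, ← integral_neg_eq_self]
  simp [MeasureTheory.convolution, mul_comm, sub_eq_add_neg, add_comm]

lemma newton_smooth {ρ : R3 → ℝ} (hρ : ContDiff ℝ ∞ ρ) (hc : HasCompactSupport ρ) :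
    ContDiff ℝ ∞ (newton ρ) := by
  rw [newton_eq_convolution]
  exact contDiff_const.mul (hc.contDiff_convolution_right (n := ⊤) _ locallyIntegrable_norm_inv hρ)

lemma dd_newton {ρ : R3 → ℝ} (hρ : ContDiff ℝ ∞ ρ) (hc : HasCompactSupport ρ) (e : R3) :
    dd e (newton ρ) = newton (dd e ρ) := by
  funext w
  have h1 := hc.hasFDerivAt_convolution_right (ContinuousLinearMap.mul ℝ ℝ)
    locallyIntegrable_norm_inv (hρ.of_le (by exact_mod_cast le_top)) w
  have h2 := h1.const_mul (-(1 / (4 * Real.pi)))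
  rw [newton_eq_convolution, newton_eq_convolution]
  simp only [dd]
  rw [h2.fderiv]
  simp only [_root_.smul_apply, smul_eq_mul]
  congr 1
  rw [MeasureTheory.convolution, ContinuousLinearMap.integral_apply]
  · rfl
  · have hc' : HasCompactSupport (fderiv ℝ ρ) := hc.fderiv ℝ
    exact (hc'.convolutionExists_right ((ContinuousLinearMap.mul ℝ ℝ).precompR R3)
      locallyIntegrable_norm_inv (hρ.continuous_fderiv (by simp))) w

lemma pd_newton {ρ : R3 → ℝ} (hρ : ContDiff ℝ ∞ ρ) (hc : HasCompactSupport ρ) (i : Fin 3) :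
    pd i (newton ρ) = newton (pd i ρ) := dd_newton hρ hc _

/-- The regularisation `(‖w‖² + ε²)^{-1/2}` of the kernel `1 / ‖w‖`. -/
def regKer (ε : ℝ) (w : R3) : ℝ := (Real.sqrt (‖w‖ ^ 2 + ε ^ 2))⁻¹

lemma regKer_smooth {ε : ℝ} (hε : 0 < ε) : ContDiff ℝ ∞ (regKer ε) := by
  have hpos : ∀ w : R3, 0 < ‖w‖ ^ 2 + ε ^ 2 := fun w => by positivity
  refine ContDiff.inv (ContDiff.sqrt ((contDiff_norm_sq ℝ).add contDiff_const) ?_) ?_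
  · exact fun w => (hpos w).ne'
  · exact fun w => (Real.sqrt_pos.2 (hpos w)).ne'

lemma regKer_nonneg (ε : ℝ) (w : R3) : 0 ≤ regKer ε w := by unfold regKer; positivity

lemma regKer_sq {ε : ℝ} (hε : 0 < ε) (w : R3) :
    (regKer ε w) ^ 2 * (‖w‖ ^ 2 + ε ^ 2) = 1 := by
  have h : 0 < ‖w‖ ^ 2 + ε ^ 2 := by positivity
  unfold regKer
  rw [inv_pow, Real.sq_sqrt h.le, inv_mul_cancel₀ h.ne']

lemma regKer_mul_norm_le {ε : ℝ} (hε : 0 < ε) (w : R3) : regKer ε w * ‖w‖ ≤ 1 := by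
  have h := regKer_sq hε w
  have h0 := regKer_nonneg ε w
  have : (regKer ε w * ‖w‖) ^ 2 ≤ 1 ^ 2 := by nlinarith [sq_nonneg (regKer ε w * ε)]
  exact (pow_le_pow_iff_left₀ (by positivity) (by norm_num) two_ne_zero).1 this

lemma regKer_le {ε : ℝ} (hε : 0 < ε) (w : R3) (hw : w ≠ 0) : regKer ε w ≤ ‖w‖⁻¹ := by
  have hw' : 0 < ‖w‖ := norm_pos_iff.2 hw
  rw [← one_div, le_div_iff₀ hw']
  exact regKer_mul_norm_le hε w

lemma pd_regKer {ε : ℝ} (hε : 0 < ε) (i : Fin 3) :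
    pd i (regKer ε) = fun w => -(w i * regKer ε w ^ 3) := by
  funext w
  have hpos : 0 < ‖w‖ ^ 2 + ε ^ 2 := by positivity
  have h1 : HasFDerivAt (fun w : R3 => ‖w‖ ^ 2 + ε ^ 2) (2 • innerSL ℝ w) w :=
    (hasStrictFDerivAt_norm_sq w).hasFDerivAt.add_const _
  have h2 := (h1.sqrt hpos.ne')
  have h3 := (hasDerivAt_inv (Real.sqrt_pos.2 hpos).ne').comp_hasFDerivAt w h2
  have h4 : fderiv ℝ (regKer ε) w = _ := h3.fderiv
  simp only [pd]
  rw [h4]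
  simp only [_root_.smul_apply, innerSL_apply_apply, inner_basisVec, smul_eq_mul,
    nsmul_eq_mul, regKer]
  have h5 : 0 < Real.sqrt (‖w‖ ^ 2 + ε ^ 2) := Real.sqrt_pos.2 hpos
  field_simp
  push_cast
  ring

lemma abs_pd_regKer_le {ε : ℝ} (hε : 0 < ε) (i : Fin 3) (w : R3) (hw : w ≠ 0) :
    |pd i (regKer ε) w| ≤ (‖w‖ ^ 2)⁻¹ := by
  have hw' : 0 < ‖w‖ := norm_pos_iff.2 hw
  have h0 := regKer_nonneg ε w
  have h1 : |w i| ≤ ‖w‖ := by simpa using PiLp.norm_apply_le w i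
  rw [pd_regKer hε, abs_neg, abs_mul, abs_of_nonneg (pow_nonneg h0 3), ← one_div,
    le_div_iff₀ (by positivity)]
  have h2 := regKer_mul_norm_le hε w
  calc |w i| * regKer ε w ^ 3 * ‖w‖ ^ 2 ≤ ‖w‖ * regKer ε w ^ 3 * ‖w‖ ^ 2 := by gcongr
    _ = (regKer ε w * ‖w‖) ^ 3 := by ring
    _ ≤ 1 := pow_le_one₀ (by positivity) h2

lemma pd_coord (i j : Fin 3) (w : R3) : pd i (fun w : R3 => w j) w = if i = j then 1 else 0 := by
  have h : HasFDerivAt (fun w : R3 => w j) (EuclideanSpace.proj (𝕜 := ℝ) j : R3 →L[ℝ] ℝ) w :=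
    (EuclideanSpace.proj (𝕜 := ℝ) j : R3 →L[ℝ] ℝ).hasFDerivAt
  simp only [pd]
  rw [h.fderiv]
  simp [basisVec, eq_comm]

lemma coord_smooth (j : Fin 3) : ContDiff ℝ ∞ (fun w : R3 => w j) :=
  (EuclideanSpace.proj (𝕜 := ℝ) j : R3 →L[ℝ] ℝ).contDiff

/-- The Laplacian of the regularised kernel is a negative multiple of a rescaled Plummer density. -/
lemma laplacian_regKer {ε : ℝ} (hε : 0 < ε) (w : R3) :
    ∑ i : Fin 3, pd i (pd i (regKer ε)) w = -(3 * (ε ^ 2 * regKer ε w ^ 5)) := by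
  have hs := regKer_smooth hε
  have h : ∀ i : Fin 3, pd i (pd i (regKer ε)) w
      = -(regKer ε w ^ 3) + 3 * (w i) ^ 2 * regKer ε w ^ 5 := by
    intro i
    have e1 : pd i (regKer ε) = fun w => (-1) * (w i * (regKer ε w * (regKer ε w * regKer ε w))) := by
      rw [pd_regKer hε]; funext w; ring
    rw [e1, pd_eq_dd, dd_const_mul ((coord_smooth i).mul (hs.mul (hs.mul hs))),
      dd_mul (coord_smooth i) (hs.mul (hs.mul hs)), dd_mul hs (hs.mul hs), dd_mul hs hs]
    simp only [← pd_eq_dd, pd_coord, pd_regKer hε, if_true]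
    ring
  simp only [h, Fin.sum_univ_three]
  have hn : ‖w‖ ^ 2 = w 0 ^ 2 + w 1 ^ 2 + w 2 ^ 2 := by
    rw [EuclideanSpace.norm_sq_eq, Fin.sum_univ_three]; simp
  have hk := regKer_sq hε w
  rw [hn] at hk
  linear_combination (3 * regKer ε w ^ 3) * hk

lemma integral_mul_pd {f g : R3 → ℝ} (hf : ContDiff ℝ ∞ f) (hc : HasCompactSupport f)
    (hg : ContDiff ℝ ∞ g) (i : Fin 3) :
    ∫ t : R3, f t * pd i g t = - ∫ t : R3, pd i f t * g t := by
  refine integral_mul_fderiv_eq_neg_fderiv_mul_of_integrable ?_ ?_ ?_ (fun x _ => diff_of_smooth hf x)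
    (fun x _ => diff_of_smooth hg x)
  · exact (((pd_smooth hf i).continuous.mul hg.continuous).integrable_of_hasCompactSupport
      ((dd_compactSupport hc _).mul_right))
  · exact ((hf.continuous.mul (pd_smooth hg i).continuous).integrable_of_hasCompactSupport
      (hc.mul_right))
  · exact ((hf.continuous.mul hg.continuous).integrable_of_hasCompactSupport (hc.mul_right))

lemma tendsto_regKer {w : R3} (hw : w ≠ 0) :
    Tendsto (fun n : ℕ => regKer (1 / ((n : ℝ) + 1)) w) atTop (𝓝 ‖w‖⁻¹) := by
  have h1 : Tendsto (fun n : ℕ => regKer (1 / ((n : ℝ) + 1)) w) atTop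
      (𝓝 (Real.sqrt (‖w‖ ^ 2 + 0 ^ 2))⁻¹) := by
    refine Tendsto.inv₀ ?_ ?_
    · exact ((tendsto_const_nhds.add (tendsto_one_div_add_atTop_nhds_zero_nat.pow 2))).sqrt
    · simpa using hw
  simpa only [ne_eq, OfNat.ofNat_ne_zero, not_false_eq_true, zero_pow, add_zero,
    Real.sqrt_sq (norm_nonneg w)] using h1

lemma tendsto_integral_regKer {g : R3 → ℝ} (hg : Continuous g) (hc : HasCompactSupport g) :
    Tendsto (fun n : ℕ => ∫ t, g t * regKer (1 / ((n : ℝ) + 1)) t) atTop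
      (𝓝 (∫ t, g t * ‖t‖⁻¹)) := by
  have hne : ∀ᵐ t : R3, t ≠ 0 := by simp [ae_iff]
  refine tendsto_integral_of_dominated_convergence (fun t => ‖g t * ‖t‖⁻¹‖) ?_
    (integrable_mul_norm_inv hg hc).norm ?_ ?_
  · intro n
    exact (hg.mul (regKer_smooth (by positivity)).continuous).aestronglyMeasurable
  · intro n
    filter_upwards [hne] with t ht
    rw [norm_mul, norm_mul, norm_inv, norm_norm, Real.norm_of_nonneg (regKer_nonneg _ _)]
    gcongr
    exact regKer_le (by positivity) t ht
  · filter_upwards [hne] with t ht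
    exact tendsto_const_nhds.mul (tendsto_regKer ht)

/-- The kernel `1 / ‖t‖²`, which dominates the gradient of the Newtonian kernel. -/
def sqKer (t : R3) : ℝ≥0∞ := ‖(‖t‖ ^ 2)⁻¹‖ₑ

lemma translate_smooth {g : R3 → ℝ} (hg : ContDiff ℝ ∞ g) (w : R3) :
    ContDiff ℝ ∞ (fun t => g (t + w)) := hg.comp (contDiff_id.add contDiff_const)

lemma translate_compactSupport {g : R3 → ℝ} (hc : HasCompactSupport g) (w : R3) :
    HasCompactSupport (fun t => g (t + w)) := hc.comp_homeomorph (Homeomorph.addRight w)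

lemma pd_translate (g : R3 → ℝ) (w : R3) (i : Fin 3) :
    pd i (fun t => g (t + w)) = fun t => pd i g (t + w) := by
  funext t
  simp only [pd, fderiv_comp_add_right]

/-- Integration by parts moves the derivative to the kernel, whose gradient is at most `1 / ‖t‖²`.
The singularity is avoided by working with the regularised kernel first. -/
lemma enorm_pd_newton_le {g : R3 → ℝ} (hg : ContDiff ℝ ∞ g) (hc : HasCompactSupport g)
    (i : Fin 3) (w : R3) :
    ‖pd i (newton g) w‖ₑ ≤ ∫⁻ t, ‖g (t + w)‖ₑ * sqKer t := by
  have hne : ∀ᵐ t : R3, t ≠ 0 := by simp [ae_iff]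
  have hgs := translate_smooth hg w
  have hgc := translate_compactSupport hc w
  have hlim := (tendsto_integral_regKer (pd_smooth hgs i).continuous
    (dd_compactSupport hgc (basisVec i))).enorm
  have hb : ‖∫ t, pd i (fun t => g (t + w)) t * ‖t‖⁻¹‖ₑ ≤ ∫⁻ t, ‖g (t + w)‖ₑ * sqKer t := by
    refine le_of_tendsto hlim (Eventually.of_forall fun n => ?_)
    have hε : (0 : ℝ) < 1 / ((n : ℝ) + 1) := by positivity
    have h1 := integral_mul_pd hgs hgc (regKer_smooth hε) i
    have h2 : ‖∫ t, pd i (fun t => g (t + w)) t * regKer (1 / ((n : ℝ) + 1)) t‖ₑ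
        = ‖∫ t, g (t + w) * pd i (regKer (1 / ((n : ℝ) + 1))) t‖ₑ := by rw [h1, enorm_neg]
    rw [h2]
    refine (enorm_integral_le_lintegral_enorm _).trans (lintegral_mono_ae ?_)
    filter_upwards [hne] with t ht
    rw [enorm_mul]
    gcongr
    rw [sqKer, enorm_le_iff_norm_le, Real.norm_eq_abs, norm_inv, norm_pow, norm_norm]
    exact abs_pd_regKer_le hε i t ht
  rw [pd_newton hg hc, newton_eq_translate, enorm_mul]
  have hpi : ‖-(1 / (4 * Real.pi))‖ₑ ≤ 1 := by
    rw [enorm_neg, ← enorm_one (G := ℝ), enorm_le_iff_norm_le, Real.norm_of_nonneg (by positivity),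
      norm_one, div_le_one (by positivity)]
    nlinarith [Real.pi_gt_three]
  calc _ ≤ 1 * ‖∫ t, pd i (fun t => g (t + w)) t * ‖t‖⁻¹‖ₑ := by
        rw [pd_translate]; gcongr
    _ ≤ _ := by rw [one_mul]; exact hb

/-- The mass density `(3 / 4π) (1 + ‖x‖²)^{-5/2}`, whose rescalings form the approximate identity
`-(1 / 4π) Δ (‖w‖² + ε²)^{-1/2}`. -/
def plummer (x : R3) : ℝ := 3 / (4 * Real.pi) * (Real.sqrt (1 + ‖x‖ ^ 2))⁻¹ ^ 5

lemma hasDerivAt_plummer_primitive (r : ℝ) :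
    HasDerivAt (fun r : ℝ => (r * (Real.sqrt (1 + r ^ 2))⁻¹) ^ 3 / 3)
      (r ^ 2 * (Real.sqrt (1 + r ^ 2))⁻¹ ^ 5) r := by
  have hpos : 0 < 1 + r ^ 2 := by positivity
  have hs : 0 < Real.sqrt (1 + r ^ 2) := Real.sqrt_pos.2 hpos
  have h1 : HasDerivAt (fun r : ℝ => 1 + r ^ 2) (2 * r) r := by
    simpa using (hasDerivAt_pow 2 r).const_add 1
  have hsq : Real.sqrt (1 + r ^ 2) ^ 2 = 1 + r ^ 2 := Real.sq_sqrt hpos.le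
  have h2 : HasDerivAt (fun r : ℝ => (Real.sqrt (1 + r ^ 2))⁻¹)
      (-(r * (Real.sqrt (1 + r ^ 2))⁻¹ ^ 3)) r := by
    refine ((h1.sqrt hpos.ne').inv hs.ne').congr_deriv ?_
    field_simp
  have h3 := (((hasDerivAt_id r).mul h2).pow 3).div_const 3
  refine h3.congr_deriv ?_
  have hq : (Real.sqrt (1 + r ^ 2))⁻¹ ^ 2 * (1 + r ^ 2) = 1 := by
    rw [inv_pow, hsq, inv_mul_cancel₀ hpos.ne']
  simp only [id, Pi.mul_apply, Nat.cast_ofNat, Nat.add_one_sub_one]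
  generalize (Real.sqrt (1 + r ^ 2))⁻¹ = q at *
  linear_combination (-(r ^ 2 * q ^ 3)) * hq

lemma tendsto_plummer_primitive :
    Tendsto (fun r : ℝ => (r * (Real.sqrt (1 + r ^ 2))⁻¹) ^ 3 / 3) atTop (𝓝 (1 / 3)) := by
  have h : Tendsto (fun r : ℝ => (Real.sqrt (r⁻¹ ^ 2 + 1))⁻¹) atTop (𝓝 (Real.sqrt (0 ^ 2 + 1))⁻¹) := by
    refine Tendsto.inv₀ ?_ (by simp)
    exact ((tendsto_inv_atTop_zero.pow 2).add_const 1).sqrt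
  have h2 := (h.pow 3).div_const 3
  simp only [ne_eq, OfNat.ofNat_ne_zero, not_false_eq_true, zero_pow, zero_add, Real.sqrt_one,
    inv_one, one_pow] at h2
  refine h2.congr' ?_
  filter_upwards [eventually_gt_atTop 0] with r hr
  congr 2
  have : 1 + r ^ 2 = r ^ 2 * (r⁻¹ ^ 2 + 1) := by field_simp
  rw [this, Real.sqrt_mul (by positivity), Real.sqrt_sq hr.le]
  field_simp

lemma integral_plummer : ∫ x : R3, plummer x = 1 := by
  have h1 := integral_fun_norm_addHaar (E := R3) volume
    (fun r : ℝ => 3 / (4 * Real.pi) * (Real.sqrt (1 + r ^ 2))⁻¹ ^ 5)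
  have h2 : ∫ r in Set.Ioi (0 : ℝ), r ^ 2 * (Real.sqrt (1 + r ^ 2))⁻¹ ^ 5 = 1 / 3 - 0 := by
    have := integral_Ioi_of_hasDerivAt_of_nonneg' (a := 0) (fun r _ => hasDerivAt_plummer_primitive r)
      (fun r _ => by positivity) tendsto_plummer_primitive
    simpa using this
  unfold plummer
  rw [h1]
  have hv : volume.real (Metric.ball (0 : R3) 1) = Real.pi * 4 / 3 := by
    simp only [Measure.real, EuclideanSpace.volume_ball_fin_three]
    rw [ENNReal.ofReal_one, one_pow, one_mul, ENNReal.toReal_ofReal (by positivity)]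
  have h3 : ∀ y : ℝ, y ^ (Module.finrank ℝ R3 - 1) • (3 / (4 * Real.pi) * (Real.sqrt (1 + y ^ 2))⁻¹ ^ 5)
      = 3 / (4 * Real.pi) * (y ^ 2 * (Real.sqrt (1 + y ^ 2))⁻¹ ^ 5) := by
    intro y; simp; ring
  simp only [h3]
  rw [integral_const_mul, h2, hv]
  simp
  field_simp

/-- The Newtonian kernel is a fundamental solution. -/
lemma newton_laplacian {g : R3 → ℝ} (hg : ContDiff ℝ ∞ g) (hc : HasCompactSupport g) (w : R3) :
    newton (fun w => ∑ i : Fin 3, pd i (pd i g) w) w = g w := by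
  have hgs := translate_smooth hg w
  have hgc := translate_compactSupport hc w
  set G : R3 → ℝ := fun t => g (t + w) with hG
  have hLs : ContDiff ℝ ∞ (fun t => ∑ i : Fin 3, pd i (pd i G) t) :=
    ContDiff.sum fun i _ => pd_smooth (pd_smooth hgs i) i
  have hLc : ∀ i, HasCompactSupport (pd i (pd i G)) := fun i =>
    dd_compactSupport (dd_compactSupport hgc _) _
  have hLc' : HasCompactSupport (fun t => ∑ i : Fin 3, pd i (pd i G) t) := by
    simp only [Fin.sum_univ_three]
    exact ((hLc 0).add (hLc 1)).add (hLc 2)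
  have hlim := tendsto_integral_regKer hLs.continuous hLc'
  -- two integrations by parts move the Laplacian to the kernel, regularised with `ε = 1 / (n + 1)`
  have hcalc : ∀ n : ℕ, ∫ t, (∑ i : Fin 3, pd i (pd i G) t) * regKer (1 / ((n : ℝ) + 1)) t
      = -(4 * Real.pi) * ∫ t, (((n : ℝ) + 1) ^ 3 * plummer (((n : ℝ) + 1) • t)) • G t := by
    intro n
    have hn : (0 : ℝ) < (n : ℝ) + 1 := by positivity
    have hε : (0 : ℝ) < 1 / ((n : ℝ) + 1) := by positivity
    have hk := regKer_smooth hε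
    have hi : ∀ i : Fin 3, ∫ t, pd i (pd i G) t * regKer (1 / ((n : ℝ) + 1)) t
        = ∫ t, G t * pd i (pd i (regKer (1 / ((n : ℝ) + 1)))) t := by
      intro i
      rw [integral_mul_pd hgs hgc (pd_smooth hk i) i,
        integral_mul_pd (pd_smooth hgs i) (dd_compactSupport hgc _) hk i, neg_neg]
    simp only [Finset.sum_mul]
    have hint : ∀ i : Fin 3, Integrable (fun t => pd i (pd i G) t * regKer (1 / ((n : ℝ) + 1)) t) :=
      fun i => ((pd_smooth (pd_smooth hgs i) i).continuous.mul
        hk.continuous).integrable_of_hasCompactSupport ((hLc i).mul_right)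
    have hint' : ∀ i : Fin 3,
        Integrable (fun t => G t * pd i (pd i (regKer (1 / ((n : ℝ) + 1)))) t) :=
      fun i => (hgs.continuous.mul (pd_smooth (pd_smooth hk i)
        i).continuous).integrable_of_hasCompactSupport (hgc.mul_right)
    rw [integral_finsetSum _ fun i _ => hint i]
    simp only [hi]
    rw [← integral_finsetSum _ fun i _ => hint' i, ← integral_const_mul]
    congr 1
    funext t
    rw [← Finset.mul_sum, laplacian_regKer hε]
    have e1 : regKer (1 / ((n : ℝ) + 1)) t
        = ((n : ℝ) + 1) * (Real.sqrt (1 + ‖((n : ℝ) + 1) • t‖ ^ 2))⁻¹ := by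
      have e2 : 1 + ‖((n : ℝ) + 1) • t‖ ^ 2
          = ((n : ℝ) + 1) ^ 2 * (‖t‖ ^ 2 + (1 / ((n : ℝ) + 1)) ^ 2) := by
        rw [norm_smul, Real.norm_of_nonneg hn.le]; field_simp; ring
      rw [e2, Real.sqrt_mul (by positivity), Real.sqrt_sq hn.le, regKer, mul_inv]
      field_simp
    rw [e1, plummer, smul_eq_mul]
    field_simp
  -- the decay that makes the rescaled densities an approximate identity
  have hφ : Tendsto (fun x : R3 => ‖x‖ ^ Module.finrank ℝ R3 * plummer x) (Bornology.cobounded R3)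
      (𝓝 0) := by
    have hinv : Tendsto (fun x : R3 => 3 / (4 * Real.pi) * ‖x‖⁻¹ ^ 2) (Bornology.cobounded R3)
        (𝓝 0) := by
      simpa using ((tendsto_inv_atTop_zero.comp (tendsto_norm_cobounded_atTop (E := R3))).pow
        2).const_mul (3 / (4 * Real.pi))
    refine squeeze_zero' (Eventually.of_forall fun x => by unfold plummer; positivity) ?_ hinv
    filter_upwards [(tendsto_norm_cobounded_atTop (E := R3)).eventually_gt_atTop 0] with x hx
    have hq : (Real.sqrt (1 + ‖x‖ ^ 2))⁻¹ ≤ ‖x‖⁻¹ := by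
      gcongr
      exact Real.le_sqrt_of_sq_le (by linarith)
    simp only [finrank_euclideanSpace, Fintype.card_fin, plummer]
    calc ‖x‖ ^ 3 * (3 / (4 * Real.pi) * (Real.sqrt (1 + ‖x‖ ^ 2))⁻¹ ^ 5)
        ≤ ‖x‖ ^ 3 * (3 / (4 * Real.pi) * ‖x‖⁻¹ ^ 5) := by gcongr
      _ = _ := by field_simp
  have hlim2 := tendsto_integral_comp_smul_smul_of_integrable (μ := (volume : Measure R3))
    (φ := plummer) (fun x => by unfold plummer; positivity) integral_plummer hφ
    (hgs.continuous.integrable_of_hasCompactSupport hgc) hgs.continuous.continuousAt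
  have hlim3 := hlim2.comp (tendsto_natCast_atTop_atTop (R := ℝ) |>.atTop_add
    (tendsto_const_nhds (x := (1 : ℝ))))
  simp only [Function.comp_def, finrank_euclideanSpace, Fintype.card_fin] at hlim3
  have hlim4 := (hlim3.const_mul (-(4 * Real.pi)))
  simp only [hcalc] at hlim
  have huniq := tendsto_nhds_unique hlim hlim4
  rw [newton_eq_translate]
  have e : (fun t : R3 => (∑ i : Fin 3, pd i (pd i g) (t + w)) * ‖t‖⁻¹)
      = fun t => (∑ i : Fin 3, pd i (pd i G) t) * ‖t‖⁻¹ := by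
    funext t; simp only [hG, pd_translate]
  rw [e, huniq, hG]
  simp
  field_simp

/-! ### Inequalities for extended nonnegative reals and `L²` norms -/

lemma le_of_sq_le_sq {a b : ℝ≥0∞} (h : a ^ 2 ≤ b ^ 2) : a ≤ b := by
  by_contra hlt
  exact absurd h (not_le.2 (ENNReal.pow_lt_pow_left two_ne_zero (not_le.1 hlt)))

lemma add_sq_le_four_mul (a b : ℝ≥0∞) : (a + b) ^ 2 ≤ 4 * (a ^ 2 + b ^ 2) := by
  have h : a + b ≤ 2 * max a b := by
    rw [two_mul]; exact add_le_add (le_max_left _ _) (le_max_right _ _)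
  calc (a + b) ^ 2 ≤ (2 * max a b) ^ 2 := by gcongr
    _ = 4 * (max a b) ^ 2 := by rw [mul_pow]; norm_num
    _ ≤ 4 * (a ^ 2 + b ^ 2) := by
        gcongr
        rcases max_choice a b with h | h <;> rw [h]
        · exact le_self_add
        · exact le_add_self

/-- The Cauchy-Schwarz inequality with a weight. -/
lemma sq_lintegral_mul_le {α : Type*} [MeasurableSpace α] {μ : Measure α} {f k : α → ℝ≥0∞}
    (hf : AEMeasurable f μ) (hk : AEMeasurable k μ) :
    (∫⁻ x, f x * k x ∂μ) ^ 2 ≤ (∫⁻ x, k x ∂μ) * ∫⁻ x, f x ^ 2 * k x ∂μ := by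
  have h := ENNReal.lintegral_mul_le_Lp_mul_Lq μ (Real.HolderConjugate.two_two)
    (hf.mul (hk.pow_const (1 / 2 : ℝ))) (hk.pow_const (1 / 2 : ℝ))
  have hkk : ∀ x, k x ^ (1 / 2 : ℝ) * k x ^ (1 / 2 : ℝ) = k x := by
    intro x
    rw [← ENNReal.rpow_add_of_nonneg _ _ (by norm_num) (by norm_num)]; norm_num
  have e1 : ∀ x, (f x * k x ^ (1 / 2 : ℝ)) * k x ^ (1 / 2 : ℝ) = f x * k x := by
    intro x; rw [mul_assoc, hkk]
  have e2 : ∀ x, (f x * k x ^ (1 / 2 : ℝ)) ^ (2 : ℝ) = f x ^ 2 * k x := by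
    intro x
    rw [ENNReal.rpow_two, mul_pow, sq (k x ^ (1 / 2 : ℝ)), hkk]
  have e3 : ∀ x, (k x ^ (1 / 2 : ℝ)) ^ (2 : ℝ) = k x := by
    intro x; rw [ENNReal.rpow_two, sq, hkk]
  simp only [Pi.mul_apply, e1, e2, e3] at h
  calc (∫⁻ x, f x * k x ∂μ) ^ 2
      ≤ ((∫⁻ x, f x ^ 2 * k x ∂μ) ^ (1 / 2 : ℝ) * (∫⁻ x, k x ∂μ) ^ (1 / 2 : ℝ)) ^ 2 := by gcongr
    _ = _ := by
        rw [mul_pow, ← ENNReal.rpow_two, ← ENNReal.rpow_two, ← ENNReal.rpow_mul,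
          ← ENNReal.rpow_mul]
        norm_num
        rw [mul_comm]

lemma normL2_sq {α : Type} [MeasureSpace α] (u : α → ℝ) :
    normL2 u ^ 2 = ∫⁻ x, ‖u x‖ₑ ^ 2 := by
  unfold normL2
  rw [eLpNorm_eq_lintegral_rpow_enorm_toReal (by norm_num) (by norm_num)]
  simp only [ENNReal.toReal_ofNat, ENNReal.rpow_two]
  rw [← ENNReal.rpow_two, ← ENNReal.rpow_mul]
  norm_num

/-! ### Functions that vanish outside a ball -/

/-- `g` vanishes outside the closed ball of radius `B` about `0`. On `R3 × R3`, with its supremum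
norm, this ball is `{(x, p) | ‖x‖ ≤ B, ‖p‖ ≤ B}`. -/
def VanishesOff {V : Type*} [Norm V] (B : ℝ) (g : V → ℝ) : Prop := ∀ z, B < ‖z‖ → g z = 0

section Vanish
variable {V : Type*} [NormedAddCommGroup V]

lemma VanishesOff.tsupport_subset {B : ℝ} {g : V → ℝ} (h : VanishesOff B g) :
    tsupport g ⊆ Metric.closedBall 0 B := by
  refine closure_minimal (fun z hz => ?_) Metric.isClosed_closedBall
  by_contra hz'
  exact hz (h z (by simpa using hz'))

lemma vanishesOff_of_tsupport {B : ℝ} {g : V → ℝ} (h : tsupport g ⊆ Metric.closedBall 0 B) :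
    VanishesOff B g := by
  intro z hz
  by_contra h0
  have := h (subset_tsupport g h0)
  simp at this
  linarith

lemma VanishesOff.hasCompactSupport [ProperSpace V] {B : ℝ} {g : V → ℝ} (h : VanishesOff B g) :
    HasCompactSupport g :=
  (isCompact_closedBall (0 : V) B).of_isClosed_subset (isClosed_tsupport g) h.tsupport_subset

lemma VanishesOff.dd [NormedSpace ℝ V] {B : ℝ} {g : V → ℝ} (h : VanishesOff B g) (e : V) :
    VanishesOff B (dd e g) := by
  refine vanishesOff_of_tsupport (Set.Subset.trans ?_ h.tsupport_subset)
  exact tsupport_fderiv_apply_subset ℝ e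

lemma VanishesOff.mul_right {B : ℝ} {g : V → ℝ} (h : VanishesOff B g) (u : V → ℝ) :
    VanishesOff B (fun z => g z * u z) := fun z hz => by simp [h z hz]

lemma VanishesOff.mul_left {B : ℝ} {g : V → ℝ} (h : VanishesOff B g) (u : V → ℝ) :
    VanishesOff B (fun z => u z * g z) := fun z hz => by simp [h z hz]

lemma VanishesOff.add {B : ℝ} {f g : V → ℝ} (hf : VanishesOff B f) (hg : VanishesOff B g) :
    VanishesOff B (fun z => f z + g z) := fun z hz => by simp [hf z hz, hg z hz]

lemma VanishesOff.sum {κ : Type*} {s : Finset κ} {B : ℝ} {f : κ → V → ℝ}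
    (hf : ∀ a ∈ s, VanishesOff B (f a)) : VanishesOff B (fun z => ∑ a ∈ s, f a z) :=
  fun z hz => Finset.sum_eq_zero fun a ha => hf a ha z hz

end Vanish

/-! ### Bounds for the gradient of the Newtonian potential -/

lemma measurable_sqKer : Measurable sqKer := by unfold sqKer; fun_prop

lemma sqKer_eq_rpow (t : R3) : sqKer t = ‖‖t‖ ^ (-(2 : ℝ))‖ₑ := by
  rw [sqKer, Real.rpow_neg (norm_nonneg _), Real.rpow_two]

lemma lintegral_sqKer_ball (R : ℝ) : ∫⁻ t in Metric.ball (0 : R3) R, sqKer t < ⊤ := by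
  simp only [sqKer_eq_rpow]
  exact (integrableOn_ball_norm_rpow (by norm_num) R).2

lemma lintegral_one_add_norm_rpow : ∫⁻ w : R3, ENNReal.ofReal ((1 + ‖w‖) ^ (-(4 : ℝ))) < ⊤ :=
  finite_integral_one_add_norm (by simp; norm_num)

lemma sqKer_le_one {t : R3} (ht : 1 ≤ ‖t‖) : sqKer t ≤ 1 := by
  rw [sqKer, ← enorm_one (G := ℝ), enorm_le_iff_norm_le, norm_inv, norm_pow, norm_norm, norm_one]
  exact inv_le_one_of_one_le₀ (one_le_pow₀ ht)

/-- Far from its singularity and for `t + w` in the ball of radius `B`, the kernel decays like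
`(1 + ‖w‖)^{-2}`, whose square is integrable in dimension three. -/
lemma sqKer_far {B : ℝ} (hB : 0 < B) {t w : R3} (h1 : ‖t + w‖ ≤ B) (h2 : 3 * B + 1 ≤ ‖t‖) :
    sqKer t ≤ 16 * ENNReal.ofReal ((1 + ‖w‖) ^ (-(2 : ℝ))) := by
  have h3 : ‖t‖ ≤ ‖w‖ + B := by
    have : ‖t‖ ≤ ‖t + w‖ + ‖w‖ := by simpa using norm_sub_le (t + w) w
    linarith
  have h4 : ‖w‖ - B ≤ ‖t‖ := by
    have : ‖w‖ ≤ ‖t + w‖ + ‖t‖ := by simpa using norm_sub_le (t + w) t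
    linarith
  have h5 : (1 + ‖w‖) ≤ 4 * ‖t‖ := by linarith
  have h6 : (16 : ℝ≥0∞) = ENNReal.ofReal 16 := by norm_num
  rw [sqKer, h6, ← ENNReal.ofReal_mul (by norm_num), Real.enorm_eq_ofReal (by positivity)]
  apply ENNReal.ofReal_le_ofReal
  rw [Real.rpow_neg (by positivity), Real.rpow_two]
  have h7 : 0 < ‖t‖ := by linarith
  have h8 : 0 < 1 + ‖w‖ := by positivity
  rw [inv_eq_one_div, div_le_iff₀ (by positivity), mul_assoc, ← div_eq_inv_mul, ← mul_div_assoc,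
    le_div_iff₀ (by positivity)]
  nlinarith

lemma lintegral_translate (F : R3 → ℝ≥0∞) (w : R3) : ∫⁻ t, F (t + w) = ∫⁻ t, F t :=
  lintegral_add_right_eq_self F w

/-- The `L¹` norm of a function supported in a ball is controlled by its `L²` norm. -/
lemma sq_lintegral_enorm_le {V : Type} [NormedAddCommGroup V] [MeasureSpace V] [BorelSpace V]
    {R : ℝ} {g : V → ℝ} (hg : Continuous g) (hv : VanishesOff R g) :
    (∫⁻ t, ‖g t‖ₑ) ^ 2 ≤ volume (Metric.closedBall (0 : V) R) * ∫⁻ t, ‖g t‖ₑ ^ 2 := by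
  have h1 : ∀ t, ‖g t‖ₑ = ‖g t‖ₑ * (Metric.closedBall (0 : V) R).indicator (fun _ => 1) t := by
    intro t
    by_cases ht : t ∈ Metric.closedBall (0 : V) R
    · simp [ht]
    · simp [hv t (by simpa using ht)]
  have hm : Measurable fun t => (Metric.closedBall (0 : V) R).indicator (fun _ => (1 : ℝ≥0∞)) t :=
    measurable_const.indicator Metric.isClosed_closedBall.measurableSet
  calc (∫⁻ t, ‖g t‖ₑ) ^ 2
      = (∫⁻ t, ‖g t‖ₑ * (Metric.closedBall (0 : V) R).indicator (fun _ => 1) t) ^ 2 := by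
        rw [lintegral_congr h1]
    _ ≤ _ := sq_lintegral_mul_le hg.enorm.measurable.aemeasurable hm.aemeasurable
    _ ≤ _ := by
        rw [lintegral_indicator_const Metric.isClosed_closedBall.measurableSet, one_mul]
        gcongr with t
        exact mul_le_of_le_one_right' (Set.indicator_le_self' (fun _ _ => zero_le) t)

/-- Convolution with `1 / ‖t‖²` maps `L²` functions supported in a fixed ball to `L²`, although the
kernel is not integrable. The part of the kernel near the singularity is integrable, and acts on `L²`
by Young's inequality. The far part is only tested against functions supported in the ball, where
`sqKer_far` applies. -/
lemma exists_lintegral_sq_conv_le {B : ℝ} (hB : 0 < B) : ∃ C : ℝ≥0, ∀ g : R3 → ℝ, Continuous g →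
    VanishesOff B g →
    ∫⁻ w, (∫⁻ t, ‖g (t + w)‖ₑ * sqKer t) ^ 2 ≤ C * ∫⁻ t, ‖g t‖ₑ ^ 2 := by
  set R := 3 * B + 1 with hR
  set M := ∫⁻ t in Metric.ball (0 : R3) R, sqKer t with hM
  set m2 := ∫⁻ w : R3, ENNReal.ofReal ((1 + ‖w‖) ^ (-(4 : ℝ))) with hm2
  set v := volume (Metric.closedBall (0 : R3) B) with hv
  have hMf : M ≠ ⊤ := (lintegral_sqKer_ball R).ne
  have hm2f : m2 ≠ ⊤ := lintegral_one_add_norm_rpow.ne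
  have hvf : v ≠ ⊤ := measure_closedBall_lt_top.ne
  have hCf : 4 * (M * M + 256 * m2 * v) ≠ ⊤ := by finiteness
  refine ⟨(4 * (M * M + 256 * m2 * v)).toNNReal, fun g hg hgv => ?_⟩
  rw [ENNReal.coe_toNNReal hCf]
  -- the part of the kernel near the singularity
  set k1 : R3 → ℝ≥0∞ := (Metric.ball (0 : R3) R).indicator sqKer with hk1
  have hk1m : Measurable k1 := measurable_sqKer.indicator Metric.isOpen_ball.measurableSet
  have hk1M : ∫⁻ t, k1 t = M := lintegral_indicator Metric.isOpen_ball.measurableSet _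
  have hgm : Measurable g := hg.measurable
  set I2 := ∫⁻ t, ‖g t‖ₑ ^ 2 with hI2
  have hpt : ∀ w, ∫⁻ t, ‖g (t + w)‖ₑ * sqKer t ≤ (∫⁻ t, ‖g (t + w)‖ₑ * k1 t)
      + 16 * ENNReal.ofReal ((1 + ‖w‖) ^ (-(2 : ℝ))) * ∫⁻ t, ‖g t‖ₑ := by
    intro w
    rw [← lintegral_translate (fun t => ‖g t‖ₑ) w, ← lintegral_const_mul _ (by fun_prop),
      ← lintegral_add_left (by fun_prop)]
    refine lintegral_mono fun t => ?_
    by_cases ht : ‖t‖ < R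
    · have : k1 t = sqKer t := Set.indicator_of_mem (by simpa using ht) _
      simp only [this]
      exact le_self_add
    · by_cases hw : ‖t + w‖ ≤ B
      · refine le_trans ?_ le_add_self
        rw [mul_comm]
        gcongr
        exact sqKer_far hB hw (not_lt.1 ht)
      · simp [hgv _ (not_le.1 hw)]
  -- the near part, by the Cauchy-Schwarz inequality with the weight `k1`, whose integral is `M`
  have hA : ∫⁻ w, (∫⁻ t, ‖g (t + w)‖ₑ * k1 t) ^ 2 ≤ M * M * I2 := by
    calc ∫⁻ w, (∫⁻ t, ‖g (t + w)‖ₑ * k1 t) ^ 2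
        ≤ ∫⁻ w, M * ∫⁻ t, ‖g (t + w)‖ₑ ^ 2 * k1 t := by
          refine lintegral_mono fun w => ?_
          rw [← hk1M]
          exact sq_lintegral_mul_le (by fun_prop) hk1m.aemeasurable
      _ = M * ∫⁻ w, ∫⁻ t, ‖g (t + w)‖ₑ ^ 2 * k1 t := by
          rw [lintegral_const_mul' _ _ hMf]
      _ = M * ∫⁻ t, ∫⁻ w, ‖g (t + w)‖ₑ ^ 2 * k1 t := by
          rw [lintegral_lintegral_swap]
          fun_prop
      _ = M * ∫⁻ t, I2 * k1 t := by
          congr 1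
          refine lintegral_congr fun t => ?_
          rw [lintegral_mul_const _ (by fun_prop)]
          congr 1
          exact lintegral_add_left_eq_self (fun w => ‖g w‖ₑ ^ 2) t
      _ = M * M * I2 := by
          rw [lintegral_const_mul _ hk1m, hk1M]; ring
  -- the far part, by the square integrability of `(1 + ‖w‖)^{-2}`
  have hBd : ∫⁻ w : R3, (16 * ENNReal.ofReal ((1 + ‖w‖) ^ (-(2 : ℝ))) * ∫⁻ t, ‖g t‖ₑ) ^ 2
      ≤ 256 * m2 * v * I2 := by
    have e : ∀ w : R3, (16 * ENNReal.ofReal ((1 + ‖w‖) ^ (-(2 : ℝ))) * ∫⁻ t, ‖g t‖ₑ) ^ 2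
        = 256 * (∫⁻ t, ‖g t‖ₑ) ^ 2 * ENNReal.ofReal ((1 + ‖w‖) ^ (-(4 : ℝ))) := by
      intro w
      have e1 : ENNReal.ofReal ((1 + ‖w‖) ^ (-(4 : ℝ)))
          = ENNReal.ofReal ((1 + ‖w‖) ^ (-(2 : ℝ))) ^ 2 := by
        rw [← ENNReal.ofReal_pow (by positivity), ← Real.rpow_natCast, ← Real.rpow_mul (by positivity)]
        norm_num
      rw [e1, mul_pow, mul_pow]
      norm_num
      ring
    rw [lintegral_congr e, lintegral_const_mul _ (by fun_prop)]
    calc 256 * (∫⁻ t, ‖g t‖ₑ) ^ 2 * m2 ≤ 256 * (v * I2) * m2 := by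
          gcongr; exact sq_lintegral_enorm_le hg hgv
      _ = _ := by ring
  calc ∫⁻ w, (∫⁻ t, ‖g (t + w)‖ₑ * sqKer t) ^ 2
      ≤ ∫⁻ w, 4 * ((∫⁻ t, ‖g (t + w)‖ₑ * k1 t) ^ 2
          + (16 * ENNReal.ofReal ((1 + ‖w‖) ^ (-(2 : ℝ))) * ∫⁻ t, ‖g t‖ₑ) ^ 2) := by
        refine lintegral_mono fun w => ?_
        refine le_trans ?_ (add_sq_le_four_mul _ _)
        gcongr
        exact hpt w
    _ ≤ 4 * (M * M * I2 + 256 * m2 * v * I2) := by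
        rw [lintegral_const_mul' _ _ (by norm_num), lintegral_add_right _ (by fun_prop)]
        gcongr
    _ = _ := by ring

/-- Convolution with `1 / ‖t‖²` maps `L⁶` functions supported in a fixed ball to `L^∞`: this is Hölder's
inequality with the exponents `6` and `6/5`, as `‖t‖^{-12/5}` is locally integrable. -/
lemma exists_lintegral_conv_le_L6 (B : ℝ) : ∃ C : ℝ≥0, ∀ g : R3 → ℝ, Continuous g →
    VanishesOff B g → ∀ w, ∫⁻ t, ‖g (t + w)‖ₑ * sqKer t ≤ C * eLpNorm g 6 volume := by
  set K6 : ℝ≥0∞ := ∫⁻ t in Metric.ball (0 : R3) 1, sqKer t ^ (6 / 5 : ℝ) with hK6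
  set v := volume (Metric.closedBall (0 : R3) B) with hv
  have hvf : v ≠ ⊤ := measure_closedBall_lt_top.ne
  have hKf : K6 ≠ ⊤ := by
    have h := (integrableOn_ball_norm_rpow (r := 12 / 5) (by norm_num) 1).2
    refine (lt_of_eq_of_lt (lintegral_congr fun t => ?_) h).ne
    rw [sqKer_eq_rpow, Real.enorm_eq_ofReal (by positivity), Real.enorm_eq_ofReal (by positivity),
      ENNReal.ofReal_rpow_of_nonneg (by positivity) (by norm_num), ← Real.rpow_mul (norm_nonneg _)]
    norm_num
  have hCf : (K6 + v) ^ (1 / (6 / 5) : ℝ) ≠ ⊤ :=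
    ENNReal.rpow_ne_top_of_nonneg (by norm_num) (by finiteness)
  refine ⟨((K6 + v) ^ (1 / (6 / 5) : ℝ)).toNNReal, fun g hg hgv w => ?_⟩
  rw [ENNReal.coe_toNNReal hCf]
  set k1 : R3 → ℝ≥0∞ := fun t => (Metric.closedBall (0 : R3) B).indicator (fun _ => 1) (t + w) * sqKer t
    with hk1
  have hind : Measurable fun t : R3 => (Metric.closedBall (0 : R3) B).indicator
      (fun _ => (1 : ℝ≥0∞)) t := measurable_const.indicator Metric.isClosed_closedBall.measurableSet
  have hk1m : Measurable k1 := (hind.comp (measurable_add_const w)).mul measurable_sqKer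
  have e1 : ∀ t, ‖g (t + w)‖ₑ * sqKer t = ‖g (t + w)‖ₑ * k1 t := by
    intro t
    by_cases ht : t + w ∈ Metric.closedBall (0 : R3) B
    · simp only [hk1, Set.indicator_of_mem ht, one_mul]
    · simp [hgv (t + w) (by simpa using ht)]
  have hconj : Real.HolderConjugate 6 (6 / 5) := by
    rw [Real.holderConjugate_iff]; norm_num
  have h := ENNReal.lintegral_mul_le_Lp_mul_Lq volume hconj
    (f := fun t => ‖g (t + w)‖ₑ) (g := k1) (by fun_prop) hk1m.aemeasurable
  have hk : ∫⁻ t, k1 t ^ (6 / 5 : ℝ) ≤ K6 + v := by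
    calc ∫⁻ t, k1 t ^ (6 / 5 : ℝ)
        ≤ ∫⁻ t, ((Metric.ball (0 : R3) 1).indicator (fun t => sqKer t ^ (6 / 5 : ℝ)) t
          + (Metric.closedBall (0 : R3) B).indicator (fun _ => 1) (t + w)) := by
          refine lintegral_mono fun t => ?_
          by_cases ht : t + w ∈ Metric.closedBall (0 : R3) B
          · simp only [hk1, Set.indicator_of_mem ht, one_mul]
            by_cases h1 : t ∈ Metric.ball (0 : R3) 1
            · rw [Set.indicator_of_mem h1]; exact le_self_add
            · rw [Set.indicator_of_notMem h1, zero_add]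
              exact ENNReal.rpow_le_one (sqKer_le_one (by simpa using h1)) (by norm_num)
          · simp only [hk1, Set.indicator_of_notMem ht, zero_mul]
            rw [ENNReal.zero_rpow_of_pos (by norm_num)]
            exact zero_le
      _ = K6 + v := by
          have hm : Measurable fun t : R3 => (Metric.closedBall (0 : R3) B).indicator
            (fun _ => (1 : ℝ≥0∞)) (t + w) := hind.comp (measurable_add_const w)
          rw [lintegral_add_right _ hm,
            lintegral_indicator Metric.isOpen_ball.measurableSet,
            lintegral_translate (fun t => (Metric.closedBall (0 : R3) B).indicator (fun _ => 1) t) w,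
            lintegral_indicator_const Metric.isClosed_closedBall.measurableSet, one_mul]
  have h6 : eLpNorm g 6 volume = (∫⁻ t, ‖g (t + w)‖ₑ ^ (6 : ℝ)) ^ (1 / 6 : ℝ) := by
    rw [eLpNorm_eq_lintegral_rpow_enorm_toReal (by norm_num) (by norm_num),
      lintegral_translate (fun t => ‖g t‖ₑ ^ (6 : ℝ)) w]
    simp
  rw [lintegral_congr e1, h6, mul_comm]
  refine h.trans ?_
  gcongr

/-- The Gagliardo-Nirenberg-Sobolev inequality controls the `L⁶` norm. -/
lemma exists_eLpNorm_six_le : ∃ C : ℝ≥0, ∀ g : R3 → ℝ, ContDiff ℝ ∞ g → HasCompactSupport g →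
    eLpNorm g 6 volume ≤ C * ∑ j : Fin 3, normL2 (pd j g) := by
  refine ⟨SNormLESNormFDerivOfEqConst ℝ (volume : Measure R3) 2, fun g hg hc => ?_⟩
  have h := eLpNorm_le_eLpNorm_fderiv_of_eq (F := ℝ) (μ := (volume : Measure R3))
    (hg.of_le (by exact_mod_cast (le_top : (1 : ℕ∞) ≤ ⊤))) hc (p := 2) (p' := 6) (by norm_num)
    (by simp) (by simp; norm_num)
  refine h.trans (mul_le_mul_right ?_ _)
  have hb : ∀ x, ‖fderiv ℝ g x‖ₑ ≤ ‖∑ j : Fin 3, ‖pd j g x‖‖ₑ := by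
    intro x
    rw [enorm_le_iff_norm_le, Real.norm_of_nonneg (Finset.sum_nonneg fun _ _ => norm_nonneg _)]
    refine ContinuousLinearMap.opNorm_le_bound _ (Finset.sum_nonneg fun _ _ => norm_nonneg _) ?_
    intro e
    have he : e = ∑ j : Fin 3, e j • basisVec j := by
      ext i
      simp [basisVec, Pi.single_apply]
    calc ‖fderiv ℝ g x e‖ = ‖∑ j : Fin 3, e j * pd j g x‖ := by
          conv_lhs => rw [he]
          simp [pd]
      _ ≤ ∑ j : Fin 3, ‖e j * pd j g x‖ := norm_sum_le _ _
      _ ≤ ∑ j : Fin 3, ‖pd j g x‖ * ‖e‖ := by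
          refine Finset.sum_le_sum fun j _ => ?_
          rw [norm_mul, mul_comm]
          gcongr
          exact PiLp.norm_apply_le e j
      _ = _ := by rw [Finset.sum_mul]
  calc eLpNorm (fderiv ℝ g) 2 volume ≤ eLpNorm (fun x => ∑ j : Fin 3, ‖pd j g x‖) 2 volume :=
        eLpNorm_mono_enorm hb
    _ ≤ ∑ j : Fin 3, eLpNorm (fun x => ‖pd j g x‖) 2 volume := by
        have := eLpNorm_sum_le (μ := (volume : Measure R3)) (s := Finset.univ)
          (f := fun (j : Fin 3) x => ‖pd j g x‖) (p := 2)
          (fun j _ => ((pd_smooth hg j).continuous.norm.aestronglyMeasurable)) one_le_two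
        refine le_trans (le_of_eq ?_) this
        congr 1
    _ = ∑ j : Fin 3, normL2 (pd j g) := by simp only [normL2, eLpNorm_norm]

/-- The gradient of the Newtonian potential is bounded on `L²` for sources in a fixed ball. -/
lemma exists_normL2_pd_newton_le {B : ℝ} (hB : 0 < B) : ∃ C : ℝ≥0, ∀ g : R3 → ℝ, ContDiff ℝ ∞ g →
    VanishesOff B g → ∀ i, normL2 (pd i (newton g)) ≤ C * normL2 g := by
  obtain ⟨C, hC⟩ := exists_lintegral_sq_conv_le hB
  refine ⟨NNReal.sqrt C, fun g hg hv i => le_of_sq_le_sq ?_⟩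
  rw [mul_pow, normL2_sq, normL2_sq, ← ENNReal.coe_pow, NNReal.sq_sqrt]
  refine le_trans (lintegral_mono fun w => ?_) (hC g hg.continuous hv)
  gcongr
  exact enorm_pd_newton_le hg hv.hasCompactSupport i w

/-- The gradient of the Newtonian potential is bounded in terms of one derivative in `L²`. -/
lemma exists_enorm_pd_newton_le (B : ℝ) : ∃ C : ℝ≥0, ∀ g : R3 → ℝ, ContDiff ℝ ∞ g →
    VanishesOff B g → ∀ i w, ‖pd i (newton g) w‖ₑ ≤ C * ∑ j : Fin 3, normL2 (pd j g) := by
  obtain ⟨C, hC⟩ := exists_lintegral_conv_le_L6 B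
  obtain ⟨C', hC'⟩ := exists_eLpNorm_six_le
  refine ⟨C * C', fun g hg hv i w => ?_⟩
  calc _ ≤ _ := enorm_pd_newton_le hg hv.hasCompactSupport i w
    _ ≤ _ := hC g hg.continuous hv w
    _ ≤ C * (C' * ∑ j : Fin 3, normL2 (pd j g)) := by gcongr; exact hC' g hg hv.hasCompactSupport
    _ = _ := by rw [ENNReal.coe_mul, mul_assoc]

/-- The potential of the Laplacian of `g` is `g`, so the bound for the gradient of a potential gives
the embedding of `H²` into `L^∞`. -/
lemma exists_enorm_le_normL2 (B : ℝ) : ∃ C : ℝ≥0, ∀ g : R3 → ℝ, ContDiff ℝ ∞ g →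
    VanishesOff B g → ∀ w, ‖g w‖ₑ ≤ C * ∑ i : Fin 3, ∑ j : Fin 3, normL2 (pd j (pd i g)) := by
  obtain ⟨C, hC⟩ := exists_enorm_pd_newton_le B
  refine ⟨C, fun g hg hv w => ?_⟩
  have hc := hv.hasCompactSupport
  have h1 : g w = ∑ i : Fin 3, pd i (newton (pd i g)) w := by
    rw [← newton_laplacian hg hc w, newton_eq_translate]
    have : ∀ i : Fin 3, pd i (newton (pd i g)) w
        = -(1 / (4 * Real.pi)) * ∫ t : R3, pd i (pd i g) (t + w) * ‖t‖⁻¹ := by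
      intro i
      rw [pd_newton (pd_smooth hg i) (hv.dd _).hasCompactSupport, newton_eq_translate]
    simp only [this]
    rw [← Finset.mul_sum, ← integral_finsetSum]
    · simp only [Finset.sum_mul]
    · intro i _
      exact integrable_mul_norm_inv (translate_smooth (pd_smooth (pd_smooth hg i) i) w).continuous
        (translate_compactSupport ((hv.dd _).dd _).hasCompactSupport w)
  rw [h1, Finset.mul_sum]
  refine (enorm_sum_le _ _).trans (Finset.sum_le_sum fun i _ => ?_)
  exact hC (pd i g) (pd_smooth hg i) (hv.dd _) i w

lemma laplacian_eq_sum_pd {u : R3 → ℝ} (hu : ContDiff ℝ ∞ u) (w : R3) :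
    Laplacian.laplacian u w = ∑ i : Fin 3, pd i (pd i u) w := by
  rw [InnerProductSpace.laplacian_eq_iteratedFDeriv_orthonormalBasis u
    (EuclideanSpace.basisFun (Fin 3) ℝ)]
  refine Finset.sum_congr rfl fun i _ => ?_
  rw [iteratedFDeriv_two_apply]
  have h : DifferentiableAt ℝ (fderiv ℝ u) w :=
    (hu.fderiv_right (m := ∞) (by simp)).differentiable (by simp) w
  have h2 := fderiv_clm_apply h (differentiableAt_const (basisVec i))
  change _ = fderiv ℝ (fun y => (fderiv ℝ u y) (basisVec i)) w (basisVec i)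
  rw [h2]
  simp [basisVec]

lemma laplacian_newton {ρ : R3 → ℝ} (hρ : ContDiff ℝ ∞ ρ) (hc : HasCompactSupport ρ) (w : R3) :
    Laplacian.laplacian (newton ρ) w = ρ w := by
  rw [laplacian_eq_sum_pd (newton_smooth hρ hc)]
  conv_rhs => rw [← newton_laplacian hρ hc w, newton_eq_translate]
  have : ∀ i : Fin 3, pd i (pd i (newton ρ)) w
      = -(1 / (4 * Real.pi)) * ∫ t : R3, pd i (pd i ρ) (t + w) * ‖t‖⁻¹ := by
    intro i
    rw [pd_newton hρ hc, pd_newton (pd_smooth hρ i) (dd_compactSupport hc _), newton_eq_translate]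
  simp only [this]
  rw [← Finset.mul_sum, ← integral_finsetSum]
  · simp only [Finset.sum_mul]
  · intro i _
    exact integrable_mul_norm_inv (translate_smooth (pd_smooth (pd_smooth hρ i) i) w).continuous
      (translate_compactSupport (dd_compactSupport (dd_compactSupport hc _) _) w)

lemma tendsto_newton {B : ℝ} {ρ : R3 → ℝ} (hρ : Continuous ρ) (hv : VanishesOff B ρ) :
    Tendsto (newton ρ) (cocompact R3) (𝓝 0) := by
  have hint : Integrable ρ := hρ.integrable_of_hasCompactSupport hv.hasCompactSupport
  have h1 : Tendsto (fun w : R3 => (∫ y, ‖ρ y‖) * (‖w‖ - B)⁻¹) (cocompact R3) (𝓝 0) := by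
    have : Tendsto (fun w : R3 => ‖w‖ - B) (cocompact R3) atTop :=
      tendsto_atTop_add_const_right _ _ (tendsto_norm_cocompact_atTop (E := R3))
    simpa using (tendsto_inv_atTop_zero.comp this).const_mul (∫ y, ‖ρ y‖)
  have h2 : Tendsto (fun w : R3 => ‖-(1 / (4 * Real.pi))‖ * ((∫ y, ‖ρ y‖) * (‖w‖ - B)⁻¹))
      (cocompact R3) (𝓝 0) := by simpa using h1.const_mul ‖-(1 / (4 * Real.pi))‖
  refine squeeze_zero_norm' ?_ h2
  filter_upwards [(tendsto_norm_cocompact_atTop (E := R3)).eventually_gt_atTop B] with w hw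
  unfold newton
  rw [norm_mul]
  gcongr
  rw [← integral_mul_const]
  refine norm_integral_le_of_norm_le (hint.norm.mul_const _) (Eventually.of_forall fun y => ?_)
  by_cases hy : ‖y‖ ≤ B
  · rw [norm_div, norm_norm, div_eq_mul_inv]
    have h3 : ‖w‖ - B ≤ ‖y - w‖ := by
      have : ‖w‖ - ‖y‖ ≤ ‖w - y‖ := norm_sub_norm_le w y
      rw [norm_sub_rev]; linarith
    have h4 : 0 < ‖w‖ - B := by linarith
    gcongr
  · simp [hv y (not_le.1 hy)]

/-! ### Sobolev norms built from iterated derivatives -/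

/-- The supremum of `|u|` over the set `S`. -/
def supOn {V : Type*} (S : Set V) (u : V → ℝ) : ℝ≥0∞ := ⨆ z ∈ S, ‖u z‖ₑ

lemma enorm_le_supOn {V : Type*} {S : Set V} (u : V → ℝ) {z : V} (hz : z ∈ S) : ‖u z‖ₑ ≤ supOn S u :=
  le_iSup₂ (f := fun z (_ : z ∈ S) => ‖u z‖ₑ) z hz

lemma supOn_le {V : Type*} {S : Set V} {u : V → ℝ} {C : ℝ≥0∞} (h : ∀ z ∈ S, ‖u z‖ₑ ≤ C) : supOn S u ≤ C :=
  iSup₂_le h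

/-- The properties of an `L^q` norm, on continuous functions, that Sobolev norms inherit. -/
structure NormLike {V : Type*} [TopologicalSpace V] (μ : (V → ℝ) → ℝ≥0∞) : Prop where
  add_le : ∀ f g, Continuous f → Continuous g → μ (fun z => f z + g z) ≤ μ f + μ g
  const_mul_le : ∀ (c : ℝ) f, μ (fun z => c * f z) ≤ ‖c‖ₑ * μ f

lemma normLike_supOn {V : Type*} [TopologicalSpace V] (S : Set V) : NormLike (supOn S) where
  add_le f g _ _ := supOn_le fun _ hz => (enorm_add_le _ _).trans
    (add_le_add (enorm_le_supOn f hz) (enorm_le_supOn g hz))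
  const_mul_le c f := supOn_le fun z hz => by
    rw [enorm_mul]; gcongr; exact enorm_le_supOn f hz

lemma supOn_mul_le {V : Type*} (S : Set V) (f g : V → ℝ) :
    supOn S (fun z => f z * g z) ≤ supOn S f * supOn S g :=
  supOn_le fun z hz => by
    rw [enorm_mul]
    exact mul_le_mul' (enorm_le_supOn f hz) (enorm_le_supOn g hz)

section Sobolev
variable {V : Type*} [NormedAddCommGroup V] [NormedSpace ℝ V] {ι : Type*} [Fintype ι]

/-- The sum of `μ (∂_{i₁} ⋯ ∂_{iₘ} g)` over all words `i₁ ⋯ iₘ` of length at most `n` in the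
directions `v`. In contrast to a sum over multi-indices it has a recursion in `n`, on which the
product rule can be applied directly. -/
def sob (v : ι → V) (μ : (V → ℝ) → ℝ≥0∞) : ℕ → (V → ℝ) → ℝ≥0∞
  | 0, g => μ g
  | n + 1, g => μ g + ∑ i, sob v μ n (dd (v i) g)

lemma normLike_normL2 {V : Type} [NormedAddCommGroup V] [MeasureSpace V] [BorelSpace V]
    [SecondCountableTopology V] : NormLike (normL2 : (V → ℝ) → ℝ≥0∞) where
  add_le _ _ hf hg := eLpNorm_add_le hf.aestronglyMeasurable hg.aestronglyMeasurable one_le_two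
  const_mul_le c _ := eLpNorm_const_smul_le (c := c)

variable {v : ι → V} {μ : (V → ℝ) → ℝ≥0∞}

lemma sob_succ (n : ℕ) (g : V → ℝ) : sob v μ (n + 1) g = μ g + ∑ i, sob v μ n (dd (v i) g) := rfl

lemma le_sob (n : ℕ) (g : V → ℝ) : μ g ≤ sob v μ n g := by
  cases n with
  | zero => exact le_rfl
  | succ n => exact le_self_add

lemma sob_dd_le (n : ℕ) (g : V → ℝ) (i : ι) : sob v μ n (dd (v i) g) ≤ sob v μ (n + 1) g :=
  (Finset.single_le_sum (f := fun i => sob v μ n (dd (v i) g)) (fun _ _ => zero_le)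
    (Finset.mem_univ i)).trans le_add_self

lemma sob_le_succ (n : ℕ) (g : V → ℝ) : sob v μ n g ≤ sob v μ (n + 1) g := by
  induction n generalizing g with
  | zero => exact le_self_add
  | succ n ih =>
    rw [sob_succ, sob_succ (n + 1)]
    gcongr with i
    exact ih _

lemma sob_mono {m n : ℕ} (h : m ≤ n) (g : V → ℝ) : sob v μ m g ≤ sob v μ n g := by
  induction n, h using Nat.le_induction with
  | base => exact le_rfl
  | succ n _ ih => exact ih.trans (sob_le_succ n g)

lemma sob_add_le (hμ : NormLike μ) (n : ℕ) {f g : V → ℝ} (hf : ContDiff ℝ ∞ f)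
    (hg : ContDiff ℝ ∞ g) : sob v μ n (fun z => f z + g z) ≤ sob v μ n f + sob v μ n g := by
  induction n generalizing f g with
  | zero => exact hμ.add_le f g hf.continuous hg.continuous
  | succ n ih =>
    simp only [sob_succ]
    calc _ ≤ (μ f + μ g) + ∑ i, (sob v μ n (dd (v i) f) + sob v μ n (dd (v i) g)) := by
          gcongr with i
          · exact hμ.add_le f g hf.continuous hg.continuous
          · rw [dd_add hf hg]; exact ih (dd_smooth hf _) (dd_smooth hg _)
      _ = _ := by rw [Finset.sum_add_distrib]; ring

lemma sob_const_mul_le (hμ : NormLike μ) (n : ℕ) (c : ℝ) {f : V → ℝ} (hf : ContDiff ℝ ∞ f) :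
    sob v μ n (fun z => c * f z) ≤ ‖c‖ₑ * sob v μ n f := by
  induction n generalizing f with
  | zero => exact hμ.const_mul_le c f
  | succ n ih =>
    simp only [sob_succ, mul_add, Finset.mul_sum]
    gcongr with i
    · exact hμ.const_mul_le c f
    · rw [dd_const_mul hf]; exact ih (dd_smooth hf _)

lemma sob_zero_fun (hμ : NormLike μ) (n : ℕ) : sob v μ n (fun _ => 0) = 0 := by
  have := sob_const_mul_le (v := v) hμ n 0 (f := fun _ => 0) contDiff_const
  simpa using this

lemma sob_sum_le (hμ : NormLike μ) (n : ℕ) {κ : Type*} (s : Finset κ) {f : κ → V → ℝ}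
    (hf : ∀ a ∈ s, ContDiff ℝ ∞ (f a)) :
    sob v μ n (fun z => ∑ a ∈ s, f a z) ≤ ∑ a ∈ s, sob v μ n (f a) := by
  classical
  induction s using Finset.induction_on with
  | empty => simp [sob_zero_fun hμ]
  | insert a s ha ih =>
    simp only [Finset.sum_insert ha]
    refine (sob_add_le hμ n (hf a (Finset.mem_insert_self a s))
      (ContDiff.sum fun b hb => hf b (Finset.mem_insert_of_mem hb))).trans ?_
    gcongr
    exact ih fun b hb => hf b (Finset.mem_insert_of_mem hb)

/-- The product rule, summed over all words. -/
lemma sob_mul_le {P : (V → ℝ) → Prop} (hP : ∀ f e, P f → P (dd e f))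
    {μ₁ μ₂ : (V → ℝ) → ℝ≥0∞} (hμ : NormLike μ)
    (hmul : ∀ f g, Continuous f → Continuous g → P f → μ (fun z => f z * g z) ≤ μ₁ f * μ₂ g)
    (n : ℕ) {f g : V → ℝ} (hf : ContDiff ℝ ∞ f) (hg : ContDiff ℝ ∞ g) (hPf : P f) :
    sob v μ n (fun z => f z * g z) ≤ 2 ^ n * sob v μ₁ n f * sob v μ₂ n g := by
  induction n generalizing f g with
  | zero => simpa [sob] using hmul f g hf.continuous hg.continuous hPf
  | succ n ih =>
    set F := sob v μ₁ (n + 1) f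
    set G := sob v μ₂ (n + 1) g
    have hF : sob v μ₁ n f ≤ F := sob_le_succ n f
    have hG : sob v μ₂ n g ≤ G := sob_le_succ n g
    have h0 : μ (fun z => f z * g z) ≤ 2 ^ n * μ₁ f * G := by
      calc _ ≤ μ₁ f * μ₂ g := hmul f g hf.continuous hg.continuous hPf
        _ ≤ μ₁ f * G := by gcongr; exact le_sob _ _
        _ = 1 * μ₁ f * G := by rw [one_mul]
        _ ≤ _ := by gcongr; exact one_le_pow₀ one_le_two
    have h0' : (0 : ℝ≥0∞) ≤ 2 ^ n * F * μ₂ g := zero_le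
    have h1 : ∀ i, sob v μ n (dd (v i) (fun z => f z * g z))
        ≤ 2 ^ n * sob v μ₁ n (dd (v i) f) * G + 2 ^ n * F * sob v μ₂ n (dd (v i) g) := by
      intro i
      rw [dd_mul hf hg]
      refine (sob_add_le hμ n ((dd_smooth hf _).mul hg) (hf.mul (dd_smooth hg _))).trans ?_
      gcongr
      · exact (ih (dd_smooth hf _) hg (hP _ _ hPf)).trans (by gcongr)
      · exact (ih hf (dd_smooth hg _) hPf).trans (by gcongr)
    calc sob v μ (n + 1) (fun z => f z * g z)
        ≤ (2 ^ n * μ₁ f * G + 2 ^ n * F * μ₂ g)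
          + ∑ i, (2 ^ n * sob v μ₁ n (dd (v i) f) * G + 2 ^ n * F * sob v μ₂ n (dd (v i) g)) := by
          rw [sob_succ]
          gcongr with i
          · exact h0.trans le_self_add
          · exact h1 i
      _ = 2 ^ n * F * G + 2 ^ n * F * G := by
          rw [Finset.sum_add_distrib, ← Finset.sum_mul, ← Finset.mul_sum, ← Finset.mul_sum]
          simp only [F, G, sob_succ]
          ring
      _ = _ := by rw [pow_succ]; ring

lemma sob_supOn_const (S : Set V) (n : ℕ) (c : ℝ) :
    sob v (supOn S) n (fun _ => c) ≤ ‖c‖ₑ := by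
  cases n with
  | zero => exact supOn_le fun _ _ => le_rfl
  | succ n =>
    simp only [sob_succ, dd_const, sob_zero_fun (normLike_supOn S), Finset.sum_const_zero, add_zero]
    exact supOn_le fun _ _ => le_rfl

lemma sob_supOn_mul_le (S : Set V) (n : ℕ) {f g : V → ℝ} (hf : ContDiff ℝ ∞ f)
    (hg : ContDiff ℝ ∞ g) :
    sob v (supOn S) n (fun z => f z * g z)
      ≤ 2 ^ n * sob v (supOn S) n f * sob v (supOn S) n g :=
  sob_mul_le (P := fun _ => True) (fun _ _ _ => trivial) (normLike_supOn S)
    (fun f g _ _ _ => supOn_mul_le S f g) n hf hg trivial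

end Sobolev

/-! ### Functions on phase space -/

/-- The six coordinate directions of phase space. -/
def phaseDir : Fin 3 ⊕ Fin 3 → R3 × R3 :=
  Sum.elim (fun i => (basisVec i, 0)) (fun i => (0, basisVec i))

/-- The Sobolev norm of order `n`, based on `L²`, on phase space. -/
def hNorm (n : ℕ) (g : R3 × R3 → ℝ) : ℝ≥0∞ := sob phaseDir normL2 n g

/-- The `C^n` norm on the part `{|x| ≤ B, |p| ≤ B}` of phase space. -/
def cNorm (B : ℝ) (n : ℕ) (g : R3 × R3 → ℝ) : ℝ≥0∞ :=
  sob phaseDir (supOn (Metric.closedBall 0 B)) n g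

/-- The Sobolev norm of order `n`, based on `L²`, on `ℝ³`. -/
def hNorm3 (n : ℕ) (u : R3 → ℝ) : ℝ≥0∞ := sob basisVec normL2 n u

/-- The `C^n` norm on `ℝ³`. -/
def cNorm3 (n : ℕ) (u : R3 → ℝ) : ℝ≥0∞ := sob basisVec (supOn Set.univ) n u

/-- The norm of a function of `p` as a multiplier of the Sobolev space of order `n` on phase space:
all derivatives up to order `n` in `L²`, and those of order less than `n` also in `L^∞`. -/
def aNorm : ℕ → (R3 → ℝ) → ℝ≥0∞
  | 0, u => normL2 u
  | n + 1, u => cNorm3 n u + hNorm3 (n + 1) u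

lemma hNorm_succ (n : ℕ) (g : R3 × R3 → ℝ) : hNorm (n + 1) g
    = normL2 g + (∑ i, hNorm n (dx i g) + ∑ i, hNorm n (dp i g)) := by
  rw [hNorm, sob_succ, Fintype.sum_sum_type]; rfl

lemma cNorm_succ (B : ℝ) (n : ℕ) (g : R3 × R3 → ℝ) : cNorm B (n + 1) g
    = supOn (Metric.closedBall 0 B) g + (∑ i, cNorm B n (dx i g) + ∑ i, cNorm B n (dp i g)) := by
  rw [cNorm, sob_succ, Fintype.sum_sum_type]; rfl

lemma hNorm_dx_le (n : ℕ) (g : R3 × R3 → ℝ) (i : Fin 3) : hNorm n (dx i g) ≤ hNorm (n + 1) g :=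
  sob_dd_le (v := phaseDir) n g (Sum.inl i)

lemma hNorm_dp_le (n : ℕ) (g : R3 × R3 → ℝ) (i : Fin 3) : hNorm n (dp i g) ≤ hNorm (n + 1) g :=
  sob_dd_le (v := phaseDir) n g (Sum.inr i)

lemma hNorm_mono {m n : ℕ} (h : m ≤ n) (g : R3 × R3 → ℝ) : hNorm m g ≤ hNorm n g := sob_mono h g

lemma cNorm_dx_le (B : ℝ) (n : ℕ) (g : R3 × R3 → ℝ) (i : Fin 3) :
    cNorm B n (dx i g) ≤ cNorm B (n + 1) g :=
  sob_dd_le (v := phaseDir) n g (Sum.inl i)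

lemma cNorm_dp_le (B : ℝ) (n : ℕ) (g : R3 × R3 → ℝ) (i : Fin 3) :
    cNorm B n (dp i g) ≤ cNorm B (n + 1) g :=
  sob_dd_le (v := phaseDir) n g (Sum.inr i)

lemma cNorm_mono (B : ℝ) {m n : ℕ} (h : m ≤ n) (g : R3 × R3 → ℝ) : cNorm B m g ≤ cNorm B n g :=
  sob_mono h g

lemma hNorm3_pd_le (n : ℕ) (u : R3 → ℝ) (i : Fin 3) : hNorm3 n (pd i u) ≤ hNorm3 (n + 1) u :=
  sob_dd_le (v := basisVec) n u i

lemma cNorm3_pd_le (n : ℕ) (u : R3 → ℝ) (i : Fin 3) : cNorm3 n (pd i u) ≤ cNorm3 (n + 1) u :=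
  sob_dd_le (v := basisVec) n u i

lemma hNorm3_mono {m n : ℕ} (h : m ≤ n) (u : R3 → ℝ) : hNorm3 m u ≤ hNorm3 n u := sob_mono h u

lemma cNorm3_mono {m n : ℕ} (h : m ≤ n) (u : R3 → ℝ) : cNorm3 m u ≤ cNorm3 n u := sob_mono h u

lemma aNorm_pd_le (n : ℕ) (u : R3 → ℝ) (i : Fin 3) : aNorm n (pd i u) ≤ aNorm (n + 1) u := by
  cases n with
  | zero => exact (le_sob (v := basisVec) 0 _).trans ((hNorm3_pd_le 0 u i).trans le_add_self)
  | succ n => exact add_le_add (cNorm3_pd_le n u i) (hNorm3_pd_le (n + 1) u i)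

lemma normL2_le_hNorm (n : ℕ) (g : R3 × R3 → ℝ) : normL2 g ≤ hNorm n g :=
  le_sob (v := phaseDir) n g

lemma dx_snd (u : R3 → ℝ) (hu : ContDiff ℝ ∞ u) (i : Fin 3) :
    dx i (fun z => u z.2) = fun _ => 0 := by
  funext z
  have h := (diff_of_smooth hu z.2).hasFDerivAt.comp z (hasFDerivAt_snd (𝕜 := ℝ) (p := z))
  simp only [dx]
  rw [show fderiv ℝ (fun z : R3 × R3 => u z.2) z = _ from h.fderiv]
  simp

lemma dp_snd (u : R3 → ℝ) (hu : ContDiff ℝ ∞ u) (i : Fin 3) :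
    dp i (fun z => u z.2) = fun z => pd i u z.2 := by
  funext z
  have h := (diff_of_smooth hu z.2).hasFDerivAt.comp z (hasFDerivAt_snd (𝕜 := ℝ) (p := z))
  simp only [dp]
  rw [show fderiv ℝ (fun z : R3 × R3 => u z.2) z = _ from h.fderiv]
  simp [pd]

lemma dx_fst (u : R3 → ℝ) (hu : ContDiff ℝ ∞ u) (i : Fin 3) :
    dx i (fun z => u z.1) = fun z => pd i u z.1 := by
  funext z
  have h := (diff_of_smooth hu z.1).hasFDerivAt.comp z (hasFDerivAt_fst (𝕜 := ℝ) (p := z))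
  simp only [dx]
  rw [show fderiv ℝ (fun z : R3 × R3 => u z.1) z = _ from h.fderiv]
  simp [pd]

lemma dp_fst (u : R3 → ℝ) (hu : ContDiff ℝ ∞ u) (i : Fin 3) :
    dp i (fun z => u z.1) = fun _ => 0 := by
  funext z
  have h := (diff_of_smooth hu z.1).hasFDerivAt.comp z (hasFDerivAt_fst (𝕜 := ℝ) (p := z))
  simp only [dp]
  rw [show fderiv ℝ (fun z : R3 × R3 => u z.1) z = _ from h.fderiv]
  simp

lemma snd_smooth {u : R3 → ℝ} (hu : ContDiff ℝ ∞ u) :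
    ContDiff ℝ ∞ (fun z : R3 × R3 => u z.2) := hu.comp contDiff_snd

lemma fst_smooth {u : R3 → ℝ} (hu : ContDiff ℝ ∞ u) :
    ContDiff ℝ ∞ (fun z : R3 × R3 => u z.1) := hu.comp contDiff_fst

lemma cNorm_snd_le (B : ℝ) (n : ℕ) {u : R3 → ℝ} (hu : ContDiff ℝ ∞ u) :
    cNorm B n (fun z => u z.2) ≤ cNorm3 n u := by
  induction n generalizing u with
  | zero => exact supOn_le fun z _ => enorm_le_supOn u (Set.mem_univ z.2)
  | succ n ih =>
    have hz : cNorm B n (fun _ : R3 × R3 => 0) = 0 := sob_zero_fun (normLike_supOn _) n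
    rw [cNorm_succ]
    simp only [dx_snd u hu, dp_snd u hu, hz, Finset.sum_const_zero, zero_add]
    rw [cNorm3, sob_succ]
    gcongr with i
    · exact supOn_le fun z _ => enorm_le_supOn u (Set.mem_univ z.2)
    · exact ih (pd_smooth hu i)

lemma cNorm_coord_le (B : ℝ) (n : ℕ) (j : Fin 3) :
    cNorm B n (fun z => z.1 j) ≤ ENNReal.ofReal B + 3 := by
  have h0 : supOn (Metric.closedBall (0 : R3 × R3) B) (fun z => z.1 j) ≤ ENNReal.ofReal B := by
    refine supOn_le fun z hz => ?_
    rw [← ofReal_norm]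
    apply ENNReal.ofReal_le_ofReal
    have h1 : ‖z‖ ≤ B := by simpa using hz
    exact (PiLp.norm_apply_le z.1 j).trans ((norm_fst_le z).trans h1)
  cases n with
  | zero => exact h0.trans le_self_add
  | succ n =>
    have hz : cNorm B n (fun _ : R3 × R3 => 0) = 0 := sob_zero_fun (normLike_supOn _) n
    rw [cNorm_succ]
    simp only [dx_fst _ (coord_smooth j), dp_fst _ (coord_smooth j), hz, Finset.sum_const_zero,
      add_zero, pd_coord]
    gcongr
    calc ∑ i : Fin 3, cNorm B n (fun _ => if i = j then 1 else 0) ≤ ∑ i : Fin 3, (1 : ℝ≥0∞) := by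
          gcongr with i
          refine (sob_supOn_const _ _ _).trans ?_
          split_ifs <;> simp
      _ = 3 := by simp

lemma normL2_mul_le_supOn {B : ℝ} {f : R3 × R3 → ℝ} (hfc : Continuous f) (hf : VanishesOff B f)
    (g : R3 × R3 → ℝ) :
    normL2 (fun z => f z * g z) ≤ normL2 f * supOn (Metric.closedBall 0 B) g := by
  refine le_of_sq_le_sq ?_
  rw [mul_pow, normL2_sq, normL2_sq, ← lintegral_mul_const _ (by have := hfc.measurable; fun_prop)]
  refine lintegral_mono fun z => ?_
  by_cases hz : z ∈ Metric.closedBall (0 : R3 × R3) B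
  · rw [enorm_mul, mul_pow]
    gcongr
    exact enorm_le_supOn g hz
  · simp [hf z (by simpa using hz)]

lemma hNorm_mul_le_cNorm {B : ℝ} (n : ℕ) {f g : R3 × R3 → ℝ} (hf : ContDiff ℝ ∞ f)
    (hg : ContDiff ℝ ∞ g) (hv : VanishesOff B f) :
    hNorm n (fun z => f z * g z) ≤ 2 ^ n * hNorm n f * cNorm B n g :=
  sob_mul_le (P := VanishesOff B) (fun _ e h => h.dd e) normLike_normL2
    (fun _ g hc _ hv => normL2_mul_le_supOn hc hv g) n hf hg hv

lemma sum_fin_three_sq_le (a : Fin 3 → ℝ≥0∞) : (∑ i, a i) ^ 2 ≤ 16 * ∑ i, a i ^ 2 := by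
  simp only [Fin.sum_univ_three]
  calc (a 0 + a 1 + a 2) ^ 2 ≤ 4 * ((a 0 + a 1) ^ 2 + a 2 ^ 2) := add_sq_le_four_mul _ _
    _ ≤ 4 * (4 * (a 0 ^ 2 + a 1 ^ 2) + 4 * a 2 ^ 2) := by
        gcongr
        · exact add_sq_le_four_mul _ _
        · exact le_mul_of_one_le_left' (by norm_num)
    _ = _ := by ring

lemma slice_smooth {g : R3 × R3 → ℝ} (hg : ContDiff ℝ ∞ g) (x : R3) :
    ContDiff ℝ ∞ (fun p => g (x, p)) := hg.comp (contDiff_const.prodMk contDiff_id)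

lemma pd_slice {g : R3 × R3 → ℝ} (hg : ContDiff ℝ ∞ g) (x : R3) (i : Fin 3) :
    pd i (fun p => g (x, p)) = fun p => dp i g (x, p) := by
  funext p
  have h := (diff_of_smooth hg (x, p)).hasFDerivAt.comp p (hasFDerivAt_prodMk_right (𝕜 := ℝ) x p)
  simp only [pd]
  rw [show fderiv ℝ (fun p => g (x, p)) p = _ from h.fderiv]
  simp [dp]

lemma pd_slice_left {g : R3 × R3 → ℝ} (hg : ContDiff ℝ ∞ g) (p : R3) (i : Fin 3) :
    pd i (fun x => g (x, p)) = fun x => dx i g (x, p) := by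
  funext x
  have h := (diff_of_smooth hg (x, p)).hasFDerivAt.comp x (hasFDerivAt_prodMk_left (𝕜 := ℝ) x p)
  simp only [pd]
  rw [show fderiv ℝ (fun x => g (x, p)) x = _ from h.fderiv]
  simp [dx]

lemma VanishesOff.slice {B : ℝ} {g : R3 × R3 → ℝ} (hv : VanishesOff B g) (x : R3) :
    VanishesOff B (fun p => g (x, p)) :=
  fun p hp => hv (x, p) (hp.trans_le (norm_snd_le (x, p)))

lemma VanishesOff.slice_left {B : ℝ} {g : R3 × R3 → ℝ} (hv : VanishesOff B g) (p : R3) :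
    VanishesOff B (fun x => g (x, p)) :=
  fun x hx => hv (x, p) (hx.trans_le (norm_fst_le (x, p)))

lemma normL2_sq_prod {g : R3 × R3 → ℝ} (hg : Continuous g) :
    normL2 g ^ 2 = ∫⁻ x, normL2 (fun p => g (x, p)) ^ 2 := by
  simp only [normL2_sq]
  rw [Measure.volume_eq_prod, lintegral_prod]
  have := hg.measurable
  fun_prop

/-- The top order case of the product estimate: `u` is in `L²` and `g` in `L²_x L^∞_p`. -/
lemma exists_normL2_mul_snd_le (B : ℝ) : ∃ C : ℝ≥0, ∀ (g : R3 × R3 → ℝ) (u : R3 → ℝ),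
    ContDiff ℝ ∞ g → VanishesOff B g → Continuous u →
    normL2 (fun z => g z * u z.2) ≤ C * hNorm 2 g * normL2 u := by
  obtain ⟨C, hC⟩ := exists_enorm_le_normL2 B
  refine ⟨C * 48, fun g u hg hv hu => le_of_sq_le_sq ?_⟩
  have hx : ∀ x, normL2 (fun p => g (x, p) * u p) ^ 2
      ≤ (C ^ 2 * 256 * normL2 u ^ 2)
        * ∑ i, ∑ j, normL2 (fun p => dp j (dp i g) (x, p)) ^ 2 := by
    intro x
    set N := ∑ i, ∑ j, normL2 (fun p => dp j (dp i g) (x, p))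
    have hs : ∀ p, ‖g (x, p)‖ₑ ≤ C * N := by
      intro p
      have := hC _ (slice_smooth hg x) (hv.slice x) p
      simp only [pd_slice hg x, pd_slice (dp_smooth hg _) x] at this
      exact this
    calc normL2 (fun p => g (x, p) * u p) ^ 2 = ∫⁻ p, ‖g (x, p) * u p‖ₑ ^ 2 := normL2_sq _
      _ ≤ ∫⁻ p, (C * N) ^ 2 * ‖u p‖ₑ ^ 2 := by
          refine lintegral_mono fun p => ?_
          rw [enorm_mul, mul_pow]
          gcongr
          exact hs p
      _ = (C * N) ^ 2 * normL2 u ^ 2 := by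
          rw [lintegral_const_mul _ (by have := hu.measurable; fun_prop), normL2_sq]
      _ = (C ^ 2 * normL2 u ^ 2) * N ^ 2 := by ring
      _ ≤ (C ^ 2 * normL2 u ^ 2) * (16 * ∑ i, (16 * ∑ j,
            normL2 (fun p => dp j (dp i g) (x, p)) ^ 2)) := by
          gcongr
          refine (sum_fin_three_sq_le _).trans ?_
          gcongr with i
          exact sum_fin_three_sq_le _
      _ = _ := by rw [← Finset.mul_sum]; ring
  have hm : ∀ i j : Fin 3, Measurable fun x => normL2 (fun p => dp j (dp i g) (x, p)) ^ 2 := by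
    intro i j
    simp only [normL2_sq]
    have := (dp_smooth (dp_smooth hg i) j).continuous.measurable
    exact Measurable.lintegral_prod_right' (f := fun z => ‖dp j (dp i g) z‖ₑ ^ 2) (by fun_prop)
  calc normL2 (fun z => g z * u z.2) ^ 2
      = ∫⁻ x, normL2 (fun p => g (x, p) * u p) ^ 2 :=
        normL2_sq_prod (hg.continuous.mul (hu.comp continuous_snd))
    _ ≤ ∫⁻ x, (C ^ 2 * 256 * normL2 u ^ 2)
        * ∑ i, ∑ j, normL2 (fun p => dp j (dp i g) (x, p)) ^ 2 := lintegral_mono hx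
    _ = (C ^ 2 * 256 * normL2 u ^ 2) * ∑ i, ∑ j, normL2 (dp j (dp i g)) ^ 2 := by
        rw [lintegral_const_mul _ (Finset.measurable_fun_sum _ fun i _ =>
          Finset.measurable_fun_sum _ fun j _ => hm i j),
          lintegral_finsetSum _ fun i _ => Finset.measurable_fun_sum _ fun j _ => hm i j]
        congr 1
        refine Finset.sum_congr rfl fun i _ => ?_
        rw [lintegral_finsetSum _ fun j _ => hm i j]
        refine Finset.sum_congr rfl fun j _ => ?_
        rw [normL2_sq_prod (dp_smooth (dp_smooth hg i) j).continuous]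
    _ ≤ (C ^ 2 * 256 * normL2 u ^ 2) * ∑ i : Fin 3, ∑ j : Fin 3, hNorm 2 g ^ 2 := by
        gcongr with i _ j _
        calc normL2 (dp j (dp i g)) ≤ hNorm 1 (dp i g) :=
              (normL2_le_hNorm 0 _).trans (hNorm_dp_le 0 _ j)
          _ ≤ hNorm 2 g := hNorm_dp_le 1 g i
    _ = _ := by
        simp only [Finset.sum_const, Finset.card_univ, Fintype.card_fin, nsmul_eq_mul]
        push_cast
        ring

/-- Multiplication by a function of `p` is bounded on the Sobolev space of order `n ≥ 2` by the
`aNorm` of the multiplier. Peeling off one derivative at a time, all terms in which a derivative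
falls on `g` are controlled by sup norms of lower derivatives of `u`; the only term that remains is
the one in which all derivatives fall on `u`. -/
lemma exists_hNorm_mul_snd_le (B : ℝ) (n : ℕ) : ∃ C : ℝ≥0, ∀ (g : R3 × R3 → ℝ) (u : R3 → ℝ),
    ContDiff ℝ ∞ g → VanishesOff B g → ContDiff ℝ ∞ u →
    hNorm n (fun z => g z * u z.2) ≤ C * hNorm (max n 2) g * aNorm n u := by
  induction n with
  | zero =>
    obtain ⟨C, hC⟩ := exists_normL2_mul_snd_le B
    exact ⟨C, fun g u hg hv hu => hC g u hg hv hu.continuous⟩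
  | succ n ih =>
    obtain ⟨C₀, hC₀⟩ := exists_normL2_mul_snd_le B
    obtain ⟨C, hC⟩ := ih
    refine ⟨C₀ + 6 * 2 ^ n + 3 * C, fun g u hg hv hu => ?_⟩
    have hus := snd_smooth hu
    set m := max (n + 1) 2 with hm
    set G := hNorm m g
    set A := aNorm (n + 1) u
    have hcA : cNorm3 n u ≤ A := le_self_add
    have hlow : ∀ f : R3 × R3 → ℝ, ContDiff ℝ ∞ f → VanishesOff B f → hNorm n f ≤ G →
        hNorm n (fun z => f z * u z.2) ≤ 2 ^ n * G * A := fun f hf hvf hle =>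
      (hNorm_mul_le_cNorm n hf hus hvf).trans
        (by gcongr; exact (cNorm_snd_le B n hu).trans hcA)
    have h0 : normL2 (fun z => g z * u z.2) ≤ C₀ * G * A := by
      refine (hC₀ g u hg hv hu.continuous).trans ?_
      gcongr
      · exact hNorm_mono (le_max_right _ _) g
      · exact (le_sob (v := basisVec) (n + 1) u).trans le_add_self
    have hmono : hNorm (n + 1) g ≤ G := hNorm_mono (le_max_left _ _) g
    have h1 : ∀ i, hNorm n (dx i (fun z => g z * u z.2)) ≤ 2 ^ n * G * A := by
      intro i
      rw [dx_eq_dd, dd_mul hg hus, ← dx_eq_dd]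
      simp only [dx_snd u hu, mul_zero, add_zero]
      exact hlow _ (dx_smooth hg i) (hv.dd _) ((hNorm_dx_le n g i).trans hmono)
    have h2 : ∀ i, hNorm n (dp i (fun z => g z * u z.2)) ≤ 2 ^ n * G * A + C * G * A := by
      intro i
      rw [dp_eq_dd, dd_mul hg hus, ← dp_eq_dd]
      simp only [dp_snd u hu]
      refine (sob_add_le normLike_normL2 n ((dp_smooth hg i).mul hus)
        (hg.mul (snd_smooth (pd_smooth hu i)))).trans ?_
      gcongr
      · exact hlow _ (dp_smooth hg i) (hv.dd _) ((hNorm_dp_le n g i).trans hmono)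
      · refine (hC g (pd i u) hg hv (pd_smooth hu i)).trans ?_
        gcongr
        · exact hNorm_mono (max_le_max_right _ (Nat.le_succ n)) g
        · exact aNorm_pd_le n u i
    rw [hNorm_succ]
    calc _ ≤ C₀ * G * A + (∑ i : Fin 3, 2 ^ n * G * A + ∑ i : Fin 3, (2 ^ n * G * A + C * G * A)) := by
          gcongr with i _ i
          · exact h1 i
          · exact h2 i
      _ = _ := by
          simp only [Finset.sum_const, Finset.card_univ, Fintype.card_fin, nsmul_eq_mul]
          push_cast
          ring

/-! ### Integration over the first variable -/

/-- The integral of `F (y, w)` over `y`. -/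
def marg (F : R3 × R3 → ℝ) : R3 → ℝ := fun w => ∫ y : R3, F (y, w)

/-- Differentiation under the integral sign. -/
lemma fderiv_marg {R : ℝ} {F : R3 × R3 → ℝ} (hF : ContDiff ℝ ∞ F) (hv : VanishesOff R F)
    (w : R3) (e : R3) :
    DifferentiableAt ℝ (marg F) w ∧ fderiv ℝ (marg F) w e = marg (dd ((0, e) : R3 × R3) F) w := by
  set F' : R3 → R3 → R3 →L[ℝ] ℝ := fun w y =>
    (fderiv ℝ F (y, w)).comp (ContinuousLinearMap.inr ℝ R3 R3) with hF'
  have hcf : Continuous (fderiv ℝ F) := hF.continuous_fderiv (by simp)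
  obtain ⟨M, hM⟩ := (hcf.norm.bddAbove_range_of_hasCompactSupport
    (hv.hasCompactSupport.fderiv ℝ).norm)
  have hz : ∀ y w, R < ‖y‖ → fderiv ℝ F (y, w) = 0 := by
    intro y w hy
    have : (y, w) ∉ tsupport F := fun h => by
      have h1 := hv.tsupport_subset h
      have h2 := norm_fst_le (y, w)
      simp only [Metric.mem_closedBall, dist_zero_right] at h1
      simp only at h2
      linarith
    by_contra h0
    exact this (support_fderiv_subset ℝ h0)
  have hcF' : ∀ w, Continuous (F' w) := fun w =>
    (hcf.comp (continuous_id.prodMk continuous_const)).clm_comp continuous_const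
  have key : HasFDerivAt (marg F) (∫ y, F' w y) w := by
    refine hasFDerivAt_integral_of_dominated_of_fderiv_le (F := fun w y => F (y, w)) (F' := F')
      (s := Set.univ) (bound := (Metric.closedBall (0 : R3) R).indicator fun _ =>
        M * ‖ContinuousLinearMap.inr ℝ R3 R3‖) Filter.univ_mem ?_ ?_ ?_ ?_ ?_ ?_
    · exact Eventually.of_forall fun w =>
        (hF.continuous.comp (continuous_id.prodMk continuous_const)).aestronglyMeasurable
    · exact (hF.continuous.comp (continuous_id.prodMk continuous_const)
        ).integrable_of_hasCompactSupport (hv.slice_left w).hasCompactSupport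
    · exact (hcF' w).aestronglyMeasurable
    · refine Eventually.of_forall fun y w _ => ?_
      by_cases hy : ‖y‖ ≤ R
      · rw [Set.indicator_of_mem (by simpa using hy)]
        refine (ContinuousLinearMap.opNorm_comp_le _ _).trans ?_
        gcongr
        exact hM ⟨(y, w), rfl⟩
      · rw [Set.indicator_of_notMem (by simpa using hy)]
        simp [hF', hz y w (not_le.1 hy)]
    · exact (integrable_indicator_iff Metric.isClosed_closedBall.measurableSet).2
        (integrableOn_const measure_closedBall_lt_top.ne)
    · refine Eventually.of_forall fun y w _ => ?_
      exact (diff_of_smooth hF (y, w)).hasFDerivAt.comp w (hasFDerivAt_prodMk_right (𝕜 := ℝ) y w)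
  refine ⟨key.differentiableAt, ?_⟩
  rw [key.fderiv, ContinuousLinearMap.integral_apply]
  · rfl
  · refine (hcF' w).integrable_of_hasCompactSupport ?_
    refine HasCompactSupport.intro (isCompact_closedBall (0 : R3) R) fun y hy => ?_
    simp [hF', hz y w (by simpa using hy)]

lemma pd_marg {R : ℝ} {F : R3 × R3 → ℝ} (hF : ContDiff ℝ ∞ F) (hv : VanishesOff R F) (i : Fin 3) :
    pd i (marg F) = marg (dp i F) := by
  funext w
  exact (fderiv_marg hF hv w (basisVec i)).2

lemma marg_smooth {R : ℝ} {F : R3 × R3 → ℝ} (hF : ContDiff ℝ ∞ F) (hv : VanishesOff R F) :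
    ContDiff ℝ ∞ (marg F) := by
  have h : ∀ n : ℕ, ∀ F : R3 × R3 → ℝ, ContDiff ℝ ∞ F → VanishesOff R F → ContDiff ℝ n (marg F) := by
    intro n
    induction n with
    | zero =>
      intro F hF hv
      exact contDiff_zero.2 (Differentiable.continuous (𝕜 := ℝ) fun w =>
        (fderiv_marg hF hv w 0).1)
    | succ n ih =>
      intro F hF hv
      push_cast
      rw [contDiff_succ_iff_fderiv_apply]
      refine ⟨fun w => (fderiv_marg hF hv w 0).1, by simp, fun e => ?_⟩
      have : (fun w => fderiv ℝ (marg F) w e) = marg (dd ((0, e) : R3 × R3) F) :=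
        funext fun w => (fderiv_marg hF hv w e).2
      rw [this]
      exact ih _ (dd_smooth hF _) (hv.dd _)
  exact contDiff_infty.2 fun n => h n F hF hv

lemma VanishesOff.marg {R : ℝ} {F : R3 × R3 → ℝ} (hv : VanishesOff R F) :
    VanishesOff R (marg F) := by
  intro w hw
  have : ∀ y, F (y, w) = 0 := fun y => hv (y, w) (hw.trans_le (norm_snd_le (y, w)))
  simp [VlasovPoisson.marg, this]

/-- The Cauchy-Schwarz inequality on the ball that contains the support in `y`. -/
lemma normL2_marg_le {R : ℝ} {F : R3 × R3 → ℝ} (hF : Continuous F) (hv : VanishesOff R F) :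
    normL2 (marg F) ≤ volume (Metric.closedBall (0 : R3) R) ^ (1 / 2 : ℝ) * normL2 F := by
  refine le_of_sq_le_sq ?_
  have e : (volume (Metric.closedBall (0 : R3) R) ^ (1 / 2 : ℝ)) ^ 2
      = volume (Metric.closedBall (0 : R3) R) := by
    rw [← ENNReal.rpow_two, ← ENNReal.rpow_mul]; norm_num
  rw [mul_pow, e, normL2_sq, normL2_sq, Measure.volume_eq_prod, lintegral_prod_symm, ←
    lintegral_const_mul']
  · refine lintegral_mono fun w => ?_
    refine le_trans ?_ (sq_lintegral_enorm_le (g := fun y => F (y, w))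
      (hF.comp (continuous_id.prodMk continuous_const)) (hv.slice_left w))
    gcongr
    exact enorm_integral_le_lintegral_enorm _
  · exact measure_closedBall_lt_top.ne
  · have := hF.measurable
    fun_prop

lemma hNorm3_marg_le {R : ℝ} (n : ℕ) {F : R3 × R3 → ℝ} (hF : ContDiff ℝ ∞ F)
    (hv : VanishesOff R F) :
    hNorm3 n (marg F) ≤ volume (Metric.closedBall (0 : R3) R) ^ (1 / 2 : ℝ) * hNorm n F := by
  induction n generalizing F with
  | zero => exact normL2_marg_le hF.continuous hv
  | succ n ih =>
    rw [hNorm3, sob_succ, hNorm_succ, mul_add]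
    gcongr
    · exact normL2_marg_le hF.continuous hv
    · refine le_trans ?_ (mul_le_mul_right le_add_self _)
      rw [Finset.mul_sum]
      gcongr with i
      rw [← pd_eq_dd, pd_marg hF hv]
      exact ih (dp_smooth hF i) (hv.dd _)

/-! ### Multiplier norms of the gradient of a potential -/

lemma exists_hNorm3_pd_newton_le {B : ℝ} (hB : 0 < B) : ∃ C : ℝ≥0, ∀ (n : ℕ) (ρ : R3 → ℝ),
    ContDiff ℝ ∞ ρ → VanishesOff B ρ → ∀ i, hNorm3 n (pd i (newton ρ)) ≤ C * hNorm3 n ρ := by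
  obtain ⟨C, hC⟩ := exists_normL2_pd_newton_le hB
  refine ⟨C, fun n => ?_⟩
  induction n with
  | zero => exact fun ρ hρ hv i => hC ρ hρ hv i
  | succ n ih =>
    intro ρ hρ hv i
    rw [hNorm3, sob_succ, hNorm3, sob_succ, mul_add, Finset.mul_sum]
    gcongr with j
    · exact hC ρ hρ hv i
    · rw [pd_eq_dd, dd_comm (newton_smooth hρ hv.hasCompactSupport), dd_newton hρ
        hv.hasCompactSupport, ← pd_eq_dd]
      exact ih _ (dd_smooth hρ _) (hv.dd _) i

/-- The field and its derivatives of order at most `n` are bounded by `n + 1` derivatives of the source. -/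
lemma exists_cNorm3_pd_newton_le (B : ℝ) : ∃ C : ℝ≥0, ∀ (n : ℕ) (ρ : R3 → ℝ),
    ContDiff ℝ ∞ ρ → VanishesOff B ρ →
    ∀ i, cNorm3 n (pd i (newton ρ)) ≤ 2 ^ n * C * hNorm3 (n + 1) ρ := by
  obtain ⟨C, hC⟩ := exists_enorm_pd_newton_le B
  refine ⟨C, fun n => ?_⟩
  have h0 : ∀ ρ : R3 → ℝ, ContDiff ℝ ∞ ρ → VanishesOff B ρ → ∀ i,
      supOn Set.univ (pd i (newton ρ)) ≤ C * ∑ j, normL2 (pd j ρ) :=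
    fun ρ hρ hv i => supOn_le fun w _ => hC ρ hρ hv i w
  induction n with
  | zero =>
    intro ρ hρ hv i
    rw [pow_zero, one_mul]
    refine (h0 ρ hρ hv i).trans ?_
    gcongr
    exact le_add_self
  | succ n ih =>
    intro ρ hρ hv i
    have h1 : ∀ j, cNorm3 n (dd (basisVec j) (pd i (newton ρ)))
        ≤ 2 ^ n * C * hNorm3 (n + 1) (pd j ρ) := by
      intro j
      rw [pd_eq_dd, dd_comm (newton_smooth hρ hv.hasCompactSupport), dd_newton hρ
        hv.hasCompactSupport, ← pd_eq_dd]
      exact ih _ (dd_smooth hρ _) (hv.dd _) i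
    have h2 : ∑ j, hNorm3 (n + 1) (pd j ρ) ≤ hNorm3 (n + 2) ρ := le_add_self
    calc cNorm3 (n + 1) (pd i (newton ρ))
        ≤ C * ∑ j, normL2 (pd j ρ) + ∑ j, 2 ^ n * C * hNorm3 (n + 1) (pd j ρ) := by
          rw [cNorm3, sob_succ]
          gcongr with j
          · exact h0 ρ hρ hv i
          · exact h1 j
      _ ≤ 2 ^ n * C * ∑ j, hNorm3 (n + 1) (pd j ρ) + 2 ^ n * C * ∑ j, hNorm3 (n + 1) (pd j ρ) := by
          rw [← Finset.mul_sum]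
          gcongr with j
          · exact le_mul_of_one_le_left' (one_le_pow₀ one_le_two)
          · exact le_sob (v := basisVec) _ _
      _ = 2 ^ (n + 1) * C * ∑ j, hNorm3 (n + 1) (pd j ρ) := by rw [pow_succ]; ring
      _ ≤ _ := by gcongr

/-- The gradient of a potential is as regular, as a multiplier, as its source. -/
lemma exists_aNorm_pd_newton_le {B : ℝ} (hB : 0 < B) (n : ℕ) : ∃ C : ℝ≥0, ∀ ρ : R3 → ℝ,
    ContDiff ℝ ∞ ρ → VanishesOff B ρ → ∀ i, aNorm n (pd i (newton ρ)) ≤ C * hNorm3 n ρ := by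
  obtain ⟨C₁, h₁⟩ := exists_hNorm3_pd_newton_le hB
  obtain ⟨C₂, h₂⟩ := exists_cNorm3_pd_newton_le B
  cases n with
  | zero => exact ⟨C₁, h₁ 0⟩
  | succ n =>
    refine ⟨2 ^ n * C₂ + C₁, fun ρ hρ hv i => ?_⟩
    push_cast
    rw [add_mul]
    exact add_le_add (h₂ n ρ hρ hv i) (h₁ (n + 1) ρ hρ hv i)

/-! ### Multi-indices -/

section Multi
variable {V : Type} [NormedAddCommGroup V] [NormedSpace ℝ V]

lemma iterate_dd_smooth {f : V → ℝ} (hf : ContDiff ℝ ∞ f) (e : V) (m : ℕ) :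
    ContDiff ℝ ∞ ((dd e)^[m] f) := by
  induction m with
  | zero => exact hf
  | succ m ih => rw [Function.iterate_succ_apply']; exact dd_smooth ih e

lemma dd_iterate_comm {f : V → ℝ} (hf : ContDiff ℝ ∞ f) (e e' : V) (m : ℕ) :
    dd e ((dd e')^[m] f) = (dd e')^[m] (dd e f) := by
  induction m with
  | zero => rfl
  | succ m ih =>
    rw [Function.iterate_succ_apply', Function.iterate_succ_apply',
      dd_comm (iterate_dd_smooth hf e' m), ih]

lemma multi_smooth {f : V → ℝ} (hf : ContDiff ℝ ∞ f) (w : Fin 3 → V) (I : Fin 3 → ℕ) :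
    ContDiff ℝ ∞ (multi (fun j => dd (w j)) I f) :=
  iterate_dd_smooth (iterate_dd_smooth (iterate_dd_smooth hf _ _) _ _) _ _

lemma dd_multi {f : V → ℝ} (hf : ContDiff ℝ ∞ f) (w : Fin 3 → V) (I : Fin 3 → ℕ) (e : V) :
    dd e (multi (fun j => dd (w j)) I f) = multi (fun j => dd (w j)) I (dd e f) := by
  have h2 := iterate_dd_smooth hf (w 2) (I 2)
  simp only [multi]
  rw [dd_iterate_comm (iterate_dd_smooth h2 _ _), dd_iterate_comm h2, dd_iterate_comm hf]

lemma multi_update {f : V → ℝ} (hf : ContDiff ℝ ∞ f) (w : Fin 3 → V) (I : Fin 3 → ℕ) (i : Fin 3) :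
    multi (fun j => dd (w j)) (Function.update I i (I i + 1)) f
      = multi (fun j => dd (w j)) I (dd (w i) f) := by
  have h2 := iterate_dd_smooth hf (w 2) (I 2)
  fin_cases i
  · simp [multi, Function.update, dd_iterate_comm h2, dd_iterate_comm hf]
  · simp [multi, Function.update, dd_iterate_comm hf]
  · simp [multi, Function.update]

lemma multi_comm {f : V → ℝ} (hf : ContDiff ℝ ∞ f) (w w' : Fin 3 → V) (I J : Fin 3 → ℕ) :
    multi (fun j => dd (w j)) I (multi (fun j => dd (w' j)) J f)
      = multi (fun j => dd (w' j)) J (multi (fun j => dd (w j)) I f) := by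
  have h : ∀ (e : V) (m : ℕ) (f : V → ℝ), ContDiff ℝ ∞ f →
      (dd e)^[m] (multi (fun j => dd (w' j)) J f) = multi (fun j => dd (w' j)) J ((dd e)^[m] f) := by
    intro e m
    induction m with
    | zero => intro f _; rfl
    | succ m ih =>
      intro f hf
      rw [Function.iterate_succ_apply, Function.iterate_succ_apply, dd_multi hf, ih _ (dd_smooth hf e)]
  have h2 := iterate_dd_smooth hf (w 2) (I 2)
  rw [multi.eq_1 (fun j => dd (w j)), h _ _ _ hf, h _ _ _ h2, h _ _ _ (iterate_dd_smooth h2 _ _)]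
  rfl

variable {ι : Type*} [Fintype ι] {v : ι → V} {μ : (V → ℝ) → ℝ≥0∞}

lemma sob_iterate_le (n m : ℕ) (g : V → ℝ) (i : ι) :
    sob v μ n ((dd (v i))^[m] g) ≤ sob v μ (n + m) g := by
  induction m generalizing g with
  | zero => exact le_rfl
  | succ m ih =>
    rw [Function.iterate_succ_apply]
    exact (ih _).trans (sob_dd_le (n + m) g i)

lemma sob_multi_le (n : ℕ) (c : Fin 3 → ι) (I : Fin 3 → ℕ) (g : V → ℝ) :
    sob v μ n (multi (fun j => dd (v (c j))) I g) ≤ sob v μ (n + ∑ i, I i) g := by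
  rw [Fin.sum_univ_three, ← add_assoc, ← add_assoc]
  exact (sob_iterate_le _ _ _ _).trans ((sob_iterate_le _ _ _ _).trans (sob_iterate_le _ _ _ _))

end Multi

lemma mem_multiIndexPairs {n : ℕ} {IJ : (Fin 3 → ℕ) × (Fin 3 → ℕ)} :
    IJ ∈ multiIndexPairs n ↔ ∑ i, IJ.1 i + ∑ i, IJ.2 i ≤ n := by
  simp only [multiIndexPairs, Finset.mem_filter, Finset.mem_product, Finset.mem_Iic,
    and_iff_right_iff_imp]
  intro h
  constructor
  · intro i
    have := Finset.single_le_sum (f := IJ.1) (fun _ _ => Nat.zero_le _) (Finset.mem_univ i)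
    change IJ.1 i ≤ n
    omega
  · intro i
    have := Finset.single_le_sum (f := IJ.2) (fun _ _ => Nat.zero_le _) (Finset.mem_univ i)
    change IJ.2 i ≤ n
    omega

lemma mem_multiIndices {n : ℕ} {I : Fin 3 → ℕ} : I ∈ multiIndices n ↔ ∑ i, I i ≤ n := by
  simp only [multiIndices, Finset.mem_filter, Finset.mem_Iic, and_iff_right_iff_imp]
  intro h i
  have := Finset.single_le_sum (f := I) (fun _ _ => Nat.zero_le _) (Finset.mem_univ i)
  change I i ≤ n
  omega

lemma normL2_multi_le {n : ℕ} {IJ : (Fin 3 → ℕ) × (Fin 3 → ℕ)} (h : IJ ∈ multiIndexPairs n)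
    (g : R3 × R3 → ℝ) : normL2 (multi dx IJ.1 (multi dp IJ.2 g)) ≤ hNorm n g := by
  rw [mem_multiIndexPairs] at h
  calc _ ≤ hNorm (0 + ∑ i, IJ.1 i) (multi dp IJ.2 g) :=
        sob_multi_le (v := phaseDir) (μ := normL2) 0 Sum.inl IJ.1 _
    _ ≤ hNorm (0 + ∑ i, IJ.1 i + ∑ i, IJ.2 i) g := sob_multi_le (v := phaseDir) _ Sum.inr IJ.2 g
    _ ≤ hNorm n g := hNorm_mono (by omega) g

lemma normL2_multi_pd_le {n : ℕ} {I : Fin 3 → ℕ} (h : I ∈ multiIndices n) (u : R3 → ℝ) :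
    normL2 (multi pd I u) ≤ hNorm3 n u := by
  rw [mem_multiIndices] at h
  exact (sob_multi_le (v := basisVec) (μ := normL2) 0 id I u).trans (hNorm3_mono (by omega) u)

lemma le_sum_multiIndexPairs {m : ℕ} (F : (Fin 3 → ℕ) × (Fin 3 → ℕ) → ℝ≥0∞) {I J : Fin 3 → ℕ}
    (h : ∑ i, I i + ∑ i, J i ≤ m) : F (I, J) ≤ ∑ IJ ∈ multiIndexPairs m, F IJ := by
  have hm : (I, J) ∈ multiIndexPairs m := mem_multiIndexPairs.2 h
  exact Finset.single_le_sum (fun _ _ => zero_le) hm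

/-- Partial derivatives commute, so the derivatives indexed by multi-indices account for all words. -/
lemma hNorm_le_sum_multi (m : ℕ) {f : R3 × R3 → ℝ} (hf : ContDiff ℝ ∞ f) :
    hNorm m f ≤ 7 ^ m * ∑ IJ ∈ multiIndexPairs m, normL2 (multi dx IJ.1 (multi dp IJ.2 f)) := by
  set Z := ∑ IJ ∈ multiIndexPairs m, normL2 (multi dx IJ.1 (multi dp IJ.2 f))
  have hZ : ∀ I J : Fin 3 → ℕ, ∑ i, I i + ∑ i, J i ≤ m →
      normL2 (multi dx I (multi dp J f)) ≤ Z := fun I J h =>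
    le_sum_multiIndexPairs (fun IJ => normL2 (multi dx IJ.1 (multi dp IJ.2 f))) h
  clear_value Z
  have key : ∀ n, ∀ I J : Fin 3 → ℕ, ∑ i, I i + ∑ i, J i + n ≤ m →
      hNorm n (multi dx I (multi dp J f)) ≤ 7 ^ n * Z := by
    intro n
    have hup : ∀ (I : Fin 3 → ℕ) (i : Fin 3), ∑ j, Function.update I i (I i + 1) j = ∑ j, I j + 1 := by
      intro I i
      fin_cases i <;> simp [Fin.sum_univ_three, Function.update] <;> ring
    induction n with
    | zero => intro I J h; rw [pow_zero, one_mul]; exact hZ I J h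
    | succ n ih =>
      intro I J h
      have hJ : ContDiff ℝ ∞ (multi dp J f) := multi_smooth hf _ J
      have e1 : ∀ i, dx i (multi dx I (multi dp J f))
          = multi dx (Function.update I i (I i + 1)) (multi dp J f) := fun i =>
        (dd_multi hJ (fun j => ((basisVec j, 0) : R3 × R3)) I _).trans
          (multi_update hJ (fun j => ((basisVec j, 0) : R3 × R3)) I i).symm
      have e2 : ∀ i, dp i (multi dx I (multi dp J f))
          = multi dx I (multi dp (Function.update J i (J i + 1)) f) := by
        intro i
        refine (dd_multi hJ (fun j => ((basisVec j, 0) : R3 × R3)) I _).trans ?_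
        refine congrArg (multi dx I) ?_
        exact (dd_multi hf (fun j => ((0, basisVec j) : R3 × R3)) J _).trans
          (multi_update hf (fun j => ((0, basisVec j) : R3 × R3)) J i).symm
      rw [hNorm_succ]
      calc _ ≤ 7 ^ n * Z + (∑ i : Fin 3, 7 ^ n * Z + ∑ i : Fin 3, 7 ^ n * Z) := by
            gcongr with i _ i
            · exact (hZ I J (by omega)).trans (le_mul_of_one_le_left' (one_le_pow₀ (by norm_num)))
            · rw [e1]; exact ih _ _ (by rw [hup]; omega)
            · rw [e2]; exact ih _ _ (by rw [hup]; omega)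
        _ = _ := by
            simp only [Finset.sum_const, Finset.card_univ, Fintype.card_fin, nsmul_eq_mul]
            push_cast
            ring
  exact key m (fun _ => 0) (fun _ => 0) (by simp)

/-! ### Polynomial bounds for families -/

section PolyBound
variable {α : Type}

/-- `X a ≤ C w(a) h(a)^e (1 + h(a))^D` with `C` and `D` independent of `a`. -/
def PolyBound (h w : α → ℝ≥0∞) (e : ℕ) (X : α → ℝ≥0∞) : Prop :=
  ∃ (C : ℝ≥0) (D : ℕ), ∀ a, X a ≤ C * w a * h a ^ e * (1 + h a) ^ D

variable {h h' w w' w'' X Y : α → ℝ≥0∞} {e e' : ℕ}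

lemma PolyBound.mono (hY : PolyBound h w e Y) (hXY : ∀ a, X a ≤ Y a) : PolyBound h w e X := by
  obtain ⟨C, D, hC⟩ := hY
  exact ⟨C, D, fun a => (hXY a).trans (hC a)⟩

lemma PolyBound.mono_weight (hX : PolyBound h w e X) (K : ℝ≥0) (hw : ∀ a, w a ≤ K * w' a) :
    PolyBound h w' e X := by
  obtain ⟨C, D, hC⟩ := hX
  refine ⟨C * K, D, fun a => (hC a).trans ?_⟩
  have := hw a
  calc _ ≤ C * (K * w' a) * h a ^ e * (1 + h a) ^ D := by gcongr
    _ = _ := by push_cast; ring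

lemma PolyBound.weaken (hX : PolyBound h w e X) (he : e' ≤ e) : PolyBound h w e' X := by
  obtain ⟨C, D, hC⟩ := hX
  refine ⟨C, D + (e - e'), fun a => (hC a).trans ?_⟩
  calc _ = C * w a * h a ^ e' * (h a ^ (e - e') * (1 + h a) ^ D) := by
        rw [← Nat.add_sub_cancel' he, pow_add, Nat.add_sub_cancel' he]
        ring
    _ ≤ C * w a * h a ^ e' * ((1 + h a) ^ (e - e') * (1 + h a) ^ D) := by
        gcongr; exact le_add_self
    _ = _ := by rw [← pow_add, add_comm D]

lemma PolyBound.add (hX : PolyBound h w e X) (hY : PolyBound h w e Y) :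
    PolyBound h w e (fun a => X a + Y a) := by
  obtain ⟨C, D, hC⟩ := hX
  obtain ⟨C', D', hC'⟩ := hY
  refine ⟨C + C', D + D', fun a => ?_⟩
  have h1 : (1 : ℝ≥0∞) ≤ 1 + h a := le_self_add
  calc X a + Y a ≤ C * w a * h a ^ e * (1 + h a) ^ D + C' * w a * h a ^ e * (1 + h a) ^ D' :=
        add_le_add (hC a) (hC' a)
    _ ≤ C * w a * h a ^ e * (1 + h a) ^ (D + D') + C' * w a * h a ^ e * (1 + h a) ^ (D + D') := by
        gcongr
        · omega
        · omega
    _ = _ := by push_cast; ring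

lemma PolyBound.mul (hX : PolyBound h w e X) (hY : PolyBound h w' e' Y) :
    PolyBound h (fun a => w a * w' a) (e + e') (fun a => X a * Y a) := by
  obtain ⟨C, D, hC⟩ := hX
  obtain ⟨C', D', hC'⟩ := hY
  refine ⟨C * C', D + D', fun a => (mul_le_mul' (hC a) (hC' a)).trans (le_of_eq ?_)⟩
  push_cast
  ring

lemma PolyBound.const_mul (hX : PolyBound h w e X) (K : ℝ≥0) :
    PolyBound h w e (fun a => K * X a) := by
  obtain ⟨C, D, hC⟩ := hX
  refine ⟨K * C, D, fun a => ?_⟩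
  calc K * X a ≤ K * (C * w a * h a ^ e * (1 + h a) ^ D) := by gcongr; exact hC a
    _ = _ := by push_cast; ring

lemma PolyBound.weight_mul (hX : PolyBound h w e X) (W : α → ℝ≥0∞) :
    PolyBound h (fun a => W a * w a) e (fun a => W a * X a) := by
  obtain ⟨C, D, hC⟩ := hX
  refine ⟨C, D, fun a => ?_⟩
  calc W a * X a ≤ W a * (C * w a * h a ^ e * (1 + h a) ^ D) := by gcongr; exact hC a
    _ = _ := by ring

lemma PolyBound.zero : PolyBound h w e (fun _ => 0) := ⟨0, 0, fun _ => zero_le⟩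

lemma PolyBound.of_le_weight (hX : ∀ a, X a ≤ w a) : PolyBound h w 0 X :=
  ⟨1, 0, fun a => by simpa using hX a⟩

lemma PolyBound.sum {κ : Type*} (s : Finset κ) {X : κ → α → ℝ≥0∞}
    (hX : ∀ i ∈ s, PolyBound h w e (X i)) : PolyBound h w e (fun a => ∑ i ∈ s, X i a) := by
  classical
  induction s using Finset.induction_on with
  | empty => simpa using PolyBound.zero
  | insert i s hi ih =>
    simp only [Finset.sum_insert hi]
    exact (hX i (Finset.mem_insert_self i s)).add
      (ih fun j hj => hX j (Finset.mem_insert_of_mem hj))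

lemma PolyBound.comap {β : Type} (hX : PolyBound h w e X) (π : β → α) :
    PolyBound (fun b => h (π b)) (fun b => w (π b)) e (fun b => X (π b)) := by
  obtain ⟨C, D, hC⟩ := hX
  exact ⟨C, D, fun b => hC (π b)⟩

end PolyBound

/-! ### Bounded families of functions -/

section Families
variable {α : Type} {B : ℝ} {h h' w w' w'' : α → ℝ≥0∞} {e e' n m : ℕ}

/-- A family of smooth functions on phase space that vanish for `|x| > B` and for `|p| > B`, with a
polynomial bound for the Sobolev norms of order `n`. -/
structure HFam (B : ℝ) (h w : α → ℝ≥0∞) (e n : ℕ) (g : α → R3 × R3 → ℝ) : Prop where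
  smooth : ∀ a, ContDiff ℝ ∞ (g a)
  vanish : ∀ a, VanishesOff B (g a)
  bound : PolyBound h w e (fun a => hNorm n (g a))

/-- A family of smooth functions on `ℝ³`, with a polynomial bound for the multiplier norms `aNorm` of
order `n`. -/
structure AFam (h w : α → ℝ≥0∞) (e n : ℕ) (u : α → R3 → ℝ) : Prop where
  smooth : ∀ a, ContDiff ℝ ∞ (u a)
  bound : PolyBound h w e (fun a => aNorm n (u a))

/-- A family of smooth functions on phase space, with a polynomial bound for the `C^n` norms on
`{|x| ≤ B, |p| ≤ B}`. -/
structure CFam (B : ℝ) (h w : α → ℝ≥0∞) (e n : ℕ) (u : α → R3 × R3 → ℝ) : Prop where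
  smooth : ∀ a, ContDiff ℝ ∞ (u a)
  bound : PolyBound h w e (fun a => cNorm B n (u a))

variable {g g' : α → R3 × R3 → ℝ} {u u' : α → R3 → ℝ} {c : α → R3 × R3 → ℝ}

lemma HFam.mono (hg : HFam B h w e n g) (hm : m ≤ n) : HFam B h w e m g :=
  ⟨hg.smooth, hg.vanish, hg.bound.mono fun _ => hNorm_mono hm _⟩

lemma HFam.mono_weight (hg : HFam B h w e n g) (K : ℝ≥0) (hw : ∀ a, w a ≤ K * w' a) :
    HFam B h w' e n g := ⟨hg.smooth, hg.vanish, hg.bound.mono_weight K hw⟩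

lemma HFam.weaken (hg : HFam B h w e n g) (he : e' ≤ e) : HFam B h w e' n g :=
  ⟨hg.smooth, hg.vanish, hg.bound.weaken he⟩

lemma HFam.dx (hg : HFam B h w e (n + 1) g) (i : Fin 3) :
    HFam B h w e n (fun a => dx i (g a)) :=
  ⟨fun a => dx_smooth (hg.smooth a) i, fun a => (hg.vanish a).dd _,
    hg.bound.mono fun _ => hNorm_dx_le n _ i⟩

lemma HFam.dp (hg : HFam B h w e (n + 1) g) (i : Fin 3) :
    HFam B h w e n (fun a => dp i (g a)) :=
  ⟨fun a => dp_smooth (hg.smooth a) i, fun a => (hg.vanish a).dd _,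
    hg.bound.mono fun _ => hNorm_dp_le n _ i⟩

lemma HFam.zero : HFam B h w e n (fun _ _ => 0) :=
  ⟨fun _ => contDiff_const, fun _ _ _ => rfl,
    PolyBound.zero.mono fun _ => (sob_zero_fun normLike_normL2 n).le⟩

lemma HFam.add (hg : HFam B h w e n g) (hg' : HFam B h w e n g') :
    HFam B h w e n (fun a z => g a z + g' a z) :=
  ⟨fun a => (hg.smooth a).add (hg'.smooth a), fun a => (hg.vanish a).add (hg'.vanish a),
    (hg.bound.add hg'.bound).mono fun a => sob_add_le normLike_normL2 n (hg.smooth a) (hg'.smooth a)⟩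

lemma HFam.sum {κ : Type*} (s : Finset κ) {g : κ → α → R3 × R3 → ℝ}
    (hg : ∀ i ∈ s, HFam B h w e n (g i)) : HFam B h w e n (fun a z => ∑ i ∈ s, g i a z) :=
  ⟨fun a => ContDiff.sum fun i hi => (hg i hi).smooth a,
    fun a => VanishesOff.sum fun i hi => (hg i hi).vanish a,
    (PolyBound.sum s fun i hi => (hg i hi).bound).mono fun a =>
      sob_sum_le normLike_normL2 n s fun i hi => (hg i hi).smooth a⟩

lemma HFam.weight_mul (hg : HFam B h w e n g) (c : α → ℝ)
    (hc : ∀ a, ‖c a‖ₑ * w a ≤ w' a) : HFam B h w' e n (fun a z => c a * g a z) :=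
  ⟨fun a => contDiff_const.mul (hg.smooth a), fun a => (hg.vanish a).mul_left _,
    ((hg.bound.weight_mul fun a => ‖c a‖ₑ).mono fun a =>
      sob_const_mul_le normLike_normL2 n (c a) (hg.smooth a)).mono_weight 1
        fun a => by simpa using hc a⟩

lemma HFam.const_mul (hg : HFam B h w e n g) (c : ℝ) :
    HFam B h w e n (fun a z => c * g a z) :=
  ⟨fun a => contDiff_const.mul (hg.smooth a), fun a => (hg.vanish a).mul_left _,
    (hg.bound.const_mul ‖c‖₊).mono fun a =>
      sob_const_mul_le normLike_normL2 n c (hg.smooth a)⟩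

lemma HFam.comap {β : Type} (hg : HFam B h w e n g) (π : β → α) :
    HFam B (fun b => h (π b)) (fun b => w (π b)) e n (fun b => g (π b)) :=
  ⟨fun _ => hg.smooth _, fun _ => hg.vanish _, hg.bound.comap π⟩

lemma AFam.weaken (hu : AFam h w e n u) (he : e' ≤ e) : AFam h w e' n u :=
  ⟨hu.smooth, hu.bound.weaken he⟩

lemma AFam.pd (hu : AFam h w e (n + 1) u) (i : Fin 3) : AFam h w e n (fun a => pd i (u a)) :=
  ⟨fun a => pd_smooth (hu.smooth a) i, hu.bound.mono fun _ => aNorm_pd_le n _ i⟩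

lemma AFam.comap {β : Type} (hu : AFam h w e n u) (π : β → α) :
    AFam (fun b => h (π b)) (fun b => w (π b)) e n (fun b => u (π b)) :=
  ⟨fun _ => hu.smooth _, hu.bound.comap π⟩

/-- One order is lost when a multiplier is estimated in sup norms. -/
lemma AFam.toCFam (hu : AFam h w e (n + 1) u) (B : ℝ) :
    CFam B h w e n (fun a z => u a z.2) :=
  ⟨fun a => snd_smooth (hu.smooth a), hu.bound.mono fun a =>
    (cNorm_snd_le B n (hu.smooth a)).trans le_self_add⟩

lemma CFam.coord (B : ℝ) (n : ℕ) (j : Fin 3) :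
    CFam B h (fun _ => 1) 0 n (fun _ z => z.1 j) :=
  ⟨fun _ => fst_smooth (coord_smooth j),
    ((PolyBound.of_le_weight (w := fun _ => 1) fun _ => le_rfl).const_mul (B.toNNReal + 3)).mono
      fun _ => (cNorm_coord_le B n j).trans (by push_cast; rw [mul_one]; rfl)⟩

lemma CFam.mono (hc : CFam B h w e n c) (hm : m ≤ n) : CFam B h w e m c :=
  ⟨hc.smooth, hc.bound.mono fun _ => cNorm_mono B hm _⟩

lemma CFam.dx (hg : CFam B h w e (n + 1) c) (i : Fin 3) :
    CFam B h w e n (fun a => VlasovPoisson.dx i (c a)) :=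
  ⟨fun a => dx_smooth (hg.smooth a) i, hg.bound.mono fun _ => cNorm_dx_le B n _ i⟩

lemma CFam.dp (hg : CFam B h w e (n + 1) c) (i : Fin 3) :
    CFam B h w e n (fun a => VlasovPoisson.dp i (c a)) :=
  ⟨fun a => dp_smooth (hg.smooth a) i, hg.bound.mono fun _ => cNorm_dp_le B n _ i⟩

lemma CFam.add {c' : α → R3 × R3 → ℝ} (hg : CFam B h w e n c) (hg' : CFam B h w e n c') :
    CFam B h w e n (fun a z => c a z + c' a z) :=
  ⟨fun a => (hg.smooth a).add (hg'.smooth a), (hg.bound.add hg'.bound).mono fun a =>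
    sob_add_le (normLike_supOn _) n (hg.smooth a) (hg'.smooth a)⟩

lemma CFam.sum {κ : Type*} (s : Finset κ) {c : κ → α → R3 × R3 → ℝ}
    (hg : ∀ i ∈ s, CFam B h w e n (c i)) : CFam B h w e n (fun a z => ∑ i ∈ s, c i a z) :=
  ⟨fun a => ContDiff.sum fun i hi => (hg i hi).smooth a,
    (PolyBound.sum s fun i hi => (hg i hi).bound).mono fun a =>
      sob_sum_le (normLike_supOn _) n s fun i hi => (hg i hi).smooth a⟩

lemma CFam.weight_mul (hg : CFam B h w e n c) (r : α → ℝ)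
    (hr : ∀ a, ‖r a‖ₑ * w a ≤ w' a) : CFam B h w' e n (fun a z => r a * c a z) :=
  ⟨fun a => contDiff_const.mul (hg.smooth a),
    ((hg.bound.weight_mul fun a => ‖r a‖ₑ).mono fun a =>
      sob_const_mul_le (normLike_supOn _) n (r a) (hg.smooth a)).mono_weight 1
        fun a => by simpa using hr a⟩

lemma CFam.mul {c' : α → R3 × R3 → ℝ} (hg : CFam B h w e n c) (hg' : CFam B h w' e' n c')
    (hw : ∀ a, w a * w' a ≤ w'' a) :
    CFam B h w'' (e + e') n (fun a z => c a z * c' a z) :=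
  ⟨fun a => (hg.smooth a).mul (hg'.smooth a),
    (((hg.bound.mul hg'.bound).const_mul (2 ^ n)).mono fun a => by
      refine (sob_supOn_mul_le _ n (hg.smooth a) (hg'.smooth a)).trans (le_of_eq ?_)
      push_cast
      rw [mul_assoc]
      rfl).mono_weight 1 fun a => by simpa using hw a⟩

/-- A factor that depends on `p` only may be estimated in the weaker norm `aNorm`, whose top order
derivatives are in `L²` only. This is why `f_{k,l}` needs no more than `k` extra derivatives. -/
lemma HFam.mul_snd (hg : HFam B h w e n g) (hu : AFam h w' e' n u) (hn : 2 ≤ n)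
    (hw : ∀ a, w a * w' a ≤ w'' a) :
    HFam B h w'' (e + e') n (fun a z => g a z * u a z.2) := by
  obtain ⟨C, hC⟩ := exists_hNorm_mul_snd_le B n
  rw [max_eq_left hn] at hC
  refine ⟨fun a => (hg.smooth a).mul (snd_smooth (hu.smooth a)), fun a => (hg.vanish a).mul_right _,
    (((hg.bound.mul hu.bound).const_mul C).mono fun a => ?_).mono_weight 1
      fun a => by simpa using hw a⟩
  rw [← mul_assoc]
  exact hC _ _ (hg.smooth a) (hg.vanish a) (hu.smooth a)

lemma HFam.mul_cFam (hg : HFam B h w e n g) (hc : CFam B h w' e' n c)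
    (hw : ∀ a, w a * w' a ≤ w'' a) :
    HFam B h w'' (e + e') n (fun a z => g a z * c a z) :=
  ⟨fun a => (hg.smooth a).mul (hc.smooth a), fun a => (hg.vanish a).mul_right _,
    (((hg.bound.mul hc.bound).const_mul (2 ^ n)).mono fun a => by
      refine (hNorm_mul_le_cNorm n (hg.smooth a) (hc.smooth a) (hg.vanish a)).trans (le_of_eq ?_)
      push_cast
      rw [mul_assoc]).mono_weight 1 fun a => by simpa using hw a⟩

lemma HFam.mul_coord (hg : HFam B h w e n g) (j : Fin 3) :
    HFam B h w e n (fun a z => g a z * z.1 j) :=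
  hg.mul_cFam (CFam.coord B n j) fun _ => by simp

end Families

/-! ### Taylor coefficients in coordinates -/

lemma gradient_apply {Φ : R3 → ℝ} (p : R3) (j : Fin 3) : gradient Φ p j = pd j Φ p := by
  rw [← inner_basisVec, gradient, InnerProductSpace.toDual_symm_apply]
  rfl

lemma eq_sum_basisVec (v : R3) : v = ∑ j : Fin 3, v j • basisVec j := by
  ext i
  simp [basisVec, Pi.single_apply]

lemma fderiv_eq_sum_pd (u : R3 → ℝ) (p v : R3) :
    fderiv ℝ u p v = ∑ j : Fin 3, v j * pd j u p := by
  conv_lhs => rw [eq_sum_basisVec v]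
  simp [pd]

lemma iteratedFDeriv_succ_eq_dd {u : R3 → ℝ} (hu : ContDiff ℝ ∞ u) (b : ℕ) (p : R3)
    (v : Fin (b + 1) → R3) :
    iteratedFDeriv ℝ (b + 1) u p v = iteratedFDeriv ℝ b (dd (v (Fin.last b)) u) p (Fin.init v) := by
  have hfd : ContDiff ℝ b (fderiv ℝ u) := (hu.fderiv_right (m := ∞) (by simp)).of_le
    (by exact_mod_cast le_top)
  rw [iteratedFDeriv_succ_apply_right]
  have := (ContinuousLinearMap.apply ℝ ℝ (v (Fin.last b))).iteratedFDeriv_comp_left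
    (x := p) hfd.contDiffAt (le_refl (b : WithTop ℕ∞))
  exact (congrArg (fun M => M (Fin.init v)) this).symm

/-- The last slot of an iterated derivative, expanded in coordinates. -/
lemma iteratedFDeriv_succ_eq_sum {u : R3 → ℝ} (hu : ContDiff ℝ ∞ u) (b : ℕ) (p : R3)
    (v : Fin (b + 1) → R3) :
    iteratedFDeriv ℝ (b + 1) u p v
      = ∑ j : Fin 3, v (Fin.last b) j * iteratedFDeriv ℝ b (pd j u) p (Fin.init v) := by
  have hs : ∀ j, ContDiff ℝ b (pd j u) := fun j => (pd_smooth hu j).of_le (by exact_mod_cast le_top)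
  rw [iteratedFDeriv_succ_eq_dd hu]
  have h3 : dd (v (Fin.last b)) u = fun q => ∑ j : Fin 3, v (Fin.last b) j • pd j u q := by
    funext q; rw [dd, fderiv_eq_sum_pd]; rfl
  rw [h3, iteratedFDeriv_fun_sum_apply (f := fun (j : Fin 3) q => v (Fin.last b) j • pd j u q)
    fun j _ => ((contDiff_const (c := v (Fin.last b) j)).mul (hs j)).contDiffAt]
  rw [_root_.sum_apply]
  refine Finset.sum_congr rfl fun j _ => ?_
  rw [iteratedFDeriv_const_smul_apply' (hs j).contDiffAt]
  rfl

/-! ### Bounds for the coefficients -/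

lemma mem_splits {k l : ℕ} {q : (ℕ × ℕ) × (ℕ × ℕ)} : q ∈ splits k l ↔
    (q.1.1 + q.1.2 = k ∧ q.2.1 + q.2.2 = l) ∧ q.2.1 ≤ q.1.1 ∧ q.2.2 ≤ q.1.2 := by
  rw [splits, Finset.mem_filter, Finset.mem_product, Finset.HasAntidiagonal.mem_antidiagonal,
    Finset.HasAntidiagonal.mem_antidiagonal]

section Static
variable {α : Type} {B : ℝ} {h : α → ℝ≥0∞} {e e' n m k l L : ℕ}
  {g : α → R3 × R3 → ℝ} {u Φ : α → R3 → ℝ} {f : α → ℕ → ℕ → R3 × R3 → ℝ} {φ : α → ℕ → ℕ → R3 → ℝ}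

/-- The coefficients of the Taylor expansion of `u` along `y` and `∇Φ(p)`, as multipliers. The slots of
the iterated derivative are peeled off one at a time, each giving a coordinate of `y` or of `∇Φ` and a
derivative of `u`. -/
lemma HFam.mul_iteratedFDeriv (hn : 2 ≤ n) (hΦ : ∀ j, AFam h (fun _ => 1) 0 n fun a => pd j (Φ a))
    (b l : ℕ) (hg : HFam B h (fun _ => 1) e n g) (hu : AFam h (fun _ => 1) e' (n + b) u) :
    HFam B h (fun _ => 1) (e + e') n (fun a z => g a z * iteratedFDeriv ℝ b (u a) z.2
      (fun j => if (j : ℕ) < l then gradient (Φ a) z.2 else z.1)) := by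
  induction b generalizing g u with
  | zero =>
    simp only [iteratedFDeriv_zero_apply]
    exact hg.mul_snd hu hn fun _ => by simp
  | succ b ih =>
    have key : ∀ j : Fin 3, HFam B h (fun _ => 1) e n
        (fun a z => g a z * (if b < l then gradient (Φ a) z.2 else z.1) j) := by
      intro j
      by_cases hb : b < l
      · simp only [hb, if_true, gradient_apply]
        exact hg.mul_snd (hΦ j) hn fun _ => by simp
      · simp only [hb, if_false]
        exact hg.mul_coord j
    have h2 := HFam.sum Finset.univ fun j _ => ih (key j) (hu.pd j)
    refine (congrArg _ ?_).mp h2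
    funext a z
    rw [iteratedFDeriv_succ_eq_sum (hu.smooth a), Finset.mul_sum]
    refine Finset.sum_congr rfl fun j _ => ?_
    rw [← mul_assoc]
    rfl

/-- Multiplication by `Ψ_{k,l}`: the term with `φ_{k₁,l₁}` involves `k - k₁ + 1` derivatives of the
potential, so that the total number of derivatives of the datum does not exceed `n + k`. -/
lemma HFam.mul_Psi (hn : 2 ≤ n) (hΦ : ∀ j, AFam h (fun _ => 1) 0 n fun a => pd j (Φ a))
    (hL : n + k ≤ L)
    (hφ : ∀ k' ≤ k, ∀ l' ≤ k', ∀ i, ∀ n', 2 ≤ n' → n' + k' ≤ L →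
      AFam h (fun _ => 1) 1 n' fun a => pd i (φ a k' l'))
    (hg : HFam B h (fun _ => 1) 1 n g) (l : ℕ) (i : Fin 3) :
    HFam B h (fun _ => 1) 2 n (fun a z => g a z * Psi (Φ a) (φ a) k l i z.1 z.2) := by
  have h2 := HFam.sum (splits k l) (B := B) (h := h) (w := fun _ => 1) (e := 2) (n := n)
    (g := fun q a z => ((q.1.2.choose q.2.2 : ℝ) * (-1) ^ q.2.2 / (q.1.2.factorial : ℝ))
      * (g a z * iteratedFDeriv ℝ q.1.2 (pd i (φ a q.1.1 q.2.1)) z.2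
          (fun j => if (j : ℕ) < q.2.2 then gradient (Φ a) z.2 else z.1))) (by
    intro q hq
    simp only [mem_splits] at hq
    refine HFam.const_mul ?_ _
    exact hg.mul_iteratedFDeriv hn hΦ _ _ (hφ _ (by omega) _ (by omega) i _ (by omega) (by omega)))
  refine (congrArg _ ?_).mp h2
  funext a z
  rw [Psi, Finset.mul_sum]
  exact Finset.sum_congr rfl fun q _ => by ring

/-- The bounds on the rows of `f` below `k` and on `φ` that control `f_{k,l}`. -/
structure RowBounds (B : ℝ) (h : α → ℝ≥0∞) (L k : ℕ) (Φ : α → R3 → ℝ)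
    (f : α → ℕ → ℕ → R3 × R3 → ℝ) (φ : α → ℕ → ℕ → R3 → ℝ) : Prop where
  background : ∀ n, 2 ≤ n → n ≤ L → ∀ j, AFam h (fun _ => 1) 0 n fun a => pd j (Φ a)
  density : ∀ k' < k, ∀ l' ≤ k', ∀ n, 2 ≤ n → n + k' ≤ L →
    HFam B h (fun _ => 1) 1 n fun a => f a k' l'
  potential : ∀ k' ≤ k, ∀ l' ≤ k', ∀ i, ∀ n, 2 ≤ n → n + k' ≤ L →
    AFam h (fun _ => 1) 1 n fun a => pd i (φ a k' l')

/-- The source terms are quadratic, since each of them is a product of a derivative of some `f_{k',l'}`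
and a field coefficient, which are at least linear. -/
lemma RowBounds.source (hr : RowBounds B h L k Φ f φ) (hn : 2 ≤ n) (hL : n + k ≤ L) (hk : 1 ≤ k)
    (l : ℕ) : HFam B h (fun _ => 1) 2 n (fun a => source (Φ a) (f a) (φ a) k l) := by
  have hΦ := hr.background n hn (by omega)
  have hφ : ∀ k₂ ≤ k, ∀ k' ≤ k₂, ∀ l' ≤ k', ∀ i, ∀ n', 2 ≤ n' → n' + k' ≤ L →
      AFam h (fun _ => 1) 1 n' fun a => pd i (φ a k' l') :=
    fun k₂ hk₂ k' hk' => hr.potential k' (hk'.trans hk₂)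
  have hf : ∀ k' < k, ∀ l' ≤ k', HFam B h (fun _ => 1) 1 (n + 1) fun a => f a k' l' :=
    fun k' hk' l' hl' => hr.density k' hk' l' hl' (n + 1) (by omega) (by omega)
  refine HFam.add (HFam.add ?_ ?_) ?_
  · refine HFam.const_mul (HFam.sum _ fun q hq => HFam.sum _ fun i _ => ?_) _
    simp only [Finset.mem_filter, mem_splits] at hq
    exact HFam.mul_Psi hn hΦ (by omega) (hφ _ (by omega))
      ((hf _ (by omega) _ (by omega)).dx i) _ i
  · by_cases h1 : 1 ≤ l
    · simp only [h1, if_true]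
      refine HFam.const_mul (HFam.sum _ fun q hq => HFam.sum _ fun i _ => HFam.sum _ fun j _ => ?_) _
      simp only [mem_splits] at hq
      exact (HFam.mul_Psi hn hΦ (by omega) (hφ _ (by omega))
        ((hf _ (by omega) _ (by omega)).dx i) _ j).mul_snd
          ((hr.background (n + 1) (by omega) (by omega) j).pd i) hn fun _ => by simp
    · simp only [h1, if_false]
      exact HFam.zero
  · refine HFam.const_mul (HFam.sum _ fun q hq => HFam.sum _ fun i _ => ?_) _
    simp only [mem_splits] at hq
    exact HFam.mul_Psi hn hΦ (by omega) (hφ _ (by omega))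
      ((hf _ (by omega) _ (by omega)).dp i) _ i

lemma RowBounds.fDown (hr : RowBounds B h L k Φ f φ) (hn : 2 ≤ n) (hL : n + k ≤ L) (hk : 1 ≤ k)
    (j : ℕ) : HFam B h (fun _ => 1) 2 n (fun a => fDown (Φ a) (f a) (φ a) k j) := by
  induction j with
  | zero => exact hr.source hn hL hk k
  | succ j ih => exact (ih.const_mul _).add (hr.source hn hL hk _)

lemma AFam.zero {w : α → ℝ≥0∞} : AFam h w e n (fun _ _ => 0) := by
  refine ⟨fun _ => contDiff_const, PolyBound.zero.mono fun _ => ?_⟩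
  cases n with
  | zero => exact (sob_zero_fun (v := basisVec) normLike_normL2 0).le
  | succ n =>
    simp only [aNorm, cNorm3, hNorm3]
    rw [sob_zero_fun (normLike_supOn _), sob_zero_fun normLike_normL2, add_zero]

/-- The bounds persist when the row `k` of the potentials is set to zero, as in the definition of
`𝒫_{k,l}`. This makes it possible to bound `ϱ_{k,l}` before `φ_{k,l}` is known. -/
lemma RowBounds.update_zero (hΦ : ∀ n, 2 ≤ n → n ≤ L → ∀ j, AFam h (fun _ => 1) 0 n fun a => pd j (Φ a))
    (hf : ∀ k' < k, ∀ l' ≤ k', ∀ n, 2 ≤ n → n + k' ≤ L → HFam B h (fun _ => 1) 1 n fun a => f a k' l')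
    (hφ : ∀ k' < k, ∀ l' ≤ k', ∀ i, ∀ n, 2 ≤ n → n + k' ≤ L →
      AFam h (fun _ => 1) 1 n fun a => pd i (φ a k' l')) :
    RowBounds B h L k Φ f (fun a => Function.update (φ a) k (fun _ _ => 0)) := by
  refine ⟨hΦ, hf, fun k' hk' l' hl' i n hn hL => ?_⟩
  rcases hk'.lt_or_eq with hlt | rfl
  · simp only [Function.update_of_ne hlt.ne]
    exact hφ k' hlt l' hl' i n hn hL
  · simp only [Function.update_self]
    have : pd i (fun _ : R3 => (0 : ℝ)) = fun _ => 0 := dd_const 0 (basisVec i)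
    simp only [this]
    exact AFam.zero

/-- A family of smooth functions on `ℝ³` that vanish for `|x| > B`, with a polynomial bound for the
Sobolev norms of order `n`. -/
structure RFam (B : ℝ) (h : α → ℝ≥0∞) (e n : ℕ) (ρ : α → R3 → ℝ) : Prop where
  smooth : ∀ a, ContDiff ℝ ∞ (ρ a)
  vanish : ∀ a, VanishesOff B (ρ a)
  bound : PolyBound h (fun _ => 1) e (fun a => hNorm3 n (ρ a))

lemma RFam.add {ρ ρ' : α → R3 → ℝ} (hr : RFam B h e n ρ) (hr' : RFam B h e n ρ') :
    RFam B h e n (fun a w => ρ a w + ρ' a w) :=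
  ⟨fun a => (hr.smooth a).add (hr'.smooth a), fun a => (hr.vanish a).add (hr'.vanish a),
    (hr.bound.add hr'.bound).mono fun a => sob_add_le normLike_normL2 n (hr.smooth a) (hr'.smooth a)⟩

lemma RFam.sum {κ : Type*} (s : Finset κ) {ρ : κ → α → R3 → ℝ}
    (hg : ∀ i ∈ s, RFam B h e n (ρ i)) : RFam B h e n (fun a z => ∑ i ∈ s, ρ i a z) :=
  ⟨fun a => ContDiff.sum fun i hi => (hg i hi).smooth a,
    fun a => VanishesOff.sum fun i hi => (hg i hi).vanish a,
    (PolyBound.sum s fun i hi => (hg i hi).bound).mono fun a =>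
      sob_sum_le normLike_normL2 n s fun i hi => (hg i hi).smooth a⟩

lemma HFam.marg (hg : HFam B h (fun _ => 1) e n g) : RFam B h e n (fun a => marg (g a)) := by
  have hfin : volume (Metric.closedBall (0 : R3) B) ^ (1 / 2 : ℝ) ≠ ⊤ :=
    ENNReal.rpow_ne_top_of_nonneg (by norm_num) measure_closedBall_lt_top.ne
  refine ⟨fun a => marg_smooth (hg.smooth a) (hg.vanish a), fun a => (hg.vanish a).marg,
    (hg.bound.const_mul (volume (Metric.closedBall (0 : R3) B) ^ (1 / 2 : ℝ)).toNNReal).mono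
      fun a => ?_⟩
  rw [ENNReal.coe_toNNReal hfin]
  exact hNorm3_marg_le n (hg.smooth a) (hg.vanish a)

lemma RFam.pd_newton {ρ : α → R3 → ℝ} (hB : 0 < B) (hr : RFam B h e n ρ) (i : Fin 3) :
    AFam h (fun _ => 1) e n (fun a => pd i (newton (ρ a))) := by
  obtain ⟨C, hC⟩ := exists_aNorm_pd_newton_le hB n
  exact ⟨fun a => pd_smooth (newton_smooth (hr.smooth a) (hr.vanish a).hasCompactSupport) i,
    (hr.bound.const_mul C).mono fun a => hC _ (hr.smooth a) (hr.vanish a) i⟩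

/-- The derivative `∂_{p^{i_1}} ⋯ ∂_{p^{i_k}}`, with the last one applied first. -/
def dpWord : (k : ℕ) → (Fin k → Fin 3) → (R3 × R3 → ℝ) → R3 × R3 → ℝ
  | 0, _, F => F
  | k + 1, i, F => dpWord k (Fin.init i) (dp (i (Fin.last k)) F)

lemma iteratedFDeriv_slice_eq_dpWord (k : ℕ) (i : Fin k → Fin 3) {F : R3 × R3 → ℝ}
    (hF : ContDiff ℝ ∞ F) (y w : R3) :
    iteratedFDeriv ℝ k (fun v => F (y, v)) w (fun j => basisVec (i j)) = dpWord k i F (y, w) := by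
  induction k generalizing F with
  | zero => simp [dpWord]
  | succ k ih =>
    rw [iteratedFDeriv_succ_eq_sum (slice_smooth hF y),
      Finset.sum_eq_single (i (Fin.last k)) (fun j _ hj => by simp [basisVec, hj]) (by simp)]
    rw [pd_slice hF, dpWord]
    have h1 : (basisVec (i (Fin.last k))) (i (Fin.last k)) = 1 := by simp [basisVec]
    rw [h1, one_mul]
    exact ih (Fin.init i) (dp_smooth hF _)

lemma HFam.dpWord {w : α → ℝ≥0∞} (k : ℕ) (i : Fin k → Fin 3) (hg : HFam B h w e (n + k) g) :
    HFam B h w e n (fun a => dpWord k i (g a)) := by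
  induction k generalizing g with
  | zero => exact hg
  | succ k ih => exact ih (Fin.init i) (HFam.dp (n := n + k) hg _)

lemma HFam.prod_mul (hn : 2 ≤ n) (hΦ : ∀ j, AFam h (fun _ => 1) 0 n fun a => pd j (Φ a))
    (hg : HFam B h (fun _ => 1) e n g) (k l : ℕ) (i : Fin k → Fin 3) :
    HFam B h (fun _ => 1) e n (fun a z =>
      (∏ j : Fin k, if (j : ℕ) < l then pd (i j) (Φ a) z.2 else z.1 (i j)) * g a z) := by
  induction k generalizing g with
  | zero => simpa using hg
  | succ k ih =>
    have key : HFam B h (fun _ => 1) e n (fun a z =>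
        g a z * if k < l then pd (i (Fin.last k)) (Φ a) z.2 else z.1 (i (Fin.last k))) := by
      by_cases hb : k < l
      · simp only [hb, if_true]
        exact hg.mul_snd (hΦ _) hn fun _ => by simp
      · simp only [hb, if_false]
        exact hg.mul_coord _
    refine (congrArg _ ?_).mp (ih key (Fin.init i))
    funext a z
    rw [Fin.prod_univ_castSucc]
    simp only [Fin.val_castSucc, Fin.val_last, Fin.init]
    ring

/-- The operator `D_{k,l}` in terms of partial derivatives. -/
lemma densityCoeff_eq {Φ : R3 → ℝ} {h : R3 × R3 → ℝ} (k l : ℕ)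
    (hs : ∀ i : Fin k → Fin 3, ContDiff ℝ ∞ (fun z : R3 × R3 =>
      (∏ j : Fin k, if (j : ℕ) < l then pd (i j) Φ z.2 else z.1 (i j)) * h z)) (w y : R3) :
    densityCoeff Φ h k l w y = (k.choose l : ℝ) * (-1) ^ (k - l) / (k.factorial : ℝ) *
      ∑ i : Fin k → Fin 3, dpWord k i (fun z =>
        (∏ j : Fin k, if (j : ℕ) < l then pd (i j) Φ z.2 else z.1 (i j)) * h z) (y, w) := by
  rw [densityCoeff]
  congr 1
  refine Finset.sum_congr rfl fun i _ => ?_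
  exact iteratedFDeriv_slice_eq_dpWord k i (hs i) y w

/-- The operators `D_{k,l}` cost `k` derivatives. -/
lemma HFam.densityCoeff (hΦ : ∀ n, 2 ≤ n → n ≤ L → ∀ j, AFam h (fun _ => 1) 0 n fun a => pd j (Φ a))
    (hn : 2 ≤ n) (hL : n + k ≤ L) (hg : HFam B h (fun _ => 1) e (n + k) g) (l : ℕ) :
    HFam B h (fun _ => 1) e n (fun a z => densityCoeff (Φ a) (g a) k l z.2 z.1) := by
  have hprod := fun i => HFam.prod_mul (by omega) (hΦ (n + k) (by omega) hL) hg k l i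
  have h2 := HFam.const_mul (HFam.sum Finset.univ fun i _ => HFam.dpWord k i (hprod i))
    ((k.choose l : ℝ) * (-1) ^ (k - l) / (k.factorial : ℝ))
  refine (congrArg _ ?_).mp h2
  funext a z
  rw [densityCoeff_eq k l fun i => (hprod i).smooth a]

/-- The density `ϱ_{k,l}` is controlled by the rows below `k`. -/
lemma rhoNext_bound (hΦ : ∀ n, 2 ≤ n → n ≤ L → ∀ j, AFam h (fun _ => 1) 0 n fun a => pd j (Φ a))
    (hf : ∀ k' < k, ∀ l' ≤ k', ∀ n, 2 ≤ n → n + k' ≤ L → HFam B h (fun _ => 1) 1 n fun a => f a k' l')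
    (hφ : ∀ k' < k, ∀ l' ≤ k', ∀ i, ∀ n, 2 ≤ n → n + k' ≤ L →
      AFam h (fun _ => 1) 1 n fun a => pd i (φ a k' l'))
    (hn : 2 ≤ n) (hL : n + k ≤ L) (hk : 1 ≤ k) (l : ℕ) :
    RFam B h 1 n (fun a => rhoNext (Φ a) (f a) (φ a) k l) := by
  refine RFam.add ?_ (RFam.sum _ fun q hq => ?_)
  · exact (((RowBounds.update_zero hΦ hf hφ).fDown hn hL hk (k - l)).weaken (by omega)).marg
  · simp only [Finset.mem_filter, mem_splits] at hq
    exact (HFam.densityCoeff hΦ hn (by omega)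
      (hf q.1.1 (by omega) q.2.1 (by omega) (n + q.1.2) (by omega) (by omega)) q.2.2).marg

end Static

/-! ### The recursion for the coefficients -/

section Table
variable {Φ : R3 → ℝ} {f f' : ℕ → ℕ → R3 × R3 → ℝ} {φ φ' : ℕ → ℕ → R3 → ℝ} {k : ℕ}

lemma Psi_congr (hφ : ∀ k' ≤ k, φ k' = φ' k') (l : ℕ) : Psi Φ φ k l = Psi Φ φ' k l := by
  funext i y p
  refine Finset.sum_congr rfl fun q hq => ?_
  simp only [mem_splits] at hq
  rw [hφ q.1.1 (by omega)]

lemma source_congr (hk : 1 ≤ k) (hf : ∀ k' < k, f k' = f' k') (hφ : ∀ k' ≤ k, φ k' = φ' k') (l : ℕ) :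
    source Φ f φ k l = source Φ f' φ' k l := by
  have hP : ∀ k' ≤ k, Psi Φ φ k' = Psi Φ φ' k' := fun k' hk' =>
    funext fun l => Psi_congr (fun k'' h => hφ k'' (h.trans hk')) l
  funext z
  simp only [source]
  congr 1
  · congr 1
    · congr 1
      refine Finset.sum_congr rfl fun q hq => ?_
      simp only [Finset.mem_filter, mem_splits] at hq
      rw [hf q.1.1 (by omega), hP q.1.2 (by omega)]
    · congr 2
      refine Finset.sum_congr rfl fun q hq => ?_
      simp only [mem_splits] at hq
      rw [hf q.1.1 (by omega), hP q.1.2 (by omega)]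
  · congr 1
    refine Finset.sum_congr rfl fun q hq => ?_
    simp only [mem_splits] at hq
    rw [hf q.1.1 (by omega), hP q.1.2 (by omega)]

lemma fDown_congr (hk : 1 ≤ k) (hf : ∀ k' < k, f k' = f' k') (hφ : ∀ k' ≤ k, φ k' = φ' k') (j : ℕ) :
    fDown Φ f φ k j = fDown Φ f' φ' k j := by
  induction j with
  | zero => exact source_congr hk hf hφ k
  | succ j ih => simp only [fDown, ih, source_congr hk hf hφ]

lemma rhoNext_congr (hk : 1 ≤ k) (hf : ∀ k' < k, f k' = f' k') (hφ : ∀ k' < k, φ k' = φ' k') (l : ℕ) :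
    rhoNext Φ f φ k l = rhoNext Φ f' φ' k l := by
  funext w
  simp only [rhoNext, calP]
  rw [fDown_congr (φ' := Function.update φ' k fun _ _ => 0) hk hf]
  · congr 1
    refine Finset.sum_congr rfl fun q hq => ?_
    simp only [Finset.mem_filter, mem_splits] at hq
    rw [hf q.1.1 (by omega)]
  · intro k' hk'
    rcases hk'.lt_or_eq with hlt | rfl
    · simp only [Function.update_of_ne hlt.ne]
      exact hφ k' hlt
    · simp

variable (F : R3 × R3 → ℝ)

/-- The rows of the table are not changed by later steps of the recursion. -/
lemma table_row {k K : ℕ} (h : k ≤ K) :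
    (table F K).f k = fCoeff F k ∧ (table F K).rho k = rhoCoeff F k
      ∧ (table F K).phi k = phiCoeff F k := by
  induction K, h using Nat.le_induction with
  | base => exact ⟨rfl, rfl, rfl⟩
  | succ K hK ih =>
    have hne : k ≠ K + 1 := by omega
    simp only [table, Function.update_of_ne hne]
    exact ih

lemma fCoeff_zero (l : ℕ) : fCoeff F 0 l = F := rfl
lemma rhoCoeff_zero (l : ℕ) : rhoCoeff F 0 l = rhoInf F := rfl
lemma phiCoeff_zero (l : ℕ) : phiCoeff F 0 l = phiInf F := rfl

/-- The defining recursion for `ϱ_{k,l}`, with all rows in place. -/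
lemma rhoCoeff_succ (K l : ℕ) : rhoCoeff F (K + 1) l
    = rhoNext (phiInf F) (fCoeff F) (phiCoeff F) (K + 1) l := by
  have h1 : rhoCoeff F (K + 1) l
      = rhoNext (phiInf F) (table F K).f (table F K).phi (K + 1) l := by
    simp only [rhoCoeff, table, Function.update_self]
  rw [h1]
  exact rhoNext_congr (by omega) (fun k' h => (table_row F (by omega)).1)
    (fun k' h => (table_row F (by omega)).2.2) l

lemma phiCoeff_eq_newton (k l : ℕ) : phiCoeff F k l = newton (rhoCoeff F k l) := by
  cases k with
  | zero => rfl
  | succ K => simp only [phiCoeff, rhoCoeff, table, Function.update_self]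

/-- The defining recursion for `f_{k,l}`, with all rows in place. -/
lemma fCoeff_succ (K l : ℕ) : fCoeff F (K + 1) l
    = fDown (phiInf F) (fCoeff F) (phiCoeff F) (K + 1) (K + 1 - l) := by
  have h1 : fCoeff F (K + 1) l
      = fDown (phiInf F) (table F K).f (table F (K + 1)).phi (K + 1) (K + 1 - l) := by
    simp only [fCoeff, table, Function.update_self]
  rw [h1]
  exact fDown_congr (by omega) (fun k' h => (table_row F (by omega)).1)
    (fun k' h => (table_row F (by omega)).2.2) _

end Table

/-- The admissible data: smooth functions that vanish for `|x| > B` and for `|p| > B`. -/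
structure Datum (B : ℝ) where
  /-- the asymptotic distribution function -/
  f : R3 × R3 → ℝ
  smooth : ContDiff ℝ ∞ f
  vanish : VanishesOff B f

/-- The Sobolev norm of order `L` of the datum. -/
def level {B : ℝ} (L : ℕ) (d : Datum B) : ℝ≥0∞ := hNorm L d.f

section Coefficients
variable {B : ℝ} {L n k l : ℕ}

lemma datum_hFam (hL : n ≤ L) :
    HFam B (level L) (fun _ => 1) 1 n (fun d : Datum B => d.f) :=
  ⟨Datum.smooth, Datum.vanish, 1, 0, fun d => by simpa [level] using hNorm_mono hL d.f⟩

lemma background_aFam (hB : 0 < B) (hL : n ≤ L) (i : Fin 3) :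
    AFam (level L) (fun _ => 1) 1 n (fun d : Datum B => pd i (phiInf d.f)) :=
  (datum_hFam hL).marg.pd_newton hB i

/-- The bounds for all coefficients, by recursion on `k`: with respect to the Sobolev norm of order
`n + k` of the datum, `f_{k,l}` is at least quadratic if `k ≥ 1`, and `ϱ_{k,l}` at least linear. -/
lemma coeff_bounds (hB : 0 < B) (L k : ℕ) : ∀ l ≤ k, ∀ n, 2 ≤ n → n + k ≤ L →
    HFam B (level L) (fun _ => 1) (if k = 0 then 1 else 2) n (fun d : Datum B => fCoeff d.f k l) ∧
    RFam B (level L) 1 n (fun d : Datum B => rhoCoeff d.f k l) := by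
  induction k using Nat.strong_induction_on with
  | _ k ih =>
  intro l hl n hn hL
  cases k with
  | zero => exact ⟨datum_hFam hL, (datum_hFam hL).marg⟩
  | succ K =>
    have hΦ : ∀ n, 2 ≤ n → n ≤ L → ∀ j,
        AFam (level L) (fun _ => 1) 0 n fun d : Datum B => pd j (phiInf d.f) :=
      fun n _ hnL j => (background_aFam hB hnL j).weaken (by omega)
    have hf : ∀ k' < K + 1, ∀ l' ≤ k', ∀ n, 2 ≤ n → n + k' ≤ L →
        HFam B (level L) (fun _ => 1) 1 n fun d : Datum B => fCoeff d.f k' l' :=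
      fun k' hk' l' hl' n hn hL => (ih k' hk' l' hl' n hn hL).1.weaken (by split_ifs <;> omega)
    have hφ : ∀ k' < K + 1, ∀ l' ≤ k', ∀ i, ∀ n, 2 ≤ n → n + k' ≤ L →
        AFam (level L) (fun _ => 1) 1 n fun d : Datum B => pd i (phiCoeff d.f k' l') := by
      intro k' hk' l' hl' i n hn hL
      simp only [phiCoeff_eq_newton]
      exact (ih k' hk' l' hl' n hn hL).2.pd_newton hB i
    have hρ : ∀ l, ∀ n, 2 ≤ n → n + (K + 1) ≤ L →
        RFam B (level L) 1 n (fun d : Datum B => rhoCoeff d.f (K + 1) l) := by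
      intro l n hn hL
      simp only [rhoCoeff_succ]
      exact rhoNext_bound hΦ hf hφ hn hL (by omega) l
    refine ⟨?_, hρ l n hn hL⟩
    simp only [fCoeff_succ]
    refine RowBounds.fDown ⟨hΦ, hf, fun k' hk' l' hl' i n hn hL => ?_⟩ hn hL (by omega) _
    rcases hk'.lt_or_eq with hlt | rfl
    · exact hφ k' hlt l' hl' i n hn hL
    · simp only [phiCoeff_eq_newton]
      exact (hρ l' n hn hL).pd_newton hB i

lemma fCoeff_hFam (hB : 0 < B) (hn : 2 ≤ n) (hl : l ≤ k) (hL : n + k ≤ L) :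
    HFam B (level L) (fun _ => 1) 1 n (fun d : Datum B => fCoeff d.f k l) :=
  (coeff_bounds hB L k l hl n hn hL).1.weaken (by split_ifs <;> omega)

lemma fCoeff_hFam_two (hB : 0 < B) (hn : 2 ≤ n) (hk : 1 ≤ k) (hl : l ≤ k) (hL : n + k ≤ L) :
    HFam B (level L) (fun _ => 1) 2 n (fun d : Datum B => fCoeff d.f k l) :=
  (coeff_bounds hB L k l hl n hn hL).1.weaken (by split_ifs <;> omega)

lemma rhoCoeff_rFam (hB : 0 < B) (hn : 2 ≤ n) (hl : l ≤ k) (hL : n + k ≤ L) :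
    RFam B (level L) 1 n (fun d : Datum B => rhoCoeff d.f k l) :=
  (coeff_bounds hB L k l hl n hn hL).2

lemma phiCoeff_aFam (hB : 0 < B) (hn : 2 ≤ n) (hl : l ≤ k) (hL : n + k ≤ L) (i : Fin 3) :
    AFam (level L) (fun _ => 1) 1 n (fun d : Datum B => pd i (phiCoeff d.f k l)) := by
  simp only [phiCoeff_eq_newton]
  exact (rhoCoeff_rFam hB hn hl hL).pd_newton hB i

variable (d : Datum B)

lemma fCoeff_smooth (hB : 0 < B) (hl : l ≤ k) : ContDiff ℝ ∞ (fCoeff d.f k l) :=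
  (fCoeff_hFam hB le_rfl hl le_rfl).smooth d

lemma fCoeff_vanish (hB : 0 < B) (hl : l ≤ k) : VanishesOff B (fCoeff d.f k l) :=
  (fCoeff_hFam hB le_rfl hl le_rfl).vanish d

lemma rhoCoeff_smooth (hB : 0 < B) (hl : l ≤ k) : ContDiff ℝ ∞ (rhoCoeff d.f k l) :=
  (rhoCoeff_rFam hB le_rfl hl le_rfl).smooth d

lemma rhoCoeff_vanish (hB : 0 < B) (hl : l ≤ k) : VanishesOff B (rhoCoeff d.f k l) :=
  (rhoCoeff_rFam hB le_rfl hl le_rfl).vanish d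

lemma phiCoeff_smooth (hB : 0 < B) (hl : l ≤ k) : ContDiff ℝ ∞ (phiCoeff d.f k l) := by
  rw [phiCoeff_eq_newton]
  exact newton_smooth (rhoCoeff_smooth d hB hl) (rhoCoeff_vanish d hB hl).hasCompactSupport

lemma phiInf_smooth (hB : 0 < B) : ContDiff ℝ ∞ (phiInf d.f) :=
  phiCoeff_smooth (k := 0) (l := 0) d hB le_rfl

end Coefficients

/-! ### Combinatorial identities -/

/-- The rearrangement behind the product of two expansions in `(log t)^l / t^k`. -/
lemma sum_splits (M : ℕ) (F : (ℕ × ℕ) × (ℕ × ℕ) → ℝ) :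
    ∑ k ∈ Finset.range M, ∑ l ∈ Finset.range (k + 1), ∑ q ∈ splits k l, F q
      = ∑ k₁ ∈ Finset.range M, ∑ l₁ ∈ Finset.range (k₁ + 1), ∑ k₂ ∈ Finset.range (M - k₁),
          ∑ l₂ ∈ Finset.range (k₂ + 1), F ((k₁, k₂), (l₁, l₂)) := by
  simp only [Finset.sum_sigma']
  refine Finset.sum_bij' (fun x _ => ⟨x.2.2.1.1, x.2.2.2.1, x.2.2.1.2, x.2.2.2.2⟩)
    (fun x _ => ⟨x.1 + x.2.2.1, x.2.1 + x.2.2.2, ((x.1, x.2.2.1), (x.2.1, x.2.2.2))⟩) ?_ ?_ ?_ ?_ ?_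
  · rintro ⟨k, l, ⟨⟨k₁, k₂⟩, ⟨l₁, l₂⟩⟩⟩ hx
    simp only [Finset.mem_sigma, Finset.mem_range, mem_splits] at hx ⊢
    omega
  · rintro ⟨k₁, l₁, k₂, l₂⟩ hx
    simp only [Finset.mem_sigma, Finset.mem_range, mem_splits] at hx ⊢
    simp only [and_true, true_and]
    omega
  · rintro ⟨k, l, ⟨⟨k₁, k₂⟩, ⟨l₁, l₂⟩⟩⟩ hx
    simp only [Finset.mem_sigma, Finset.mem_range, mem_splits] at hx
    obtain ⟨_, _, ⟨rfl, rfl⟩, _⟩ := hx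
    rfl
  · rintro ⟨k₁, l₁, k₂, l₂⟩ hx
    rfl
  · rintro ⟨k, l, ⟨⟨k₁, k₂⟩, ⟨l₁, l₂⟩⟩⟩ hx
    rfl

/-- The set of the first `c` indices. -/
def firstIndices (b c : ℕ) : Finset (Fin b) := Finset.univ.filter fun j => (j : ℕ) < c

lemma exists_perm_firstIndices {b : ℕ} (S : Finset (Fin b)) :
    ∃ σ : Equiv.Perm (Fin b), ∀ j, σ j ∈ S ↔ (j : ℕ) < S.card := by
  have hc : Fintype.card {j : Fin b // (j : ℕ) < S.card} = Fintype.card {j // j ∈ S} := by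
    have hS : S.card ≤ b := by simpa using Finset.card_le_univ S
    rw [Fintype.card_coe, Fintype.card_subtype, Fin.card_filter_val_lt]
    omega
  let e := Fintype.equivOfCardEq hc
  refine ⟨e.extendSubtype, fun j => ⟨fun h => ?_, fun h => e.extendSubtype_mem j h⟩⟩
  by_contra hj
  exact e.extendSubtype_not_mem j hj h

/-- A permutation-invariant function of subsets depends only on the cardinality. -/
lemma sum_subsets_eq {b : ℕ} (F : Finset (Fin b) → ℝ)
    (hF : ∀ (σ : Equiv.Perm (Fin b)) (S T : Finset (Fin b)), (∀ j, σ j ∈ S ↔ j ∈ T) → F S = F T) :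
    ∑ S, F S = ∑ c ∈ Finset.range (b + 1), (b.choose c : ℝ) * F (firstIndices b c) := by
  have h1 : ∀ S, F S = F (firstIndices b S.card) := by
    intro S
    obtain ⟨σ, hσ⟩ := exists_perm_firstIndices S
    exact hF σ S _ fun j => by simp [hσ j, firstIndices]
  calc ∑ S, F S = ∑ S ∈ (Finset.univ : Finset (Fin b)).powerset, F (firstIndices b S.card) := by
        rw [Finset.powerset_univ]; exact Finset.sum_congr rfl fun S _ => h1 S
    _ = _ := by
        rw [Finset.sum_powerset_apply_card fun c => F (firstIndices b c)]
        simp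

lemma foldr_dd_smooth {u : R3 → ℝ} (hu : ContDiff ℝ ∞ u) (s : List R3) :
    ContDiff ℝ ∞ (s.foldr dd u) := by
  induction s with
  | nil => exact hu
  | cons e s ih => exact dd_smooth ih e

lemma foldr_dd_perm {u : R3 → ℝ} (hu : ContDiff ℝ ∞ u) {s s' : List R3} (h : s.Perm s') :
    s.foldr dd u = s'.foldr dd u := by
  induction h with
  | nil => rfl
  | cons e _ ih => exact congrArg (dd e) ih
  | swap e e' s => exact dd_comm (foldr_dd_smooth hu s) _ _
  | trans _ _ ih ih' => exact ih.trans ih'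

lemma iteratedFDeriv_eq_foldr {u : R3 → ℝ} (hu : ContDiff ℝ ∞ u) (b : ℕ) (p : R3) (v : Fin b → R3) :
    iteratedFDeriv ℝ b u p v = (List.ofFn v).foldr dd u p := by
  induction b generalizing u with
  | zero => simp
  | succ b ih =>
    rw [iteratedFDeriv_succ_eq_dd hu, ih (dd_smooth hu _), List.ofFn_succ_last, List.foldr_append]
    rfl

/-- The symmetry of higher derivatives. -/
lemma iteratedFDeriv_perm {u : R3 → ℝ} (hu : ContDiff ℝ ∞ u) (b : ℕ) (p : R3) (v : Fin b → R3)
    (σ : Equiv.Perm (Fin b)) : iteratedFDeriv ℝ b u p (v ∘ σ) = iteratedFDeriv ℝ b u p v := by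
  rw [iteratedFDeriv_eq_foldr hu, iteratedFDeriv_eq_foldr hu,
    foldr_dd_perm hu (σ.ofFn_comp_perm v)]

/-- The binomial formula for a symmetric multilinear form. -/
lemma iteratedFDeriv_add_smul {u : R3 → ℝ} (hu : ContDiff ℝ ∞ u) (b : ℕ) (p y v : R3) (s : ℝ) :
    iteratedFDeriv ℝ b u p (fun _ => y + s • v)
      = ∑ c ∈ Finset.range (b + 1), (b.choose c : ℝ) * (s ^ c
          * iteratedFDeriv ℝ b u p (fun j => if (j : ℕ) < c then v else y)) := by
  classical
  set M := iteratedFDeriv ℝ b u p with hM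
  have h1 : M (fun _ => y + s • v)
      = ∑ S : Finset (Fin b), s ^ S.card * M (fun j => if j ∈ S then v else y) := by
    have h2 := M.toMultilinearMap.map_add_univ (fun _ => s • v) (fun _ => y)
    have h3 : M (fun _ => y + s • v) = M.toMultilinearMap ((fun _ => s • v) + fun _ => y) := by
      change M _ = M _
      congr 1
      funext _
      exact add_comm _ _
    rw [h3, h2]
    refine Finset.sum_congr rfl fun S _ => ?_
    have h4 : S.piecewise (fun _ => s • v) (fun _ => y)
        = fun j => (if j ∈ S then s else 1) • (if j ∈ S then v else y) := by
      funext j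
      by_cases hj : j ∈ S <;> simp [hj]
    rw [h4, MultilinearMap.map_smul_univ, Finset.prod_ite, smul_eq_mul]
    simp
  rw [h1, sum_subsets_eq fun S => s ^ S.card * M (fun j => if j ∈ S then v else y)]
  · refine Finset.sum_congr rfl fun c hc => ?_
    have hcard : (firstIndices b c).card = c := by
      rw [firstIndices, Fin.card_filter_val_lt]
      have := Finset.mem_range.1 hc
      omega
    rw [hcard]
    simp [firstIndices]
  · intro σ S T hST
    have hcard : S.card = T.card := by
      rw [← Finset.card_map σ.toEmbedding (s := T)]
      congr 1
      ext j
      rw [Finset.mem_map_equiv, ← hST, Equiv.apply_symm_apply]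
    have : (fun j => if j ∈ T then v else y) = (fun j => if j ∈ S then v else y) ∘ σ := by
      funext j
      simp [hST]
    rw [hcard, this, hM, iteratedFDeriv_perm hu]

/-- Expansion of the density coefficients: the terms with the same number of factors `∂Φ` agree. -/
lemma sum_iteratedFDeriv_prod_add {Φ : R3 → ℝ} (hΦ : ContDiff ℝ ∞ Φ) {h : R3 × R3 → ℝ}
    (hh : ContDiff ℝ ∞ h) (b : ℕ) (y w : R3) (s : ℝ) :
    ∑ i : Fin b → Fin 3, iteratedFDeriv ℝ b
        (fun v => (∏ j, (y (i j) + s * pd (i j) Φ v)) * h (y, v)) w (fun j => basisVec (i j))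
      = ∑ c ∈ Finset.range (b + 1), (b.choose c : ℝ) * (s ^ c * ∑ i : Fin b → Fin 3,
          iteratedFDeriv ℝ b
            (fun v => (∏ j : Fin b, if (j : ℕ) < c then pd (i j) Φ v else y (i j)) * h (y, v))
            w (fun j => basisVec (i j))) := by
  classical
  set G : Finset (Fin b) → (Fin b → Fin 3) → R3 → ℝ := fun S i v =>
    (∏ j, if j ∈ S then pd (i j) Φ v else y (i j)) * h (y, v) with hG
  have hGs : ∀ S i, ContDiff ℝ ∞ (G S i) := fun S i => by
    refine ContDiff.mul (contDiff_prod fun j _ => ?_) (slice_smooth hh y)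
    by_cases hj : j ∈ S
    · simp only [hj, if_true]; exact pd_smooth hΦ _
    · simp only [hj, if_false]; exact contDiff_const
  have h1 : ∀ i : Fin b → Fin 3, iteratedFDeriv ℝ b
        (fun v => (∏ j, (y (i j) + s * pd (i j) Φ v)) * h (y, v)) w (fun j => basisVec (i j))
      = ∑ S : Finset (Fin b), s ^ S.card * iteratedFDeriv ℝ b (G S i) w (fun j => basisVec (i j)) := by
    intro i
    have h2 : (fun v => (∏ j, (y (i j) + s * pd (i j) Φ v)) * h (y, v))
        = fun v => ∑ S : Finset (Fin b), s ^ S.card • G S i v := by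
      funext v
      simp only [add_comm (y (i _)), Fintype.prod_add, Finset.sum_mul, smul_eq_mul]
      refine Finset.sum_congr rfl fun S _ => ?_
      simp only [hG]
      rw [← mul_assoc]
      congr 1
      rw [Finset.prod_ite, Finset.prod_mul_distrib, Finset.prod_const]
      simp [Finset.filter_not, Finset.compl_eq_univ_sdiff, mul_assoc]
    have hb : ∀ S i, ContDiff ℝ b (G S i) := fun S i => (hGs S i).of_le (by exact_mod_cast le_top)
    rw [h2, iteratedFDeriv_fun_sum_apply (f := fun S v => s ^ S.card • G S i v)
      fun S _ => ((contDiff_const (c := s ^ S.card)).mul (hb S i)).contDiffAt]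
    rw [_root_.sum_apply]
    refine Finset.sum_congr rfl fun S _ => ?_
    rw [iteratedFDeriv_const_smul_apply' (hb S i).contDiffAt]
    rfl
  simp only [h1]
  rw [Finset.sum_comm]
  simp only [← Finset.mul_sum]
  rw [sum_subsets_eq fun S => s ^ S.card * ∑ i, iteratedFDeriv ℝ b (G S i) w fun j => basisVec (i j)]
  · refine Finset.sum_congr rfl fun c hc => ?_
    have hcard : (firstIndices b c).card = c := by
      rw [firstIndices, Fin.card_filter_val_lt]
      have := Finset.mem_range.1 hc
      omega
    rw [hcard]
    simp [firstIndices, hG]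
  · intro σ S T hST
    have hcard : S.card = T.card := by
      rw [← Finset.card_map σ.toEmbedding (s := T)]
      congr 1
      ext j
      rw [Finset.mem_map_equiv, ← hST, Equiv.apply_symm_apply]
    rw [hcard]
    congr 1
    refine Fintype.sum_equiv (Equiv.arrowCongr σ.symm (Equiv.refl _)) _ _ fun i => ?_
    have h3 : G T (Equiv.arrowCongr σ.symm (Equiv.refl _) i) = G S i := by
      funext v
      simp only [hG]
      congr 1
      exact Fintype.prod_equiv σ _ _ fun x => by simp [hST]
    rw [h3, ← iteratedFDeriv_perm (hGs S i) b w _ σ]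
    rfl

/-! ### The potentials of the newest row drop out of the integrals -/

section CalP
variable {Φ : R3 → ℝ} {f : ℕ → ℕ → R3 × R3 → ℝ} {φ : ℕ → ℕ → R3 → ℝ} {k l : ℕ}

/-- The only term of `Ψ_{k,l}` that involves the row `k` of potentials is `∇φ_{k,l}(p)`, which does not
depend on `y`. -/
lemma Psi_eq_add_of_newest (hl : l ≤ k) (i : Fin 3) (y p : R3) :
    Psi Φ φ k l i y p
      = Psi Φ (Function.update φ k fun _ _ => 0) k l i y p + pd i (φ k l) p := by
  classical
  have hm : ((k, 0), (l, 0)) ∈ splits k l := mem_splits.2 (by simpa using hl)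
  simp only [Psi]
  rw [← Finset.add_sum_erase _ _ hm, ← Finset.add_sum_erase (splits k l) _ hm]
  have h0 : pd i (fun _ : R3 => (0 : ℝ)) = fun _ => 0 := dd_const 0 (basisVec i)
  simp only [Nat.choose_self, Nat.cast_one, pow_zero, Nat.factorial_zero, one_mul,
    mul_one, Function.update_self, iteratedFDeriv_zero_apply, h0, zero_add, div_one]
  rw [add_comm]
  congr 1
  refine Finset.sum_congr rfl fun q hq => ?_
  simp only [Finset.mem_erase, mem_splits] at hq
  have : q.1.1 ≠ k := by
    rintro h
    apply hq.1
    obtain ⟨⟨a, b⟩, ⟨c, d⟩⟩ := q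
    simp only [Prod.mk.injEq] at *
    omega
  rw [Function.update_of_ne this]

/-- The only source term that involves the row `k` of potentials is `∂_{x^i} f_∞ ∂_i φ_{k,l}(p) / k`. -/
lemma source_eq_sub_of_newest (hk : 1 ≤ k) (hl : l ≤ k) (z : R3 × R3) :
    source Φ f φ k l z = source Φ f (Function.update φ k fun _ _ => 0) k l z
      - 1 / (k : ℝ) * ∑ i : Fin 3, dx i (f 0 0) z * pd i (φ k l) z.2 := by
  classical
  have hm : ((0, k), (0, l)) ∈ (splits k l).filter fun q => q.1.1 < k :=
    Finset.mem_filter.2 ⟨mem_splits.2 (by simpa using hl), hk⟩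
  have hP : ∀ k' < k, ∀ l', Psi Φ (Function.update φ k fun _ _ => 0) k' l' = Psi Φ φ k' l' :=
    fun k' hk' l' => Psi_congr (fun k'' hk'' => Function.update_of_ne (by omega) _ _) l'
  simp only [source]
  have h2 : ∀ l, ∑ q ∈ splits (k - 1) l, ∑ i : Fin 3,
      dp i (f q.1.1 q.2.1) z * Psi Φ (Function.update φ k fun _ _ => 0) q.1.2 q.2.2 i z.1 z.2
      = ∑ q ∈ splits (k - 1) l, ∑ i : Fin 3,
      dp i (f q.1.1 q.2.1) z * Psi Φ φ q.1.2 q.2.2 i z.1 z.2 := fun l =>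
    Finset.sum_congr rfl fun q hq => by
      rw [mem_splits] at hq
      rw [hP q.1.2 (by omega)]
  have h3 : ∀ l, ∑ q ∈ splits (k - 1) l, ∑ i : Fin 3, ∑ j : Fin 3, dx i (f q.1.1 q.2.1) z
        * Psi Φ (Function.update φ k fun _ _ => 0) q.1.2 q.2.2 j z.1 z.2 * pd i (pd j Φ) z.2
      = ∑ q ∈ splits (k - 1) l, ∑ i : Fin 3, ∑ j : Fin 3, dx i (f q.1.1 q.2.1) z
        * Psi Φ φ q.1.2 q.2.2 j z.1 z.2 * pd i (pd j Φ) z.2 := fun l =>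
    Finset.sum_congr rfl fun q hq => by
      rw [mem_splits] at hq
      rw [hP q.1.2 (by omega)]
  rw [h2, h3, ← Finset.add_sum_erase _ _ hm,
    ← Finset.add_sum_erase ((splits k l).filter fun q => q.1.1 < k) _ hm]
  have h4 : ∑ q ∈ ((splits k l).filter fun q => q.1.1 < k).erase ((0, k), (0, l)), ∑ i : Fin 3,
      dx i (f q.1.1 q.2.1) z * Psi Φ (Function.update φ k fun _ _ => 0) q.1.2 q.2.2 i z.1 z.2
      = ∑ q ∈ ((splits k l).filter fun q => q.1.1 < k).erase ((0, k), (0, l)), ∑ i : Fin 3,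
      dx i (f q.1.1 q.2.1) z * Psi Φ φ q.1.2 q.2.2 i z.1 z.2 :=
    Finset.sum_congr rfl fun q hq => by
      simp only [Finset.mem_erase, Finset.mem_filter, mem_splits] at hq
      have : q.1.2 < k := by
        obtain ⟨⟨a, b⟩, ⟨c, d⟩⟩ := q
        by_contra hcon
        apply hq.1
        simp only [Prod.mk.injEq] at *
        omega
      rw [hP q.1.2 this]
  rw [h4]
  have h5 : ∑ i : Fin 3, dx i (f 0 0) z * Psi Φ φ k l i z.1 z.2
      = ∑ i : Fin 3, dx i (f 0 0) z * Psi Φ (Function.update φ k fun _ _ => 0) k l i z.1 z.2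
        + ∑ i : Fin 3, dx i (f 0 0) z * pd i (φ k l) z.2 := by
    rw [← Finset.sum_add_distrib]
    exact Finset.sum_congr rfl fun i _ => by rw [Psi_eq_add_of_newest hl, mul_add]
  rw [h5]
  ring

end CalP

lemma integrable_slice {B : ℝ} {g : R3 × R3 → ℝ} (hg : ContDiff ℝ ∞ g) (hv : VanishesOff B g) (w : R3) :
    Integrable fun y => g (y, w) :=
  (hg.continuous.comp (by fun_prop)).integrable_of_hasCompactSupport
    (hv.slice_left w).hasCompactSupport

lemma marg_add {B : ℝ} {g g' : R3 × R3 → ℝ} (hg : ContDiff ℝ ∞ g) (hv : VanishesOff B g)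
    (hg' : ContDiff ℝ ∞ g') (hv' : VanishesOff B g') (w : R3) :
    marg (fun z => g z + g' z) w = marg g w + marg g' w :=
  integral_add (integrable_slice hg hv w) (integrable_slice hg' hv' w)

/-- An exact derivative in `y`, times a function of `p`, has integral zero over `y`. -/
lemma marg_dx_mul_snd {B : ℝ} {g : R3 × R3 → ℝ} (hg : ContDiff ℝ ∞ g) (hv : VanishesOff B g)
    (u : R3 → ℝ) (i : Fin 3) (w : R3) : marg (fun z => dx i g z * u z.2) w = 0 := by
  simp only [marg]
  rw [integral_mul_const]
  have h1 : (fun y => dx i g (y, w)) = pd i (fun y => g (y, w)) := (pd_slice_left hg w i).symm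
  have h2 : ∫ y, dx i g (y, w) = 0 := by
    rw [h1]
    have hs : ContDiff ℝ ∞ fun y => g (y, w) := hg.comp (contDiff_id.prodMk contDiff_const)
    have h3 := integral_mul_pd hs (hv.slice_left w).hasCompactSupport
      (contDiff_const (c := (1 : ℝ))) i
    rw [show pd i (fun _ : R3 => (1 : ℝ)) = fun _ => 0 from dd_const 1 (basisVec i)] at h3
    simpa using h3.symm
  rw [h2, zero_mul]

lemma marg_const_mul (c : ℝ) (g : R3 × R3 → ℝ) (w : R3) :
    marg (fun z => c * g z) w = c * marg g w := integral_const_mul c _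

lemma marg_sum {κ : Type*} (s : Finset κ) {B : ℝ} {g : κ → R3 × R3 → ℝ}
    (hg : ∀ i ∈ s, ContDiff ℝ ∞ (g i)) (hv : ∀ i ∈ s, VanishesOff B (g i)) (w : R3) :
    marg (fun z => ∑ i ∈ s, g i z) w = ∑ i ∈ s, marg (g i) w :=
  integral_finsetSum s fun i hi => integrable_slice (hg i hi) (hv i hi) w

section Rows
variable {B : ℝ}

lemma coeff_rowBounds (hB : 0 < B) (L k : ℕ) : RowBounds B (level L) L k
    (fun d : Datum B => phiInf d.f) (fun d => fCoeff d.f) (fun d => phiCoeff d.f) :=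
  ⟨fun _ _ hnL j => (background_aFam hB hnL j).weaken (by omega),
    fun _ _ _ hl' _ hn hL => fCoeff_hFam hB hn hl' hL,
    fun _ _ _ hl' i _ hn hL => phiCoeff_aFam hB hn hl' hL i⟩

lemma coeff_rowBounds_update (hB : 0 < B) (L k : ℕ) : RowBounds B (level L) L k
    (fun d : Datum B => phiInf d.f) (fun d => fCoeff d.f)
    (fun d => Function.update (phiCoeff d.f) k fun _ _ => 0) :=
  RowBounds.update_zero (coeff_rowBounds hB L k).background (coeff_rowBounds hB L k).density
    fun k' hk' => (coeff_rowBounds hB L k).potential k' hk'.le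

/-- The integral of `f_{k,l}` in the first argument does not involve the row `k` of potentials, since
these multiply an exact derivative. -/
lemma marg_fCoeff (hB : 0 < B) (d : Datum B) {k l : ℕ} (hk : 1 ≤ k) (hl : l ≤ k) (w : R3) :
    marg (fCoeff d.f k l) w = calP (phiInf d.f) (fCoeff d.f) (phiCoeff d.f) k l w := by
  obtain ⟨K, rfl⟩ : ∃ K, k = K + 1 := ⟨k - 1, by omega⟩
  rw [fCoeff_succ]
  change _ = marg (fDown (phiInf d.f) (fCoeff d.f)
    (Function.update (phiCoeff d.f) (K + 1) fun _ _ => 0) (K + 1) (K + 1 - l)) w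
  have hr := coeff_rowBounds hB (2 + (K + 1)) (K + 1)
  have hr' := coeff_rowBounds_update hB (2 + (K + 1)) (K + 1)
  have hsrc : ∀ l ≤ K + 1, marg (source (phiInf d.f) (fCoeff d.f) (phiCoeff d.f) (K + 1) l) w
      = marg (source (phiInf d.f) (fCoeff d.f)
          (Function.update (phiCoeff d.f) (K + 1) fun _ _ => 0) (K + 1) l) w := by
    intro l hl
    have hs := hr'.source le_rfl le_rfl hk l
    have hterm : ∀ i : Fin 3, ContDiff ℝ ∞
        (fun z : R3 × R3 => dx i d.f z * pd i (phiCoeff d.f (K + 1) l) z.2) := fun i =>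
      (dx_smooth d.smooth i).mul (snd_smooth (pd_smooth (phiCoeff_smooth d hB hl) i))
    have hterm' : ∀ i : Fin 3, VanishesOff B
        (fun z : R3 × R3 => dx i d.f z * pd i (phiCoeff d.f (K + 1) l) z.2) := fun i =>
      (d.vanish.dd _).mul_right _
    rw [funext (source_eq_sub_of_newest hk hl (Φ := phiInf d.f) (f := fCoeff d.f)
      (φ := phiCoeff d.f))]
    simp only [sub_eq_add_neg, ← neg_mul, fCoeff_zero]
    rw [marg_add (hs.smooth d) (hs.vanish d)
      (contDiff_const.mul (ContDiff.sum fun i _ => hterm i))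
      ((VanishesOff.sum fun i _ => hterm' i).mul_left _), marg_const_mul,
      marg_sum _ (fun i _ => hterm i) (fun i _ => hterm' i)]
    simp only [marg_dx_mul_snd d.smooth d.vanish, Finset.sum_const_zero, mul_zero,
      add_zero]
  have hall : ∀ j, marg (fDown (phiInf d.f) (fCoeff d.f) (phiCoeff d.f) (K + 1) j) w
      = marg (fDown (phiInf d.f) (fCoeff d.f)
          (Function.update (phiCoeff d.f) (K + 1) fun _ _ => 0) (K + 1) j) w := by
    intro j
    induction j with
    | zero => exact hsrc _ le_rfl
    | succ j ih =>
      have h1 := hr.fDown le_rfl le_rfl hk j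
      have h2 := hr'.fDown le_rfl le_rfl hk j
      have s1 := hr.source le_rfl le_rfl hk (K + 1 - (j + 1))
      have s2 := hr'.source le_rfl le_rfl hk (K + 1 - (j + 1))
      simp only [fDown]
      rw [marg_add (contDiff_const.mul (h1.smooth d)) ((h1.vanish d).mul_left _) (s1.smooth d)
          (s1.vanish d),
        marg_add (contDiff_const.mul (h2.smooth d)) ((h2.vanish d).mul_left _) (s2.smooth d)
          (s2.vanish d), marg_const_mul, marg_const_mul, ih, hsrc _ (by omega)]
  exact hall _

end Rows

/-! ### Late times -/

lemma hNorm_ne_top {B : ℝ} (n : ℕ) {g : R3 × R3 → ℝ} (hg : ContDiff ℝ ∞ g) (hv : VanishesOff B g) :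
    hNorm n g ≠ ⊤ := by
  have h0 : ∀ g : R3 × R3 → ℝ, ContDiff ℝ ∞ g → VanishesOff B g → normL2 g ≠ ⊤ := fun g hg hv =>
    (hg.continuous.memLp_of_hasCompactSupport (p := 2) hv.hasCompactSupport).2.ne
  induction n generalizing g with
  | zero => exact h0 g hg hv
  | succ n ih =>
    rw [hNorm_succ]
    exact ENNReal.add_ne_top.2 ⟨h0 g hg hv, ENNReal.add_ne_top.2
      ⟨ENNReal.sum_ne_top.2 fun i _ => ih (dx_smooth hg i) (hv.dd _),
        ENNReal.sum_ne_top.2 fun i _ => ih (dp_smooth hg i) (hv.dd _)⟩⟩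

lemma level_ne_top {B : ℝ} (L : ℕ) (d : Datum B) : level L d ≠ ⊤ :=
  hNorm_ne_top L d.smooth d.vanish

/-- A bound for the field `∇φ_∞` in `C^{N+1}`. -/
def fieldNorm {B : ℝ} (N : ℕ) (d : Datum B) : ℝ≥0∞ :=
  1 + ∑ i : Fin 3, cNorm3 (N + 1) (pd i (phiInf d.f))

lemma one_le_fieldNorm {B : ℝ} (N : ℕ) (d : Datum B) : 1 ≤ fieldNorm N d := le_self_add

lemma cNorm3_pd_pd_le_fieldNorm {B : ℝ} (N : ℕ) (d : Datum B) (i j : Fin 3) :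
    cNorm3 N (pd i (pd j (phiInf d.f))) ≤ fieldNorm N d :=
  (cNorm3_pd_le N _ i).trans ((Finset.single_le_sum
    (f := fun j => cNorm3 (N + 1) (pd j (phiInf d.f))) (fun _ _ => zero_le)
    (Finset.mem_univ j)).trans le_add_self)

lemma fieldNorm_ne_top {B : ℝ} (hB : 0 < B) (N : ℕ) (d : Datum B) : fieldNorm N d ≠ ⊤ := by
  refine ENNReal.add_ne_top.2 ⟨ENNReal.one_ne_top, ENNReal.sum_ne_top.2 fun i _ => ?_⟩
  obtain ⟨C, D, hC⟩ := (background_aFam hB (le_refl (N + 2)) i).bound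
  refine ne_top_of_le_ne_top ?_ (le_self_add.trans (hC d))
  have := level_ne_top (N + 2) d
  simp only [mul_one, pow_one]
  exact ENNReal.mul_ne_top (ENNReal.mul_ne_top ENNReal.coe_ne_top this)
    (ENNReal.pow_ne_top (ENNReal.add_ne_top.2 ⟨ENNReal.one_ne_top, this⟩))

/-- The size at time `t` of the non-constant coefficients of the vector fields `L_k` and
`t⁻¹ ∂_{p^k}`, in the coordinates `(y, p)`. -/
def defect {B : ℝ} (N : ℕ) (d : Datum B) (t : ℝ) : ℝ≥0∞ :=
  ENNReal.ofReal (Real.log t ^ 2 / t) * fieldNorm N d ^ 2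

/-- A datum together with a time that is so late, depending on the datum, that the vector fields
`L_k` and `t⁻¹ ∂_{p^k}` have bounded coefficients in the coordinates `(y, p)`. -/
structure Late (B : ℝ) (N : ℕ) where
  /-- the datum -/
  datum : Datum B
  /-- the time -/
  t : ℝ
  exp_le : Real.exp 1 ≤ t
  late : defect N datum t ≤ 1

namespace Late
variable {B : ℝ} {N : ℕ} (a : Late B N)

/-- The potential `φ_∞`. -/
def Φ : R3 → ℝ := phiInf a.datum.f

/-- The logarithm of the time. -/
def logt : ℝ := Real.log a.t

/-- The size of the coefficients of the vector fields. -/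
def δ : ℝ≥0∞ := defect N a.datum a.t

/-- The small parameter `log t / t`. -/
def η : ℝ≥0∞ := ENNReal.ofReal (a.logt / a.t)

lemma t_pos : 0 < a.t := (Real.exp_pos 1).trans_le a.exp_le

lemma one_le_t : 1 ≤ a.t := (Real.one_le_exp zero_le_one).trans a.exp_le

lemma one_le_logt : 1 ≤ a.logt := (Real.le_log_iff_exp_le a.t_pos).2 a.exp_le

lemma logt_le : a.logt ≤ a.t := (Real.log_le_sub_one_of_pos a.t_pos).trans (by linarith)

lemma δ_le_one : a.δ ≤ 1 := a.late

lemma Φ_smooth (hB : 0 < B) : ContDiff ℝ ∞ a.Φ := phiInf_smooth a.datum hB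

lemma div_nonneg' : 0 ≤ a.logt / a.t :=
  div_nonneg (zero_le_one.trans a.one_le_logt) a.t_pos.le

lemma η_le_one : a.η ≤ 1 :=
  ENNReal.ofReal_le_one.2 ((div_le_one a.t_pos).2 a.logt_le)

/-- The coefficients `(log t)^l / t^k` with `l ≤ k` are at most `(log t / t)^k`. -/
lemma enorm_coeff_le {l k : ℕ} (hl : l ≤ k) : ‖a.logt ^ l / a.t ^ k‖ₑ ≤ a.η ^ k := by
  have h1 : 0 ≤ a.logt := zero_le_one.trans a.one_le_logt
  rw [Real.enorm_eq_ofReal (div_nonneg (pow_nonneg h1 _) (pow_nonneg a.t_pos.le _)), η,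
    ← ENNReal.ofReal_pow a.div_nonneg', div_pow]
  have := a.t_pos
  gcongr
  exact a.one_le_logt

lemma enorm_inv_t_le : ‖a.t⁻¹‖ₑ ≤ a.η := by
  simpa using a.enorm_coeff_le (Nat.zero_le 1)

lemma enorm_div_le : ‖a.logt / a.t‖ₑ ≤ a.η := by
  simpa using a.enorm_coeff_le (le_refl 1)

lemma η_pow_le {m n : ℕ} (h : m ≤ n) : a.η ^ n ≤ a.η ^ m := pow_le_pow_right_of_le_one' a.η_le_one h

lemma enorm_div_le_defect : ‖a.logt / a.t‖ₑ * fieldNorm N a.datum ≤ a.δ := by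
  have h0 := a.t_pos
  have h1 := a.one_le_logt
  rw [Real.enorm_eq_ofReal a.div_nonneg', δ, defect]
  refine mul_le_mul' (ENNReal.ofReal_le_ofReal ?_) ?_
  · change a.logt / a.t ≤ a.logt ^ 2 / a.t
    gcongr
    nlinarith
  · rw [pow_two]
    exact le_mul_of_one_le_left' (one_le_fieldNorm N _)

lemma enorm_sq_div_le_defect :
    ‖a.logt ^ 2 / a.t‖ₑ * (fieldNorm N a.datum * fieldNorm N a.datum) ≤ a.δ := by
  rw [Real.enorm_eq_ofReal (div_nonneg (sq_nonneg _) a.t_pos.le), δ, defect, pow_two (fieldNorm _ _)]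
  rfl

lemma enorm_inv_le_defect : ‖a.t⁻¹‖ₑ ≤ a.δ := by
  have h0 := a.t_pos
  have h1 := a.one_le_logt
  refine le_trans ?_ (le_trans (le_mul_of_one_le_right' (one_le_fieldNorm N a.datum))
    a.enorm_div_le_defect)
  rw [Real.enorm_eq_ofReal a.div_nonneg', Real.enorm_eq_ofReal (by positivity)]
  apply ENNReal.ofReal_le_ofReal
  rw [inv_eq_one_div]
  gcongr

end Late

/-! ### The coordinates `(y, p)` -/

/-- The change of coordinates `(x, p) ↦ (y, p)` with `y = x - t p + log t ∇Φ(p)`. -/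
def shear (Φ : R3 → ℝ) (t : ℝ) (z : R3 × R3) : R3 × R3 :=
  (z.1 - t • z.2 + Real.log t • gradient Φ z.2, z.2)

lemma gradient_eq_sum (Φ : R3 → ℝ) (p : R3) : gradient Φ p = ∑ j : Fin 3, pd j Φ p • basisVec j := by
  conv_lhs => rw [eq_sum_basisVec (gradient Φ p)]
  simp only [gradient_apply]

lemma gradient_smooth {Φ : R3 → ℝ} (hΦ : ContDiff ℝ ∞ Φ) : ContDiff ℝ ∞ (gradient Φ) := by
  have : gradient Φ = fun p => ∑ j : Fin 3, pd j Φ p • basisVec j := funext (gradient_eq_sum Φ)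
  rw [this]
  exact ContDiff.sum fun j _ => (pd_smooth hΦ j).smul contDiff_const

lemma fderiv_gradient {Φ : R3 → ℝ} (hΦ : ContDiff ℝ ∞ Φ) (p e : R3) :
    fderiv ℝ (gradient Φ) p e = ∑ j : Fin 3, dd e (pd j Φ) p • basisVec j := by
  have h1 : gradient Φ = fun p => ∑ j : Fin 3, pd j Φ p • basisVec j := funext (gradient_eq_sum Φ)
  have h2 : HasFDerivAt (fun p => ∑ j : Fin 3, pd j Φ p • basisVec j)
      (∑ j : Fin 3, (fderiv ℝ (pd j Φ) p).smulRight (basisVec j)) p :=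
    HasFDerivAt.fun_sum fun j _ => (diff_of_smooth (pd_smooth hΦ j) p).hasFDerivAt.smul_const _
  rw [h1, h2.fderiv]
  simp [dd]

lemma shear_smooth {Φ : R3 → ℝ} (hΦ : ContDiff ℝ ∞ Φ) (t : ℝ) : ContDiff ℝ ∞ (shear Φ t) := by
  have h : ContDiff ℝ ∞ fun z : R3 × R3 => gradient Φ z.2 := (gradient_smooth hΦ).comp contDiff_snd
  have h1 : ContDiff ℝ ∞ fun z : R3 × R3 => z.1 - t • z.2 + Real.log t • gradient Φ z.2 := by
    fun_prop
  exact h1.prodMk contDiff_snd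

lemma comp_shear_smooth {Φ : R3 → ℝ} (hΦ : ContDiff ℝ ∞ Φ) (t : ℝ) {g : R3 × R3 → ℝ}
    (hg : ContDiff ℝ ∞ g) : ContDiff ℝ ∞ (fun z => g (shear Φ t z)) := hg.comp (shear_smooth hΦ t)

lemma fderiv_shear {Φ : R3 → ℝ} (hΦ : ContDiff ℝ ∞ Φ) (t : ℝ) (z e : R3 × R3) :
    fderiv ℝ (shear Φ t) z e
      = (e.1 - t • e.2 + Real.log t • ∑ j : Fin 3, dd e.2 (pd j Φ) z.2 • basisVec j, e.2) := by
  have hG : HasFDerivAt (gradient Φ) (fderiv ℝ (gradient Φ) z.2) z.2 :=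
    (((gradient_smooth hΦ).differentiable (by simp)) z.2).hasFDerivAt
  have h1 : HasFDerivAt (shear Φ t) _ z := HasFDerivAt.prodMk
    (((hasFDerivAt_fst (𝕜 := ℝ) (p := z)).sub ((hasFDerivAt_snd (𝕜 := ℝ) (p := z)).const_smul t)).add
      ((hG.comp z (hasFDerivAt_snd (𝕜 := ℝ) (p := z))).const_smul (Real.log t)))
    (hasFDerivAt_snd (𝕜 := ℝ) (p := z))
  rw [h1.fderiv]
  simp [fderiv_gradient hΦ]

lemma dd_comp_shear {Φ : R3 → ℝ} (hΦ : ContDiff ℝ ∞ Φ) (t : ℝ) {g : R3 × R3 → ℝ}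
    (hg : ContDiff ℝ ∞ g) (z e : R3 × R3) :
    dd e (fun z => g (shear Φ t z)) z = fderiv ℝ g (shear Φ t z) (fderiv ℝ (shear Φ t) z e) := by
  have h := (diff_of_smooth hg (shear Φ t z)).hasFDerivAt.comp z
    (((shear_smooth hΦ t).differentiable (by simp)) z).hasFDerivAt
  change fderiv ℝ (g ∘ shear Φ t) z e = _
  rw [h.fderiv]
  rfl

lemma dx_comp_shear {Φ : R3 → ℝ} (hΦ : ContDiff ℝ ∞ Φ) (t : ℝ) {g : R3 × R3 → ℝ}
    (hg : ContDiff ℝ ∞ g) (i : Fin 3) (z : R3 × R3) :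
    dx i (fun z => g (shear Φ t z)) z = dx i g (shear Φ t z) := by
  rw [dx_eq_dd, dd_comp_shear hΦ t hg, fderiv_shear hΦ]
  have h0 : ∀ j, dd (0 : R3) (pd j Φ) z.2 = 0 := fun j => by simp [dd]
  simp only [h0]
  simp [dd]

lemma dp_comp_shear {Φ : R3 → ℝ} (hΦ : ContDiff ℝ ∞ Φ) (t : ℝ) {g : R3 × R3 → ℝ}
    (hg : ContDiff ℝ ∞ g) (i : Fin 3) (z : R3 × R3) :
    dp i (fun z => g (shear Φ t z)) z = dp i g (shear Φ t z) - t * dx i g (shear Φ t z)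
      + Real.log t * ∑ j : Fin 3, pd i (pd j Φ) z.2 * dx j g (shear Φ t z) := by
  rw [dp_eq_dd, dd_comp_shear hΦ t hg, fderiv_shear hΦ]
  set A := fderiv ℝ g (shear Φ t z) with hA
  have h1 : ((0 : R3) - t • basisVec i
        + Real.log t • ∑ j : Fin 3, dd (basisVec i) (pd j Φ) z.2 • basisVec j, basisVec i)
      = ((0 : R3), basisVec i) - t • (basisVec i, (0 : R3))
        + Real.log t • ∑ j : Fin 3, pd i (pd j Φ) z.2 • (basisVec j, (0 : R3)) := by
    ext1
    · simp [Prod.fst_sum, pd_eq_dd]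
    · simp [Prod.snd_sum]
  simp only
  rw [h1, map_add, map_sub, map_smul, map_smul, map_sum]
  simp only [map_smul, smul_eq_mul]
  rfl

/-- For fixed `p` the change of coordinates is a translation, so it preserves the measure. -/
lemma normL2_comp_shear {Φ : R3 → ℝ} (t : ℝ) {g : R3 × R3 → ℝ} (hg : Continuous g)
    (hΦ : ContDiff ℝ ∞ Φ) : normL2 (fun z => g (shear Φ t z)) = normL2 g := by
  have hc := (shear_smooth hΦ t).continuous
  have h2 : normL2 (fun z => g (shear Φ t z)) ^ 2 = normL2 g ^ 2 := by
    rw [normL2_sq, normL2_sq, Measure.volume_eq_prod, lintegral_prod_symm, lintegral_prod_symm]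
    · refine lintegral_congr fun p => ?_
      simp only [shear]
      have : ∀ x : R3, x - t • p + Real.log t • gradient Φ p
          = x + (-(t • p) + Real.log t • gradient Φ p) := fun x => by abel
      simp only [this]
      exact lintegral_add_right_eq_self (fun x => ‖g (x, p)‖ₑ ^ 2) _
    · have := hg.measurable
      fun_prop
    · have := (hg.comp hc).measurable
      have : Measurable fun z => g (shear Φ t z) := this
      fun_prop
  exact le_antisymm (le_of_sq_le_sq h2.le) (le_of_sq_le_sq h2.ge)

/-- The vector field `L_k` in the coordinates `(y, p)`. -/
def shearedL (Φ : R3 → ℝ) (t : ℝ) (k : Fin 3) (g : R3 × R3 → ℝ) : R3 × R3 → ℝ := fun z =>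
  dp k g z + ∑ i : Fin 3, dp i g z * (Real.log t / t * pd k (pd i Φ) z.2)
    + ∑ i : Fin 3, ∑ j : Fin 3,
        dx j g z * (Real.log t ^ 2 / t * (pd k (pd i Φ) z.2 * pd i (pd j Φ) z.2))

/-- The vector field `t⁻¹ ∂_{p^k}` in the coordinates `(y, p)`. -/
def shearedP (Φ : R3 → ℝ) (t : ℝ) (k : Fin 3) (g : R3 × R3 → ℝ) : R3 × R3 → ℝ := fun z =>
  -dx k g z + t⁻¹ * dp k g z
    + ∑ j : Fin 3, dx j g z * (Real.log t / t * pd k (pd j Φ) z.2)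

section Sheared
variable {Φ : R3 → ℝ} (hΦ : ContDiff ℝ ∞ Φ) {t : ℝ} {g : R3 × R3 → ℝ} (hg : ContDiff ℝ ∞ g)

include hΦ hg

lemma shearedL_smooth (k : Fin 3) : ContDiff ℝ ∞ (shearedL Φ t k g) := by
  have h2 : ∀ i j : Fin 3, ContDiff ℝ ∞ fun z : R3 × R3 => pd i (pd j Φ) z.2 := fun i j =>
    snd_smooth (pd_smooth (pd_smooth hΦ j) i)
  refine ((dp_smooth hg k).add (ContDiff.sum fun i _ => (dp_smooth hg i).mul
    (contDiff_const.mul (h2 k i)))).add (ContDiff.sum fun i _ => ContDiff.sum fun j _ =>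
      (dx_smooth hg j).mul (contDiff_const.mul ((h2 k i).mul (h2 i j))))

lemma shearedP_smooth (k : Fin 3) : ContDiff ℝ ∞ (shearedP Φ t k g) := by
  have h2 : ∀ i j : Fin 3, ContDiff ℝ ∞ fun z : R3 × R3 => pd i (pd j Φ) z.2 := fun i j =>
    snd_smooth (pd_smooth (pd_smooth hΦ j) i)
  exact ((dx_smooth hg k).neg.add (contDiff_const.mul (dp_smooth hg k))).add
    (ContDiff.sum fun j _ => (dx_smooth hg j).mul (contDiff_const.mul (h2 k j)))

lemma vecL_comp_shear (ht : 0 < t) (k : Fin 3) :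
    vecL Φ t k (fun z => g (shear Φ t z)) = fun z => shearedL Φ t k g (shear Φ t z) := by
  funext z
  have hz : (shear Φ t z).2 = z.2 := rfl
  simp only [vecL, shearedL, dx_comp_shear hΦ t hg, dp_comp_shear hΦ t hg, hz, Fin.sum_univ_three]
  field_simp
  ring

lemma tinvdp_comp_shear (ht : 0 < t) (k : Fin 3) :
    tinvdp t k (fun z => g (shear Φ t z)) = fun z => shearedP Φ t k g (shear Φ t z) := by
  funext z
  have hz : (shear Φ t z).2 = z.2 := rfl
  simp only [tinvdp, shearedP, dp_comp_shear hΦ t hg, hz, Fin.sum_univ_three]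
  field_simp
  ring

end Sheared

/-- Conjugation of a product of operators. -/
lemma multi_comp {α β : Type} {D : Fin 3 → (α → ℝ) → α → ℝ} {E : Fin 3 → (β → ℝ) → β → ℝ} {Y : α → β}
    {P : (β → ℝ) → Prop} (hP : ∀ k g, P g → P (E k g))
    (h : ∀ k g, P g → D k (fun z => g (Y z)) = fun z => E k g (Y z)) (I : Fin 3 → ℕ) {g : β → ℝ}
    (hg : P g) :
    multi D I (fun z => g (Y z)) = (fun z => multi E I g (Y z)) ∧ P (multi E I g) := by
  have hit : ∀ (k : Fin 3) (m : ℕ) (g : β → ℝ), P g →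
      (D k)^[m] (fun z => g (Y z)) = (fun z => (E k)^[m] g (Y z)) ∧ P ((E k)^[m] g) := by
    intro k m
    induction m with
    | zero => exact fun g hg => ⟨rfl, hg⟩
    | succ m ih =>
      intro g hg
      rw [Function.iterate_succ_apply', Function.iterate_succ_apply', (ih g hg).1, h k _ (ih g hg).2]
      exact ⟨rfl, hP k _ (ih g hg).2⟩
  have h2 := hit 2 (I 2) g hg
  have h1 := hit 1 (I 1) _ h2.2
  have h0 := hit 0 (I 0) _ h1.2
  simp only [multi]
  exact ⟨by rw [h2.1, h1.1, h0.1], h0.2⟩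

lemma multi_vecL_tinvdp_comp_shear {Φ : R3 → ℝ} (hΦ : ContDiff ℝ ∞ Φ) {t : ℝ} (ht : 0 < t)
    {g : R3 × R3 → ℝ} (hg : ContDiff ℝ ∞ g) (I J : Fin 3 → ℕ) :
    multi (vecL Φ t) I (multi (tinvdp t) J (fun z => g (shear Φ t z)))
        = (fun z => multi (shearedL Φ t) I (multi (shearedP Φ t) J g) (shear Φ t z)) ∧
      ContDiff ℝ ∞ (multi (shearedL Φ t) I (multi (shearedP Φ t) J g)) := by
  have h1 := multi_comp (P := ContDiff ℝ ∞) (D := tinvdp t) (E := shearedP Φ t)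
    (fun k g hg => shearedP_smooth hΦ hg k) (fun k g hg => tinvdp_comp_shear hΦ hg ht k) J hg
  rw [h1.1]
  exact multi_comp (P := ContDiff ℝ ∞) (D := vecL Φ t) (E := shearedL Φ t)
    (fun k g hg => shearedL_smooth hΦ hg k) (fun k g hg => vecL_comp_shear hΦ hg ht k) I h1.2

/-! ### Perturbed operators -/

section Pert
variable {B : ℝ} {N : ℕ} {h w : Late B N → ℝ≥0∞} {e n : ℕ}
  {g g₀ : Late B N → R3 × R3 → ℝ}

/-- The operators `Op a k` of order one are perturbations of size `δ` of the operators `D k`. -/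
structure IsPert (Op : Late B N → Fin 3 → (R3 × R3 → ℝ) → R3 × R3 → ℝ)
    (D : Fin 3 → (R3 × R3 → ℝ) → R3 × R3 → ℝ) : Prop where
  main : ∀ {h w : Late B N → ℝ≥0∞} {e n : ℕ} {g : Late B N → R3 × R3 → ℝ} (k : Fin 3),
    HFam B h w e (n + 1) g → HFam B h w e n fun a => D k (g a)
  sub : ∀ (k : Fin 3) {f g : R3 × R3 → ℝ}, ContDiff ℝ ∞ f → ContDiff ℝ ∞ g →
    D k (fun z => f z - g z) = fun z => D k f z - D k g z
  pert : ∀ {h w : Late B N → ℝ≥0∞} {e n : ℕ} {g : Late B N → R3 × R3 → ℝ} (k : Fin 3), n ≤ N →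
    HFam B h w e (n + 1) g → HFam B h (fun a => a.δ * w a) e n fun a z => Op a k (g a) z - D k (g a) z

/-- Two families of functions that differ by an error of relative size `δ`. -/
structure Close (h w : Late B N → ℝ≥0∞) (e n : ℕ) (g g₀ : Late B N → R3 × R3 → ℝ) : Prop where
  main : HFam B h w e n g₀
  err : HFam B h (fun a => a.δ * w a) e n fun a z => g a z - g₀ a z

lemma HFam.of_defect (hg : HFam B h (fun a => a.δ * w a) e n g) : HFam B h w e n g :=
  hg.mono_weight 1 fun a => by simpa using mul_le_mul' a.δ_le_one (le_refl (w a))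

lemma Close.left (hc : Close h w e n g g₀) : HFam B h w e n g := by
  refine (congrArg _ ?_).mp (hc.err.of_defect.add hc.main)
  funext a z
  ring

lemma Close.refl (hg : HFam B h w e n g) : Close h w e n g g :=
  ⟨hg, by simpa using HFam.zero⟩

lemma Close.step {Op : Late B N → Fin 3 → (R3 × R3 → ℝ) → R3 × R3 → ℝ}
    {D : Fin 3 → (R3 × R3 → ℝ) → R3 × R3 → ℝ} (hp : IsPert Op D) (hn : n ≤ N) (k : Fin 3)
    (hc : Close h w e (n + 1) g g₀) : Close h w e n (fun a => Op a k (g a)) (fun a => D k (g₀ a)) := by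
  refine ⟨hp.main k hc.main, ?_⟩
  refine (congrArg _ ?_).mp ((hp.pert k hn hc.left).add (hp.main k hc.err))
  funext a z
  rw [hp.sub k (hc.left.smooth a) (hc.main.smooth a)]
  ring

lemma Close.multi {Op : Late B N → Fin 3 → (R3 × R3 → ℝ) → R3 × R3 → ℝ}
    {D : Fin 3 → (R3 × R3 → ℝ) → R3 × R3 → ℝ} (hp : IsPert Op D) (I : Fin 3 → ℕ)
    (hn : n + ∑ i, I i ≤ N) (hc : Close h w e (n + ∑ i, I i) g g₀) :
    Close h w e n (fun a => multi (Op a) I (g a)) (fun a => multi D I (g₀ a)) := by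
  have hit : ∀ (k : Fin 3) (m n : ℕ) (g g₀ : Late B N → R3 × R3 → ℝ), n + m ≤ N →
      Close h w e (n + m) g g₀ →
      Close h w e n (fun a => (Op a k)^[m] (g a)) (fun a => (D k)^[m] (g₀ a)) := by
    intro k m
    induction m with
    | zero => exact fun n g g₀ _ hc => hc
    | succ m ih =>
      intro n g g₀ hn hc
      simp only [Function.iterate_succ_apply]
      exact ih n _ _ (by omega) (Close.step hp (by omega) k hc)
  rw [Fin.sum_univ_three, ← add_assoc, ← add_assoc] at hc hn
  exact hit 0 _ _ _ _ (by omega) (hit 1 _ _ _ _ (by omega) (hit 2 _ _ _ _ (by omega) hc))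

/-- The first order coefficients of the sheared vector fields are of size `δ`. -/
lemma defect_cFam_one (hB : 0 < B) (k i : Fin 3) (hn : n ≤ N) : CFam B h (fun a => a.δ) 0 n
    fun (a : Late B N) z => Real.log a.t / a.t * pd k (pd i a.Φ) z.2 := by
  have hs : ∀ a : Late B N, ContDiff ℝ ∞ (pd k (pd i a.Φ)) := fun a =>
    pd_smooth (pd_smooth (a.Φ_smooth hB) i) k
  refine ⟨fun a => contDiff_const.mul (snd_smooth (hs a)), PolyBound.of_le_weight fun a => ?_⟩
  refine (sob_const_mul_le (normLike_supOn _) n _ (snd_smooth (hs a))).trans ?_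
  refine le_trans ?_ a.enorm_div_le_defect
  refine mul_le_mul' le_rfl ?_
  exact (cNorm_snd_le B n (hs a)).trans ((cNorm3_mono hn _).trans
    (cNorm3_pd_pd_le_fieldNorm N a.datum k i))

/-- The coefficients of `shearedL` with two factors of the Hessian are of size `δ`. These
terms are the reason for the squares in `defect`. -/
lemma defect_cFam_two (hB : 0 < B) (k i j : Fin 3) (hn : n ≤ N) : CFam B h (fun a => a.δ) 0 n
    fun (a : Late B N) z => Real.log a.t ^ 2 / a.t * (pd k (pd i a.Φ) z.2 * pd i (pd j a.Φ) z.2) := by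
  have hs : ∀ (a : Late B N) k i, ContDiff ℝ ∞ (fun z : R3 × R3 => pd k (pd i a.Φ) z.2) :=
    fun a k i => snd_smooth (pd_smooth (pd_smooth (a.Φ_smooth hB) i) k)
  have hb : ∀ (a : Late B N) k i, cNorm B n (fun z => pd k (pd i a.Φ) z.2) ≤ fieldNorm N a.datum :=
    fun a k i => (cNorm_snd_le B n (pd_smooth (pd_smooth (a.Φ_smooth hB) i) k)).trans
      ((cNorm3_mono hn _).trans (cNorm3_pd_pd_le_fieldNorm N a.datum k i))
  refine ⟨fun a => contDiff_const.mul ((hs a k i).mul (hs a i j)),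
    ((PolyBound.of_le_weight (w := fun a : Late B N => a.δ) fun a => le_rfl).const_mul (2 ^ n)).mono
      fun a => ?_⟩
  refine (sob_const_mul_le (normLike_supOn _) n _ ((hs a k i).mul (hs a i j))).trans ?_
  calc _ ≤ ‖Real.log a.t ^ 2 / a.t‖ₑ
        * (2 ^ n * fieldNorm N a.datum * fieldNorm N a.datum) := by
        refine mul_le_mul' le_rfl ((sob_supOn_mul_le _ n (hs a k i) (hs a i j)).trans ?_)
        exact mul_le_mul' (mul_le_mul' le_rfl (hb a k i)) (hb a i j)
    _ = 2 ^ n * (‖a.logt ^ 2 / a.t‖ₑ * (fieldNorm N a.datum * fieldNorm N a.datum)) := by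
        rw [Late.logt]; ring
    _ ≤ 2 ^ n * a.δ := mul_le_mul' le_rfl a.enorm_sq_div_le_defect
    _ = _ := by push_cast; rfl

/-- In the coordinates `(y, p)`, the field `L_k` is `∂_{p^k}` up to an error of size `δ`: the large
terms `t ∂_{x^k}` and `log t ∂_k ∂_i φ_∞ ∂_{x^i}` cancel. -/
lemma isPert_shearedL (hB : 0 < B) : IsPert (fun a : Late B N => shearedL a.Φ a.t) dp where
  main k hg := hg.dp k
  sub k _ _ hf hg := by rw [dp_eq_dd]; exact dd_sub hf hg _
  pert {h w e n g} k hn hg := by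
    have h1 := fun i => (hg.dp i).mul_cFam (defect_cFam_one (h := h) hB k i hn)
      (w'' := fun a => a.δ * w a) fun a => by rw [mul_comm]
    have h2 := fun i j => (hg.dx j).mul_cFam (defect_cFam_two (h := h) hB k i j hn)
      (w'' := fun a => a.δ * w a) fun a => by rw [mul_comm]
    refine (congrArg _ ?_).mp ((HFam.sum Finset.univ fun i _ => h1 i).add
      (HFam.sum Finset.univ fun i _ => HFam.sum Finset.univ fun j _ => h2 i j))
    funext a z
    simp only [shearedL]
    ring

/-- In the coordinates `(y, p)`, the field `t⁻¹ ∂_{p^k}` is `-∂_{y^k}` up to an error of size `δ`. -/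
lemma isPert_shearedP (hB : 0 < B) : IsPert (fun a : Late B N => shearedP a.Φ a.t)
    (fun k g z => (-1) * dx k g z) where
  main k hg := (hg.dx k).const_mul (-1)
  sub k _ _ hf hg := by
    simp only [dx_eq_dd]
    rw [dd_sub hf hg]
    funext z
    ring
  pert {h w e n g} k hn hg := by
    have h1 := fun i => (hg.dx i).mul_cFam (defect_cFam_one (h := h) hB k i hn)
      (w'' := fun a => a.δ * w a) fun a => by rw [mul_comm]
    have h2 := (hg.dp k).weight_mul (fun a : Late B N => a.t⁻¹) (w' := fun a => a.δ * w a)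
      fun a => mul_le_mul' a.enorm_inv_le_defect le_rfl
    refine (congrArg _ ?_).mp (h2.add (HFam.sum Finset.univ fun i _ => h1 i))
    funext a z
    simp only [shearedP]
    ring

lemma close_sheared (hB : 0 < B) {IJ : (Fin 3 → ℕ) × (Fin 3 → ℕ)} (hIJ : IJ ∈ multiIndexPairs N)
    (hg : HFam B h w e N g) :
    Close h w e 0
      (fun a => VlasovPoisson.multi (shearedL a.Φ a.t) IJ.1
        (VlasovPoisson.multi (shearedP a.Φ a.t) IJ.2 (g a)))
      (fun a => VlasovPoisson.multi dp IJ.1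
        (VlasovPoisson.multi (fun k g z => (-1) * dx k g z) IJ.2 (g a))) := by
  rw [mem_multiIndexPairs] at hIJ
  exact Close.multi (isPert_shearedL hB) IJ.1 (by omega)
    (Close.multi (isPert_shearedP hB) IJ.2 (by omega) (Close.refl (hg.mono (by omega))))

/-- The weighted Sobolev norm of the left-hand sides of the estimates on phase space. -/
def weightedNorm (N : ℕ) (Φ : R3 → ℝ) (t : ℝ) (g : R3 × R3 → ℝ) : ℝ≥0∞ :=
  ∑ IJ ∈ multiIndexPairs N, normL2 (multi (vecL Φ t) IJ.1 (multi (tinvdp t) IJ.2 g))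

/-- At late times, the weighted norm of a function of `(y, p)` is bounded by its Sobolev norm. -/
lemma weightedNorm_polyBound (hB : 0 < B) (hg : HFam B h w e N g) :
    PolyBound h w e fun a => weightedNorm N a.Φ a.t fun z => g a (shear a.Φ a.t z) := by
  refine PolyBound.sum _ fun IJ hIJ => ?_
  refine (close_sheared hB hIJ hg).left.bound.mono fun a => ?_
  have h1 := multi_vecL_tinvdp_comp_shear (a.Φ_smooth hB) a.t_pos (hg.smooth a) IJ.1 IJ.2
  rw [h1.1, normL2_comp_shear a.t h1.2.continuous (a.Φ_smooth hB)]
  exact normL2_le_hNorm 0 _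

lemma normL2_const_mul {V : Type} [MeasureSpace V] (c : ℝ) (g : V → ℝ) :
    normL2 (fun z => c * g z) = ‖c‖ₑ * normL2 g := eLpNorm_const_smul c g 2 volume

lemma multi_smul (s c : ℝ) (v : Fin 3 → R3 × R3) (I : Fin 3 → ℕ) {g : R3 × R3 → ℝ}
    (hg : ContDiff ℝ ∞ g) :
    VlasovPoisson.multi (fun k g z => s * dd (v k) g z) I (fun z => c * g z)
      = fun z => c * s ^ (I 2) * s ^ (I 1) * s ^ (I 0)
          * VlasovPoisson.multi (fun k => dd (v k)) I g z := by
  have hit : ∀ (k : Fin 3) (m : ℕ) (c : ℝ) (g : R3 × R3 → ℝ), ContDiff ℝ ∞ g →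
      (fun (g : R3 × R3 → ℝ) z => s * dd (v k) g z)^[m] (fun z => c * g z)
        = fun z => c * s ^ m * (dd (v k))^[m] g z := by
    intro k m
    induction m with
    | zero => intro c g _; simp
    | succ m ih =>
      intro c g hg
      rw [Function.iterate_succ_apply', Function.iterate_succ_apply', ih c g hg,
        dd_const_mul (iterate_dd_smooth hg _ _)]
      funext z
      ring
  simp only [VlasovPoisson.multi]
  have h2 := iterate_dd_smooth hg (v 2) (I 2)
  rw [hit 2 _ _ _ hg, hit 1 _ _ _ h2, hit 0 _ _ _ (iterate_dd_smooth h2 _ _)]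

/-- The main parts of the weighted derivatives are the derivatives of the datum. -/
lemma normL2_multi_neg_dx (I J : Fin 3 → ℕ) {f : R3 × R3 → ℝ} (hf : ContDiff ℝ ∞ f) :
    normL2 (VlasovPoisson.multi dp I (VlasovPoisson.multi (fun k g z => (-1) * dx k g z) J f))
      = normL2 (VlasovPoisson.multi dx J (VlasovPoisson.multi dp I f)) := by
  have h1 := multi_smul (-1) 1 (fun k => (basisVec k, 0)) J hf
  have h2 := fun c => multi_smul 1 c (fun k => (0, basisVec k)) I
    (multi_smooth hf (fun k => (basisVec k, (0 : R3))) J)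
  simp only [one_mul, one_pow, mul_one] at h1 h2
  have h3 : VlasovPoisson.multi dp I (VlasovPoisson.multi (fun k g z => (-1) * dx k g z) J f)
      = fun z => ((-1) ^ (J 2) * (-1) ^ (J 1) * (-1) ^ (J 0))
        * VlasovPoisson.multi dx J (VlasovPoisson.multi dp I f) z := by
    refine Eq.trans ?_ ((h2 ((-1) ^ (J 2) * (-1) ^ (J 1) * (-1) ^ (J 0))).trans ?_)
    · exact congrArg (VlasovPoisson.multi dp I) h1
    · funext z
      congr 1
      exact congrFun (multi_comm hf (fun k => ((0 : R3), basisVec k))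
        (fun k => (basisVec k, (0 : R3))) I J) z
  rw [h3, normL2_const_mul, enorm_mul, enorm_mul]
  simp only [enorm_pow, enorm_neg, enorm_one, one_pow, one_mul]

/-- The weighted norm of a function of `(y, p)` is, up to a small error, its Sobolev norm. -/
lemma weightedNorm_sub_polyBound (hB : 0 < B) (hg : HFam B h w e N g) :
    ∃ X : Late B N → ℝ≥0∞, PolyBound h (fun a => a.δ * w a) e X ∧
      ∀ a, weightedNorm N a.Φ a.t (fun z => g a (shear a.Φ a.t z))
        ≤ ∑ IJ ∈ multiIndexPairs N,
            normL2 (VlasovPoisson.multi dx IJ.1 (VlasovPoisson.multi dp IJ.2 (g a))) + X a := by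
  refine ⟨fun a => ∑ IJ ∈ multiIndexPairs N, hNorm 0 fun z =>
      VlasovPoisson.multi (shearedL a.Φ a.t) IJ.1
        (VlasovPoisson.multi (shearedP a.Φ a.t) IJ.2 (g a)) z
      - VlasovPoisson.multi dp IJ.1
        (VlasovPoisson.multi (fun k g z => (-1) * dx k g z) IJ.2 (g a)) z,
    PolyBound.sum _ fun IJ hIJ => (close_sheared hB hIJ hg).err.bound, fun a => ?_⟩
  have hswap : ∑ IJ ∈ multiIndexPairs N,
        normL2 (VlasovPoisson.multi dx IJ.1 (VlasovPoisson.multi dp IJ.2 (g a)))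
      = ∑ IJ ∈ multiIndexPairs N,
        normL2 (VlasovPoisson.multi dx IJ.2 (VlasovPoisson.multi dp IJ.1 (g a))) :=
    Finset.sum_nbij' Prod.swap Prod.swap
      (fun x hx => by rw [mem_multiIndexPairs] at hx ⊢; simp only [Prod.swap]; omega)
      (fun x hx => by rw [mem_multiIndexPairs] at hx ⊢; simp only [Prod.swap]; omega)
      (fun _ _ => rfl) (fun _ _ => rfl) (fun _ _ => rfl)
  rw [hswap, ← Finset.sum_add_distrib]
  refine Finset.sum_le_sum fun IJ hIJ => ?_
  have hc := close_sheared hB hIJ hg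
  have h1 := multi_vecL_tinvdp_comp_shear (a.Φ_smooth hB) a.t_pos (hg.smooth a) IJ.1 IJ.2
  rw [h1.1, normL2_comp_shear a.t h1.2.continuous (a.Φ_smooth hB), ← normL2_multi_neg_dx _ _ (hg.smooth a)]
  have h2 := normLike_normL2.add_le _ _ (hc.main.smooth a).continuous (hc.err.smooth a).continuous
  simp only [add_sub_cancel] at h2
  exact h2

end Pert

/-! ### Taylor remainders -/

/-- The homogeneous Taylor polynomial of degree `b` of `u`, at `p` in the direction `ζ`, as a function
of the pair `(p, ζ)`. -/
def taylorTerm (b : ℕ) (u : R3 → ℝ) (q : R3 × R3) : ℝ :=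
  1 / (b.factorial : ℝ) * iteratedFDeriv ℝ b u q.1 fun _ => q.2

/-- The remainder of the Taylor expansion of `u(p + ζ)` after the terms of degree less than `m`. -/
def taylorRem (m : ℕ) (u : R3 → ℝ) (q : R3 × R3) : ℝ :=
  u (q.1 + q.2) - ∑ b ∈ Finset.range m, taylorTerm b u q

lemma taylorTerm_zero (u : R3 → ℝ) : taylorTerm 0 u = fun q => u q.1 := by
  funext q; simp [taylorTerm]

lemma taylorTerm_succ {u : R3 → ℝ} (hu : ContDiff ℝ ∞ u) (b : ℕ) : taylorTerm (b + 1) u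
    = fun q => 1 / ((b : ℝ) + 1) * ∑ j : Fin 3, q.2 j * taylorTerm b (pd j u) q := by
  funext q
  rw [taylorTerm, iteratedFDeriv_succ_eq_sum hu, Finset.mul_sum, Finset.mul_sum]
  refine Finset.sum_congr rfl fun j _ => ?_
  rw [taylorTerm, Nat.factorial_succ]
  have h1 : (b.factorial : ℝ) ≠ 0 := by positivity
  have h2 : (b : ℝ) + 1 ≠ 0 := by positivity
  push_cast
  field_simp
  rfl

lemma taylorTerm_smooth {u : R3 → ℝ} (hu : ContDiff ℝ ∞ u) (b : ℕ) : ContDiff ℝ ∞ (taylorTerm b u) := by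
  induction b generalizing u with
  | zero => rw [taylorTerm_zero]; exact fst_smooth hu
  | succ b ih =>
    rw [taylorTerm_succ hu]
    exact contDiff_const.mul (ContDiff.sum fun j _ =>
      (snd_smooth (coord_smooth j)).mul (ih (pd_smooth hu j)))

lemma dx_taylorTerm {u : R3 → ℝ} (hu : ContDiff ℝ ∞ u) (b : ℕ) (i : Fin 3) :
    dx i (taylorTerm b u) = taylorTerm b (pd i u) := by
  induction b generalizing u with
  | zero => rw [taylorTerm_zero, taylorTerm_zero, dx_fst u hu]
  | succ b ih =>
    have hs : ∀ j, ContDiff ℝ ∞ (fun q : R3 × R3 => q.2 j * taylorTerm b (pd j u) q) := fun j =>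
      (snd_smooth (coord_smooth j)).mul (taylorTerm_smooth (pd_smooth hu j) b)
    rw [taylorTerm_succ hu, taylorTerm_succ (pd_smooth hu i), dx_eq_dd,
      dd_const_mul (ContDiff.sum fun j _ => hs j), dd_sum _ fun j _ => hs j]
    funext q
    congr 1
    refine Finset.sum_congr rfl fun j _ => ?_
    rw [dd_mul (snd_smooth (coord_smooth j)) (taylorTerm_smooth (pd_smooth hu j) b), ← dx_eq_dd,
      dx_snd _ (coord_smooth j), ih (pd_smooth hu j)]
    have : pd i (pd j u) = pd j (pd i u) := dd_comm hu _ _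
    rw [this]
    ring

lemma dp_taylorTerm_zero {u : R3 → ℝ} (hu : ContDiff ℝ ∞ u) (i : Fin 3) :
    dp i (taylorTerm 0 u) = fun _ => 0 := by
  rw [taylorTerm_zero, dp_fst u hu]

/-- The derivative in the increment lowers the degree by one. -/
lemma dp_taylorTerm_succ {u : R3 → ℝ} (hu : ContDiff ℝ ∞ u) (b : ℕ) (i : Fin 3) :
    dp i (taylorTerm (b + 1) u) = taylorTerm b (pd i u) := by
  have key : ∀ b : ℕ, ∀ u : R3 → ℝ, ContDiff ℝ ∞ u → dp i (taylorTerm (b + 1) u) = fun q =>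
      1 / ((b : ℝ) + 1) * (taylorTerm b (pd i u) q
        + ∑ j : Fin 3, q.2 j * dp i (taylorTerm b (pd j u)) q) := by
    intro b u hu
    have hs : ∀ j, ContDiff ℝ ∞ (fun q : R3 × R3 => q.2 j * taylorTerm b (pd j u) q) := fun j =>
      (snd_smooth (coord_smooth j)).mul (taylorTerm_smooth (pd_smooth hu j) b)
    rw [taylorTerm_succ hu, dp_eq_dd, dd_const_mul (ContDiff.sum fun j _ => hs j),
      dd_sum _ fun j _ => hs j]
    funext q
    congr 1
    have h2 : ∀ j : Fin 3, dd ((0 : R3), basisVec i) (fun q : R3 × R3 => q.2 j * taylorTerm b (pd j u) q) q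
        = (if j = i then taylorTerm b (pd j u) q else 0)
          + q.2 j * dd ((0 : R3), basisVec i) (taylorTerm b (pd j u)) q := by
      intro j
      rw [dd_mul (snd_smooth (coord_smooth j)) (taylorTerm_smooth (pd_smooth hu j) b), ← dp_eq_dd,
        dp_snd _ (coord_smooth j)]
      simp only [pd_coord]
      by_cases hij : j = i
      · subst hij; simp
      · have : i ≠ j := fun h => hij h.symm
        simp [hij, this]
    simp only [h2, Finset.sum_add_distrib, Finset.sum_ite_eq', Finset.mem_univ, if_true]
  induction b generalizing u with
  | zero =>
    rw [key 0 u hu]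
    funext q
    simp [dp_taylorTerm_zero (pd_smooth hu _)]
  | succ b ih =>
    rw [key (b + 1) u hu]
    funext q
    have h2 : ∑ j : Fin 3, q.2 j * dp i (taylorTerm (b + 1) (pd j u)) q
        = ((b : ℝ) + 1) * taylorTerm (b + 1) (pd i u) q := by
      rw [taylorTerm_succ (pd_smooth hu i)]
      have h3 : (b : ℝ) + 1 ≠ 0 := by positivity
      rw [← mul_assoc, mul_one_div_cancel h3, one_mul]
      refine Finset.sum_congr rfl fun j _ => ?_
      rw [ih (pd_smooth hu j)]
      have : pd i (pd j u) = pd j (pd i u) := dd_comm hu _ _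
      rw [this]
    rw [h2]
    push_cast
    field_simp
    ring

lemma translate_add_smooth {u : R3 → ℝ} (hu : ContDiff ℝ ∞ u) :
    ContDiff ℝ ∞ (fun q : R3 × R3 => u (q.1 + q.2)) := hu.comp (contDiff_fst.add contDiff_snd)

lemma dd_comp_add {u : R3 → ℝ} (hu : ContDiff ℝ ∞ u) (e : R3 × R3) :
    dd e (fun q : R3 × R3 => u (q.1 + q.2)) = fun q => dd (e.1 + e.2) u (q.1 + q.2) := by
  funext q
  have h := (diff_of_smooth hu (q.1 + q.2)).hasFDerivAt.comp q
    ((hasFDerivAt_fst (𝕜 := ℝ) (p := q)).add (hasFDerivAt_snd (𝕜 := ℝ) (p := q)))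
  simp only [dd]
  rw [show fderiv ℝ (fun q : R3 × R3 => u (q.1 + q.2)) q = _ from h.fderiv]
  rfl

lemma taylorRem_smooth {u : R3 → ℝ} (hu : ContDiff ℝ ∞ u) (m : ℕ) : ContDiff ℝ ∞ (taylorRem m u) :=
  (translate_add_smooth hu).sub (ContDiff.sum fun b _ => taylorTerm_smooth hu b)

lemma dx_taylorRem {u : R3 → ℝ} (hu : ContDiff ℝ ∞ u) (m : ℕ) (i : Fin 3) :
    dx i (taylorRem m u) = taylorRem m (pd i u) := by
  have h1 : taylorRem m u = fun q => u (q.1 + q.2) - ∑ b ∈ Finset.range m, taylorTerm b u q := rfl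
  rw [h1, dx_eq_dd, dd_sub (translate_add_smooth hu) (ContDiff.sum fun b _ => taylorTerm_smooth hu b),
    dd_sum _ fun b _ => taylorTerm_smooth hu b, dd_comp_add hu]
  funext q
  simp only [← dx_eq_dd, dx_taylorTerm hu, add_zero]
  rfl

lemma dp_taylorRem {u : R3 → ℝ} (hu : ContDiff ℝ ∞ u) (m : ℕ) (i : Fin 3) :
    dp i (taylorRem m u) = taylorRem (m - 1) (pd i u) := by
  have h1 : taylorRem m u = fun q => u (q.1 + q.2) - ∑ b ∈ Finset.range m, taylorTerm b u q := rfl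
  rw [h1, dp_eq_dd, dd_sub (translate_add_smooth hu) (ContDiff.sum fun b _ => taylorTerm_smooth hu b),
    dd_sum _ fun b _ => taylorTerm_smooth hu b, dd_comp_add hu]
  funext q
  simp only [← dp_eq_dd, zero_add, taylorRem]
  congr 1
  cases m with
  | zero => simp
  | succ m =>
    rw [Finset.sum_range_succ', dp_taylorTerm_zero hu]
    simp only [dp_taylorTerm_succ hu, add_zero, Nat.add_sub_cancel]

lemma taylorRem_succ_zero (u : R3 → ℝ) (m : ℕ) (p : R3) : taylorRem (m + 1) u (p, 0) = 0 := by
  rw [taylorRem, Finset.sum_range_succ', taylorTerm_zero]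
  have : ∀ b, taylorTerm (b + 1) u (p, 0) = 0 := fun b => by
    rw [taylorTerm]
    have : iteratedFDeriv ℝ (b + 1) u p (fun _ => (0 : R3)) = 0 :=
      (iteratedFDeriv ℝ (b + 1) u p).map_coord_zero 0 rfl
    rw [this, mul_zero]
  simp [this]

lemma fderiv_eq_sum_dx_dp (g : R3 × R3 → ℝ) (q e : R3 × R3) :
    fderiv ℝ g q e = ∑ j : Fin 3, e.1 j * dx j g q + ∑ j : Fin 3, e.2 j * dp j g q := by
  have h1 : e = ∑ j : Fin 3, e.1 j • (basisVec j, (0 : R3)) + ∑ j : Fin 3, e.2 j • ((0 : R3), basisVec j) := by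
    ext1
    · simp only [Prod.fst_add, Prod.fst_sum, Prod.smul_fst, smul_zero, Finset.sum_const_zero, add_zero]
      exact eq_sum_basisVec e.1
    · simp only [Prod.snd_add, Prod.snd_sum, Prod.smul_snd, smul_zero, Finset.sum_const_zero, zero_add]
      exact eq_sum_basisVec e.2
  conv_lhs => rw [h1]
  rw [map_add, map_sum, map_sum]
  simp only [map_smul, smul_eq_mul]
  rfl

/-- Taylor's theorem, in the form that is stable under differentiation. -/
lemma enorm_taylorRem_le (m : ℕ) {u : R3 → ℝ} (hu : ContDiff ℝ ∞ u) (p ζ : R3) :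
    ‖taylorRem m u (p, ζ)‖ₑ ≤ (∑ j : Fin 3, ‖ζ j‖ₑ) ^ m * cNorm3 m u := by
  induction m generalizing u ζ with
  | zero =>
    simp only [taylorRem, Finset.range_zero, Finset.sum_empty, sub_zero, pow_zero, one_mul]
    exact enorm_le_supOn u (Set.mem_univ _)
  | succ m ih =>
    set κ := ∑ j : Fin 3, ‖ζ j‖ₑ with hκ
    set M := κ ^ (m + 1) * cNorm3 (m + 1) u with hM
    by_cases hMt : M = ⊤
    · rw [hMt]; exact le_top
    have hder : ∀ s : ℝ, HasDerivAt (fun s : ℝ => taylorRem (m + 1) u (p, s • ζ))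
        (∑ j : Fin 3, ζ j * taylorRem m (pd j u) (p, s • ζ)) s := by
      intro s
      have h1 : HasDerivAt (fun s : ℝ => (p, s • ζ)) ((0 : R3), ζ) s := by
        have := (hasDerivAt_id s).smul_const ζ
        simpa using (hasDerivAt_const s p).prodMk this
      have h2 := (diff_of_smooth (taylorRem_smooth hu (m + 1)) (p, s • ζ)).hasFDerivAt.comp_hasDerivAt s h1
      rw [fderiv_eq_sum_dx_dp] at h2
      simp [dp_taylorRem hu] at h2
      exact h2
    have hb : ∀ s ∈ Set.Ico (0 : ℝ) 1, ‖∑ j : Fin 3, ζ j * taylorRem m (pd j u) (p, s • ζ)‖ ≤ M.toReal := by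
      intro s hs
      rw [← toReal_enorm]
      refine ENNReal.toReal_mono hMt ?_
      have hs1 : ∑ j : Fin 3, ‖(s • ζ) j‖ₑ ≤ κ := by
        refine Finset.sum_le_sum fun j _ => ?_
        rw [PiLp.smul_apply, smul_eq_mul, enorm_mul]
        refine mul_le_of_le_one_left' ?_
        rw [Real.enorm_eq_ofReal hs.1]
        exact ENNReal.ofReal_le_one.2 hs.2.le
      calc _ ≤ ∑ j : Fin 3, ‖ζ j * taylorRem m (pd j u) (p, s • ζ)‖ₑ := enorm_sum_le _ _
        _ ≤ ∑ j : Fin 3, ‖ζ j‖ₑ * (κ ^ m * cNorm3 (m + 1) u) := by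
            refine Finset.sum_le_sum fun j _ => ?_
            rw [enorm_mul]
            refine mul_le_mul' le_rfl ((ih (pd_smooth hu j) (s • ζ)).trans ?_)
            exact mul_le_mul' (pow_le_pow_left' hs1 m) (cNorm3_pd_le m u j)
        _ = M := by rw [← Finset.sum_mul, ← hκ, hM, pow_succ]; ring
    have h3 := norm_image_sub_le_of_norm_deriv_le_segment_01'
      (fun s _ => (hder s).hasDerivWithinAt) hb
    simp only [one_smul, zero_smul, taylorRem_succ_zero, sub_zero] at h3
    rw [← ofReal_norm, ← ENNReal.ofReal_toReal hMt]
    exact ENNReal.ofReal_le_ofReal h3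

section TaylorFamilies
variable {α : Type} {B : ℝ} {h w w' : α → ℝ≥0∞} {e n m : ℕ}

lemma CFam.of_deriv {c : α → R3 × R3 → ℝ} (hs : ∀ a, ContDiff ℝ ∞ (c a))
    (h0 : PolyBound h w e fun a => supOn (Metric.closedBall 0 B) (c a))
    (hx : ∀ i, CFam B h w e n fun a => VlasovPoisson.dx i (c a))
    (hp : ∀ i, CFam B h w e n fun a => VlasovPoisson.dp i (c a)) : CFam B h w e (n + 1) c :=
  ⟨hs, (h0.add ((PolyBound.sum _ fun i _ => (hx i).bound).add
    (PolyBound.sum _ fun i _ => (hp i).bound))).mono fun _ => (cNorm_succ B n _).le⟩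

lemma PolyBound.one_mul_pow {X : α → ℝ≥0∞} (hX : PolyBound h w 0 X) (m : ℕ) :
    PolyBound h (fun a => w a ^ m) 0 (fun a => X a ^ m) := by
  obtain ⟨C, D, hC⟩ := hX
  refine ⟨C ^ m, D * m, fun a => (pow_le_pow_left' (hC a) m).trans (le_of_eq ?_)⟩
  push_cast
  rw [pow_zero, mul_one, mul_pow, mul_pow, ← pow_mul]
  ring

lemma taylorRem_comp_smooth {u : R3 → ℝ} (hu : ContDiff ℝ ∞ u) {ζ : R3 × R3 → R3}
    (hζ : ContDiff ℝ ∞ ζ) (m : ℕ) : ContDiff ℝ ∞ fun z : R3 × R3 => taylorRem m u (z.2, ζ z) :=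
  (taylorRem_smooth hu m).comp (contDiff_snd.prodMk hζ)

lemma dd_taylorRem_comp {u : R3 → ℝ} (hu : ContDiff ℝ ∞ u) {ζ : R3 × R3 → R3}
    (hζ : ContDiff ℝ ∞ ζ) (m : ℕ) (e z : R3 × R3) :
    dd e (fun z : R3 × R3 => taylorRem m u (z.2, ζ z)) z
      = ∑ j : Fin 3, e.2 j * taylorRem m (pd j u) (z.2, ζ z)
        + ∑ j : Fin 3, dd e (fun z => ζ z j) z * taylorRem (m - 1) (pd j u) (z.2, ζ z) := by
  have hd := (hζ.differentiable (by simp) z).hasFDerivAt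
  have h := (diff_of_smooth (taylorRem_smooth hu m) (z.2, ζ z)).hasFDerivAt.comp z
    ((hasFDerivAt_snd (𝕜 := ℝ) (p := z)).prodMk hd)
  have hc : ∀ j : Fin 3, dd e (fun z => ζ z j) z = fderiv ℝ ζ z e j := by
    intro j
    have h1 := (EuclideanSpace.proj j : EuclideanSpace ℝ (Fin 3) →L[ℝ] ℝ).hasFDerivAt.comp z hd
    rw [dd, show fderiv ℝ (fun z => ζ z j) z = _ from h1.fderiv]
    rfl
  rw [dd, show fderiv ℝ (fun z : R3 × R3 => taylorRem m u (z.2, ζ z)) z = _ from h.fderiv]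
  rw [ContinuousLinearMap.comp_apply, fderiv_eq_sum_dx_dp]
  simp only [dx_taylorRem hu, dp_taylorRem hu, hc]
  rfl

/-- The Taylor remainder of order `m` gains the factor `w^m` if the increment has size `w`. -/
lemma CFam.taylorRem {u : α → R3 → ℝ} {ζ : α → R3 × R3 → R3} (hw : ∀ a, w a ≤ 1)
    (hζs : ∀ a, ContDiff ℝ ∞ (ζ a)) (hζ : ∀ j : Fin 3, CFam B h w 0 n fun a z => ζ a z j)
    (hu : ∀ a, ContDiff ℝ ∞ (u a)) (hub : PolyBound h w' e fun a => cNorm3 (m + n) (u a)) :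
    CFam B h (fun a => w a ^ m * w' a) e n fun a z => taylorRem m (u a) (z.2, ζ a z) := by
  have hsup : ∀ m n : ℕ, (∀ j : Fin 3, CFam B h w 0 n fun a z => ζ a z j) →
      ∀ u : α → R3 → ℝ, (∀ a, ContDiff ℝ ∞ (u a)) →
      (PolyBound h w' e fun a => cNorm3 (m + n) (u a)) →
      PolyBound h (fun a => w a ^ m * w' a) e fun a =>
        supOn (Metric.closedBall 0 B) fun z => VlasovPoisson.taylorRem m (u a) (z.2, ζ a z) := by
    intro m n hζ u hu hub
    have h1 : PolyBound h w 0 fun a => ∑ j : Fin 3, cNorm B n fun z => ζ a z j :=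
      PolyBound.sum _ fun j _ => (hζ j).bound
    have h2 := (h1.one_mul_pow m).mul hub
    rw [zero_add] at h2
    refine h2.mono fun a => supOn_le fun z hz => ?_
    refine (enorm_taylorRem_le m (hu a) _ _).trans (mul_le_mul' (pow_le_pow_left' ?_ m)
      (cNorm3_mono (by omega) _))
    exact Finset.sum_le_sum fun j _ => (enorm_le_supOn (fun z => ζ a z j) hz).trans
      (le_sob (v := phaseDir) n _)
  induction n generalizing u m with
  | zero => exact ⟨fun a => taylorRem_comp_smooth (hu a) (hζs a) m, hsup m 0 hζ u hu hub⟩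
  | succ n ih =>
    have hu' : ∀ j a, ContDiff ℝ ∞ (pd j (u a)) := fun j a => pd_smooth (hu a) j
    have hζn : ∀ j : Fin 3, CFam B h w 0 n fun a z => ζ a z j := fun j => (hζ j).mono (by omega)
    have h1 : ∀ j, CFam B h (fun a => w a ^ m * w' a) e n
        fun a z => VlasovPoisson.taylorRem m (pd j (u a)) (z.2, ζ a z) := fun j =>
      ih hζn (hu' j) (hub.mono fun a => cNorm3_pd_le (m + n) (u a) j)
    have h2 : ∀ j, CFam B h (fun a => w a ^ (m - 1) * w' a) e n
        fun a z => VlasovPoisson.taylorRem (m - 1) (pd j (u a)) (z.2, ζ a z) := fun j =>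
      ih hζn (hu' j) (hub.mono fun a => (cNorm3_pd_le _ (u a) j).trans (cNorm3_mono (by omega) _))
    have hweight : ∀ a, w a * (w a ^ (m - 1) * w' a) ≤ w a ^ m * w' a := by
      intro a
      cases m with
      | zero => simpa using mul_le_of_le_one_left' (hw a)
      | succ m => rw [Nat.add_sub_cancel, pow_succ]; exact le_of_eq (by ring)
    have hx : ∀ i j, CFam B h (fun a => w a ^ m * w' a) e n fun a z =>
        VlasovPoisson.dx i (fun z => ζ a z j) z
          * VlasovPoisson.taylorRem (m - 1) (pd j (u a)) (z.2, ζ a z) := fun i j => by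
      simpa using ((hζ j).dx i).mul (h2 j) hweight
    have hp : ∀ i j, CFam B h (fun a => w a ^ m * w' a) e n fun a z =>
        VlasovPoisson.dp i (fun z => ζ a z j) z
          * VlasovPoisson.taylorRem (m - 1) (pd j (u a)) (z.2, ζ a z) := fun i j => by
      simpa using ((hζ j).dp i).mul (h2 j) hweight
    refine CFam.of_deriv (fun a => taylorRem_comp_smooth (hu a) (hζs a) m) (hsup m _ hζ u hu hub)
      (fun i => ?_) (fun i => ?_)
    · refine (congrArg _ ?_).mp (CFam.sum Finset.univ fun j _ => hx i j)
      funext a z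
      rw [dx_eq_dd, dd_taylorRem_comp (hu a) (hζs a)]
      simp
    · refine (congrArg _ ?_).mp ((h1 i).add (CFam.sum Finset.univ fun j _ => hp i j))
      funext a z
      rw [dp_eq_dd, dd_taylorRem_comp (hu a) (hζs a)]
      simp [basisVec]

end TaylorFamilies

/-! ### Polyhomogeneous sums -/

section PolySum

/-- `∑_{k < M} ∑_{l ≤ k} s^l / t^k X_{k,l}`. -/
def polySum (s t : ℝ) (M : ℕ) (X : ℕ → ℕ → ℝ) : ℝ :=
  ∑ k ∈ Finset.range M, ∑ l ∈ Finset.range (k + 1), s ^ l / t ^ k * X k l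

/-- The coefficients of the product of two expansions. -/
def conv (X Y : ℕ → ℕ → ℝ) (k l : ℕ) : ℝ := ∑ q ∈ splits k l, X q.1.1 q.2.1 * Y q.1.2 q.2.2

/-- The terms of order at least `m` of a product of two expansions with `M` terms each. -/
def tailSum (s t : ℝ) (M m : ℕ) (X Y : ℕ → ℕ → ℝ) : ℝ :=
  ∑ k₁ ∈ Finset.range M, ∑ l₁ ∈ Finset.range (k₁ + 1),
    ∑ k₂ ∈ (Finset.range M).filter fun k₂ => m ≤ k₁ + k₂, ∑ l₂ ∈ Finset.range (k₂ + 1),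
      s ^ (l₁ + l₂) / t ^ (k₁ + k₂) * (X k₁ l₁ * Y k₂ l₂)

variable {s t : ℝ} {M m : ℕ} {X Y : ℕ → ℕ → ℝ}

lemma polySum_congr (h : ∀ k < M, ∀ l ≤ k, X k l = Y k l) : polySum s t M X = polySum s t M Y :=
  Finset.sum_congr rfl fun k hk => Finset.sum_congr rfl fun l hl => by
    rw [h k (Finset.mem_range.1 hk) l (Finset.mem_range_succ_iff.1 hl)]

lemma polySum_add : polySum s t M (fun k l => X k l + Y k l) = polySum s t M X + polySum s t M Y := by
  simp only [polySum, mul_add, Finset.sum_add_distrib]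

lemma polySum_sub : polySum s t M (fun k l => X k l - Y k l) = polySum s t M X - polySum s t M Y := by
  simp only [polySum, mul_sub, Finset.sum_sub_distrib]

lemma polySum_const_mul (c : ℝ) : polySum s t M (fun k l => c * X k l) = c * polySum s t M X := by
  simp only [polySum, Finset.mul_sum]
  exact Finset.sum_congr rfl fun k _ => Finset.sum_congr rfl fun l _ => by ring

lemma polySum_mul_const (c : ℝ) : polySum s t M (fun k l => X k l * c) = polySum s t M X * c := by
  rw [mul_comm, ← polySum_const_mul]
  simp only [mul_comm]

lemma polySum_sum {ι : Type*} (S : Finset ι) (X : ι → ℕ → ℕ → ℝ) :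
    polySum s t M (fun k l => ∑ i ∈ S, X i k l) = ∑ i ∈ S, polySum s t M (X i) := by
  classical
  induction S using Finset.induction_on with
  | empty => simp [polySum]
  | insert i S hi ih => simp only [Finset.sum_insert hi, polySum_add, ih]

lemma conv_succ_self (k : ℕ) : conv X Y k (k + 1) = 0 := by
  refine Finset.sum_eq_zero fun q hq => ?_
  rw [mem_splits] at hq
  omega

/-- The product of two expansions, sorted by powers of `1 / t`: the orders below `m` are complete sums
over all splittings, and the rest is the tail. -/
lemma polySum_mul (ht : t ≠ 0) (hm : m ≤ M) : polySum s t M X * polySum s t M Y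
    = polySum s t m (conv X Y) + tailSum s t M m X Y := by
  have h1 : polySum s t m (conv X Y) = ∑ k₁ ∈ Finset.range m, ∑ l₁ ∈ Finset.range (k₁ + 1),
      ∑ k₂ ∈ Finset.range (m - k₁), ∑ l₂ ∈ Finset.range (k₂ + 1),
      s ^ (l₁ + l₂) / t ^ (k₁ + k₂) * (X k₁ l₁ * Y k₂ l₂) := by
    rw [← sum_splits m fun q => s ^ (q.2.1 + q.2.2) / t ^ (q.1.1 + q.1.2)
      * (X q.1.1 q.2.1 * Y q.1.2 q.2.2)]
    refine Finset.sum_congr rfl fun k _ => Finset.sum_congr rfl fun l _ => ?_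
    rw [conv, Finset.mul_sum]
    refine Finset.sum_congr rfl fun q hq => ?_
    rw [mem_splits] at hq
    rw [hq.1.1, hq.1.2]
  have h2 : ∑ k₁ ∈ Finset.range m, ∑ l₁ ∈ Finset.range (k₁ + 1),
      ∑ k₂ ∈ Finset.range (m - k₁), ∑ l₂ ∈ Finset.range (k₂ + 1),
        s ^ (l₁ + l₂) / t ^ (k₁ + k₂) * (X k₁ l₁ * Y k₂ l₂)
      = ∑ k₁ ∈ Finset.range M, ∑ l₁ ∈ Finset.range (k₁ + 1),
      ∑ k₂ ∈ (Finset.range M).filter (fun k₂ => ¬ m ≤ k₁ + k₂), ∑ l₂ ∈ Finset.range (k₂ + 1),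
        s ^ (l₁ + l₂) / t ^ (k₁ + k₂) * (X k₁ l₁ * Y k₂ l₂) := by
    have hf : ∀ k₁, (Finset.range M).filter (fun k₂ => ¬ m ≤ k₁ + k₂) = Finset.range (m - k₁) := by
      intro k₁
      ext k₂
      simp only [Finset.mem_filter, Finset.mem_range]
      omega
    simp only [hf]
    refine Finset.sum_subset (Finset.range_mono hm) fun k₁ _ hk₁ => ?_
    have : m - k₁ = 0 := by simp only [Finset.mem_range] at hk₁; omega
    simp [this]
  rw [h1, h2, tailSum, ← Finset.sum_add_distrib, polySum, polySum, Finset.sum_mul]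
  refine Finset.sum_congr rfl fun k₁ _ => ?_
  rw [← Finset.sum_add_distrib, Finset.sum_mul]
  refine Finset.sum_congr rfl fun l₁ _ => ?_
  rw [add_comm, Finset.sum_filter_add_sum_filter_not, Finset.mul_sum]
  refine Finset.sum_congr rfl fun k₂ _ => ?_
  rw [Finset.mul_sum]
  refine Finset.sum_congr rfl fun l₂ _ => ?_
  rw [pow_add, pow_add]
  field_simp

/-- Multiplication by `log t / t` shifts both indices. -/
lemma polySum_shift_both (ht : t ≠ 0) (Z : ℕ → ℕ → ℝ) :
    polySum s t (m + 1) (fun k l => if 1 ≤ l then Z (k - 1) (l - 1) else 0)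
      = s / t * polySum s t m Z := by
  have h0 : ∑ l ∈ Finset.range (0 + 1),
      s ^ l / t ^ 0 * (if 1 ≤ l then Z (0 - 1) (l - 1) else 0) = 0 := by simp
  rw [polySum, Finset.sum_range_succ', h0, add_zero, polySum, Finset.mul_sum]
  refine Finset.sum_congr rfl fun k _ => ?_
  rw [Finset.sum_range_succ', Finset.mul_sum, if_neg (by omega), mul_zero, add_zero]
  refine Finset.sum_congr rfl fun l _ => ?_
  rw [if_pos (by omega), Nat.add_sub_cancel, Nat.add_sub_cancel, pow_succ, pow_succ]
  field_simp

/-- Multiplication by `1 / t` shifts the first index. -/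
lemma polySum_shift (ht : t ≠ 0) (Z : ℕ → ℕ → ℝ) (hZ : ∀ k, Z k (k + 1) = 0) :
    polySum s t (m + 1) (fun k l => if 1 ≤ k then Z (k - 1) l else 0)
      = t⁻¹ * polySum s t m Z := by
  have h0 : ∑ l ∈ Finset.range (0 + 1),
      s ^ l / t ^ 0 * (if 1 ≤ 0 then Z (0 - 1) l else 0) = 0 := by simp
  rw [polySum, Finset.sum_range_succ', h0, add_zero, polySum, Finset.mul_sum]
  refine Finset.sum_congr rfl fun k _ => ?_
  rw [Finset.sum_range_succ, if_pos (by omega), Nat.add_sub_cancel, hZ, mul_zero, add_zero,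
    Finset.mul_sum]
  refine Finset.sum_congr rfl fun l _ => ?_
  rw [if_pos (by omega), pow_succ]
  field_simp

/-- The derivative of the powers of the logarithm, as a shift of the second index. -/
lemma polySum_shift_log (X : ℕ → ℕ → ℝ) :
    polySum s t M (fun k l => if l < k then ((l : ℝ) + 1) * X k (l + 1) else 0)
      = ∑ k ∈ Finset.range M, ∑ l ∈ Finset.range (k + 1), (l * s ^ (l - 1)) / t ^ k * X k l := by
  refine Finset.sum_congr rfl fun k _ => ?_
  rw [Finset.sum_range_succ, Finset.sum_range_succ' _ k]
  simp only [lt_irrefl, if_false, mul_zero, add_zero, Nat.cast_zero, zero_mul, zero_div]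
  refine Finset.sum_congr rfl fun l hl => ?_
  rw [if_pos (Finset.mem_range.1 hl), Nat.add_sub_cancel]
  push_cast
  ring

/-- The cancellation in the Vlasov equation: if `f` satisfies the recursion, with the values `F` of
`f`, `X`, `P` of its derivatives in `y` and `p`, `Ψ` of the field coefficients and `A`, `H` of the
gradient and the Hessian of `φ_∞`, then only terms of high order remain. -/
lemma residual_identity (ht : t ≠ 0) {F : ℕ → ℕ → ℝ} {X P Ψ : Fin 3 → ℕ → ℕ → ℝ} {A r : Fin 3 → ℝ}
    {H : Fin 3 → Fin 3 → ℝ} (hH : ∀ i j, H i j = H j i) (m : ℕ)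
    (hrec : ∀ k l, l ≤ k → k * F k l - (if l < k then ((l : ℝ) + 1) * F k (l + 1) else 0)
      = ∑ i, X i k l * A i - ∑ i, conv (X i) (Ψ i) k l
        + (if 1 ≤ l then ∑ i, ∑ j, H i j * conv (X i) (Ψ j) (k - 1) (l - 1) else 0)
        + (if 1 ≤ k then ∑ i, conv (P i) (Ψ i) (k - 1) l else 0)) :
    ∑ k ∈ Finset.range (m + 1), ∑ l ∈ Finset.range (k + 1),
        ((l * s ^ (l - 1)) / t ^ k * F k l - k * (s ^ l / t ^ k * F k l))
      + ∑ i, (A i - (polySum s t (m + 1) (Ψ i) + r i)) * polySum s t (m + 1) (X i)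
      + t⁻¹ * ∑ i, (polySum s t (m + 1) (Ψ i) + r i)
          * (s * ∑ j, H i j * polySum s t (m + 1) (X j) + polySum s t (m + 1) (P i))
      = -(∑ i, tailSum s t (m + 1) (m + 1) (X i) (Ψ i)) - ∑ i, polySum s t (m + 1) (X i) * r i
        + s / t * ∑ i, ∑ j, (tailSum s t (m + 1) m (X i) (Ψ j) * H i j
            + polySum s t (m + 1) (X i) * H i j * r j)
        + t⁻¹ * ∑ i, (tailSum s t (m + 1) m (P i) (Ψ i) + polySum s t (m + 1) (P i) * r i) := by
  have h1 := polySum_congr (s := s) (t := t) (M := m + 1) fun k _ l hl => hrec k l hl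
  rw [polySum_sub, polySum_add, polySum_add, polySum_sub, polySum_shift_log,
    polySum_shift_both ht (fun k l => ∑ i, ∑ j, H i j * conv (X i) (Ψ j) k l),
    polySum_shift ht (fun k l => ∑ i, conv (P i) (Ψ i) k l)
      (fun k => Finset.sum_eq_zero fun i _ => conv_succ_self k)] at h1
  simp only [polySum_sum, polySum_mul_const, polySum_const_mul] at h1
  have h2 : polySum s t (m + 1) (fun k l => k * F k l)
      = ∑ k ∈ Finset.range (m + 1), ∑ l ∈ Finset.range (k + 1), k * (s ^ l / t ^ k * F k l) :=
    Finset.sum_congr rfl fun k _ => Finset.sum_congr rfl fun l _ => by ring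
  rw [h2] at h1
  -- the product with `∂_{x^i} f` is complete up to the order `m`; the other two come with a factor
  -- `log t / t` or `1 / t`, and are needed only up to the order `m - 1`
  have h3 : ∀ i, polySum s t (m + 1) (fun k l => conv (X i) (Ψ i) k l)
      = polySum s t (m + 1) (X i) * polySum s t (m + 1) (Ψ i)
        - tailSum s t (m + 1) (m + 1) (X i) (Ψ i) := fun i =>
    eq_sub_of_add_eq (polySum_mul ht le_rfl).symm
  have h4 : ∀ (Z : Fin 3 → ℕ → ℕ → ℝ) i j, polySum s t m (fun k l => conv (Z i) (Ψ j) k l)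
      = polySum s t (m + 1) (Z i) * polySum s t (m + 1) (Ψ j)
        - tailSum s t (m + 1) m (Z i) (Ψ j) := fun Z i j =>
    eq_sub_of_add_eq (polySum_mul ht (Nat.le_succ m)).symm
  simp only [h3, h4] at h1
  simp only [Finset.sum_sub_distrib]
  simp only [Fin.sum_univ_three] at h1 ⊢
  -- the Hessian enters the recursion and the vector field with its indices exchanged
  rw [hH 1 0, hH 2 0, hH 2 1] at h1 ⊢
  linear_combination (exp := 1) -h1

end PolySum

/-! ### The recursion at a point -/

section Residual
variable (F : R3 × R3 → ℝ)

/-- The recursion for `f_{k,l}` in a form that is uniform in `k` and `l`. The term `k₁ = k` of the product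
of `∂_{x^i} f` and `Ψ^i` is completed, and compensated by `∂_{x^i} f_{k,l} ∂_i φ_∞`, since
`Ψ_{0,0} = ∇φ_∞`. For `k = 0` both sides vanish. -/
lemma fCoeff_rec (z : R3 × R3) (k l : ℕ) (hl : l ≤ k) :
    k * fCoeff F k l z - (if l < k then ((l : ℝ) + 1) * fCoeff F k (l + 1) z else 0)
      = ∑ i, dx i (fCoeff F k l) z * pd i (phiInf F) z.2
        - ∑ i, conv (fun k l => dx i (fCoeff F k l) z)
            (fun k l => Psi (phiInf F) (phiCoeff F) k l i z.1 z.2) k l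
        + (if 1 ≤ l then ∑ i, ∑ j, pd i (pd j (phiInf F)) z.2
            * conv (fun k l => dx i (fCoeff F k l) z)
                (fun k l => Psi (phiInf F) (phiCoeff F) k l j z.1 z.2) (k - 1) (l - 1) else 0)
        + (if 1 ≤ k then ∑ i, conv (fun k l => dp i (fCoeff F k l) z)
            (fun k l => Psi (phiInf F) (phiCoeff F) k l i z.1 z.2) (k - 1) l else 0) := by
  classical
  have hm : ((k, 0), (l, 0)) ∈ splits k l := mem_splits.2 (by simpa using hl)
  have hP0 : ∀ i, Psi (phiInf F) (phiCoeff F) 0 0 i z.1 z.2 = pd i (phiInf F) z.2 := by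
    intro i
    have : splits 0 0 = {((0, 0), (0, 0))} := by
      ext ⟨⟨a, b⟩, ⟨c, d⟩⟩
      simp only [mem_splits, Finset.mem_singleton, Prod.mk.injEq]
      omega
    rw [Psi, this]
    simp [phiCoeff_zero]
  have hsplit : ∀ i, conv (fun k l => dx i (fCoeff F k l) z)
            (fun k l => Psi (phiInf F) (phiCoeff F) k l i z.1 z.2) k l
      = dx i (fCoeff F k l) z * pd i (phiInf F) z.2
        + ∑ q ∈ (splits k l).filter (fun q => q.1.1 < k),
          dx i (fCoeff F q.1.1 q.2.1) z * Psi (phiInf F) (phiCoeff F) q.1.2 q.2.2 i z.1 z.2 := by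
    intro i
    rw [conv, ← Finset.add_sum_erase _ _ hm]
    simp only [hP0]
    congr 1
    refine Finset.sum_congr ?_ fun _ _ => rfl
    ext ⟨⟨a, b⟩, ⟨c, d⟩⟩
    simp only [Finset.mem_erase, mem_splits, Finset.mem_filter, ne_eq, Prod.mk.injEq]
    omega
  simp only [hsplit, Finset.sum_add_distrib]
  cases k with
  | zero =>
    obtain rfl : l = 0 := by omega
    simp
  | succ K =>
    have hK : ((K + 1 : ℕ) : ℝ) ≠ 0 := by positivity
    have hsrc : ((K + 1 : ℕ) : ℝ) * source (phiInf F) (fCoeff F) (phiCoeff F) (K + 1) l z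
        = -(∑ i, ∑ q ∈ (splits (K + 1) l).filter (fun q => q.1.1 < K + 1),
            dx i (fCoeff F q.1.1 q.2.1) z * Psi (phiInf F) (phiCoeff F) q.1.2 q.2.2 i z.1 z.2)
          + (if 1 ≤ l then ∑ i, ∑ j, pd i (pd j (phiInf F)) z.2
            * conv (fun k l => dx i (fCoeff F k l) z)
                (fun k l => Psi (phiInf F) (phiCoeff F) k l j z.1 z.2) (K + 1 - 1) (l - 1) else 0)
          + (if 1 ≤ K + 1 then ∑ i, conv (fun k l => dp i (fCoeff F k l) z)
            (fun k l => Psi (phiInf F) (phiCoeff F) k l i z.1 z.2) (K + 1 - 1) l else 0) := by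
      rw [source, if_pos (Nat.le_add_left 1 K), Finset.sum_comm (s := (splits (K + 1) l).filter _),
        Finset.sum_comm (s := splits (K + 1 - 1) l)]
      have hB : ∑ q ∈ splits (K + 1 - 1) (l - 1), ∑ i : Fin 3, ∑ j : Fin 3,
            dx i (fCoeff F q.1.1 q.2.1) z * Psi (phiInf F) (phiCoeff F) q.1.2 q.2.2 j z.1 z.2
              * pd i (pd j (phiInf F)) z.2
          = ∑ i, ∑ j, pd i (pd j (phiInf F)) z.2 * conv (fun k l => dx i (fCoeff F k l) z)
                (fun k l => Psi (phiInf F) (phiCoeff F) k l j z.1 z.2) (K + 1 - 1) (l - 1) := by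
        rw [Finset.sum_comm]
        refine Finset.sum_congr rfl fun i _ => ?_
        rw [Finset.sum_comm]
        refine Finset.sum_congr rfl fun j _ => ?_
        rw [conv, Finset.mul_sum]
        exact Finset.sum_congr rfl fun q _ => by ring
      rw [hB]
      simp only [conv]
      by_cases h1 : 1 ≤ l
      · simp only [h1, if_true]
        field_simp
      · simp only [h1, if_false]
        field_simp
        ring
    have hval : ((K + 1 : ℕ) : ℝ) * fCoeff F (K + 1) l z
          - (if l < K + 1 then ((l : ℝ) + 1) * fCoeff F (K + 1) (l + 1) z else 0)
        = ((K + 1 : ℕ) : ℝ) * source (phiInf F) (fCoeff F) (phiCoeff F) (K + 1) l z := by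
      by_cases hlt : l < K + 1
      · rw [if_pos hlt, fCoeff_succ, fCoeff_succ, show K + 1 - l = (K - l) + 1 by omega, fDown,
          show K + 1 - (K - l) = l + 1 by omega, show K + 1 - (K - l + 1) = l by omega,
          show K + 1 - (l + 1) = K - l by omega]
        push_cast at hK ⊢
        field_simp
        ring
      · obtain rfl : l = K + 1 := by omega
        rw [if_neg hlt, fCoeff_succ, Nat.sub_self, fDown, sub_zero]
    rw [hval, hsrc]
    ring

end Residual

/-! ### The residual in the Vlasov equation -/

/-- The displacement `x / t - p` in terms of `(y, p)`. -/
def shift (Φ : R3 → ℝ) (t : ℝ) (z : R3 × R3) : R3 := t⁻¹ • (z.1 - Real.log t • gradient Φ z.2)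

/-- The Taylor remainders in the expansion of the field `∂_i φ_{[K]}` in terms of `(y, p)`. -/
def fieldRem (F : R3 × R3 → ℝ) (K : ℕ) (t : ℝ) (i : Fin 3) (z : R3 × R3) : ℝ :=
  polySum (Real.log t) t (K + 1) fun k l =>
    taylorRem (K + 1 - k) (pd i (phiCoeff F k l)) (z.2, shift (phiInf F) t z)

/-- The function `X_{φ_{[K]}} f_{[K]}` in the coordinates `(y, p)`. -/
def residual (F : R3 × R3 → ℝ) (K : ℕ) (t : ℝ) (z : R3 × R3) : ℝ :=
  t⁻¹ * (-(∑ i, tailSum (Real.log t) t (K + 1) (K + 1) (fun k l => dx i (fCoeff F k l) z)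
        (fun k l => Psi (phiInf F) (phiCoeff F) k l i z.1 z.2))
    - ∑ i, polySum (Real.log t) t (K + 1) (fun k l => dx i (fCoeff F k l) z) * fieldRem F K t i z
    + Real.log t / t * ∑ i, ∑ j,
        (tailSum (Real.log t) t (K + 1) K (fun k l => dx i (fCoeff F k l) z)
            (fun k l => Psi (phiInf F) (phiCoeff F) k l j z.1 z.2) * pd i (pd j (phiInf F)) z.2
          + polySum (Real.log t) t (K + 1) (fun k l => dx i (fCoeff F k l) z)
            * pd i (pd j (phiInf F)) z.2 * fieldRem F K t j z)
    + t⁻¹ * ∑ i, (tailSum (Real.log t) t (K + 1) K (fun k l => dp i (fCoeff F k l) z)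
            (fun k l => Psi (phiInf F) (phiCoeff F) k l i z.1 z.2)
          + polySum (Real.log t) t (K + 1) (fun k l => dp i (fCoeff F k l) z) * fieldRem F K t i z))

section Smooth
variable {s t : ℝ} {M : ℕ} {V : Type*} [NormedAddCommGroup V] [NormedSpace ℝ V]
  {f : ℕ → ℕ → V → ℝ}

lemma polySum_smooth (hf : ∀ k < M, ∀ l ≤ k, ContDiff ℝ ∞ (f k l)) :
    ContDiff ℝ ∞ fun z => polySum s t M fun k l => f k l z :=
  ContDiff.sum fun k hk => ContDiff.sum fun l hl => contDiff_const.mul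
    (hf k (Finset.mem_range.1 hk) l (Finset.mem_range_succ_iff.1 hl))

lemma dd_polySum (hf : ∀ k < M, ∀ l ≤ k, ContDiff ℝ ∞ (f k l)) (e : V) :
    dd e (fun z => polySum s t M fun k l => f k l z)
      = fun z => polySum s t M fun k l => dd e (f k l) z := by
  have h1 : ∀ k ∈ Finset.range M, ∀ l ∈ Finset.range (k + 1),
      ContDiff ℝ ∞ fun z => s ^ l / t ^ k * f k l z := fun k hk l hl => contDiff_const.mul
    (hf k (Finset.mem_range.1 hk) l (Finset.mem_range_succ_iff.1 hl))
  simp only [polySum]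
  rw [dd_sum _ fun k hk => ContDiff.sum (h1 k hk)]
  funext z
  refine Finset.sum_congr rfl fun k hk => ?_
  rw [dd_sum _ (h1 k hk)]
  refine Finset.sum_congr rfl fun l hl => ?_
  rw [dd_const_mul (hf k (Finset.mem_range.1 hk) l (Finset.mem_range_succ_iff.1 hl))]

end Smooth

lemma pd_comp_smul {u : R3 → ℝ} (hu : ContDiff ℝ ∞ u) (c : ℝ) (i : Fin 3) (x : R3) :
    pd i (fun x => u (c • x)) x = c * pd i u (c • x) := by
  have h := (diff_of_smooth hu (c • x)).hasFDerivAt.comp x ((hasFDerivAt_id x).const_smul c)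
  rw [pd, show fderiv ℝ (fun x => u (c • x)) x = _ from h.fderiv]
  simp [pd]

lemma comp_smul_smooth {u : R3 → ℝ} (hu : ContDiff ℝ ∞ u) (c : ℝ) :
    ContDiff ℝ ∞ fun x => u (c • x) := hu.comp (contDiff_const_smul c)

section Identity
variable {F : R3 × R3 → ℝ} {K : ℕ} {t : ℝ}

lemma pd_phiApprox (hφ : ∀ k l, l ≤ k → ContDiff ℝ ∞ (phiCoeff F k l)) (i : Fin 3) (x : R3) :
    pd i (phiApprox F K t) x
      = t⁻¹ * t⁻¹ * polySum (Real.log t) t (K + 1) fun k l => pd i (phiCoeff F k l) (t⁻¹ • x) := by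
  have hs : ∀ k < K + 1, ∀ l ≤ k, ContDiff ℝ ∞ fun x => phiCoeff F k l (t⁻¹ • x) :=
    fun k _ l hl => comp_smul_smooth (hφ k l hl) _
  have h1 : phiApprox F K t = fun x => 1 / t * polySum (Real.log t) t (K + 1)
      fun k l => phiCoeff F k l (t⁻¹ • x) := rfl
  rw [h1, pd_eq_dd, dd_const_mul (polySum_smooth hs), dd_polySum hs]
  have h2 : (polySum (Real.log t) t (K + 1) fun k l =>
      dd (basisVec i) (fun x => phiCoeff F k l (t⁻¹ • x)) x)
      = t⁻¹ * polySum (Real.log t) t (K + 1) fun k l => pd i (phiCoeff F k l) (t⁻¹ • x) := by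
    rw [← polySum_const_mul]
    refine polySum_congr fun k _ l hl => ?_
    rw [← pd_eq_dd, pd_comp_smul (hφ k l hl)]
  simp only [h2, pd_eq_dd]
  ring

/-- Taylor's theorem at `p` with the increment `(y - log t ∇Φ(p)) / t`, sorted by the powers of `log t`
and `1 / t`. The power of the logarithm counts the slots filled with `∇Φ`. -/
lemma taylor_expansion {u : R3 → ℝ} (hu : ContDiff ℝ ∞ u) (Φ : R3 → ℝ) (z : R3 × R3) (m : ℕ) :
    u (z.2 + shift Φ t z) = ∑ b ∈ Finset.range m, ∑ c ∈ Finset.range (b + 1),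
        Real.log t ^ c / t ^ b * ((b.choose c : ℝ) * (-1) ^ c / (b.factorial : ℝ)
          * iteratedFDeriv ℝ b u z.2 fun j => if (j : ℕ) < c then gradient Φ z.2 else z.1)
      + taylorRem m u (z.2, shift Φ t z) := by
  have h1 : ∀ b, taylorTerm b u (z.2, shift Φ t z) = ∑ c ∈ Finset.range (b + 1),
        Real.log t ^ c / t ^ b * ((b.choose c : ℝ) * (-1) ^ c / (b.factorial : ℝ)
          * iteratedFDeriv ℝ b u z.2 fun j => if (j : ℕ) < c then gradient Φ z.2 else z.1) := by
    intro b
    have h2 : shift Φ t z = t⁻¹ • (z.1 + (-Real.log t) • gradient Φ z.2) := by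
      rw [shift, neg_smul, sub_eq_add_neg]
    have h3 := (iteratedFDeriv ℝ b u z.2).map_smul_univ (fun _ => t⁻¹)
      (fun _ => z.1 + (-Real.log t) • gradient Φ z.2)
    rw [taylorTerm]
    simp only [h2]
    rw [h3, iteratedFDeriv_add_smul hu, Finset.prod_const, Finset.card_univ, Fintype.card_fin,
      smul_eq_mul, Finset.mul_sum, Finset.mul_sum]
    refine Finset.sum_congr rfl fun c _ => ?_
    rw [neg_pow, inv_pow]
    ring
  rw [taylorRem]
  simp only [h1]
  ring

/-- The expansion of the field in terms of `(y, p)`, with the coefficients `Ψ_{k,l}`. -/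
lemma field_expansion (hφ : ∀ k l, l ≤ k → ContDiff ℝ ∞ (phiCoeff F k l)) (ht : t ≠ 0) (i : Fin 3)
    (z : R3 × R3) :
    (polySum (Real.log t) t (K + 1) fun k l =>
        pd i (phiCoeff F k l) (z.2 + shift (phiInf F) t z))
      = (polySum (Real.log t) t (K + 1) fun k l => Psi (phiInf F) (phiCoeff F) k l i z.1 z.2)
        + fieldRem F K t i z := by
  rw [fieldRem]
  rw [polySum_congr fun k _ l hl => taylor_expansion (pd_smooth (hφ k l hl) i) (phiInf F) z (K + 1 - k),
    polySum_add]
  congr 1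
  have h1 := sum_splits (K + 1) fun q => Real.log t ^ (q.2.1 + q.2.2) / t ^ (q.1.1 + q.1.2)
    * ((q.1.2.choose q.2.2 : ℝ) * (-1) ^ q.2.2 / (q.1.2.factorial : ℝ)
      * iteratedFDeriv ℝ q.1.2 (pd i (phiCoeff F q.1.1 q.2.1)) z.2
          (fun j => if (j : ℕ) < q.2.2 then gradient (phiInf F) z.2 else z.1))
  have h2 : (polySum (Real.log t) t (K + 1) fun k l => Psi (phiInf F) (phiCoeff F) k l i z.1 z.2)
      = ∑ k ∈ Finset.range (K + 1), ∑ l ∈ Finset.range (k + 1), ∑ q ∈ splits k l,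
        Real.log t ^ (q.2.1 + q.2.2) / t ^ (q.1.1 + q.1.2)
    * ((q.1.2.choose q.2.2 : ℝ) * (-1) ^ q.2.2 / (q.1.2.factorial : ℝ)
      * iteratedFDeriv ℝ q.1.2 (pd i (phiCoeff F q.1.1 q.2.1)) z.2
          (fun j => if (j : ℕ) < q.2.2 then gradient (phiInf F) z.2 else z.1)) := by
    refine Finset.sum_congr rfl fun k _ => Finset.sum_congr rfl fun l _ => ?_
    simp only [Psi, Finset.mul_sum]
    refine Finset.sum_congr rfl fun q hq => ?_
    rw [mem_splits] at hq
    rw [hq.1.1, hq.1.2]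
  rw [h2, h1, polySum]
  refine Finset.sum_congr rfl fun k _ => Finset.sum_congr rfl fun l _ => ?_
  rw [Finset.mul_sum]
  refine Finset.sum_congr rfl fun b _ => ?_
  rw [Finset.mul_sum]
  refine Finset.sum_congr rfl fun c _ => ?_
  rw [pow_add, pow_add]
  field_simp

lemma hasDerivAt_comp_shear {g : R3 × R3 → ℝ} (hg : ContDiff ℝ ∞ g) (Φ : R3 → ℝ) (ht : t ≠ 0)
    (z : R3 × R3) : HasDerivAt (fun s => g (shear Φ s z))
      (∑ i : Fin 3, (-z.2 i + t⁻¹ * pd i Φ z.2) * dx i g (shear Φ t z)) t := by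
  have h1 : HasDerivAt (fun s => shear Φ s z) (-z.2 + t⁻¹ • gradient Φ z.2, (0 : R3)) t := by
    have ha := ((hasDerivAt_id t).smul_const z.2).const_sub z.1
    have hb := (Real.hasDerivAt_log ht).smul_const (gradient Φ z.2)
    have := (ha.add hb).prodMk (hasDerivAt_const t z.2)
    simpa [shear] using this
  have h2 := (diff_of_smooth hg (shear Φ t z)).hasFDerivAt.comp_hasDerivAt t h1
  rw [fderiv_eq_sum_dx_dp] at h2
  simp [gradient_apply] at h2
  exact h2

lemma hasDerivAt_log_pow_div (ht : t ≠ 0) (k l : ℕ) :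
    HasDerivAt (fun s => Real.log s ^ l / s ^ k)
      (t⁻¹ * (l * Real.log t ^ (l - 1) / t ^ k - k * (Real.log t ^ l / t ^ k))) t := by
  have h1 := ((Real.hasDerivAt_log ht).pow l).div (hasDerivAt_pow k t) (pow_ne_zero k ht)
  refine h1.congr_deriv ?_
  cases k with
  | zero => simp; ring
  | succ k =>
    rw [Nat.add_sub_cancel, pow_succ]
    field_simp
    simp only [Pi.pow_apply]
    ring

/-- The time derivative acts on the powers of `log t` and `t` and, through `∂_t y = -p + t⁻¹ ∇φ_∞(p)`,
on the coefficients. -/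
lemma deriv_fApprox (hf : ∀ k l, l ≤ k → ContDiff ℝ ∞ (fCoeff F k l)) (ht : t ≠ 0) (z : R3 × R3) :
    deriv (fun s => fApprox F K s z) t
      = t⁻¹ * ∑ k ∈ Finset.range (K + 1), ∑ l ∈ Finset.range (k + 1),
          ((l * Real.log t ^ (l - 1)) / t ^ k * fCoeff F k l (shear (phiInf F) t z)
            - k * (Real.log t ^ l / t ^ k * fCoeff F k l (shear (phiInf F) t z)))
        + ∑ i : Fin 3, (-z.2 i + t⁻¹ * pd i (phiInf F) z.2)
          * polySum (Real.log t) t (K + 1) fun k l => dx i (fCoeff F k l) (shear (phiInf F) t z) := by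
  have h1 : HasDerivAt (fun s => fApprox F K s z)
      (∑ k ∈ Finset.range (K + 1), ∑ l ∈ Finset.range (k + 1),
        (t⁻¹ * (l * Real.log t ^ (l - 1) / t ^ k - k * (Real.log t ^ l / t ^ k))
            * fCoeff F k l (shear (phiInf F) t z)
          + Real.log t ^ l / t ^ k * ∑ i : Fin 3, (-z.2 i + t⁻¹ * pd i (phiInf F) z.2)
              * dx i (fCoeff F k l) (shear (phiInf F) t z))) t :=
    HasDerivAt.fun_sum fun k _ => HasDerivAt.fun_sum fun l hl =>
      (hasDerivAt_log_pow_div ht k l).mul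
        (hasDerivAt_comp_shear (hf k l (Finset.mem_range_succ_iff.1 hl)) (phiInf F) ht z)
  rw [h1.deriv]
  have h2 : ∑ i : Fin 3, (-z.2 i + t⁻¹ * pd i (phiInf F) z.2)
          * polySum (Real.log t) t (K + 1) (fun k l => dx i (fCoeff F k l) (shear (phiInf F) t z))
      = polySum (Real.log t) t (K + 1) fun k l => ∑ i : Fin 3,
          (-z.2 i + t⁻¹ * pd i (phiInf F) z.2) * dx i (fCoeff F k l) (shear (phiInf F) t z) := by
    rw [polySum_sum]
    simp only [polySum_const_mul]
  rw [h2, polySum, Finset.mul_sum, ← Finset.sum_add_distrib]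
  refine Finset.sum_congr rfl fun k _ => ?_
  rw [Finset.mul_sum, ← Finset.sum_add_distrib]
  refine Finset.sum_congr rfl fun l _ => ?_
  ring

/-- The approximate solution in the coordinates `(y, p)`: all orders up to `K` cancel by
`residual_identity`, since `x / t = p + shift` turns the field into its expansion
`field_expansion`. -/
lemma vlasov_eq_residual (hΦ : ContDiff ℝ ∞ (phiInf F))
    (hf : ∀ k l, l ≤ k → ContDiff ℝ ∞ (fCoeff F k l))
    (hφ : ∀ k l, l ≤ k → ContDiff ℝ ∞ (phiCoeff F k l)) (ht : t ≠ 0) :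
    vlasov (phiApprox F K) (fApprox F K) t = fun z => residual F K t (shear (phiInf F) t z) := by
  funext z
  set Y := shear (phiInf F) t z with hY
  have hYp : Y.2 = z.2 := rfl
  have hpos : t⁻¹ • z.1 = Y.2 + shift (phiInf F) t Y := by
    have : Y.1 - Real.log t • gradient (phiInf F) z.2 = z.1 - t • z.2 := by
      simp only [hY, shear]; abel
    rw [shift, hYp, this, smul_sub, smul_smul, inv_mul_cancel₀ ht, one_smul]
    abel
  have hG : ContDiff ℝ ∞ fun z => polySum (Real.log t) t (K + 1) fun k l => fCoeff F k l z :=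
    polySum_smooth fun k _ l hl => hf k l hl
  have hfa : fApprox F K t = fun z => (fun z => polySum (Real.log t) t (K + 1)
      fun k l => fCoeff F k l z) (shear (phiInf F) t z) := rfl
  have hdx : ∀ i z, dx i (fun z => polySum (Real.log t) t (K + 1) fun k l => fCoeff F k l z) z
      = polySum (Real.log t) t (K + 1) fun k l => dx i (fCoeff F k l) z := fun i z =>
    congrFun (dd_polySum (fun k _ l hl => hf k l hl) _) z
  have hdp : ∀ i z, dp i (fun z => polySum (Real.log t) t (K + 1) fun k l => fCoeff F k l z) z
      = polySum (Real.log t) t (K + 1) fun k l => dp i (fCoeff F k l) z := fun i z =>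
    congrFun (dd_polySum (fun k _ l hl => hf k l hl) _) z
  rw [vlasov, deriv_fApprox hf ht]
  simp only [hfa, dx_comp_shear hΦ t hG, dp_comp_shear hΦ t hG, hdx, hdp, pd_phiApprox hφ, hpos,
    field_expansion hφ ht]
  have hid := residual_identity (s := Real.log t) ht (F := fun k l => fCoeff F k l Y)
    (X := fun i k l => dx i (fCoeff F k l) Y) (P := fun i k l => dp i (fCoeff F k l) Y)
    (Ψ := fun i k l => Psi (phiInf F) (phiCoeff F) k l i Y.1 Y.2)
    (A := fun i => pd i (phiInf F) Y.2) (r := fun i => fieldRem F K t i Y)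
    (H := fun i j => pd i (pd j (phiInf F)) Y.2)
    (fun i j => congrFun (dd_comm hΦ (basisVec i) (basisVec j)) Y.2) K
    (fun k l hl => fCoeff_rec F Y k l hl)
  rw [residual, ← hid]
  simp only [← hY, hYp]
  simp only [Fin.sum_univ_three]
  field_simp
  ring

end Identity

/-! ### Estimate of the residual -/

section ResidualBound
variable {B : ℝ} {N K L n m M e e' : ℕ} {h : Late B N → ℝ≥0∞}

/-- Expansions in `(log t)^l / t^k` with `l ≤ k` are bounded uniformly in time. -/
lemma HFam.polySum {f : Late B N → ℕ → ℕ → R3 × R3 → ℝ} {w : Late B N → ℝ≥0∞}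
    (hf : ∀ k < M, ∀ l ≤ k, HFam B h w e n fun a => f a k l) :
    HFam B h w e n fun (a : Late B N) z => polySum a.logt a.t M fun k l => f a k l z :=
  HFam.sum _ fun k hk => HFam.sum _ fun l hl =>
    (hf k (Finset.mem_range.1 hk) l (Finset.mem_range_succ_iff.1 hl)).weight_mul _ fun a =>
      mul_le_of_le_one_left' ((a.enorm_coeff_le (Finset.mem_range_succ_iff.1 hl)).trans
        (pow_le_one' a.η_le_one k))

/-- A tail of order `m` has size `(log t / t)^m`, since every power of the logarithm comes with at least
as many powers of `1 / t`. -/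
lemma HFam.tailSum {X Y : Late B N → R3 × R3 → ℕ → ℕ → ℝ}
    (hf : ∀ k₁ < M, ∀ l₁ ≤ k₁, ∀ k₂ < M, ∀ l₂ ≤ k₂,
      HFam B h (fun _ => 1) e n fun a z => X a z k₁ l₁ * Y a z k₂ l₂) :
    HFam B h (fun a => a.η ^ m) e n fun (a : Late B N) z => tailSum a.logt a.t M m (X a z) (Y a z) := by
  refine HFam.sum _ fun k₁ hk₁ => HFam.sum _ fun l₁ hl₁ => HFam.sum _ fun k₂ hk₂ =>
    HFam.sum _ fun l₂ hl₂ => ?_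
  simp only [Finset.mem_filter, Finset.mem_range] at hk₁ hl₁ hk₂ hl₂
  refine (hf k₁ hk₁ l₁ (by omega) k₂ hk₂.1 l₂ (by omega)).weight_mul _ fun a => ?_
  rw [mul_one]
  exact (a.enorm_coeff_le (by omega)).trans (a.η_pow_le hk₂.2)

lemma shift_smooth {Φ : R3 → ℝ} (hΦ : ContDiff ℝ ∞ Φ) (t : ℝ) : ContDiff ℝ ∞ (shift Φ t) := by
  have h : ContDiff ℝ ∞ fun z : R3 × R3 => gradient Φ z.2 := (gradient_smooth hΦ).comp contDiff_snd
  have h1 : ContDiff ℝ ∞ fun z : R3 × R3 => t⁻¹ • (z.1 - Real.log t • gradient Φ z.2) := by fun_prop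
  exact h1

lemma background_aFam_late (hB : 0 < B) (hn : n ≤ L) (i : Fin 3) :
    AFam (fun a : Late B N => level L a.datum) (fun _ => 1) 0 n fun a => pd i a.Φ :=
  ((background_aFam hB hn i).weaken (by omega)).comap Late.datum

/-- The increment has size `log t / t`. -/
lemma shift_cFam (hB : 0 < B) (hn : n + 1 ≤ L) (j : Fin 3) :
    CFam B (fun a : Late B N => level L a.datum) (fun a => a.η) 0 n fun a z => shift a.Φ a.t z j := by
  have h1 := (CFam.coord (h := fun a : Late B N => level L a.datum) B n j).weight_mul
    (w' := fun a => a.η) (fun a => a.t⁻¹) fun a => by simpa using a.enorm_inv_t_le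
  have h2 := ((background_aFam_late (N := N) hB hn j).toCFam B).weight_mul
    (w' := fun a => a.η) (fun a => -(a.logt / a.t)) fun a => by simpa using a.enorm_div_le
  refine (congrArg _ ?_).mp (h1.add h2)
  funext a z
  simp only [shift, PiLp.smul_apply, PiLp.sub_apply, gradient_apply, smul_eq_mul, Late.logt]
  ring

/-- The remainder of the field has size `(log t / t)^{K+1}`: the coefficient of `φ_{k,l}` contributes the
power `k`, and the Taylor remainder the power `K + 1 - k`. -/
lemma fieldRem_cFam (hB : 0 < B) (hn : n + K + 2 ≤ L) (i : Fin 3) :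
    CFam B (fun a : Late B N => level L a.datum) (fun a => a.η ^ (K + 1)) 1 n
      fun a => fieldRem a.datum.f K a.t i := by
  change CFam B _ _ 1 n fun (a : Late B N) z => ∑ k ∈ Finset.range (K + 1),
    ∑ l ∈ Finset.range (k + 1), a.logt ^ l / a.t ^ k
      * taylorRem (K + 1 - k) (pd i (phiCoeff a.datum.f k l)) (z.2, shift a.Φ a.t z)
  refine CFam.sum _ fun k hk => CFam.sum _ fun l hl => ?_
  rw [Finset.mem_range] at hk hl
  have hu := phiCoeff_aFam (n := K + 1 - k + n + 1) hB (by omega) (show l ≤ k by omega)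
    (show _ ≤ L by omega) i
  have hub : PolyBound (fun a : Late B N => level L a.datum) (fun _ => 1) 1
      fun a => cNorm3 (K + 1 - k + n) (pd i (phiCoeff a.datum.f k l)) :=
    (hu.comap Late.datum).bound.mono fun a => le_self_add
  refine (CFam.taylorRem (fun a : Late B N => a.η_le_one)
    (fun a => shift_smooth (a.Φ_smooth hB) a.t) (fun j => shift_cFam hB (by omega) j)
    (fun a => hu.smooth a.datum) hub).weight_mul _ fun a => ?_
  rw [mul_one]
  calc _ ≤ a.η ^ k * a.η ^ (K + 1 - k) := mul_le_mul' (a.enorm_coeff_le (by omega)) le_rfl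
    _ = a.η ^ (K + 1) := by rw [← pow_add]; congr 1; omega

lemma mul_Psi_late (hB : 0 < B) (hn : 2 ≤ n) {k : ℕ} (hL : n + k ≤ L)
    {g : Datum B → R3 × R3 → ℝ} (hg : HFam B (level L) (fun _ => 1) 1 n g) (l : ℕ) (i : Fin 3) :
    HFam B (fun a : Late B N => level L a.datum) (fun _ => 1) 2 n fun a z =>
      g a.datum z * Psi a.Φ (phiCoeff a.datum.f) k l i z.1 z.2 :=
  (HFam.mul_Psi hn ((coeff_rowBounds hB L k).background n hn (by omega)) hL
    (coeff_rowBounds hB L k).potential hg l i).comap Late.datum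

/-- Each term of the residual has size `(log t)^{K+1} / t^{K+2}`. The tails of order `K` occur with an
additional factor `log t / t` or `1 / t`. -/
lemma residual_hFam (hB : 0 < B) (hn : 2 ≤ n) (hL : n + K + 2 ≤ L) :
    HFam B (fun a : Late B N => level L a.datum) (fun a => ‖a.t⁻¹‖ₑ * a.η ^ (K + 1)) 2 n
      fun a => residual a.datum.f K a.t := by
  have hx : ∀ i, ∀ k < K + 1, ∀ l ≤ k, HFam B (level L) (fun _ => 1) 1 n
      fun d : Datum B => dx i (fCoeff d.f k l) := fun i k hk l hl =>
    (fCoeff_hFam (n := n + 1) hB (by omega) hl (by omega)).dx i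
  have hp : ∀ i, ∀ k < K + 1, ∀ l ≤ k, HFam B (level L) (fun _ => 1) 1 n
      fun d : Datum B => dp i (fCoeff d.f k l) := fun i k hk l hl =>
    (fCoeff_hFam (n := n + 1) hB (by omega) hl (by omega)).dp i
  have hxΨ : ∀ i j m, HFam B (fun a : Late B N => level L a.datum) (fun a => a.η ^ m) 2 n
      fun a z => tailSum a.logt a.t (K + 1) m (fun k l => dx i (fCoeff a.datum.f k l) z)
        (fun k l => Psi a.Φ (phiCoeff a.datum.f) k l j z.1 z.2) := fun i j m =>
    HFam.tailSum fun k₁ hk₁ l₁ hl₁ k₂ hk₂ l₂ _ =>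
      mul_Psi_late hB hn (by omega) (hx i k₁ hk₁ l₁ hl₁) l₂ j
  have hpΨ : ∀ i j m, HFam B (fun a : Late B N => level L a.datum) (fun a => a.η ^ m) 2 n
      fun a z => tailSum a.logt a.t (K + 1) m (fun k l => dp i (fCoeff a.datum.f k l) z)
        (fun k l => Psi a.Φ (phiCoeff a.datum.f) k l j z.1 z.2) := fun i j m =>
    HFam.tailSum fun k₁ hk₁ l₁ hl₁ k₂ hk₂ l₂ _ =>
      mul_Psi_late hB hn (by omega) (hp i k₁ hk₁ l₁ hl₁) l₂ j
  have hxs : ∀ i, HFam B (fun a : Late B N => level L a.datum) (fun _ => 1) 1 n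
      fun a z => polySum a.logt a.t (K + 1) fun k l => dx i (fCoeff a.datum.f k l) z := fun i =>
    HFam.polySum (f := fun a k l => dx i (fCoeff a.datum.f k l)) fun k hk l hl =>
      (hx i k hk l hl).comap Late.datum
  have hps : ∀ i, HFam B (fun a : Late B N => level L a.datum) (fun _ => 1) 1 n
      fun a z => polySum a.logt a.t (K + 1) fun k l => dp i (fCoeff a.datum.f k l) z := fun i =>
    HFam.polySum (f := fun a k l => dp i (fCoeff a.datum.f k l)) fun k hk l hl =>
      (hp i k hk l hl).comap Late.datum
  have hrem := fun i => fieldRem_cFam (N := N) hB hL i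
  have hH : ∀ i j, AFam (fun a : Late B N => level L a.datum) (fun _ => 1) 0 n
      fun a => pd i (pd j a.Φ) := fun i j =>
    (background_aFam_late (n := n + 1) hB (by omega) j).pd i
  have hw1 : ∀ a : Late B N, ‖(-1 : ℝ)‖ₑ * a.η ^ (K + 1) ≤ a.η ^ (K + 1) := fun a => by simp
  have h1 := (HFam.sum Finset.univ fun i _ => hxΨ i i (K + 1)).weight_mul (fun _ => -1) hw1
  have h2 := (HFam.sum Finset.univ fun i _ => (hxs i).mul_cFam (hrem i)
    (w'' := fun a => a.η ^ (K + 1)) fun a => by rw [one_mul]).weight_mul (fun _ => -1) hw1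
  have h3 := (HFam.sum Finset.univ fun i _ => HFam.sum Finset.univ fun j _ =>
    HFam.add ((hxΨ i j K).mul_snd (hH i j) hn (w'' := fun a => a.η ^ K) fun a => by rw [mul_one])
      (((hxs i).mul_snd (hH i j) hn (w'' := fun _ => 1) fun a => by rw [mul_one]).mul_cFam (hrem j)
        (w'' := fun a => a.η ^ K) fun a => by
          rw [one_mul]; exact a.η_pow_le (Nat.le_succ K))).weight_mul (fun a : Late B N => a.logt / a.t)
    (w' := fun a => a.η ^ (K + 1)) fun a => by
      rw [pow_succ' a.η]; exact mul_le_mul' a.enorm_div_le le_rfl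
  have h4 := (HFam.sum Finset.univ fun i _ =>
    HFam.add (hpΨ i i K) ((hps i).mul_cFam (hrem i)
        (w'' := fun a => a.η ^ K) fun a => by
          rw [one_mul]; exact a.η_pow_le (Nat.le_succ K))).weight_mul (fun a : Late B N => a.t⁻¹)
    (w' := fun a => a.η ^ (K + 1)) fun a => by
      rw [pow_succ' a.η]; exact mul_le_mul' a.enorm_inv_t_le le_rfl
  refine (congrArg _ ?_).mp ((((h1.add h2).add h3).add h4).weight_mul (fun a : Late B N => a.t⁻¹)
    (w' := fun a => ‖a.t⁻¹‖ₑ * a.η ^ (K + 1)) fun a => le_rfl)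
  funext a z
  simp only [residual, Late.logt, Late.Φ]
  ring

/-- The approximate solution satisfies the Vlasov equation up to `(log t)^{K+1} / t^{K+2}`. -/
lemma weightedNorm_vlasov_polyBound (hB : 0 < B) (hN : 2 ≤ N) (hL : N + K + 2 ≤ L) :
    PolyBound (fun a : Late B N => level L a.datum) (fun a => ‖a.t⁻¹‖ₑ * a.η ^ (K + 1)) 2
      fun a => weightedNorm N a.Φ a.t
        (vlasov (phiApprox a.datum.f K) (fApprox a.datum.f K) a.t) := by
  refine (weightedNorm_polyBound hB (residual_hFam hB hN hL)).mono fun a => ?_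
  rw [vlasov_eq_residual (a.Φ_smooth hB) (fun k l hl => fCoeff_smooth a.datum hB hl)
    (fun k l hl => phiCoeff_smooth a.datum hB hl) a.t_pos.ne']
  exact le_rfl

end ResidualBound

/-! ### Estimates of the approximate distribution function -/

section Distribution
variable {B : ℝ} {N K L : ℕ}

/-- All terms but the first of the expansion of `f` carry a factor `log t / t`. -/
lemma higher_hFam (hB : 0 < B) (hN : 2 ≤ N) (hL : N + K ≤ L) :
    HFam B (fun a : Late B N => level L a.datum) (fun a => a.η) 1 N
      fun a z => (polySum a.logt a.t (K + 1) fun k l => fCoeff a.datum.f k l z) - a.datum.f z := by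
  have h1 : HFam B (fun a : Late B N => level L a.datum) (fun a => a.η) 1 N
      fun a z => ∑ k ∈ Finset.range K, ∑ l ∈ Finset.range (k + 1 + 1),
        a.logt ^ l / a.t ^ (k + 1) * fCoeff a.datum.f (k + 1) l z := by
    refine HFam.sum _ fun k hk => HFam.sum _ fun l hl => ?_
    rw [Finset.mem_range] at hk hl
    refine HFam.weight_mul ((fCoeff_hFam hB hN (show l ≤ k + 1 by omega)
      (show _ ≤ L by omega)).comap Late.datum) _ fun a => ?_
    rw [mul_one]
    refine (a.enorm_coeff_le (by omega)).trans ((a.η_pow_le (show 1 ≤ k + 1 by omega)).trans ?_)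
    rw [pow_one]
  refine (congrArg _ ?_).mp h1
  funext a z
  rw [polySum, Finset.sum_range_succ']
  simp [fCoeff_zero]

lemma weightedNorm_fApprox_sub_polyBound (hB : 0 < B) (hN : 2 ≤ N) (hL : N + K ≤ L) :
    PolyBound (fun a : Late B N => level L a.datum) (fun a => a.η) 1
      fun a => weightedNorm N a.Φ a.t
        (fun z => fApprox a.datum.f K a.t z - fApprox a.datum.f 0 a.t z) := by
  refine (weightedNorm_polyBound hB (higher_hFam hB hN hL)).mono fun a => le_of_eq ?_
  congr 1
  funext z
  simp [fApprox, polySum, fCoeff_zero, shear, Late.Φ, Late.logt]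

/-- The transported profile has the norm of `f_∞`, up to an error that vanishes as `t → ∞`. -/
lemma weightedNorm_fApprox_zero_polyBound (hB : 0 < B) :
    ∃ X : Late B N → ℝ≥0∞, PolyBound (fun a : Late B N => level N a.datum) (fun a => a.δ) 1 X ∧
      ∀ a, weightedNorm N a.Φ a.t (fApprox a.datum.f 0 a.t)
        ≤ ∑ IJ ∈ multiIndexPairs N, normL2 (multi dx IJ.1 (multi dp IJ.2 a.datum.f)) + X a := by
  obtain ⟨X, hX, hle⟩ := weightedNorm_sub_polyBound (N := N) hB
    ((datum_hFam (B := B) (le_refl N)).comap Late.datum)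
  refine ⟨X, by simpa using hX, fun a => (le_of_eq ?_).trans (hle a)⟩
  congr 1
  funext z
  simp [fApprox, fCoeff_zero, shear, Late.Φ]

end Distribution

/-! ### Taylor expansion of the spatial density -/

/-- The derivative `∑_j y_j ∂_{p^j}`. -/
def radial (F : R3 × R3 → ℝ) : R3 × R3 → ℝ := fun z => ∑ j : Fin 3, z.1 j * dp j F z

/-- The remainder of the Taylor expansion of `F(y, w - ε y)` in powers of `ε`. -/
def radialRem (m : ℕ) (ε : ℝ) (F : R3 × R3 → ℝ) : R3 × R3 → ℝ := fun z =>
  F (z.1, z.2 - ε • z.1) - ∑ b ∈ Finset.range m, (-ε) ^ b / (b.factorial : ℝ) * radial^[b] F z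

lemma radialRem_zero (m : ℕ) (F : R3 × R3 → ℝ) (z : R3 × R3) : radialRem (m + 1) 0 F z = 0 := by
  simp only [radialRem]
  rw [Finset.sum_range_succ']
  simp

section Radial
variable {F : R3 × R3 → ℝ} (hF : ContDiff ℝ ∞ F)

include hF

lemma radial_smooth : ContDiff ℝ ∞ (radial F) :=
  ContDiff.sum fun j _ => (fst_smooth (coord_smooth j)).mul (dp_smooth hF j)

lemma radial_iterate_smooth (m : ℕ) : ContDiff ℝ ∞ (radial^[m] F) := by
  induction m with
  | zero => exact hF
  | succ m ih => rw [Function.iterate_succ_apply']; exact radial_smooth ih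

/-- The operator `radial` has coefficients that do not depend on `p`. -/
lemma dp_radial (i : Fin 3) : dp i (radial F) = radial (dp i F) := by
  have hs : ∀ j, ContDiff ℝ ∞ (fun z : R3 × R3 => z.1 j * dp j F z) := fun j =>
    (fst_smooth (coord_smooth j)).mul (dp_smooth hF j)
  have h1 : radial F = fun z => ∑ j : Fin 3, z.1 j * dp j F z := rfl
  rw [h1, dp_eq_dd, dd_sum _ fun j _ => hs j]
  funext z
  refine Finset.sum_congr rfl fun j _ => ?_
  rw [dd_mul (fst_smooth (coord_smooth j)) (dp_smooth hF j), ← dp_eq_dd, dp_fst _ (coord_smooth j)]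
  have : dp i (dp j F) = dp j (dp i F) := dd_comm hF _ _
  rw [this]
  ring

lemma dp_radial_iterate (m : ℕ) (i : Fin 3) : dp i (radial^[m] F) = radial^[m] (dp i F) := by
  induction m with
  | zero => rfl
  | succ m ih =>
    rw [Function.iterate_succ_apply', Function.iterate_succ_apply',
      dp_radial (radial_iterate_smooth hF m), ih]

lemma translated_smooth (ε : ℝ) : ContDiff ℝ ∞ fun z : R3 × R3 => F (z.1, z.2 - ε • z.1) :=
  hF.comp (by fun_prop)

lemma radialRem_smooth (m : ℕ) (ε : ℝ) : ContDiff ℝ ∞ (radialRem m ε F) :=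
  (translated_smooth hF ε).sub (ContDiff.sum fun b _ =>
    contDiff_const.mul (radial_iterate_smooth hF b))

lemma dp_translated (ε : ℝ) (i : Fin 3) : dp i (fun z : R3 × R3 => F (z.1, z.2 - ε • z.1))
    = fun z => dp i F (z.1, z.2 - ε • z.1) := by
  funext z
  have h1 : HasFDerivAt (fun z : R3 × R3 => (z.1, z.2 - ε • z.1)) _ z :=
    (hasFDerivAt_fst (𝕜 := ℝ) (p := z)).prodMk
      ((hasFDerivAt_snd (𝕜 := ℝ) (p := z)).sub ((hasFDerivAt_fst (𝕜 := ℝ) (p := z)).const_smul ε))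
  have h := (diff_of_smooth hF (z.1, z.2 - ε • z.1)).hasFDerivAt.comp z h1
  rw [dp, show fderiv ℝ (fun z : R3 × R3 => F (z.1, z.2 - ε • z.1)) z = _ from h.fderiv]
  simp [dp]

lemma dp_radialRem (m : ℕ) (ε : ℝ) (i : Fin 3) :
    dp i (radialRem m ε F) = radialRem m ε (dp i F) := by
  have h1 : radialRem m ε F = fun z => F (z.1, z.2 - ε • z.1)
      - ∑ b ∈ Finset.range m, (-ε) ^ b / (b.factorial : ℝ) * radial^[b] F z := rfl
  have hs : ∀ b ∈ Finset.range m, ContDiff ℝ ∞ fun z => (-ε) ^ b / (b.factorial : ℝ) * radial^[b] F z :=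
    fun b _ => contDiff_const.mul (radial_iterate_smooth hF b)
  rw [h1, dp_eq_dd, dd_sub (translated_smooth hF ε) (ContDiff.sum hs), dd_sum _ hs, ← dp_eq_dd,
    dp_translated hF]
  funext z
  simp only [radialRem]
  congr 1
  refine Finset.sum_congr rfl fun b _ => ?_
  rw [dp_eq_dd, dd_const_mul (radial_iterate_smooth hF b), ← dp_eq_dd, dp_radial_iterate hF]

/-- Taylor remainders are primitives of Taylor remainders: this is the recursion behind the `L²` bound. -/
lemma hasDerivAt_radialRem (m : ℕ) (ε : ℝ) (z : R3 × R3) :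
    HasDerivAt (fun ε => radialRem (m + 1) ε F z) (-radialRem m ε (radial F) z) ε := by
  have h1 : HasDerivAt (fun ε : ℝ => (z.1, z.2 - ε • z.1)) ((0 : R3), -z.1) ε := by
    have := (hasDerivAt_const ε z.1).prodMk (((hasDerivAt_id ε).smul_const z.1).const_sub z.2)
    simpa using this
  have h2 := (diff_of_smooth hF (z.1, z.2 - ε • z.1)).hasFDerivAt.comp_hasDerivAt ε h1
  rw [fderiv_eq_sum_dx_dp] at h2
  have h3 : ∀ b : ℕ, HasDerivAt (fun ε : ℝ => (-ε) ^ (b + 1) / ((b + 1).factorial : ℝ)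
      * radial^[b + 1] F z) (-((-ε) ^ b / (b.factorial : ℝ) * radial^[b] (radial F) z)) ε := by
    intro b
    have h4 := (((hasDerivAt_id ε).neg.pow (b + 1)).div_const ((b + 1).factorial : ℝ)).mul_const
      (radial^[b + 1] F z)
    refine h4.congr_deriv ?_
    rw [Function.iterate_succ_apply, Nat.add_sub_cancel, Nat.factorial_succ]
    have hb : (b.factorial : ℝ) ≠ 0 := by positivity
    push_cast
    simp only [Pi.neg_apply, id]
    field_simp
  have h5 := h2.sub ((HasDerivAt.fun_sum (u := Finset.range m) fun b _ => h3 b).add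
    (hasDerivAt_const ε (F z)))
  refine (h5.congr_deriv ?_).congr_of_eventuallyEq (Eventually.of_forall fun ε => ?_)
  · simp only [radialRem, radial]
    simp
    ring
  · simp only [radialRem]
    rw [Finset.sum_range_succ']
    simp

lemma continuous_radialRem (m : ℕ) : Continuous fun q : ℝ × (R3 × R3) => radialRem m q.1 F q.2 := by
  have h1 : Continuous fun q : ℝ × (R3 × R3) => F (q.2.1, q.2.2 - q.1 • q.2.1) :=
    hF.continuous.comp (by fun_prop)
  have h2 : ∀ b, Continuous fun q : ℝ × (R3 × R3) => radial^[b] F q.2 := fun b =>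
    (radial_iterate_smooth hF b).continuous.comp continuous_snd
  unfold radialRem
  fun_prop

end Radial

lemma normL2_translated {F : R3 × R3 → ℝ} (hF : Continuous F) (ε : ℝ) :
    normL2 (fun z : R3 × R3 => F (z.1, z.2 - ε • z.1)) = normL2 F := by
  have h2 : normL2 (fun z : R3 × R3 => F (z.1, z.2 - ε • z.1)) ^ 2 = normL2 F ^ 2 := by
    rw [normL2_sq_prod hF, normL2_sq_prod (by fun_prop)]
    refine lintegral_congr fun y => ?_
    rw [normL2_sq, normL2_sq]
    exact lintegral_sub_right_eq_self (fun w => ‖F (y, w)‖ₑ ^ 2) (ε • y)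
  exact le_antisymm (le_of_sq_le_sq h2.le) (le_of_sq_le_sq h2.ge)

/-- The `L²` bound for the Taylor remainder. -/
lemma normL2_radialRem_le (m : ℕ) {ε : ℝ} (hε : 0 ≤ ε) {F : R3 × R3 → ℝ} (hF : ContDiff ℝ ∞ F) :
    normL2 (radialRem m ε F) ≤ ENNReal.ofReal ε ^ m * normL2 (radial^[m] F) := by
  induction m generalizing F ε with
  | zero =>
    have : radialRem 0 ε F = fun z : R3 × R3 => F (z.1, z.2 - ε • z.1) := by
      funext z; simp [radialRem]
    rw [this, normL2_translated hF.continuous]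
    simp
  | succ m ih =>
    set X := ENNReal.ofReal ε ^ m * normL2 (radial^[m] (radial F)) with hX
    -- Taylor's formula with integral remainder, and the Cauchy-Schwarz inequality in `s`
    have hpt : ∀ z, ‖radialRem (m + 1) ε F z‖ₑ ^ 2
        ≤ ENNReal.ofReal ε * ∫⁻ s in Set.Ioc 0 ε, ‖radialRem m s (radial F) z‖ₑ ^ 2 := by
      intro z
      have hc : Continuous fun s => radialRem m s (radial F) z :=
        (continuous_radialRem (radial_smooth hF) m).comp
          (continuous_id.prodMk continuous_const : Continuous fun s : ℝ => (s, z))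
      have h1 : ∫ s in (0 : ℝ)..ε, -radialRem m s (radial F) z = radialRem (m + 1) ε F z := by
        rw [intervalIntegral.integral_eq_sub_of_hasDerivAt
          (fun s _ => hasDerivAt_radialRem hF m s z) (hc.neg.intervalIntegrable _ _),
          radialRem_zero, sub_zero]
      rw [← h1, intervalIntegral.integral_of_le hε, integral_neg, enorm_neg]
      calc _ ≤ (∫⁻ s in Set.Ioc 0 ε, ‖radialRem m s (radial F) z‖ₑ) ^ 2 := by
            gcongr; exact enorm_integral_le_lintegral_enorm _
        _ = (∫⁻ s in Set.Ioc 0 ε, ‖radialRem m s (radial F) z‖ₑ * 1) ^ 2 := by simp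
        _ ≤ (∫⁻ s in Set.Ioc 0 ε, 1)
              * ∫⁻ s in Set.Ioc 0 ε, ‖radialRem m s (radial F) z‖ₑ ^ 2 * 1 :=
            sq_lintegral_mul_le hc.measurable.enorm.aemeasurable aemeasurable_const
        _ = _ := by simp
    refine le_of_sq_le_sq ?_
    have hmeas : Measurable fun q : (R3 × R3) × ℝ => ‖radialRem m q.2 (radial F) q.1‖ₑ ^ 2 := by
      have := ((continuous_radialRem (radial_smooth hF) m).comp continuous_swap).measurable
      have h2 : Measurable fun q : (R3 × R3) × ℝ => radialRem m q.2 (radial F) q.1 := this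
      fun_prop
    calc normL2 (radialRem (m + 1) ε F) ^ 2
        = ∫⁻ z, ‖radialRem (m + 1) ε F z‖ₑ ^ 2 := normL2_sq _
      _ ≤ ∫⁻ z, ENNReal.ofReal ε * ∫⁻ s in Set.Ioc 0 ε, ‖radialRem m s (radial F) z‖ₑ ^ 2 :=
          lintegral_mono hpt
      _ = ENNReal.ofReal ε * ∫⁻ s in Set.Ioc 0 ε, ∫⁻ z, ‖radialRem m s (radial F) z‖ₑ ^ 2 := by
          rw [lintegral_const_mul' _ _ ENNReal.ofReal_ne_top, lintegral_lintegral_swap]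
          exact hmeas.aemeasurable
      _ ≤ ENNReal.ofReal ε * ∫⁻ s in Set.Ioc 0 ε, X ^ 2 := by
          refine mul_le_mul' le_rfl (setLIntegral_mono' measurableSet_Ioc fun s hs => ?_)
          rw [← normL2_sq]
          refine pow_le_pow_left' ((ih hs.1.le (radial_smooth hF)).trans ?_) 2
          rw [hX]
          have := hs.2
          gcongr
      _ = _ := by
          rw [setLIntegral_const, Real.volume_Ioc, sub_zero, hX, ← Function.iterate_succ_apply]
          ring

/-- The Sobolev norm of order `n` that involves derivatives in `p` only. -/
def pNorm (n : ℕ) (F : R3 × R3 → ℝ) : ℝ≥0∞ := sob (fun i : Fin 3 => ((0 : R3), basisVec i)) normL2 n F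

lemma pNorm_succ (n : ℕ) (F : R3 × R3 → ℝ) :
    pNorm (n + 1) F = normL2 F + ∑ i, pNorm n (dp i F) := rfl

lemma pNorm_radialRem_le (n m : ℕ) {ε : ℝ} (hε : 0 ≤ ε) {F : R3 × R3 → ℝ} (hF : ContDiff ℝ ∞ F) :
    pNorm n (radialRem m ε F) ≤ ENNReal.ofReal ε ^ m * pNorm n (radial^[m] F) := by
  induction n generalizing F with
  | zero => exact normL2_radialRem_le m hε hF
  | succ n ih =>
    rw [pNorm_succ, pNorm_succ, mul_add, Finset.mul_sum]
    refine add_le_add (normL2_radialRem_le m hε hF) (Finset.sum_le_sum fun i _ => ?_)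
    rw [dp_radialRem hF, dp_radial_iterate hF]
    exact ih (dp_smooth hF i)

lemma hNorm3_marg_le_pNorm {R : ℝ} (n : ℕ) {F : R3 × R3 → ℝ} (hF : ContDiff ℝ ∞ F)
    (hv : VanishesOff R F) :
    hNorm3 n (marg F) ≤ volume (Metric.closedBall (0 : R3) R) ^ (1 / 2 : ℝ) * pNorm n F := by
  induction n generalizing F with
  | zero => exact normL2_marg_le hF.continuous hv
  | succ n ih =>
    rw [pNorm_succ, mul_add, Finset.mul_sum]
    refine add_le_add (normL2_marg_le hF.continuous hv) (Finset.sum_le_sum fun i _ => ?_)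
    rw [← pd_eq_dd, pd_marg hF hv]
    exact ih (dp_smooth hF i) (hv.dd _)

lemma VanishesOff.radial {R : ℝ} {F : R3 × R3 → ℝ} (hv : VanishesOff R F) :
    VanishesOff R (radial F) :=
  VanishesOff.sum fun j _ => (hv.dd _).mul_left fun z => z.1 j

lemma VanishesOff.radial_iterate {R : ℝ} {F : R3 × R3 → ℝ} (hv : VanishesOff R F) (m : ℕ) :
    VanishesOff R (VlasovPoisson.radial^[m] F) := by
  induction m with
  | zero => exact hv
  | succ m ih => rw [Function.iterate_succ_apply']; exact ih.radial

lemma VanishesOff.mono {R R' : ℝ} {V : Type*} [NormedAddCommGroup V] {F : V → ℝ}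
    (hv : VanishesOff R F) (h : R ≤ R') : VanishesOff R' F := fun z hz => hv z (h.trans_lt hz)

lemma VanishesOff.translated {R ε : ℝ} (hε : 0 ≤ ε) (hε1 : ε ≤ 1) {F : R3 × R3 → ℝ}
    (hv : VanishesOff R F) : VanishesOff (2 * R) fun z : R3 × R3 => F (z.1, z.2 - ε • z.1) := by
  intro z hz
  refine hv _ ?_
  by_contra hcon
  rw [not_lt, Prod.norm_def, max_le_iff] at hcon
  have h0 : 0 ≤ R := (norm_nonneg _).trans hcon.1
  have h1 : ‖z.2‖ ≤ ‖z.2 - ε • z.1‖ + ε * ‖z.1‖ := by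
    have := norm_add_le (z.2 - ε • z.1) (ε • z.1)
    rwa [sub_add_cancel, norm_smul, Real.norm_of_nonneg hε] at this
  have h2 : ε * ‖z.1‖ ≤ 1 * R := mul_le_mul hε1 hcon.1 (norm_nonneg _) zero_le_one
  have h3 : ‖z‖ ≤ 2 * R := by
    rw [Prod.norm_def, max_le_iff]
    exact ⟨by linarith [hcon.1], by linarith [hcon.2]⟩
  exact absurd hz h3.not_gt

lemma VanishesOff.radialRem {R ε : ℝ} (hR : 0 ≤ R) (hε : 0 ≤ ε) (hε1 : ε ≤ 1) {F : R3 × R3 → ℝ}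
    (hv : VanishesOff R F) (m : ℕ) : VanishesOff (2 * R) (radialRem m ε F) := by
  intro z hz
  have h1 : ∀ b, VlasovPoisson.radial^[b] F z = 0 := fun b =>
    (hv.radial_iterate b).mono (by linarith) z hz
  simp only [VlasovPoisson.radialRem, h1, hv.translated hε hε1 z hz, mul_zero, Finset.sum_const_zero,
    sub_zero]

/-! ### Iterated derivatives of marginals -/

lemma dpWord_smooth (b : ℕ) (i : Fin b → Fin 3) {F : R3 × R3 → ℝ} (hF : ContDiff ℝ ∞ F) :
    ContDiff ℝ ∞ (dpWord b i F) := by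
  induction b generalizing F with
  | zero => exact hF
  | succ b ih => exact ih _ (dp_smooth hF _)

lemma VanishesOff.dpWord {R : ℝ} (b : ℕ) (i : Fin b → Fin 3) {F : R3 × R3 → ℝ}
    (hv : VanishesOff R F) : VanishesOff R (dpWord b i F) := by
  induction b generalizing F with
  | zero => exact hv
  | succ b ih => exact ih _ (hv.dd _)

lemma dpWord_sum {κ : Type*} (b : ℕ) (i : Fin b → Fin 3) (s : Finset κ) {F : κ → R3 × R3 → ℝ}
    (hF : ∀ c ∈ s, ContDiff ℝ ∞ (F c)) :
    dpWord b i (fun z => ∑ c ∈ s, F c z) = fun z => ∑ c ∈ s, dpWord b i (F c) z := by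
  induction b generalizing F with
  | zero => rfl
  | succ b ih =>
    rw [dpWord, dp_eq_dd, dd_sum _ hF]
    exact ih (Fin.init i) fun c hc => dp_smooth (hF c hc) _

lemma iteratedFDeriv_marg {R : ℝ} (b : ℕ) (i : Fin b → Fin 3) {F : R3 × R3 → ℝ}
    (hF : ContDiff ℝ ∞ F) (hv : VanishesOff R F) (w : R3) :
    iteratedFDeriv ℝ b (marg F) w (fun j => basisVec (i j)) = marg (dpWord b i F) w := by
  induction b generalizing F with
  | zero => simp [dpWord]
  | succ b ih =>
    rw [iteratedFDeriv_succ_eq_dd (marg_smooth hF hv), ← pd_eq_dd, pd_marg hF hv]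
    exact ih (Fin.init i) (dp_smooth hF _) (hv.dd _)

lemma coord_prod_smooth (b : ℕ) (i : Fin b → Fin 3) :
    ContDiff ℝ ∞ fun z : R3 × R3 => ∏ j : Fin b, z.1 (i j) :=
  contDiff_prod fun j _ => fst_smooth (coord_smooth (i j))

/-- The iterates of `radial` in terms of partial derivatives and monomials in `y`. -/
lemma radial_iterate_eq_sum (b : ℕ) {F : R3 × R3 → ℝ} (hF : ContDiff ℝ ∞ F) :
    radial^[b] F = fun z => ∑ i : Fin b → Fin 3, dpWord b i (fun z => (∏ j, z.1 (i j)) * F z) z := by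
  induction b generalizing F with
  | zero => funext z; simp [dpWord]
  | succ b ih =>
    rw [Function.iterate_succ_apply, ih (radial_smooth hF)]
    funext z
    rw [← (Fin.snocEquiv fun _ : Fin (b + 1) => Fin 3).sum_comp, Fintype.sum_prod_type,
      Finset.sum_comm]
    refine Finset.sum_congr rfl fun i _ => ?_
    have hs : ∀ k ∈ (Finset.univ : Finset (Fin 3)), ContDiff ℝ ∞ fun z : R3 × R3 =>
        dp k (fun z => (∏ j, z.1 (i j)) * z.1 k * F z) z := fun k _ =>
      dp_smooth (((coord_prod_smooth b i).mul (fst_smooth (coord_smooth k))).mul hF) k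
    have h1 : (fun z : R3 × R3 => (∏ j, z.1 (i j)) * radial F z)
        = fun z => ∑ k : Fin 3, dp k (fun z => (∏ j, z.1 (i j)) * z.1 k * F z) z := by
      funext z
      rw [radial, Finset.mul_sum]
      refine Finset.sum_congr rfl fun k _ => ?_
      have hfst : dp k (fun z : R3 × R3 => (∏ j, z.1 (i j)) * z.1 k) = fun _ => 0 :=
        dp_fst (fun y => (∏ j, y (i j)) * y k)
          ((contDiff_prod fun j _ => coord_smooth (i j)).mul (coord_smooth k)) k
      rw [dp_eq_dd, dd_mul ((coord_prod_smooth b i).mul (fst_smooth (coord_smooth k))) hF, ← dp_eq_dd,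
        hfst]
      ring
    rw [h1, dpWord_sum b i _ hs]
    refine Finset.sum_congr rfl fun k _ => ?_
    have h2 : Fin.init (Fin.snocEquiv (fun _ : Fin (b + 1) => Fin 3) (k, i)) = i :=
      Fin.init_snoc (α := fun _ => Fin 3) k i
    have h3 : Fin.snocEquiv (fun _ : Fin (b + 1) => Fin 3) (k, i) (Fin.last b) = k :=
      Fin.snoc_last (α := fun _ => Fin 3) k i
    have h4 : ∀ j : Fin b, Fin.snocEquiv (fun _ : Fin (b + 1) => Fin 3) (k, i) j.castSucc = i j :=
      fun j => Fin.snoc_castSucc (α := fun _ => Fin 3) k i j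
    rw [dpWord, h2, h3]
    simp only [Fin.prod_univ_castSucc, h3, h4]

/-! ### Shifts of the first argument by a multiple of the field -/

/-- The map `(y, p) ↦ (y + s ∇Φ(p), p)`. -/
def skew (Φ : R3 → ℝ) (s : ℝ) (z : R3 × R3) : R3 × R3 := (z.1 + s • gradient Φ z.2, z.2)

/-- The operator `∂_{p^i} + s ∑_j ∂_i ∂_j Φ(p) ∂_{x^j}`, which is `∂_{p^i}` conjugated by `skew`. -/
def skewP (Φ : R3 → ℝ) (s : ℝ) (i : Fin 3) (g : R3 × R3 → ℝ) : R3 × R3 → ℝ := fun z =>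
  dp i g z + s * ∑ j : Fin 3, dx j g z * pd i (pd j Φ) z.2

/-- The operator `radial` conjugated by `skew`. -/
def skewRadial (Φ : R3 → ℝ) (s : ℝ) (g : R3 × R3 → ℝ) : R3 × R3 → ℝ := fun z =>
  ∑ j : Fin 3, (skewP Φ s j g z * z.1 j + -s * (skewP Φ s j g z * pd j Φ z.2))

section Skew
variable {Φ : R3 → ℝ} (hΦ : ContDiff ℝ ∞ Φ) (s : ℝ) {g : R3 × R3 → ℝ} (hg : ContDiff ℝ ∞ g)

include hΦ

lemma skew_smooth : ContDiff ℝ ∞ (skew Φ s) := by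
  have h : ContDiff ℝ ∞ fun z : R3 × R3 => gradient Φ z.2 := (gradient_smooth hΦ).comp contDiff_snd
  have h1 : ContDiff ℝ ∞ fun z : R3 × R3 => z.1 + s • gradient Φ z.2 := by fun_prop
  exact h1.prodMk contDiff_snd

include hg

lemma comp_skew_smooth : ContDiff ℝ ∞ (fun z => g (skew Φ s z)) := hg.comp (skew_smooth hΦ s)

lemma skewP_smooth (i : Fin 3) : ContDiff ℝ ∞ (skewP Φ s i g) :=
  (dp_smooth hg i).add (contDiff_const.mul (ContDiff.sum fun j _ =>
    (dx_smooth hg j).mul (snd_smooth (pd_smooth (pd_smooth hΦ j) i))))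

lemma skewRadial_smooth : ContDiff ℝ ∞ (skewRadial Φ s g) :=
  ContDiff.sum fun j _ => ((skewP_smooth hΦ s hg j).mul (fst_smooth (coord_smooth j))).add
    (contDiff_const.mul ((skewP_smooth hΦ s hg j).mul (snd_smooth (pd_smooth hΦ j))))

lemma dp_comp_skew (i : Fin 3) :
    dp i (fun z => g (skew Φ s z)) = fun z => skewP Φ s i g (skew Φ s z) := by
  funext z
  have hG : HasFDerivAt (gradient Φ) (fderiv ℝ (gradient Φ) z.2) z.2 :=
    (((gradient_smooth hΦ).differentiable (by simp)) z.2).hasFDerivAt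
  have h1 : HasFDerivAt (skew Φ s) _ z := HasFDerivAt.prodMk
    ((hasFDerivAt_fst (𝕜 := ℝ) (p := z)).add
      ((hG.comp z (hasFDerivAt_snd (𝕜 := ℝ) (p := z))).const_smul s))
    (hasFDerivAt_snd (𝕜 := ℝ) (p := z))
  have h := (diff_of_smooth hg (skew Φ s z)).hasFDerivAt.comp z h1
  have h2 : fderiv ℝ (fun z => g (skew Φ s z)) z = _ := h.fderiv
  rw [dp, h2]
  have hz : (skew Φ s z).2 = z.2 := rfl
  simp only [skewP, hz]
  set A := fderiv ℝ g (skew Φ s z) with hA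
  have h3 : (s • fderiv ℝ (gradient Φ) z.2 (basisVec i), basisVec i)
      = ((0 : R3), basisVec i)
        + s • ∑ j : Fin 3, pd i (pd j Φ) z.2 • (basisVec j, (0 : R3)) := by
    ext1
    · simp [Prod.fst_sum, pd_eq_dd, fderiv_gradient hΦ]
    · simp [Prod.snd_sum]
  have h4 : A (s • fderiv ℝ (gradient Φ) z.2 (basisVec i), basisVec i)
      = dp i g (skew Φ s z) + s * ∑ j : Fin 3, dx j g (skew Φ s z) * pd i (pd j Φ) z.2 := by
    rw [h3, map_add, map_smul, map_sum]
    simp only [map_smul, smul_eq_mul, mul_comm (pd i _ _)]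
    rfl
  rw [← h4]
  simp

lemma radial_comp_skew :
    radial (fun z => g (skew Φ s z)) = fun z => skewRadial Φ s g (skew Φ s z) := by
  funext z
  simp only [radial, dp_comp_skew hΦ s hg, skewRadial]
  refine Finset.sum_congr rfl fun j _ => ?_
  have h1 : (skew Φ s z).1 j = z.1 j + s * pd j Φ z.2 := by
    simp [skew, gradient_apply]
  rw [h1]
  simp only [skew]
  ring

lemma radial_iterate_comp_skew (m : ℕ) :
    radial^[m] (fun z => g (skew Φ s z)) = (fun z => (skewRadial Φ s)^[m] g (skew Φ s z)) := by
  have h : radial^[m] (fun z => g (skew Φ s z)) = (fun z => (skewRadial Φ s)^[m] g (skew Φ s z))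
      ∧ ContDiff ℝ ∞ ((skewRadial Φ s)^[m] g) := by
    induction m with
    | zero => exact ⟨rfl, hg⟩
    | succ m ih =>
      rw [Function.iterate_succ_apply', Function.iterate_succ_apply', ih.1]
      exact ⟨radial_comp_skew hΦ s ih.2, skewRadial_smooth hΦ s ih.2⟩
  exact h.1

lemma normL2_comp_skew : normL2 (fun z => g (skew Φ s z)) = normL2 g := by
  have hc := (skew_smooth hΦ s).continuous
  have h2 : normL2 (fun z => g (skew Φ s z)) ^ 2 = normL2 g ^ 2 := by
    rw [normL2_sq, normL2_sq, Measure.volume_eq_prod, lintegral_prod_symm, lintegral_prod_symm]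
    · refine lintegral_congr fun p => ?_
      simp only [skew]
      exact lintegral_add_right_eq_self (fun x => ‖g (x, p)‖ₑ ^ 2) _
    · have := hg.continuous.measurable
      fun_prop
    · have := (hg.continuous.comp hc).measurable
      have : Measurable fun z => g (skew Φ s z) := this
      fun_prop
  exact le_antisymm (le_of_sq_le_sq h2.le) (le_of_sq_le_sq h2.ge)

end Skew

lemma VanishesOff.comp_skew {Φ : R3 → ℝ} {B s G : ℝ} (hs : 0 ≤ s) (hG : ∀ v, ‖gradient Φ v‖ ≤ G)
    {g : R3 × R3 → ℝ} (hv : VanishesOff B g) :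
    VanishesOff (B + s * G) fun z => g (skew Φ s z) := by
  have hG0 : 0 ≤ G := (norm_nonneg _).trans (hG 0)
  intro z hz
  refine hv _ ?_
  by_contra hcon
  rw [not_lt, Prod.norm_def, max_le_iff] at hcon
  simp only [skew] at hcon
  have h1 : ‖z.1‖ ≤ ‖z.1 + s • gradient Φ z.2‖ + s * ‖gradient Φ z.2‖ := by
    have := norm_sub_le (z.1 + s • gradient Φ z.2) (s • gradient Φ z.2)
    rwa [add_sub_cancel_right, norm_smul, Real.norm_of_nonneg hs] at this
  have h2 : s * ‖gradient Φ z.2‖ ≤ s * G := mul_le_mul_of_nonneg_left (hG _) hs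
  have h0 : 0 ≤ s * G := mul_nonneg hs hG0
  have h3 : ‖z‖ ≤ B + s * G := by
    rw [Prod.norm_def, max_le_iff]
    exact ⟨by linarith [hcon.1], by linarith [hcon.2]⟩
  exact absurd hz h3.not_gt

/-! ### The moments of the Taylor coefficients, in terms of the density coefficients -/

section Moments
variable {Φ : R3 → ℝ} (hΦ : ContDiff ℝ ∞ Φ) {h : R3 × R3 → ℝ} (hh : ContDiff ℝ ∞ h)

lemma prod_factor_smooth (hΦ : ContDiff ℝ ∞ Φ) (hh : ContDiff ℝ ∞ h) (b c : ℕ)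
    (i : Fin b → Fin 3) : ContDiff ℝ ∞ (fun z : R3 × R3 =>
      (∏ j : Fin b, if (j : ℕ) < c then pd (i j) Φ z.2 else z.1 (i j)) * h z) := by
  refine ContDiff.mul (contDiff_prod fun j _ => ?_) hh
  by_cases hj : (j : ℕ) < c
  · simp only [hj, if_true]; exact snd_smooth (pd_smooth hΦ _)
  · simp only [hj, if_false]; exact fst_smooth (coord_smooth _)

include hΦ hh in
lemma densityCoeff_smooth (b c : ℕ) :
    ContDiff ℝ ∞ fun z : R3 × R3 => densityCoeff Φ h b c z.2 z.1 := by
  simp only [densityCoeff_eq b c (prod_factor_smooth hΦ hh b c)]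
  exact contDiff_const.mul (ContDiff.sum fun i _ => dpWord_smooth b i (prod_factor_smooth hΦ hh b c i))

include hΦ hh in
lemma VanishesOff.densityCoeff {B : ℝ} (hv : VanishesOff B h) (b c : ℕ) :
    VanishesOff B fun z : R3 × R3 => VlasovPoisson.densityCoeff Φ h b c z.2 z.1 := by
  simp only [densityCoeff_eq b c (prod_factor_smooth hΦ hh b c)]
  exact (VanishesOff.sum fun i _ => VanishesOff.dpWord b i (hv.mul_left _)).mul_left _

include hΦ hh in
/-- The moments of the transported function. The translation `y ↦ y - s ∇Φ(p)` under the integral turns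
the monomials in `y` into products of factors `y_i - s ∂_iΦ`, and after expansion the terms with the
same number of factors `∂Φ` agree by symmetry. These are the operators `D_{b,c}`. -/
lemma marg_radial_iterate {B R : ℝ} (hv : VanishesOff B h) {s : ℝ}
    (hv' : VanishesOff R fun z => h (skew Φ s z)) (b : ℕ) (w : R3) :
    (-1) ^ b / (b.factorial : ℝ) * marg (radial^[b] fun z => h (skew Φ s z)) w
      = ∑ c ∈ Finset.range (b + 1), s ^ c * ∫ y, densityCoeff Φ h b c w y := by
  have hH := comp_skew_smooth hΦ s hh
  set G : (Fin b → Fin 3) → R3 × R3 → ℝ := fun i z =>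
    (∏ j, (z.1 (i j) + -s * pd (i j) Φ z.2)) * h z with hG
  have hGs : ∀ i, ContDiff ℝ ∞ (G i) := fun i => ContDiff.mul (contDiff_prod fun j _ =>
    (fst_smooth (coord_smooth _)).add (contDiff_const.mul (snd_smooth (pd_smooth hΦ _)))) hh
  have hGv : ∀ i, VanishesOff B (G i) := fun i => hv.mul_left _
  have h1 : ∀ i : Fin b → Fin 3,
      marg (dpWord b i fun z => (∏ j, z.1 (i j)) * h (skew Φ s z)) w = marg (dpWord b i (G i)) w := by
    intro i
    rw [← iteratedFDeriv_marg b i ((coord_prod_smooth b i).mul hH) (hv'.mul_left _),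
      ← iteratedFDeriv_marg b i (hGs i) (hGv i)]
    congr 2
    funext v
    simp only [marg, hG]
    -- translation by `s ∇Φ(v)`, which is allowed as the derivatives are taken outside the integral
    rw [← integral_add_right_eq_self
      (fun y : R3 => (∏ j, (y (i j) + -s * pd (i j) Φ v)) * h (y, v)) (s • gradient Φ v)]
    refine integral_congr_ae (Eventually.of_forall fun y => ?_)
    simp only [skew, PiLp.add_apply, PiLp.smul_apply, gradient_apply, smul_eq_mul]
    congr 1
    exact Finset.prod_congr rfl fun j _ => by ring
  have hD := fun c => integrable_slice (densityCoeff_smooth hΦ hh b c) (hv.densityCoeff hΦ hh b c) w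
  rw [radial_iterate_eq_sum b hH, marg_sum _
    (fun i _ => dpWord_smooth b i ((coord_prod_smooth b i).mul hH))
    (fun i _ => VanishesOff.dpWord b i (hv'.mul_left _)), Finset.sum_congr rfl fun i _ => h1 i,
    ← marg_sum _ (fun i _ => dpWord_smooth b i (hGs i)) (fun i _ => (hGv i).dpWord b i),
    ← marg_const_mul]
  simp only [← integral_const_mul]
  rw [← integral_finsetSum _ fun c _ => (hD c).const_mul _]
  refine integral_congr_ae (Eventually.of_forall fun y => ?_)
  simp only [← iteratedFDeriv_slice_eq_dpWord b _ (hGs _)]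
  simp only [hG]
  rw [sum_iteratedFDeriv_prod_add hΦ hh, Finset.mul_sum]
  refine Finset.sum_congr rfl fun c hc => ?_
  have hcb : c ≤ b := Finset.mem_range_succ_iff.1 hc
  have hsgn : ((-1 : ℝ)) ^ b * (-s) ^ c = s ^ c * (-1) ^ (b - c) := by
    obtain ⟨d, rfl⟩ := Nat.exists_eq_add_of_le hcb
    rw [Nat.add_sub_cancel_left, neg_pow s, pow_add]
    have : ((-1 : ℝ)) ^ c * (-1) ^ c = 1 := by rw [← mul_pow]; simp
    linear_combination s ^ c * (-1) ^ d * this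
  rw [densityCoeff]
  linear_combination ((b.choose c : ℝ) / (b.factorial : ℝ) * ∑ i : Fin b → Fin 3,
    iteratedFDeriv ℝ b (fun v => (∏ j : Fin b, if (j : ℕ) < c then pd (i j) Φ v else y (i j))
      * h (y, v)) w fun j => basisVec (i j)) * hsgn

include hΦ hh in
/-- The spatial density of a function transported along the asymptotic flow. -/
lemma integral_transport {B R : ℝ} (hv : VanishesOff B h) {s t : ℝ} (ht : 1 ≤ t) (hR : 0 ≤ R)
    (hv' : VanishesOff R fun z => h (skew Φ s z)) (m : ℕ) (w : R3) :
    t ^ 3 * ∫ p, h (t • w - t • p + s • gradient Φ p, p)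
      = (∑ b ∈ Finset.range m, ∑ c ∈ Finset.range (b + 1),
          s ^ c / t ^ b * ∫ y, densityCoeff Φ h b c w y)
        + marg (radialRem m t⁻¹ fun z => h (skew Φ s z)) w := by
  have ht0 : 0 < t := by linarith
  have hH := comp_skew_smooth hΦ s hh
  -- substitution `y = t (w - p)`
  have h1 : t ^ 3 * ∫ p, h (t • w - t • p + s • gradient Φ p, p)
      = marg (fun z => h (skew Φ s (z.1, z.2 - t⁻¹ • z.1))) w := by
    have e1 : ∫ p, h (t • w - t • p + s • gradient Φ p, p)
        = ∫ q : R3, h (t • q + s • gradient Φ (w - q), w - q) := by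
      rw [← integral_sub_left_eq_self
        (fun p : R3 => h (t • w - t • p + s • gradient Φ p, p)) volume w]
      refine integral_congr_ae (Eventually.of_forall fun q => ?_)
      simp only [smul_sub]
      congr 3
      abel
    have e2 := Measure.integral_comp_smul volume
      (fun q : R3 => h (t • q + s • gradient Φ (w - q), w - q)) t⁻¹
    have e3 : |((t⁻¹) ^ Module.finrank ℝ R3)⁻¹| = t ^ 3 := by
      rw [finrank_euclideanSpace_fin, inv_pow, inv_inv, abs_of_pos (by positivity)]
    rw [e3, smul_eq_mul] at e2
    rw [e1, ← e2, marg]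
    refine integral_congr_ae (Eventually.of_forall fun y => ?_)
    simp only [skew, smul_smul, mul_inv_cancel₀ ht0.ne', one_smul]
  have h2 : (fun z : R3 × R3 => h (skew Φ s (z.1, z.2 - t⁻¹ • z.1)))
      = fun z => (∑ b ∈ Finset.range m, (-t⁻¹) ^ b / (b.factorial : ℝ)
          * radial^[b] (fun z => h (skew Φ s z)) z)
        + radialRem m t⁻¹ (fun z => h (skew Φ s z)) z := by
    funext z
    simp only [radialRem]
    ring
  have hs : ∀ b ∈ Finset.range m, ContDiff ℝ ∞ fun z => (-t⁻¹) ^ b / (b.factorial : ℝ)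
      * radial^[b] (fun z => h (skew Φ s z)) z := fun b _ =>
    contDiff_const.mul (radial_iterate_smooth hH b)
  have hsv : ∀ b ∈ Finset.range m, VanishesOff (2 * R) fun z => (-t⁻¹) ^ b / (b.factorial : ℝ)
      * radial^[b] (fun z => h (skew Φ s z)) z := fun b _ =>
    ((hv'.radial_iterate b).mono (by linarith)).mul_left _
  rw [h1, h2, marg_add (ContDiff.sum hs) (VanishesOff.sum hsv) (radialRem_smooth hH m _)
    (hv'.radialRem hR (inv_nonneg.2 ht0.le) (inv_le_one_of_one_le₀ ht) m), marg_sum _ hs hsv]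
  congr 1
  refine Finset.sum_congr rfl fun b _ => ?_
  rw [marg_const_mul]
  have h3 := marg_radial_iterate hΦ hh hv hv' b w
  have h4 : (-t⁻¹) ^ b / (b.factorial : ℝ) * marg (radial^[b] fun z => h (skew Φ s z)) w
      = (t ^ b)⁻¹ * ((-1) ^ b / (b.factorial : ℝ) * marg (radial^[b] fun z => h (skew Φ s z)) w) := by
    rw [neg_pow, inv_pow]; ring
  rw [h4, h3, Finset.mul_sum]
  exact Finset.sum_congr rfl fun c _ => by ring

end Moments

/-! ### The remainder of the density -/

section Remainder
variable {B : ℝ} {N K L n m e : ℕ} {w : Late B N → ℝ≥0∞} {g : Late B N → R3 × R3 → ℝ}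

/-- The logarithm of the time, as a weight. -/
def Late.lam (a : Late B N) : ℝ≥0∞ := ENNReal.ofReal a.logt

lemma Late.one_le_lam (a : Late B N) : 1 ≤ a.lam := by
  rw [Late.lam, ← ENNReal.ofReal_one]
  exact ENNReal.ofReal_le_ofReal a.one_le_logt

lemma Late.enorm_logt (a : Late B N) : ‖a.logt‖ₑ = a.lam :=
  Real.enorm_eq_ofReal (zero_le_one.trans a.one_le_logt)

/-- Powers of the logarithm are absorbed by the time. -/
lemma Late.inv_t_mul_lam_pow_le (a : Late B N) (P : ℕ) :
    ‖a.t⁻¹‖ₑ * a.lam ^ P ≤ (P.factorial : ℝ≥0) := by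
  have h0 : 0 ≤ a.logt := zero_le_one.trans a.one_le_logt
  have h1 := Real.pow_div_factorial_le_exp a.logt h0 P
  rw [Late.logt, Real.exp_log a.t_pos, div_le_iff₀ (by positivity)] at h1
  rw [Real.enorm_eq_ofReal (inv_nonneg.2 a.t_pos.le), Late.lam, ← ENNReal.ofReal_pow h0,
    ← ENNReal.ofReal_mul (inv_nonneg.2 a.t_pos.le)]
  refine (ENNReal.ofReal_le_ofReal (q := (P.factorial : ℝ)) ?_).trans (by simp)
  rw [inv_mul_le_iff₀ a.t_pos]
  exact h1

lemma HFam.skewP (hB : 0 < B) (hL : n + 2 ≤ L)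
    (hg : HFam B (fun a : Late B N => level L a.datum) w e (n + 1) g) (i : Fin 3) :
    HFam B (fun a : Late B N => level L a.datum) (fun a => a.lam * w a) e n
      fun a => skewP a.Φ a.logt i (g a) := by
  have h1 := (hg.dp i).mono_weight (w' := fun a => a.lam * w a) 1 fun a => by
    simpa using le_mul_of_one_le_left' a.one_le_lam
  have h2 := fun j => (hg.dx j).mul_cFam
    (((background_aFam_late (N := N) (n := n + 1 + 1) hB hL j).pd i).toCFam B)
    (w'' := w) fun a => by rw [mul_one]
  exact h1.add ((HFam.sum Finset.univ fun j _ => h2 j).weight_mul (fun a : Late B N => a.logt)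
    fun a => by rw [a.enorm_logt])

lemma HFam.skewRadial (hB : 0 < B) (hL : n + 2 ≤ L)
    (hg : HFam B (fun a : Late B N => level L a.datum) w e (n + 1) g) :
    HFam B (fun a : Late B N => level L a.datum) (fun a => a.lam ^ 2 * w a) e n
      fun a => skewRadial a.Φ a.logt (g a) := by
  refine HFam.sum Finset.univ fun j _ => ?_
  have h0 := hg.skewP hB hL j
  have h1 := (h0.mul_coord j).mono_weight (w' := fun a => a.lam ^ 2 * w a) 1 fun a => by
    rw [ENNReal.coe_one, one_mul, pow_two, mul_assoc]
    exact le_mul_of_one_le_left' a.one_le_lam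
  exact h1.add ((h0.mul_cFam ((background_aFam_late (N := N) (n := n + 1) hB (by omega) j).toCFam B)
    (w'' := fun a => a.lam * w a) fun a => by rw [mul_one]).weight_mul (fun a => -a.logt)
      fun a => by rw [enorm_neg, a.enorm_logt, pow_two, mul_assoc])

/-- Every factor `radial` costs at most two logarithms. -/
lemma HFam.skewRadial_iterate (hB : 0 < B) (hL : n + m + 1 ≤ L)
    (hg : HFam B (fun a : Late B N => level L a.datum) w e (n + m) g) :
    HFam B (fun a : Late B N => level L a.datum) (fun a => a.lam ^ (2 * m) * w a) e n
      fun a => (VlasovPoisson.skewRadial a.Φ a.logt)^[m] (g a) := by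
  induction m generalizing n with
  | zero => simpa using hg
  | succ m ih =>
    have h1 := ih (n := n + 1) (by omega) (by rwa [show n + 1 + m = n + (m + 1) by omega])
    refine (congrArg _ ?_).mp ((h1.skewRadial hB (by omega)).mono_weight
      (w' := fun a => a.lam ^ (2 * (m + 1)) * w a) 1 fun a => ?_)
    · funext a
      rw [Function.iterate_succ_apply']
    · rw [ENNReal.coe_one, one_mul, ← mul_assoc, ← pow_add]
      exact le_of_eq (by congr 2; omega)

/-- Every derivative in `p` of a function of `y + log t ∇φ_∞(p)` costs at most a factor `log t`. -/
lemma pNorm_comp_skew_polyBound (hB : 0 < B) (hL : n + 1 ≤ L)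
    (hg : HFam B (fun a : Late B N => level L a.datum) w e n g) :
    PolyBound (fun a : Late B N => level L a.datum) (fun a => a.lam ^ n * w a) e
      fun a => pNorm n fun z => g a (skew a.Φ a.logt z) := by
  induction n generalizing w g with
  | zero =>
    refine (hg.bound.mono_weight (w' := fun a => a.lam ^ 0 * w a) 1 fun a => by simp).mono fun a => ?_
    exact (normL2_comp_skew (a.Φ_smooth hB) _ (hg.smooth a)).le.trans (normL2_le_hNorm 0 _)
  | succ n ih =>
    simp only [pNorm_succ]
    refine PolyBound.add ?_ (PolyBound.sum _ fun i _ => ?_)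
    · refine (hg.bound.mono_weight (w' := fun a => a.lam ^ (n + 1) * w a) 1 fun a => ?_).mono
        fun a => (normL2_comp_skew (a.Φ_smooth hB) _ (hg.smooth a)).le.trans
          (normL2_le_hNorm (n + 1) _)
      simpa using le_mul_of_one_le_left' (one_le_pow₀ a.one_le_lam)
    · refine ((ih (by omega) (hg.skewP hB hL i)).mono_weight
        (w' := fun a => a.lam ^ (n + 1) * w a) 1 fun a => ?_).mono fun a => ?_
      · rw [ENNReal.coe_one, one_mul, pow_succ, mul_assoc]
      · rw [dp_comp_skew (a.Φ_smooth hB) _ (hg.smooth a)]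

/-- A radius such that the coefficients, in the coordinates of `skew`, are supported in the ball
of this radius. -/
def Late.radius (a : Late B N) : ℝ := B + a.logt * (fieldNorm N a.datum).toReal

lemma norm_gradient_le (hB : 0 < B) (d : Datum B) (v : R3) :
    ‖gradient (phiInf d.f) v‖ ≤ (fieldNorm N d).toReal := by
  have h1 : ‖gradient (phiInf d.f) v‖ₑ ≤ fieldNorm N d := by
    have hb : ∀ j, ‖basisVec j‖ₑ = 1 := fun j => by simp [basisVec, enorm_eq_nnnorm]
    rw [gradient_eq_sum]
    calc _ ≤ ∑ j : Fin 3, ‖pd j (phiInf d.f) v • basisVec j‖ₑ := enorm_sum_le _ _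
      _ ≤ ∑ j : Fin 3, cNorm3 (N + 1) (pd j (phiInf d.f)) := Finset.sum_le_sum fun j _ => by
          rw [enorm_smul, hb, mul_one]
          exact (enorm_le_supOn _ (Set.mem_univ v)).trans (cNorm3_mono (Nat.zero_le _) _)
      _ ≤ _ := le_add_self
  rw [← toReal_enorm]
  exact ENNReal.toReal_mono (fieldNorm_ne_top hB N d) h1

lemma Late.radius_nonneg (hB : 0 < B) (a : Late B N) : 0 ≤ a.radius :=
  add_nonneg hB.le (mul_nonneg (zero_le_one.trans a.one_le_logt) ENNReal.toReal_nonneg)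

lemma Late.vanish_comp_skew (hB : 0 < B) (a : Late B N) {g : R3 × R3 → ℝ} (hv : VanishesOff B g) :
    VanishesOff a.radius fun z => g (skew a.Φ a.logt z) :=
  hv.comp_skew (zero_le_one.trans a.one_le_logt) (norm_gradient_le hB a.datum)

lemma fieldNorm_polyBound (hB : 0 < B) (hL : N + 2 ≤ L) :
    PolyBound (fun a : Late B N => level L a.datum) (fun _ => 1) 0
      fun a => fieldNorm N a.datum :=
  (PolyBound.of_le_weight fun _ => le_rfl).add (PolyBound.sum _ fun i _ =>
    (background_aFam_late hB hL i).bound.mono fun _ => le_self_add)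

/-- The supports have a radius of size `log t`, so that the factor from the Cauchy-Schwarz inequality
grows at most like a power of the logarithm. -/
lemma volume_ball_polyBound (hB : 0 < B) (hL : N + 2 ≤ L) :
    PolyBound (fun a : Late B N => level L a.datum) (fun a => a.lam ^ 3) 0
      fun a => volume (Metric.closedBall (0 : R3) (2 * a.radius)) ^ (1 / 2 : ℝ) := by
  have hF := fieldNorm_polyBound (N := N) hB hL
  have h3 := (((hF.mul hF).mul hF).weight_mul fun a => a.lam ^ 3).mono_weight
    (w' := fun a => a.lam ^ 3) 1 fun a => by simp
  set V := volume (Metric.ball (0 : R3) 1) with hV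
  have hVtop : V ≠ ⊤ := measure_ball_lt_top.ne
  refine (h3.const_mul (1 + (ENNReal.ofReal (2 * (B + 1)) ^ 3 * V).toNNReal)).mono fun a => ?_
  set X := volume (Metric.closedBall (0 : R3) (2 * a.radius)) with hX
  have hlam := a.one_le_lam
  have hfld := one_le_fieldNorm N a.datum
  set Y := a.lam ^ 3 * (fieldNorm N a.datum * fieldNorm N a.datum * fieldNorm N a.datum) with hY
  have hY1 : 1 ≤ Y := one_le_mul (one_le_pow₀ hlam) (one_le_mul (one_le_mul hfld hfld) hfld)
  have hXle : X ≤ ENNReal.ofReal (2 * (B + 1)) ^ 3 * V * Y := by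
    have hr : ENNReal.ofReal (2 * a.radius)
        ≤ ENNReal.ofReal (2 * (B + 1)) * (a.lam * fieldNorm N a.datum) := by
      have hl0 : 0 ≤ a.logt := zero_le_one.trans a.one_le_logt
      rw [Late.lam, ← ENNReal.ofReal_toReal (fieldNorm_ne_top hB N a.datum),
        ← ENNReal.ofReal_mul hl0, ← ENNReal.ofReal_mul (by positivity)]
      apply ENNReal.ofReal_le_ofReal
      have h1 : 1 ≤ a.logt * (fieldNorm N a.datum).toReal := by
        refine one_le_mul_of_one_le_of_one_le a.one_le_logt ?_
        rw [← ENNReal.toReal_one]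
        exact ENNReal.toReal_mono (fieldNorm_ne_top hB N a.datum) hfld
      rw [Late.radius]
      nlinarith
    have h2 : X = ENNReal.ofReal (2 * a.radius) ^ 3 * V := by
      rw [hX, Measure.addHaar_closedBall _ _ (by linarith [a.radius_nonneg hB]),
        finrank_euclideanSpace_fin, ENNReal.ofReal_pow (by linarith [a.radius_nonneg hB])]
    rw [h2]
    calc _ ≤ (ENNReal.ofReal (2 * (B + 1)) * (a.lam * fieldNorm N a.datum)) ^ 3 * V := by gcongr
      _ = _ := by rw [hY]; ring
  -- square roots are not polynomials, so the root is estimated by `1 + X`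
  have hsqrt : X ^ (1 / 2 : ℝ) ≤ 1 + X := by
    rcases le_total X 1 with h | h
    · exact (ENNReal.rpow_le_one h (by norm_num)).trans le_self_add
    · refine le_trans ?_ (le_add_self (a := X))
      conv_rhs => rw [← ENNReal.rpow_one X]
      exact ENNReal.rpow_le_rpow_of_exponent_le h (by norm_num)
  push_cast
  rw [ENNReal.coe_toNNReal (ENNReal.mul_ne_top (ENNReal.pow_ne_top ENNReal.ofReal_ne_top) hVtop),
    add_mul, one_mul]
  exact hsqrt.trans (add_le_add hY1 hXle)

/-- The Taylor remainder of order `m` of the density is of size `t^{-m}`, up to logarithms. -/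
lemma marg_radialRem_polyBound (hB : 0 < B) (hL : N + m + 1 ≤ L) (hL' : N + 2 ≤ L)
    (hg : HFam B (fun a : Late B N => level L a.datum) (fun _ => 1) e (N + m) g) :
    PolyBound (fun a : Late B N => level L a.datum)
      (fun a => ‖a.t⁻¹‖ₑ ^ m * a.lam ^ (3 + N + 2 * m)) e
      fun a => hNorm3 N (marg (radialRem m a.t⁻¹ fun z => g a (skew a.Φ a.logt z))) := by
  have h1 := pNorm_comp_skew_polyBound hB (show N + 1 ≤ L by omega) (hg.skewRadial_iterate hB hL)
  have h2 := ((volume_ball_polyBound hB hL').mul h1).weight_mul fun a => ‖a.t⁻¹‖ₑ ^ m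
  rw [zero_add] at h2
  refine (h2.mono_weight (w' := fun a => ‖a.t⁻¹‖ₑ ^ m * a.lam ^ (3 + N + 2 * m)) 1
    fun a => ?_).mono fun a => ?_
  · rw [ENNReal.coe_one, one_mul, mul_one, ← pow_add, ← pow_add, add_assoc]
  · have hH := comp_skew_smooth (a.Φ_smooth hB) a.logt (hg.smooth a)
    have ht : 0 ≤ a.t⁻¹ := inv_nonneg.2 a.t_pos.le
    refine (hNorm3_marg_le_pNorm N (radialRem_smooth hH m _)
      ((a.vanish_comp_skew hB (hg.vanish a)).radialRem (a.radius_nonneg hB) ht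
        (inv_le_one_of_one_le₀ a.one_le_t) m)).trans ?_
    rw [← radial_iterate_comp_skew (a.Φ_smooth hB) _ (hg.smooth a)]
    refine (mul_le_mul' le_rfl (pNorm_radialRem_le N m ht hH)).trans (le_of_eq ?_)
    rw [Real.enorm_eq_ofReal ht]
    ring

end Remainder

/-! ### The expansion of the density -/

section Expansion
variable {B : ℝ} {K k l : ℕ}

/-- The coefficients of the expansion of the density are `ϱ_{k,l}`: the term with `k₁ = k` is the integral
of `f_{k,l}`, which is `𝒫_{k,l}` by `marg_fCoeff`. -/
lemma sum_densityCoeff_eq_rhoCoeff (hB : 0 < B) (d : Datum B) (hl : l ≤ k) (w : R3) :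
    ∑ q ∈ splits k l, ∫ y, densityCoeff (phiInf d.f) (fCoeff d.f q.1.1 q.2.1) q.1.2 q.2.2 w y
      = rhoCoeff d.f k l w := by
  -- the only splitting with `k₁ = k`
  have hfil : (splits k l).filter (fun q => ¬ q.1.1 < k) = {((k, 0), (l, 0))} := by
    ext ⟨⟨k₁, k₂⟩, ⟨l₁, l₂⟩⟩
    simp only [Finset.mem_filter, mem_splits, Finset.mem_singleton, Prod.mk.injEq]
    omega
  have h0 : ∫ y, densityCoeff (phiInf d.f) (fCoeff d.f k l) 0 0 w y = marg (fCoeff d.f k l) w := by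
    simp [densityCoeff, marg]
  rw [← Finset.sum_filter_add_sum_filter_not _ (fun q => q.1.1 < k), hfil, Finset.sum_singleton, h0]
  cases k with
  | zero =>
    simp only [not_lt_zero, Finset.filter_false, Finset.sum_empty, zero_add, fCoeff_zero,
      rhoCoeff_zero]
    rfl
  | succ k => rw [marg_fCoeff hB d (by omega) hl, rhoCoeff_succ, rhoNext, add_comm]

/-- The error in the expansion of the density: the terms of order `K + 1`, and the remainders. -/
def densityRem (d : Datum B) (K : ℕ) (t : ℝ) (w : R3) : ℝ :=
  (∑ l ∈ Finset.range (K + 2), Real.log t ^ l / t ^ (K + 1)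
      * ∑ q ∈ (splits (K + 1) l).filter fun q => q.1.1 < K + 1,
          ∫ y, densityCoeff (phiInf d.f) (fCoeff d.f q.1.1 q.2.1) q.1.2 q.2.2 w y)
  + ∑ k ∈ Finset.range (K + 1), ∑ l ∈ Finset.range (k + 1), Real.log t ^ l / t ^ k
      * marg (radialRem (K + 2 - k) t⁻¹
          fun z => fCoeff d.f k l (skew (phiInf d.f) (Real.log t) z)) w

/-- The density of the approximate solution at `x = t w`. The coefficient `f_{k,l}` is expanded to the
order `K + 1 - k`, that is one order beyond the expansion of `ϱ`. -/
lemma density_expansion {N : ℕ} (hB : 0 < B) (a : Late B N) (K : ℕ) (w : R3) :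
    a.t ^ 3 * ∫ p, fApprox a.datum.f K a.t (a.t • w, p)
      = polySum a.logt a.t (K + 1) (fun k l => rhoCoeff a.datum.f k l w)
        + densityRem a.datum K a.t w := by
  have ht := a.t_pos
  set s := Real.log a.t with hs
  set Φ := phiInf a.datum.f with hΦ
  set D : (ℕ × ℕ) × (ℕ × ℕ) → ℝ := fun q =>
    ∫ y, densityCoeff Φ (fCoeff a.datum.f q.1.1 q.2.1) q.1.2 q.2.2 w y with hD
  have hΦs : ContDiff ℝ ∞ Φ := a.Φ_smooth hB
  have hint : ∀ k, ∀ l ≤ k, Integrable fun p : R3 =>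
      fCoeff a.datum.f k l (a.t • w - a.t • p + s • gradient Φ p, p) := by
    intro k l hl
    have hc : Continuous fun p : R3 => (a.t • w - a.t • p + s • gradient Φ p, p) := by
      have := (gradient_smooth hΦs).continuous
      fun_prop
    refine ((fCoeff_smooth a.datum hB hl).continuous.comp hc).integrable_of_hasCompactSupport
      (VanishesOff.hasCompactSupport (B := B) fun p hp => ?_)
    exact fCoeff_vanish a.datum hB hl _ (hp.trans_le (norm_snd_le
      (a.t • w - a.t • p + s • gradient Φ p, p)))
  have h1 : a.t ^ 3 * ∫ p, fApprox a.datum.f K a.t (a.t • w, p)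
      = ∑ k ∈ Finset.range (K + 1), ∑ l ∈ Finset.range (k + 1), s ^ l / a.t ^ k
        * ((∑ b ∈ Finset.range (K + 2 - k), ∑ c ∈ Finset.range (b + 1),
              s ^ c / a.t ^ b * D ((k, b), (l, c)))
          + marg (radialRem (K + 2 - k) a.t⁻¹ fun z => fCoeff a.datum.f k l (skew Φ s z)) w) := by
    simp only [fApprox]
    rw [integral_finsetSum _ fun k _ => integrable_finsetSum _ fun l hl =>
      (hint k l (Finset.mem_range_succ_iff.1 hl)).const_mul _, Finset.mul_sum]
    refine Finset.sum_congr rfl fun k _ => ?_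
    rw [integral_finsetSum _ fun l hl =>
      (hint k l (Finset.mem_range_succ_iff.1 hl)).const_mul _, Finset.mul_sum]
    refine Finset.sum_congr rfl fun l hl => ?_
    have hl' := Finset.mem_range_succ_iff.1 hl
    have key := integral_transport hΦs (fCoeff_smooth a.datum hB hl')
      (fCoeff_vanish a.datum hB hl') a.one_le_t (a.radius_nonneg hB)
      (a.vanish_comp_skew hB (fCoeff_vanish a.datum hB hl')) (K + 2 - k) w
    rw [integral_const_mul, mul_left_comm]
    exact congrArg (s ^ l / a.t ^ k * ·) key
  have h2 := sum_splits (K + 2) fun q => if q.1.1 < K + 1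
    then s ^ (q.2.1 + q.2.2) / a.t ^ (q.1.1 + q.1.2) * D q else 0
  have h3 : ∑ k ∈ Finset.range (K + 2), ∑ l ∈ Finset.range (k + 1), ∑ b ∈ Finset.range (K + 2 - k),
      ∑ c ∈ Finset.range (b + 1), (if k < K + 1
        then s ^ (l + c) / a.t ^ (k + b) * D ((k, b), (l, c)) else 0)
      = ∑ k ∈ Finset.range (K + 1), ∑ l ∈ Finset.range (k + 1), s ^ l / a.t ^ k
        * ∑ b ∈ Finset.range (K + 2 - k), ∑ c ∈ Finset.range (b + 1),
              s ^ c / a.t ^ b * D ((k, b), (l, c)) := by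
    rw [Finset.sum_range_succ]
    simp only [lt_irrefl, if_false, Finset.sum_const_zero, add_zero]
    refine Finset.sum_congr rfl fun k hk => Finset.sum_congr rfl fun l _ => ?_
    simp only [Finset.mem_range.1 hk, if_true, Finset.mul_sum]
    refine Finset.sum_congr rfl fun b _ => Finset.sum_congr rfl fun c _ => ?_
    rw [pow_add, pow_add]
    field_simp
  have h4 : ∑ k ∈ Finset.range (K + 2), ∑ l ∈ Finset.range (k + 1), ∑ q ∈ splits k l,
        (if q.1.1 < K + 1 then s ^ (q.2.1 + q.2.2) / a.t ^ (q.1.1 + q.1.2) * D q else 0)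
      = polySum s a.t (K + 1) (fun k l => rhoCoeff a.datum.f k l w)
        + ∑ l ∈ Finset.range (K + 2), s ^ l / a.t ^ (K + 1)
          * ∑ q ∈ (splits (K + 1) l).filter fun q => q.1.1 < K + 1, D q := by
    rw [Finset.sum_range_succ]
    congr 1
    · refine Finset.sum_congr rfl fun k hk => Finset.sum_congr rfl fun l hl => ?_
      beta_reduce
      rw [← sum_densityCoeff_eq_rhoCoeff hB a.datum (Finset.mem_range_succ_iff.1 hl) w,
        Finset.mul_sum]
      refine Finset.sum_congr rfl fun q hq => ?_
      rw [mem_splits] at hq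
      rw [Finset.mem_range] at hk
      rw [if_pos (by omega), hq.1.1, hq.1.2]
    · refine Finset.sum_congr rfl fun l _ => ?_
      rw [Finset.sum_filter, Finset.mul_sum]
      refine Finset.sum_congr rfl fun q hq => ?_
      rw [mem_splits] at hq
      rw [hq.1.1, hq.1.2, mul_ite, mul_zero]
  rw [h1]
  simp only [mul_add, Finset.sum_add_distrib]
  rw [← h3, ← h2, h4, densityRem, add_assoc]
  rfl

end Expansion

section DensityBound
variable {B : ℝ} {N K L : ℕ}

lemma densityRem_smooth (hB : 0 < B) (a : Late B N) (K : ℕ) :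
    ContDiff ℝ ∞ (densityRem a.datum K a.t) := by
  refine ContDiff.add (ContDiff.sum fun l _ => contDiff_const.mul (ContDiff.sum fun q hq => ?_))
    (ContDiff.sum fun k _ => ContDiff.sum fun l hl => contDiff_const.mul ?_)
  · simp only [Finset.mem_filter, mem_splits] at hq
    have hs := fCoeff_smooth a.datum hB hq.1.2.1
    exact marg_smooth (densityCoeff_smooth (a.Φ_smooth hB) hs q.1.2 q.2.2)
      ((fCoeff_vanish a.datum hB hq.1.2.1).densityCoeff (a.Φ_smooth hB) hs q.1.2 q.2.2)
  · have hl' := Finset.mem_range_succ_iff.1 hl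
    exact marg_smooth (radialRem_smooth
        (comp_skew_smooth (a.Φ_smooth hB) _ (fCoeff_smooth a.datum hB hl')) _ _)
      ((a.vanish_comp_skew hB (fCoeff_vanish a.datum hB hl')).radialRem (a.radius_nonneg hB)
        (inv_nonneg.2 a.t_pos.le) (inv_le_one_of_one_le₀ a.one_le_t) _)

/-- The remainder has size `(log t / t)^{K+1}`. The Taylor remainders are of order `K + 2`, and the extra
power of `1 / t` absorbs their logarithms, whose number depends on `N` and `K`. -/
lemma densityRem_polyBound (hB : 0 < B) (hN : 2 ≤ N) (hL : N + K + 3 ≤ L) :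
    PolyBound (fun a : Late B N => level L a.datum) (fun a => a.η ^ (K + 1)) 1
      fun a => hNorm3 N (densityRem a.datum K a.t) := by
  have hD : ∀ l, ∀ q ∈ (splits (K + 1) l).filter (fun q => q.1.1 < K + 1),
      RFam B (level L) 1 N fun (d : Datum B) w =>
        ∫ y, densityCoeff (phiInf d.f) (fCoeff d.f q.1.1 q.2.1) q.1.2 q.2.2 w y := by
    intro l q hq
    simp only [Finset.mem_filter, mem_splits] at hq
    exact (HFam.densityCoeff (L := L) (coeff_rowBounds hB L 0).background hN (by omega)
      (fCoeff_hFam hB (by omega) hq.1.2.1 (by omega)) q.2.2).marg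
  have hM : ∀ k < K + 1, ∀ l ≤ k, PolyBound (fun a : Late B N => level L a.datum)
      (fun a => a.η ^ (K + 1)) 1 fun a => ‖a.logt ^ l / a.t ^ k‖ₑ
        * hNorm3 N (marg (radialRem (K + 2 - k) a.t⁻¹
          fun z => fCoeff a.datum.f k l (skew a.Φ a.logt z))) := by
    intro k hk l hl
    have h1 := marg_radialRem_polyBound (N := N) (m := K + 2 - k) hB (by omega) (by omega)
      ((fCoeff_hFam hB (n := N + (K + 2 - k)) (L := L) (by omega) hl (by omega)).comap Late.datum)
    refine (h1.weight_mul fun a => ‖a.logt ^ l / a.t ^ k‖ₑ).mono_weight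
      ((l + (3 + N + 2 * (K + 2 - k))).factorial : ℝ≥0) fun a => ?_
    have h2 : ‖a.logt ^ l / a.t ^ k‖ₑ = a.lam ^ l * ‖a.t⁻¹‖ₑ ^ k := by
      rw [div_eq_mul_inv, enorm_mul, enorm_pow, a.enorm_logt, ← inv_pow, enorm_pow]
    rw [h2]
    calc _ = ‖a.t⁻¹‖ₑ ^ (K + 1)
          * (‖a.t⁻¹‖ₑ * a.lam ^ (l + (3 + N + 2 * (K + 2 - k)))) := by
          have : ‖a.t⁻¹‖ₑ ^ k * ‖a.t⁻¹‖ₑ ^ (K + 2 - k) = ‖a.t⁻¹‖ₑ ^ (K + 1) * ‖a.t⁻¹‖ₑ := by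
            rw [← pow_add, ← pow_succ]; congr 1; omega
          rw [pow_add a.lam l]
          calc _ = (‖a.t⁻¹‖ₑ ^ k * ‖a.t⁻¹‖ₑ ^ (K + 2 - k))
                * (a.lam ^ l * a.lam ^ (3 + N + 2 * (K + 2 - k))) := by ring
            _ = _ := by rw [this]; ring
      _ ≤ a.η ^ (K + 1) * ((l + (3 + N + 2 * (K + 2 - k))).factorial : ℝ≥0) :=
          mul_le_mul' (pow_le_pow_left' a.enorm_inv_t_le _) (a.inv_t_mul_lam_pow_le _)
      _ = _ := mul_comm _ _
  have hl1 : PolyBound (fun a : Late B N => level L a.datum) (fun a => a.η ^ (K + 1)) 1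
      fun a => ∑ l ∈ Finset.range (K + 2), ‖a.logt ^ l / a.t ^ (K + 1)‖ₑ
        * ∑ q ∈ (splits (K + 1) l).filter (fun q => q.1.1 < K + 1),
          hNorm3 N fun w =>
            ∫ y, densityCoeff a.Φ (fCoeff a.datum.f q.1.1 q.2.1) q.1.2 q.2.2 w y := by
    refine PolyBound.sum _ fun l hl => ?_
    refine ((PolyBound.sum _ fun q hq => ((hD l q hq).bound.comap Late.datum)).weight_mul
      fun a : Late B N => ‖a.logt ^ l / a.t ^ (K + 1)‖ₑ).mono_weight 1 fun a => ?_
    rw [mul_one, ENNReal.coe_one, one_mul]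
    exact a.enorm_coeff_le (Finset.mem_range_succ_iff.1 hl)
  refine (hl1.add (PolyBound.sum (Finset.range (K + 1)) fun k hk =>
    PolyBound.sum (Finset.range (k + 1)) fun l hl => hM k (Finset.mem_range.1 hk) l
      (Finset.mem_range_succ_iff.1 hl))).mono fun a => ?_
  have sD : ∀ l, ∀ q ∈ (splits (K + 1) l).filter (fun q => q.1.1 < K + 1), ContDiff ℝ ∞ fun w =>
      ∫ y, densityCoeff a.Φ (fCoeff a.datum.f q.1.1 q.2.1) q.1.2 q.2.2 w y :=
    fun l q hq => (hD l q hq).smooth a.datum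
  have sM : ∀ k, ∀ l ≤ k, ContDiff ℝ ∞ (marg (radialRem (K + 2 - k) a.t⁻¹
      fun z => fCoeff a.datum.f k l (skew a.Φ a.logt z))) := fun k l hl =>
    marg_smooth (radialRem_smooth
        (comp_skew_smooth (a.Φ_smooth hB) _ (fCoeff_smooth a.datum hB hl)) _ _)
      ((a.vanish_comp_skew hB (fCoeff_vanish a.datum hB hl)).radialRem (a.radius_nonneg hB)
        (inv_nonneg.2 a.t_pos.le) (inv_le_one_of_one_le₀ a.one_le_t) _)
  have hnl : NormLike (normL2 : (R3 → ℝ) → ℝ≥0∞) := normLike_normL2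
  refine (sob_add_le hnl N (ContDiff.sum fun l _ => contDiff_const.mul
    (ContDiff.sum fun q hq => sD l q hq)) (ContDiff.sum fun k _ => ContDiff.sum fun l hl =>
      contDiff_const.mul (sM k l (Finset.mem_range_succ_iff.1 hl)))).trans (add_le_add ?_ ?_)
  · refine (sob_sum_le hnl N _ fun l _ => contDiff_const.mul
      (ContDiff.sum fun q hq => sD l q hq)).trans (Finset.sum_le_sum fun l _ => ?_)
    refine (sob_const_mul_le hnl N _ (ContDiff.sum fun q hq => sD l q hq)).trans ?_
    exact mul_le_mul' le_rfl (sob_sum_le hnl N _ fun q hq => sD l q hq)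
  · refine (sob_sum_le hnl N _ fun k _ => ContDiff.sum fun l hl =>
      contDiff_const.mul (sM k l (Finset.mem_range_succ_iff.1 hl))).trans
      (Finset.sum_le_sum fun k _ => ?_)
    refine (sob_sum_le hnl N _ fun l hl =>
      contDiff_const.mul (sM k l (Finset.mem_range_succ_iff.1 hl))).trans
      (Finset.sum_le_sum fun l hl => ?_)
    exact sob_const_mul_le hnl N _ (sM k l (Finset.mem_range_succ_iff.1 hl))

end DensityBound

/-! ### The density in the original variables -/

lemma normL2_comp_smul {u : R3 → ℝ} (hu : Continuous u) {t : ℝ} (ht : 0 < t) :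
    normL2 (fun x => u (t⁻¹ • x)) = ENNReal.ofReal (t ^ (3 / 2 : ℝ)) * normL2 u := by
  have ht' : t⁻¹ ≠ 0 := (inv_pos.2 ht).ne'
  have h2 : normL2 (fun x => u (t⁻¹ • x)) ^ 2
      = (ENNReal.ofReal (t ^ (3 / 2 : ℝ)) * normL2 u) ^ 2 := by
    have hm : Measurable fun x => ‖u x‖ₑ ^ 2 := by have := hu.measurable; fun_prop
    rw [mul_pow, normL2_sq, normL2_sq, ← ENNReal.ofReal_pow (by positivity), ← Real.rpow_natCast,
      ← Real.rpow_mul ht.le]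
    have h3 := lintegral_map (μ := (volume : Measure R3)) hm (measurable_const_smul t⁻¹)
    rw [Measure.map_addHaar_smul _ ht', lintegral_smul_measure, finrank_euclideanSpace_fin] at h3
    rw [← h3, smul_eq_mul, inv_pow, inv_inv, abs_of_pos (by positivity)]
    norm_num
  exact le_antisymm (le_of_sq_le_sq h2.le) (le_of_sq_le_sq h2.ge)

lemma multi_tdx_comp_smul {u : R3 → ℝ} (hu : ContDiff ℝ ∞ u) {t : ℝ} (ht : t ≠ 0) (I : Fin 3 → ℕ) :
    multi (tdx t) I (fun x => u (t⁻¹ • x)) = (fun x => multi pd I u (t⁻¹ • x))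
      ∧ ContDiff ℝ ∞ (multi pd I u) :=
  multi_comp (P := ContDiff ℝ ∞) (fun k _ hg => pd_smooth hg k) (fun k g hg => by
    funext x
    rw [tdx, pd_comp_smul hg, ← mul_assoc, mul_inv_cancel₀ ht, one_mul]) I hu

section Density
variable {B : ℝ} {N K L : ℕ}

lemma density_sub_rhoApprox (hB : 0 < B) (a : Late B N) (K : ℕ) :
    (fun x => (∫ p : R3, fApprox a.datum.f K a.t (x, p)) - rhoApprox a.datum.f K a.t x)
      = fun x => (fun w => (a.t ^ 3)⁻¹ * densityRem a.datum K a.t w) (a.t⁻¹ • x) := by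
  funext x
  have ht := a.t_pos.ne'
  have h1 := density_expansion hB a K (a.t⁻¹ • x)
  rw [smul_smul, mul_inv_cancel₀ ht, one_smul] at h1
  have h2 : rhoApprox a.datum.f K a.t x
      = (a.t ^ 3)⁻¹ * polySum a.logt a.t (K + 1) fun k l => rhoCoeff a.datum.f k l (a.t⁻¹ • x) := by
    rw [rhoApprox, one_div]; rfl
  have h3 : ∫ p : R3, fApprox a.datum.f K a.t (x, p)
      = (a.t ^ 3)⁻¹ * (a.t ^ 3 * ∫ p : R3, fApprox a.datum.f K a.t (x, p)) := by
    rw [← mul_assoc, inv_mul_cancel₀ (pow_ne_zero 3 ht), one_mul]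
  rw [h2, h3, h1]
  ring

/-- The density of the approximate solution, up to `(log t)^{K+1} / t^{K+5/2}`. -/
lemma density_polyBound (hB : 0 < B) (hN : 2 ≤ N) (hL : N + K + 3 ≤ L) :
    PolyBound (fun a : Late B N => level L a.datum)
      (fun a => ENNReal.ofReal (a.logt ^ (K + 1) / a.t ^ ((5 : ℝ) / 2 + (K : ℝ)))) 1
      fun a => ∑ I ∈ multiIndices N, normL2 (multi (tdx a.t) I
        (fun x => (∫ p : R3, fApprox a.datum.f K a.t (x, p)) - rhoApprox a.datum.f K a.t x)) := by
  refine PolyBound.sum _ fun I hI => ?_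
  set W : Late B N → ℝ≥0∞ := fun a => ENNReal.ofReal (a.t ^ (3 / 2 : ℝ)) * ‖(a.t ^ 3)⁻¹‖ₑ with hW
  have hweight : ∀ a : Late B N, W a * a.η ^ (K + 1)
      ≤ (1 : ℝ≥0) * ENNReal.ofReal (a.logt ^ (K + 1) / a.t ^ ((5 : ℝ) / 2 + (K : ℝ))) := by
    intro a
    have ht := a.t_pos
    have hl : 0 ≤ a.logt := zero_le_one.trans a.one_le_logt
    simp only [hW]
    rw [ENNReal.coe_one, one_mul, Late.η, Real.enorm_eq_ofReal (by positivity),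
      ← ENNReal.ofReal_pow a.div_nonneg', ← ENNReal.ofReal_mul (by positivity),
      ← ENNReal.ofReal_mul (by positivity)]
    apply ENNReal.ofReal_le_ofReal (le_of_eq _)
    have h1 : a.t ^ (3 / 2 : ℝ) * a.t ^ ((5 : ℝ) / 2 + (K : ℝ)) = a.t ^ 3 * a.t ^ (K + 1) := by
      rw [← Real.rpow_add ht, ← pow_add, ← Real.rpow_natCast]
      congr 1
      push_cast
      ring
    rw [div_pow, eq_div_iff (by positivity)]
    calc _ = (a.t ^ (3 / 2 : ℝ) * a.t ^ ((5 : ℝ) / 2 + (K : ℝ)))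
          * ((a.t ^ 3)⁻¹ * (a.logt ^ (K + 1) / a.t ^ (K + 1))) := by ring
      _ = _ := by rw [h1]; field_simp
  have hle : ∀ a : Late B N, normL2 (multi (tdx a.t) I
        (fun x => (∫ p : R3, fApprox a.datum.f K a.t (x, p)) - rhoApprox a.datum.f K a.t x))
      ≤ W a * hNorm3 N (densityRem a.datum K a.t) := by
    intro a
    have hs := densityRem_smooth hB a K
    rw [density_sub_rhoApprox hB a K]
    have h := multi_tdx_comp_smul (contDiff_const.mul hs :
      ContDiff ℝ ∞ fun w => (a.t ^ 3)⁻¹ * densityRem a.datum K a.t w) a.t_pos.ne' I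
    rw [h.1, normL2_comp_smul h.2.continuous a.t_pos, hW, mul_assoc]
    exact mul_le_mul' le_rfl ((normL2_multi_pd_le hI _).trans
      (sob_const_mul_le normLike_normL2 N _ hs))
  have hb := (densityRem_polyBound (K := K) hB hN hL).weight_mul W
  exact (hb.mono_weight 1 hweight).mono hle

end Density

/-! ### Subadditivity of the weighted norm -/

/-- Additivity of products of operators, on a class `P` of functions on which the factors are additive. -/
lemma multi_add {α : Type} {D : Fin 3 → (α → ℝ) → α → ℝ} {P : (α → ℝ) → Prop}
    (hP : ∀ k g, P g → P (D k g))
    (h : ∀ k f g, P f → P g → D k (fun z => f z + g z) = fun z => D k f z + D k g z)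
    (I : Fin 3 → ℕ) {f g : α → ℝ} (hf : P f) (hg : P g) :
    multi D I (fun z => f z + g z) = (fun z => multi D I f z + multi D I g z)
      ∧ P (multi D I f) ∧ P (multi D I g) := by
  have hit : ∀ (k : Fin 3) (m : ℕ) (f g : α → ℝ), P f → P g →
      (D k)^[m] (fun z => f z + g z) = (fun z => (D k)^[m] f z + (D k)^[m] g z)
        ∧ P ((D k)^[m] f) ∧ P ((D k)^[m] g) := by
    intro k m
    induction m with
    | zero => exact fun f g hf hg => ⟨rfl, hf, hg⟩
    | succ m ih =>
      intro f g hf hg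
      obtain ⟨h1, h2, h3⟩ := ih f g hf hg
      simp only [Function.iterate_succ_apply']
      rw [h1, h k _ _ h2 h3]
      exact ⟨rfl, hP k _ h2, hP k _ h3⟩
  have h2 := hit 2 (I 2) f g hf hg
  have h1 := hit 1 (I 1) _ _ h2.2.1 h2.2.2
  have h0 := hit 0 (I 0) _ _ h1.2.1 h1.2.2
  simp only [multi]
  exact ⟨by rw [h2.1, h1.1, h0.1], h0.2⟩

lemma weightedNorm_add_le {Φ : R3 → ℝ} (hΦ : ContDiff ℝ ∞ Φ) (N : ℕ) (t : ℝ) {f g : R3 × R3 → ℝ}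
    (hf : ContDiff ℝ ∞ f) (hg : ContDiff ℝ ∞ g) :
    weightedNorm N Φ t (fun z => f z + g z) ≤ weightedNorm N Φ t f + weightedNorm N Φ t g := by
  rw [weightedNorm, weightedNorm, weightedNorm, ← Finset.sum_add_distrib]
  refine Finset.sum_le_sum fun IJ _ => ?_
  have h1 := multi_add (D := tinvdp t) (P := ContDiff ℝ ∞)
    (fun k g hg => contDiff_const.mul (dp_smooth hg k)) (fun k f g hf hg => by
      funext z
      simp only [tinvdp]
      rw [dp_eq_dd, dd_add hf hg]
      ring) IJ.2 hf hg
  have h2 := multi_add (D := vecL Φ t) (P := ContDiff ℝ ∞)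
    (fun k g hg => ((contDiff_const.mul (dx_smooth hg k)).add (dp_smooth hg k)).add
      (contDiff_const.mul (ContDiff.sum fun i _ =>
        (snd_smooth (pd_smooth (pd_smooth hΦ i) k)).mul (dp_smooth hg i))))
    (fun k f g hf hg => by
      funext z
      simp only [vecL, dx_eq_dd, dp_eq_dd, dd_add hf hg, mul_add, Finset.sum_add_distrib]
      ring) IJ.1 h1.2.1 h1.2.2
  rw [h1.1, h2.1]
  exact normLike_normL2.add_le _ _ h2.2.1.continuous h2.2.2.continuous

lemma fApprox_smooth {B : ℝ} (hB : 0 < B) (d : Datum B) (K : ℕ) (t : ℝ) :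
    ContDiff ℝ ∞ (fApprox d.f K t) :=
  ContDiff.sum fun _ _ => ContDiff.sum fun _ hl => contDiff_const.mul
    (comp_shear_smooth (phiInf_smooth d hB) t (fCoeff_smooth d hB (Finset.mem_range_succ_iff.1 hl)))

/-! ### From Sobolev norms to `F_∞^n` -/

/-- A polynomial without constant term in the Sobolev norm is bounded by `F_∞^n`, if the power `𝔫 n`
in the definition of `F_∞^n` is at least the degree. -/
lemma exists_hNorm_mul_pow_le (n D : ℕ) : ∃ C : ℝ≥0, ∀ 𝔫 : ℕ → ℕ, D + 1 ≤ 𝔫 n →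
    ∀ f : R3 × R3 → ℝ, ContDiff ℝ ∞ f → hNorm n f * (1 + hNorm n f) ^ D ≤ C * calF 𝔫 n f := by
  set A : ℝ≥0 := 7 ^ n * (multiIndexPairs n).card with hA
  have hne : (multiIndexPairs n).Nonempty := ⟨0, mem_multiIndexPairs.2 (by simp)⟩
  have hA1 : 1 ≤ A := one_le_mul (one_le_pow₀ (by norm_num))
    (by exact_mod_cast Finset.card_pos.2 hne)
  refine ⟨(2 * A) ^ (D + 1), fun 𝔫 h𝔫 f hf => ?_⟩
  set x : (Fin 3 → ℕ) × (Fin 3 → ℕ) → ℝ≥0∞ := fun IJ => normL2 (multi dx IJ.1 (multi dp IJ.2 f))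
  obtain ⟨J, hJ, hmax⟩ := Finset.exists_max_image (multiIndexPairs n) x hne
  have hH : hNorm n f ≤ A * x J := by
    refine (hNorm_le_sum_multi n hf).trans ?_
    rw [hA]
    push_cast
    rw [mul_assoc]
    refine mul_le_mul' le_rfl ((Finset.sum_le_card_nsmul _ x _ hmax).trans ?_)
    rw [nsmul_eq_mul]
  have hcal : x J + x J ^ 𝔫 n ≤ calF 𝔫 n f :=
    Finset.single_le_sum (f := fun IJ => x IJ + x IJ ^ 𝔫 n) (fun _ _ => zero_le) hJ
  set y := x J
  -- the linear term of `F_∞^n` is the larger one for `y ≤ 1`, the power for `y ≥ 1`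
  have hyle : y * (1 + y) ^ D ≤ 2 ^ (D + 1) * (y + y ^ 𝔫 n) := by
    rcases le_total y 1 with h | h
    · calc y * (1 + y) ^ D ≤ y * (1 + 1) ^ D := by gcongr
        _ = 2 ^ D * y := by rw [one_add_one_eq_two, mul_comm]
        _ ≤ 2 ^ (D + 1) * (y + y ^ 𝔫 n) :=
            mul_le_mul' (pow_le_pow_right₀ (by norm_num) (by omega)) le_self_add
    · calc y * (1 + y) ^ D ≤ y * (y + y) ^ D := by gcongr
        _ = 2 ^ D * y ^ (D + 1) := by rw [← two_mul, mul_pow, pow_succ]; ring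
        _ ≤ 2 ^ (D + 1) * (y + y ^ 𝔫 n) :=
            mul_le_mul' (pow_le_pow_right₀ (by norm_num) (by omega))
              ((pow_le_pow_right₀ h h𝔫).trans le_add_self)
  have hA1' : (1 : ℝ≥0∞) ≤ A := by exact_mod_cast hA1
  calc _ ≤ A * y * (A + A * y) ^ D := by gcongr
    _ = A ^ (D + 1) * (y * (1 + y) ^ D) := by
        rw [show (A : ℝ≥0∞) + A * y = A * (1 + y) by ring, mul_pow]; ring
    _ ≤ A ^ (D + 1) * (2 ^ (D + 1) * calF 𝔫 n f) := by
        exact mul_le_mul' le_rfl (hyle.trans (mul_le_mul' le_rfl hcal))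
    _ = _ := by push_cast; ring

/-- Bounds by powers of the Sobolev norm become bounds by the same powers of `F_∞^n`, as soon as the power
`𝔫 n` exceeds the degree. -/
lemma PolyBound.exists_calF_le {α : Type} {B : ℝ} {π : α → Datum B} {n e : ℕ} {w X : α → ℝ≥0∞}
    (he : 1 ≤ e) (hX : PolyBound (fun a => level n (π a)) w e X) :
    ∃ (C : ℝ≥0) (E : ℕ), ∀ 𝔫 : ℕ → ℕ, E ≤ 𝔫 n → ∀ a, X a ≤ C * w a * calF 𝔫 n (π a).f ^ e := by
  obtain ⟨C, D, hC⟩ := hX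
  obtain ⟨C', hC'⟩ := exists_hNorm_mul_pow_le n D
  refine ⟨C * C' ^ e, D + 1, fun 𝔫 h𝔫 a => (hC a).trans ?_⟩
  set H := level n (π a) with hH
  have h1 : H * (1 + H) ^ D ≤ C' * calF 𝔫 n (π a).f := hC' 𝔫 h𝔫 _ (π a).smooth
  have h2 : (1 + H) ^ D ≤ ((1 + H) ^ D) ^ e := le_self_pow₀ (one_le_pow₀ le_self_add) (by omega)
  calc _ = C * w a * (H ^ e * (1 + H) ^ D) := by ring
    _ ≤ C * w a * (H ^ e * ((1 + H) ^ D) ^ e) := by gcongr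
    _ = C * w a * (H * (1 + H) ^ D) ^ e := by rw [mul_pow]
    _ ≤ C * w a * (C' * calF 𝔫 n (π a).f) ^ e := by gcongr
    _ = _ := by push_cast; ring

/-! ### The constants -/

section Constants
variable {B : ℝ} {N : ℕ}

/-- All estimates with the same `K`, with one constant and one lower bound for the powers `𝔫 n`. -/
lemma exists_constants (hB : 0 < B) (hN : 2 ≤ N) (K : ℕ) :
    ∃ (C : ℝ≥0) (E : ℕ), ∀ 𝔫 : ℕ → ℕ, (∀ n, K ≤ n → E ≤ 𝔫 n) →
      (∀ a : Late B N,
        weightedNorm N a.Φ a.t (vlasov (phiApprox a.datum.f K) (fApprox a.datum.f K) a.t)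
          ≤ C * (‖a.t⁻¹‖ₑ * a.η ^ (K + 1)) * calF 𝔫 (N + 2 * K + 3) a.datum.f ^ 2 ∧
        ∑ I ∈ multiIndices N, normL2 (multi (tdx a.t) I
            (fun x => (∫ p : R3, fApprox a.datum.f K a.t (x, p)) - rhoApprox a.datum.f K a.t x))
          ≤ C * ENNReal.ofReal (a.logt ^ (K + 1) / a.t ^ ((5 : ℝ) / 2 + (K : ℝ)))
            * calF 𝔫 (N + 2 * K + 3) a.datum.f ∧
        weightedNorm N a.Φ a.t (fun z => fApprox a.datum.f K a.t z - fApprox a.datum.f 0 a.t z)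
          ≤ C * a.η * calF 𝔫 (N + K) a.datum.f) ∧
      (1 ≤ K → ∀ (d : Datum B), ∀ l ≤ K,
        ∑ IJ ∈ multiIndexPairs N, normL2 (multi dx IJ.1 (multi dp IJ.2 (fCoeff d.f K l)))
          ≤ C * calF 𝔫 (N + K) d.f ^ 2 ∧
        ∑ I ∈ multiIndices N, (normL2 (multi pd I (rhoCoeff d.f K l))
            + ∑ i : Fin 3, normL2 (multi pd I (pd i (phiCoeff d.f K l))))
          ≤ C * calF 𝔫 (N + K) d.f) := by
  obtain ⟨C₁, E₁, h₁⟩ := (weightedNorm_vlasov_polyBound (N := N) (K := K) (L := N + 2 * K + 3) hB hN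
    (by omega)).exists_calF_le (by norm_num)
  obtain ⟨C₂, E₂, h₂⟩ := (density_polyBound (N := N) (K := K) (L := N + 2 * K + 3) hB hN
    (by omega)).exists_calF_le le_rfl
  obtain ⟨C₃, E₃, h₃⟩ := (weightedNorm_fApprox_sub_polyBound (N := N) (K := K) hB hN
    le_rfl).exists_calF_le le_rfl
  have hf : ∃ (C : ℝ≥0) (E : ℕ), ∀ 𝔫 : ℕ → ℕ, E ≤ 𝔫 (N + K) → 1 ≤ K → ∀ d : Datum B,
      ∑ l ∈ Finset.range (K + 1), ∑ IJ ∈ multiIndexPairs N,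
        normL2 (multi dx IJ.1 (multi dp IJ.2 (fCoeff d.f K l)))
        ≤ C * 1 * calF 𝔫 (N + K) d.f ^ 2 := by
    by_cases hK : 1 ≤ K
    · have hX : PolyBound (level (B := B) (N + K)) (fun _ => 1) 2 fun d =>
          ∑ l ∈ Finset.range (K + 1), ∑ IJ ∈ multiIndexPairs N,
            normL2 (multi dx IJ.1 (multi dp IJ.2 (fCoeff d.f K l))) :=
        PolyBound.sum _ fun l hl => PolyBound.sum _ fun IJ hIJ =>
          (fCoeff_hFam_two hB hN hK (Finset.mem_range_succ_iff.1 hl) le_rfl).bound.mono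
            fun d => normL2_multi_le hIJ _
      obtain ⟨C, E, h⟩ := PolyBound.exists_calF_le (π := id) (by norm_num) hX
      exact ⟨C, E, fun 𝔫 h𝔫 _ => h 𝔫 h𝔫⟩
    · exact ⟨0, 0, fun _ _ h => absurd h hK⟩
  obtain ⟨C₄, E₄, h₄⟩ := hf
  have hρ : PolyBound (level (B := B) (N + K)) (fun _ => 1) 1 fun d =>
      ∑ l ∈ Finset.range (K + 1), ∑ I ∈ multiIndices N, (normL2 (multi pd I (rhoCoeff d.f K l))
        + ∑ i : Fin 3, normL2 (multi pd I (pd i (phiCoeff d.f K l)))) := by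
    refine PolyBound.sum _ fun l hl => PolyBound.sum _ fun I hI => PolyBound.add ?_
      (PolyBound.sum _ fun i _ => ?_)
    · exact (rhoCoeff_rFam hB hN (Finset.mem_range_succ_iff.1 hl) le_rfl).bound.mono
        fun d => normL2_multi_pd_le hI _
    -- for positive order, `aNorm` contains the Sobolev norm of the same order
    · obtain ⟨M, rfl⟩ : ∃ M, N = M + 1 := ⟨N - 1, by omega⟩
      exact (phiCoeff_aFam hB hN (Finset.mem_range_succ_iff.1 hl) le_rfl i).bound.mono
        fun d => (normL2_multi_pd_le hI _).trans le_add_self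
  obtain ⟨C₅, E₅, h₅⟩ := PolyBound.exists_calF_le (π := id) le_rfl hρ
  set C := C₁ + C₂ + C₃ + C₄ + C₅ with hC
  have c₁ : (C₁ : ℝ≥0∞) ≤ C := by rw [hC]; exact_mod_cast (by simp only [add_assoc]; exact le_self_add)
  have c₂ : (C₂ : ℝ≥0∞) ≤ C := by
    rw [hC, add_comm C₁]; exact_mod_cast (by simp only [add_assoc]; exact le_self_add)
  have c₃ : (C₃ : ℝ≥0∞) ≤ C := by
    rw [hC, add_comm _ C₃]; exact_mod_cast (by simp only [add_assoc]; exact le_self_add)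
  have c₄ : (C₄ : ℝ≥0∞) ≤ C := by
    rw [hC, add_comm _ C₄]; exact_mod_cast (by simp only [add_assoc]; exact le_self_add)
  have c₅ : (C₅ : ℝ≥0∞) ≤ C := by rw [hC]; exact_mod_cast le_add_self
  refine ⟨C, E₁ + E₂ + E₃ + E₄ + E₅, fun 𝔫 h𝔫 => ⟨fun a => ⟨?_, ?_, ?_⟩, fun hK d l hl => ⟨?_, ?_⟩⟩⟩
  · have := h𝔫 (N + 2 * K + 3) (by omega)
    exact (h₁ 𝔫 (by omega) a).trans (by gcongr)
  · have := h𝔫 (N + 2 * K + 3) (by omega)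
    have h := h₂ 𝔫 (by omega) a
    rw [pow_one] at h
    exact h.trans (by gcongr)
  · have := h𝔫 (N + K) (by omega)
    have h := h₃ 𝔫 (by omega) a
    rw [pow_one] at h
    exact h.trans (by gcongr)
  · have := h𝔫 (N + K) (by omega)
    have h := h₄ 𝔫 (by omega) hK d
    rw [mul_one] at h
    exact (Finset.single_le_sum (f := fun l => ∑ IJ ∈ multiIndexPairs N,
      normL2 (multi dx IJ.1 (multi dp IJ.2 (fCoeff d.f K l)))) (fun _ _ => zero_le)
      (Finset.mem_range_succ_iff.2 hl)).trans (h.trans (by gcongr))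
  · have := h𝔫 (N + K) (by omega)
    have h := h₅ 𝔫 (by omega) d
    rw [mul_one, pow_one] at h
    exact (Finset.single_le_sum (f := fun l => ∑ I ∈ multiIndices N,
      (normL2 (multi pd I (rhoCoeff d.f K l))
        + ∑ i : Fin 3, normL2 (multi pd I (pd i (phiCoeff d.f K l))))) (fun _ _ => zero_le)
      (Finset.mem_range_succ_iff.2 hl)).trans (h.trans (by gcongr; rfl))

lemma tendsto_defect (hB : 0 < B) (d : Datum B) : Tendsto (defect N d) atTop (𝓝 0) := by
  have h1 : Tendsto (fun t : ℝ => Real.log t ^ 2 / t) atTop (𝓝 0) :=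
    (Real.isLittleO_pow_log_id_atTop (n := 2)).tendsto_div_nhds_zero
  have h2 := ENNReal.tendsto_ofReal h1
  rw [ENNReal.ofReal_zero] at h2
  have h3 := ENNReal.Tendsto.mul_const (b := fieldNorm N d ^ 2) h2
    (Or.inr (ENNReal.pow_ne_top (fieldNorm_ne_top hB N d)))
  rw [zero_mul] at h3
  exact h3

/-- From some time on, which may depend on the datum, the profile `f_∞` transported by the asymptotic
flow is bounded by `F_∞^N`. The nonlinear terms of `F_∞^N` absorb the error, which decays in time. -/
lemma exists_time (hB : 0 < B) (𝔫 : ℕ → ℕ) (d : Datum B) :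
    ∃ T : ℝ, Real.exp 1 ≤ T ∧ ∀ t, T ≤ t → defect N d t ≤ 1 ∧ ∀ a : Late B N, a.datum = d → a.t = t →
      weightedNorm N a.Φ a.t (fApprox d.f 0 a.t) ≤ calF 𝔫 N d.f := by
  obtain ⟨X, ⟨C, D, hX⟩, hle⟩ := weightedNorm_fApprox_zero_polyBound (N := N) hB
  set Y : ℝ≥0∞ := C * (level N d * (1 + level N d) ^ D) with hY
  have hYtop : Y ≠ ⊤ := ENNReal.mul_ne_top ENNReal.coe_ne_top (ENNReal.mul_ne_top (level_ne_top N d)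
    (ENNReal.pow_ne_top (ENNReal.add_ne_top.2 ⟨ENNReal.one_ne_top, level_ne_top N d⟩)))
  set z := normL2 d.f ^ 𝔫 N with hz
  have hev : ∀ᶠ t in atTop, Y * defect N d t ≤ z := by
    by_cases h0 : normL2 d.f = 0
    · -- if `f_∞ = 0` in `L²`, then `f_∞ = 0`, and there is no error
      have hf : d.f = fun _ => 0 := by
        have h1 := (eLpNorm_eq_zero_iff d.smooth.continuous.aestronglyMeasurable
          (by norm_num : (2 : ℝ≥0∞) ≠ 0)).1 h0
        exact (d.smooth.continuous.ae_eq_iff_eq volume continuous_const).1 h1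
      have h2 : level N d = 0 := by
        rw [level, hf]; exact sob_zero_fun normLike_normL2 N
      refine Eventually.of_forall fun t => ?_
      rw [hY, h2]
      simp
    · have hz0 : 0 < z := pos_iff_ne_zero.2 (pow_ne_zero _ h0)
      have h3 := ENNReal.Tendsto.const_mul (tendsto_defect (N := N) hB d) (Or.inr hYtop)
      rw [mul_zero] at h3
      exact (h3.eventually_lt_const hz0).mono fun t ht => ht.le
  have hev1 : ∀ᶠ t in atTop, defect N d t ≤ 1 :=
    ((tendsto_defect hB d).eventually_lt_const one_pos).mono fun t ht => ht.le
  obtain ⟨T, hT⟩ := eventually_atTop.1 (hev.and (hev1.and (eventually_ge_atTop (Real.exp 1))))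
  refine ⟨T, (hT T le_rfl).2.2, fun t ht => ⟨(hT t ht).2.1, ?_⟩⟩
  rintro a rfl rfl
  refine (hle a).trans ?_
  have h4 : X a ≤ z := by
    refine (hX a).trans (le_trans (le_of_eq ?_) (hT a.t ht).1)
    change _ = Y * a.δ
    rw [hY]
    ring
  -- the summand with `I = J = 0` of the nonlinear part of `F_∞^N`
  have h5 : z ≤ ∑ IJ ∈ multiIndexPairs N,
      normL2 (multi dx IJ.1 (multi dp IJ.2 a.datum.f)) ^ 𝔫 N :=
    le_sum_multiIndexPairs (fun IJ => normL2 (multi dx IJ.1 (multi dp IJ.2 a.datum.f)) ^ 𝔫 N)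
      (I := 0) (J := 0) (by simp)
  rw [calF, Finset.sum_add_distrib]
  exact add_le_add le_rfl (h4.trans h5)

end Constants

end VlasovPoisson

end

theorem theorem4p1 (N : ℕ) (hN : 6 ≤ N) (B : ℝ) (hB : 0 < B) :
    -- the constants `C_K` and the sequence `𝔫` depend only on `N` and `B`
    ∃ (C : ℕ → ℝ) (𝔫 : ℕ → ℕ), StrictMono 𝔫 ∧ (∀ n, n < 𝔫 n) ∧
    ∀ fInf : R3 × R3 → ℝ,
      ContDiff ℝ ∞ fInf → (∀ z, 0 ≤ fInf z) →
      tsupport fInf ⊆ {z | ‖z.1‖ + ‖z.2‖ ≤ B} →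
      -- the coefficients are smooth, and `φ_{k,l}` solves the Poisson equation
      (∀ k l, l ≤ k →
        ContDiff ℝ ∞ (fCoeff fInf k l) ∧
        ContDiff ℝ ∞ (rhoCoeff fInf k l) ∧
        ContDiff ℝ ∞ (phiCoeff fInf k l) ∧
        (∀ w, Laplacian.laplacian (phiCoeff fInf k l) w
          = rhoCoeff fInf k l w) ∧
        Tendsto (phiCoeff fInf k l) (cocompact R3) (𝓝 0)) ∧
      fCoeff fInf 0 0 = fInf ∧
      rhoCoeff fInf 0 0 = rhoInf fInf ∧
      phiCoeff fInf 0 0 = phiInf fInf ∧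
      -- the ansatz is an approximate solution of order `K`, with further estimates
      (∃ T₀ : ℝ, 0 < T₀ ∧ ∀ (K : ℕ) (t : ℝ), T₀ ≤ t →
        (∑ IJ ∈ multiIndexPairs N,
            normL2
              (multi (vecL (phiInf fInf) t) IJ.1
                (multi (tinvdp t) IJ.2
                  (vlasov (phiApprox fInf K)
                    (fApprox fInf K) t)))
          ≤ ENNReal.ofReal (C K * (Real.log t ^ (1 + K) / t ^ (2 + K)))
              * calF 𝔫 (N + 2 * K + 3) fInf ^ 2) ∧
        (∑ I ∈ multiIndices N,
            normL2
              (multi (tdx t) I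
                (fun x => (∫ p : R3, fApprox fInf K t (x, p))
                  - rhoApprox fInf K t x))
          ≤ ENNReal.ofReal (C K * (Real.log t ^ (K + 1) / t ^ ((5 : ℝ) / 2 + (K : ℝ))))
              * calF 𝔫 (N + 2 * K + 3) fInf) ∧
        (∑ IJ ∈ multiIndexPairs N,
            normL2
              (multi (vecL (phiInf fInf) t) IJ.1
                (multi (tinvdp t) IJ.2
                  (fApprox fInf K t)))
          ≤ calF 𝔫 N fInf
              + ENNReal.ofReal (C K * (Real.log t / t)) * calF 𝔫 (N + K) fInf) ∧
        (∑ IJ ∈ multiIndexPairs N,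
            normL2
              (multi (vecL (phiInf fInf) t) IJ.1
                (multi (tinvdp t) IJ.2
                  (fun z => fApprox fInf K t z - fApprox fInf 0 t z)))
          ≤ ENNReal.ofReal (C K * (Real.log t / t)) * calF 𝔫 (N + K) fInf)) ∧
      -- support properties
      (∀ k l, l ≤ k →
        tsupport (fCoeff fInf k l) ⊆ {z | ‖z.1‖ ≤ B ∧ ‖z.2‖ ≤ B} ∧
        tsupport (rhoCoeff fInf k l) ⊆ {x | ‖x‖ ≤ B}) ∧
      -- Sobolev bounds
      (∀ k l, 1 ≤ k → l ≤ k →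
        (∑ IJ ∈ multiIndexPairs N,
            normL2 (multi dx IJ.1
              (multi dp IJ.2 (fCoeff fInf k l)))
          ≤ ENNReal.ofReal (C k) * calF 𝔫 (N + k) fInf ^ 2) ∧
        (∑ I ∈ multiIndices N,
            (normL2 (multi pd I
                (rhoCoeff fInf k l))
              + ∑ i : Fin 3, normL2 (multi pd I
                  (pd i (phiCoeff fInf k l))))
          ≤ ENNReal.ofReal (C k) * calF 𝔫 (N + k) fInf)) := by
  have hN2 : 2 ≤ N := by omega
  -- `𝔫 n` has to exceed `E K` only for `K ≤ n`, since the estimates with the index `K` involve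
  -- `F_∞^n` for some `n ≥ K` only: the sum of all `E k`, `k ≤ n`, is enough
  choose C E hCE using fun K => exists_constants (N := N) hB hN2 K
  have hmono : ∀ K n, K ≤ n → E K ≤ n + 1 + ∑ k ∈ Finset.range (n + 1), E k := fun K n h =>
    (Finset.single_le_sum (f := E) (fun _ _ => Nat.zero_le _)
      (Finset.mem_range_succ_iff.2 h)).trans (Nat.le_add_left _ _)
  refine ⟨fun K => (C K : ℝ), fun n => n + 1 + ∑ k ∈ Finset.range (n + 1), E k, ?_, fun n => ?_, ?_⟩
  · refine strictMono_nat_of_lt_succ fun n => ?_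
    rw [Finset.sum_range_succ _ (n + 1)]
    omega
  · dsimp only
    omega
  intro fInf hf _ hsupp
  set 𝔫 : ℕ → ℕ := fun n => n + 1 + ∑ k ∈ Finset.range (n + 1), E k
  have h𝔫 := fun K => hCE K 𝔫 fun n h => hmono K n h
  have hvan : VanishesOff B fInf := by
    intro z hz
    by_contra hne
    have h1 : ‖z.1‖ + ‖z.2‖ ≤ B := hsupp (subset_tsupport _ hne)
    have h2 : ‖z‖ ≤ B := by
      rw [Prod.norm_def, max_le_iff]
      exact ⟨by linarith [norm_nonneg z.2], by linarith [norm_nonneg z.1]⟩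
    exact absurd hz h2.not_gt
  set d : Datum B := ⟨fInf, hf, hvan⟩
  obtain ⟨T, hTe, hT⟩ := exists_time (N := N) hB 𝔫 d
  refine ⟨fun k l hl => ⟨fCoeff_smooth d hB hl, rhoCoeff_smooth d hB hl, phiCoeff_smooth d hB hl,
    fun w => ?_, ?_⟩, rfl, rfl, rfl, ⟨T, (Real.exp_pos 1).trans_le hTe, fun K t ht => ?_⟩,
    fun k l hl => ⟨?_, ?_⟩, fun k l hk hl => ?_⟩
  · rw [phiCoeff_eq_newton]
    exact laplacian_newton (rhoCoeff_smooth d hB hl) (rhoCoeff_vanish d hB hl).hasCompactSupport w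
  · rw [phiCoeff_eq_newton]
    exact tendsto_newton (rhoCoeff_smooth d hB hl).continuous (rhoCoeff_vanish d hB hl)
  · obtain ⟨hdef, hprof⟩ := hT t ht
    set a : Late B N := ⟨d, t, hTe.trans ht, hdef⟩
    obtain ⟨h1, h2, h3⟩ := (h𝔫 K).1 a
    have ht0 : 0 < t := a.t_pos
    have hl0 : 0 ≤ Real.log t := zero_le_one.trans a.one_le_logt
    have hC : ∀ x : ℝ, ENNReal.ofReal ((C K : ℝ) * x) = C K * ENNReal.ofReal x := fun x => by
      rw [ENNReal.ofReal_mul (C K).coe_nonneg, ENNReal.ofReal_coe_nnreal]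
    simp only [hC]
    refine ⟨?_, h2, ?_, h3⟩
    · have hw : ‖a.t⁻¹‖ₑ * a.η ^ (K + 1)
          = ENNReal.ofReal (Real.log t ^ (1 + K) / t ^ (2 + K)) := by
        rw [Real.enorm_eq_ofReal (inv_nonneg.2 ht0.le), Late.η, ← ENNReal.ofReal_pow a.div_nonneg',
          ← ENNReal.ofReal_mul (inv_nonneg.2 ht0.le)]
        congr 1
        change t⁻¹ * (Real.log t / t) ^ (K + 1) = _
        rw [div_pow, show 2 + K = K + 1 + 1 by omega, add_comm 1 K, pow_succ t (K + 1)]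
        field_simp
      rw [hw] at h1
      exact h1
    · have hs0 := fApprox_smooth hB d 0 t
      have hsK := fApprox_smooth hB d K t
      -- the triangle inequality for `f_{[K]} = f_{[0]} + (f_{[K]} - f_{[0]})`
      have h4 := weightedNorm_add_le (a.Φ_smooth hB) N t hs0 (hsK.sub hs0)
      simp only [add_sub_cancel] at h4
      exact h4.trans (add_le_add (hprof a rfl rfl) h3)
  · intro z hz
    have h1 := (fCoeff_vanish d hB hl).tsupport_subset hz
    rw [mem_closedBall_zero_iff, Prod.norm_def, max_le_iff] at h1
    exact h1
  · intro x hx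
    exact mem_closedBall_zero_iff.1 ((rhoCoeff_vanish d hB hl).tsupport_subset hx)
  · rw [ENNReal.ofReal_coe_nnreal]
    exact (h𝔫 k).2 hk d l hl
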